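/- Let $\mathbb K$ be a field of characteristic zero, $n\in\mathbb Z$, and let $S$ be a finite set. **Graphs.** All graphs are finite multigraphs (tadpoles and multiple edges allowed) with directed edges, with internal vertices, and with external vertices labelled bijectively by $S$; they are connected. An *undirected-admissible* graph has all internal vertices at least 3-valent and all external vertices 1-valent; the graph with no internal vertex and a single edge joining two external vertices is included (for $|S|=2$). An *oriented-admissible* graph has external vertices that are 1-valent targets, internal vertices that are at least 2-valent, have at least one outgoing edge and are not passing (one incoming and one outgoing edge), and has no directed cycle. A graph with $v$ internal vertices and $e$ edges (hairs included) has degree $(n-1)e-nv$ and loop order $e-(v+|S|)+1$. **Complexes.** $\mathsf{HG}^S_n$ is spanned by undirected-admissible graphs with numbered internal vertices and edges, modulo $\gamma\Gamma=\mathrm{sgn}(\gamma)\Gamma$ for $\gamma\in\mathbb S_v\times(\mathbb S_e\ltimes\mathbb S_2^{e})$, where for even $n$ permutations of edges are odd, and for odd $n$ permutations of internal vertices and reversals of edges are odd. $\mathsf{HOG}^S_n$ is defined in the same way by oriented-admissible graphs and the group $\mathbb S_v\times\mathbb S_e$ (edges odd for even $n$, internal vertices odd for odd $n$). The differential, of degree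 $+1$, is $d\Gamma=\sum_a\pm\Gamma/a$, where $a$ runs over the edges between two different internal vertices; the tail of $a$ is merged into its head, the sign is $(-1)^{i-1}$ with $i$ the number of $a$ (for even $n$) or of the tail of $a$ (for odd $n$), and in the oriented case terms with a directed cycle are dropped. The complexes of formal series of graphs $\mathsf{HGC}^S_n=(\mathsf{HG}^S_n,d)^*$ and $\mathsf{HOGC}^S_n=(\mathsf{HOG}^S_n,d)^*$ are their (degreewise) duals, with the dual differential $\delta$ of degree $+1$. **The maps.** A spanning forest $\tau$ of $\Gamma$ is a subgraph without cycles which contains all vertices and each of whose connected components contains exactly one external vertex. Let $\Phi_\tau(\Gamma)$ be the directed graph in which each edge of $\tau$ is directed towards the external vertex of its component, and each other edge $a$ is replaced by a zigzag $\bullet\leftarrow m_a\rightarrow\bullet$ with a new internal vertex $m_a$. Its labelling and sign are as follows: an internal vertex gets the number of the forest edge leaving it, and $m_a$ gets the number of $a$; the edges are ordered by listing first the forest edges, by the number of their tail in $\Gamma$, and then the halves of the zigzags, by the number of $a$, with the half towards the tail of $a$ in front of the half towards the head of $a$; for odd $n$ there is a factor $-1$ for each edge of $\tau$ whose direction has been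 reversed. Put $\Phi(\Gamma)=\sum_\tau\Phi_\tau(\Gamma)$, summed over all spanning forests. **Theorem.** The differentials above are well defined on the quotients and square to zero. For every finite $S$, $\Phi$ defines a degree-preserving map of complexes $\Phi:(\mathsf{HG}^S_n,d)\to(\mathsf{HOG}^S_{n+1},d)$; let $$F:(\mathsf{HOGC}^S_{n+1},\delta)\to(\mathsf{HGC}^S_n,\delta)$$ be its dual. If $S\neq\emptyset$, then $F$ and $\Phi$ are quasi-isomorphisms. The complexes are functorial with respect to bijections of label sets $S$, and $F$ and $\Phi$ are natural in $S$. The differentials $\delta$, and $F$ and $\Phi$, preserve the loop order. -/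

import Mathlib

open CategoryTheory

universe u w

noncomputable section

/-! ### Graphs with hairs -/

/-- A finite multigraph with directed edges, with internal vertices `V`, external vertices `S` and
edges `E`. Multiple edges and tadpoles are possible. For undirected graphs the directions are only
part of the labelling, and they are removed below by passing to coinvariants. -/
@[ext] structure HairyGraph (V E S : Type*) where
  /-- the tail of an edge -/
  src : E → V ⊕ S
  /-- the head of an edge -/
  tgt : E → V ⊕ S

namespace HairyGraph

variable {V E S : Type*} (Γ : HairyGraph V E S)

/-- The number of outgoing edges at `x`. -/
def outDeg (x : V ⊕ S) : ℕ := Nat.card {a : E // Γ.src a = x}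

/-- The number of incoming edges at `x`. -/
def inDeg (x : V ⊕ S) : ℕ := Nat.card {a : E // Γ.tgt a = x}

/-- The valency of `x`; a tadpole counts twice. -/
def valency (x : V ⊕ S) : ℕ := Γ.outDeg x + Γ.inDeg x

/-- The simple graph that underlies the spanning subgraph with edge set `τ`. -/
def subgraph (τ : Set E) : SimpleGraph (V ⊕ S) :=
  SimpleGraph.fromRel fun x y => ∃ a ∈ τ, Γ.src a = x ∧ Γ.tgt a = y

/-- Connectedness of the whole graph, external vertices included. -/
def IsConnected : Prop := (Γ.subgraph Set.univ).Connected

/-- The graphs that span the undirected hairy graph complex. The graph without internal vertices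
that consists of one edge between two external vertices is included. -/
def IsUndirectedAdmissible : Prop :=
  Γ.IsConnected ∧ (∀ v : V, 3 ≤ Γ.valency (Sum.inl v)) ∧ ∀ s : S, Γ.valency (Sum.inr s) = 1

/-- The graphs that span the oriented hairy graph complex: external vertices are 1-valent
targets, internal vertices are at least 2-valent, neither targets nor passing vertices, and there
is no directed cycle. -/
def IsOrientedAdmissible : Prop :=
  Γ.IsConnected ∧
  (∀ s : S, Γ.outDeg (Sum.inr s) = 0 ∧ Γ.inDeg (Sum.inr s) = 1) ∧
  (∀ v : V, 2 ≤ Γ.valency (Sum.inl v)) ∧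
  (∀ v : V, 1 ≤ Γ.outDeg (Sum.inl v)) ∧
  (∀ v : V, ¬ (Γ.inDeg (Sum.inl v) = 1 ∧ Γ.outDeg (Sum.inl v) = 1)) ∧
  ∀ x, ¬ Relation.TransGen (fun y z => ∃ a, Γ.src a = y ∧ Γ.tgt a = z) x x

/-- Renaming of internal vertices by `σ` and of edges by `ρ`, where in addition the direction of
each edge `a` with `ε a = true` is reversed. -/
def relabel {V' E' : Type*} (σ : V ≃ V') (ρ : E ≃ E') (ε : E → Bool) : HairyGraph V' E' S where
  src b := Sum.map σ id (if ε (ρ.symm b) then Γ.tgt (ρ.symm b) else Γ.src (ρ.symm b))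
  tgt b := Sum.map σ id (if ε (ρ.symm b) then Γ.src (ρ.symm b) else Γ.tgt (ρ.symm b))

/-- Renaming of external vertices by `θ`. -/
def mapHairs {T : Type*} (θ : S ≃ T) : HairyGraph V E T where
  src a := Equiv.sumCongr (Equiv.refl V) θ (Γ.src a)
  tgt a := Equiv.sumCongr (Equiv.refl V) θ (Γ.tgt a)

/-- A graph whose vertices and edges are linearly ordered, with the vertices and edges
numbered in increasing order. -/
def numbered [Fintype V] [LinearOrder V] [Fintype E] [LinearOrder E] :
    HairyGraph (Fin (Fintype.card V)) (Fin (Fintype.card E)) S :=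
  Γ.relabel (monoEquivOfFin V rfl).symm.toEquiv (monoEquivOfFin E rfl).symm.toEquiv
    fun _ => false

/-- The edges that can be contracted: edges between two different internal vertices, together
with their tail and head. -/
def Contractible : Type _ :=
  {p : E × V × V // Γ.src p.1 = Sum.inl p.2.1 ∧ Γ.tgt p.1 = Sum.inl p.2.2 ∧ p.2.2 ≠ p.2.1}

instance [Finite V] [Finite E] : Finite Γ.Contractible := by
  unfold Contractible; infer_instance

instance [Finite V] [Finite E] : Fintype Γ.Contractible := Fintype.ofFinite _

variable {Γ}

/-- The contracted edge. -/
def Contractible.edge (p : Γ.Contractible) : E := p.1.1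

/-- The tail of the contracted edge. -/
def Contractible.tail (p : Γ.Contractible) : V := p.1.2.1

/-- The head of the contracted edge. -/
def Contractible.head (p : Γ.Contractible) : V := p.1.2.2

open Classical in
/-- The map on vertices for the contraction of an edge: the tail is merged into the head. -/
def Contractible.merge (p : Γ.Contractible) : V ⊕ S → {v : V // v ≠ p.tail} ⊕ S
  | Sum.inl v => Sum.inl (if h : v = p.tail then ⟨p.head, p.2.2.2⟩ else ⟨v, h⟩)
  | Sum.inr s => Sum.inr s

variable (Γ)

/-- The contraction `Γ/a` of an edge `a`. The edge is deleted, and its tail is merged into its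
head, so the remaining vertices and edges keep their order. -/
def contract (p : Γ.Contractible) :
    HairyGraph {v : V // v ≠ p.tail} {b : E // b ≠ p.edge} S where
  src b := p.merge (Γ.src b)
  tgt b := p.merge (Γ.tgt b)

end HairyGraph

/-! ### The two graph complexes -/

/-- The two kinds of hairy graph complexes. -/
inductive Flavor
  /-- undirected graphs with at least 3-valent internal vertices -/
  | undirected
  /-- directed acyclic graphs with at least 2-valent internal vertices -/
  | oriented

/-- Admissible graphs of either kind. -/
def HairyGraph.IsAdmissible {V E S : Type*} : Flavor → HairyGraph V E S → Prop
  | .undirected, Γ => Γ.IsUndirectedAdmissible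
  | .oriented, Γ => Γ.IsOrientedAdmissible

/-- Labelled admissible graphs: internal vertices and edges are numbered. -/
structure LabelledGraph (c : Flavor) (S : Type w) where
  /-- the number of internal vertices -/
  v : ℕ
  /-- the number of edges, those at external vertices included -/
  e : ℕ
  /-- the graph -/
  graph : HairyGraph (Fin v) (Fin e) S
  adm : graph.IsAdmissible c

namespace LabelledGraph

variable {c : Flavor} {S : Type w}

/-- The degree: every edge has degree `n - 1` and every internal vertex has degree `-n`. -/
def degree (n : ℤ) (Γ : LabelledGraph c S) : ℤ := (n - 1) * Γ.e - n * Γ.v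

/-- The loop order, i.e. the first Betti number of the (connected) graph. -/
def loopOrder (Γ : LabelledGraph c S) : ℤ := Γ.e - (Γ.v + Nat.card S) + 1

end LabelledGraph

/-- The sign by which a relabelling acts: for even `n` edges are odd, for odd `n` internal
vertices and edge directions are odd. -/
def relabelSign (n : ℤ) {v e : ℕ} (σ : Equiv.Perm (Fin v)) (ρ : Equiv.Perm (Fin e))
    (ε : Fin e → Bool) : ℤ :=
  if Even n then (Equiv.Perm.sign ρ : ℤ)
  else (Equiv.Perm.sign σ : ℤ) * ∏ a, if ε a then (-1 : ℤ) else 1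

section Complex

variable (K : Type u) [Field K] (c : Flavor) (n : ℤ) (S : Type w)

/-- Formal linear combinations of labelled admissible graphs of degree `k`. -/
abbrev FreeGraphs (k : ℤ) : Type (max u w) := {Γ : LabelledGraph c S // Γ.degree n = k} →₀ K

/-- The relations `g Γ = sgn(g) Γ` for the group `𝕊_v × (𝕊_e ⋉ 𝕊_2^e)` in the undirected case,
and for the group `𝕊_v × 𝕊_e` in the oriented case. -/
def signRelations (k : ℤ) : Submodule K (FreeGraphs K c n S k) :=
  Submodule.span K
    {x | ∃ (v e : ℕ) (Γ Γ' : HairyGraph (Fin v) (Fin e) S)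
      (h : Γ.IsAdmissible c) (h' : Γ'.IsAdmissible c)
      (hk : LabelledGraph.degree n ⟨v, e, Γ, h⟩ = k)
      (hk' : LabelledGraph.degree n ⟨v, e, Γ', h'⟩ = k)
      (σ : Equiv.Perm (Fin v)) (ρ : Equiv.Perm (Fin e)) (ε : Fin e → Bool),
      (c = .oriented → ∀ a, ε a = false) ∧
      Γ' = Γ.relabel σ ρ ε ∧
      x = Finsupp.single ⟨⟨v, e, Γ', h'⟩, hk'⟩ 1
        - (relabelSign n σ ρ ε : K) • Finsupp.single ⟨⟨v, e, Γ, h⟩, hk⟩ 1}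

/-- The degree `k` part of the graph complex `HG^S_n` (for `c = undirected`) or `HOG^S_n`
(for `c = oriented`): coinvariants of labelled graphs. -/
abbrev GraphSpace (k : ℤ) : Type (max u w) := FreeGraphs K c n S k ⧸ signRelations K c n S k

variable {S}

open Classical in
/-- The degree `k` component of the class of a graph with linearly ordered vertices and edges.
It is zero if the graph is not admissible, or if its degree is different from `k`. -/
def graphClass {V E : Type*} [Fintype V] [LinearOrder V] [Fintype E] [LinearOrder E] (k : ℤ)
    (Γ : HairyGraph V E S) : GraphSpace K c n S k :=
  if h : ∃ h : Γ.numbered.IsAdmissible c, LabelledGraph.degree n ⟨_, _, Γ.numbered, h⟩ = k then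
    Submodule.Quotient.mk (Finsupp.single ⟨⟨_, _, Γ.numbered, h.1⟩, h.2⟩ 1)
  else 0

/-- The sign of the contraction of an edge: the odd edge (for even `n`), respectively the odd
vertex which is merged into its neighbour (for odd `n`), is first moved to the front. -/
def contractSign {v e : ℕ} {Γ : HairyGraph (Fin v) (Fin e) S} (p : Γ.Contractible) : ℤ :=
  if Even n then (-1) ^ (p.edge : ℕ) else (-1) ^ (p.tail : ℕ)

variable (S)

/-- The differential `d Γ = ∑_a Γ/a` on labelled graphs, as a map from degree `i` to degree `j`.
It is zero unless `j = i + 1`, because a contraction raises the degree by one. In the oriented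
case contractions with a directed cycle are dropped. -/
def contractFree (i j : ℤ) : FreeGraphs K c n S i →ₗ[K] GraphSpace K c n S j :=
  Finsupp.linearCombination K fun Γ =>
    ∑ p : Γ.1.graph.Contractible,
      (contractSign n p : K) • graphClass K c n j (Γ.1.graph.contract p)

/-- The contraction differential passes to coinvariants, and its square is zero. -/
structure IsGraphComplex : Prop where
  descends : ∀ i j, signRelations K c n S i ≤ LinearMap.ker (contractFree K c n S i j)
  sq_zero : ∀ i j k,
    (Submodule.liftQ _ (contractFree K c n S j k) (descends j k)) ∘ₗ
      (Submodule.liftQ _ (contractFree K c n S i j) (descends i j)) = 0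

theorem graphClass_eq_zero {V E : Type*} [Fintype V] [LinearOrder V] [Fintype E] [LinearOrder E]
    {k : ℤ} (Γ : HairyGraph V E S)
    (h : (n - 1) * (Fintype.card E : ℤ) - n * (Fintype.card V : ℤ) ≠ k) :
    graphClass K c n k Γ = 0 :=
  dif_neg fun ⟨_, h'⟩ => h h'

theorem contractFree_eq_zero {i j : ℤ} (hij : i + 1 ≠ j) : contractFree K c n S i j = 0 := by
  refine Finsupp.lhom_ext' fun Γ => LinearMap.ext_ring ?_
  obtain ⟨⟨v, e, Γ, h⟩, rfl⟩ := Γ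
  simp only [contractFree, LinearMap.comp_apply, Finsupp.lsingle_apply,
    Finsupp.linearCombination_single, one_smul, LinearMap.zero_apply]
  refine Finset.sum_eq_zero fun p _ => ?_
  rw [graphClass_eq_zero, smul_zero]
  have hv : 0 < v := p.tail.pos
  have he : 0 < e := p.edge.pos
  intro hj
  apply hij
  rw [← hj]
  simp only [ne_eq, LabelledGraph.degree, Fintype.card_subtype_compl, Fintype.card_fin,
    Fintype.card_subtype_eq, Nat.cast_sub hv, Nat.cast_sub he]
  push_cast
  ring

variable {K c n S}


/-- The contraction differential on coinvariants. -/
def IsGraphComplex.d (h : IsGraphComplex K c n S) (i j : ℤ) :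
    GraphSpace K c n S i →ₗ[K] GraphSpace K c n S j :=
  Submodule.liftQ _ (contractFree K c n S i j) (h.descends i j)

theorem IsGraphComplex.d_eq_zero (h : IsGraphComplex K c n S) {i j : ℤ} (hij : i + 1 ≠ j) :
    h.d i j = 0 := by
  refine Submodule.linearMap_qext _ ?_
  simp [IsGraphComplex.d, contractFree_eq_zero K c n S hij]

/-- The degree `k` part of the dual complex, `HGC^S_n` respectively `HOGC^S_n`: all linear
functionals on the part of degree `-k`, i.e. formal series of graphs. -/
abbrev DualGraphSpace (K : Type u) [Field K] (c : Flavor) (n : ℤ) (S : Type w) (k : ℤ) :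
    Type (max u w) :=
  Module.Dual K (GraphSpace K c n S (-k))

/-- The vertex splitting differential `δ`, the transpose of the contraction differential. -/
def IsGraphComplex.δ (h : IsGraphComplex K c n S) (i j : ℤ) :
    DualGraphSpace K c n S i →ₗ[K] DualGraphSpace K c n S j :=
  (h.d (-j) (-i)).dualMap

/-- The cochain complex `(HG^S_n, d)`, respectively `(HOG^S_n, d)`. -/
def IsGraphComplex.complex (h : IsGraphComplex K c n S) :
    CochainComplex (ModuleCat.{max u w} K) ℤ where
  X k := ModuleCat.of K (GraphSpace K c n S k)
  d i j := ModuleCat.ofHom (h.d i j)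
  shape i j hij := by rw [h.d_eq_zero hij]; rfl
  d_comp_d' i j k _ _ := by
    rw [← ModuleCat.ofHom_comp, show h.d j k ∘ₗ h.d i j = 0 from h.sq_zero i j k]; rfl

/-- The dual cochain complex `(HGC^S_n, δ)`, respectively `(HOGC^S_n, δ)`. -/
def IsGraphComplex.dualComplex (h : IsGraphComplex K c n S) :
    CochainComplex (ModuleCat.{max u w} K) ℤ where
  X k := ModuleCat.of K (DualGraphSpace K c n S k)
  d i j := ModuleCat.ofHom (h.δ i j)
  shape i j hij := by
    rw [IsGraphComplex.δ, h.d_eq_zero (fun e => hij (show i + 1 = j by omega))]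
    ext; simp
  d_comp_d' i j k _ _ := by
    rw [← ModuleCat.ofHom_comp, IsGraphComplex.δ, IsGraphComplex.δ,
      LinearMap.dualMap_comp_dualMap,
      show h.d (-j) (-i) ∘ₗ h.d (-k) (-j) = 0 from h.sq_zero _ _ _]
    ext; simp

end Complex

/-! ### Functoriality in the label set, and the loop order -/

section Functoriality

variable {S T : Type w}

namespace HairyGraph

variable {V E : Type*} (Γ : HairyGraph V E S) (θ : S ≃ T)

theorem outDeg_mapHairs (x : V ⊕ S) :
    (Γ.mapHairs θ).outDeg (Equiv.sumCongr (Equiv.refl V) θ x) = Γ.outDeg x := by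
  simp only [outDeg, mapHairs, EmbeddingLike.apply_eq_iff_eq]

theorem inDeg_mapHairs (x : V ⊕ S) :
    (Γ.mapHairs θ).inDeg (Equiv.sumCongr (Equiv.refl V) θ x) = Γ.inDeg x := by
  simp only [inDeg, mapHairs, EmbeddingLike.apply_eq_iff_eq]

theorem valency_mapHairs (x : V ⊕ S) :
    (Γ.mapHairs θ).valency (Equiv.sumCongr (Equiv.refl V) θ x) = Γ.valency x := by
  rw [valency, valency, outDeg_mapHairs, inDeg_mapHairs]

theorem IsConnected.mapHairs {Γ : HairyGraph V E S} (h : Γ.IsConnected) :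
    (Γ.mapHairs θ).IsConnected := by
  refine (SimpleGraph.Iso.connected_iff (G := Γ.subgraph Set.univ)
    (H := (Γ.mapHairs θ).subgraph Set.univ)
    ⟨Equiv.sumCongr (Equiv.refl V) θ, ?_⟩).1 h
  intro x y
  simp only [subgraph, SimpleGraph.fromRel_adj, HairyGraph.mapHairs, Set.mem_univ, true_and,
    EmbeddingLike.apply_eq_iff_eq, ne_eq]

theorem IsAdmissible.mapHairs {Γ : HairyGraph V E S} {c : Flavor} (h : Γ.IsAdmissible c) :
    (Γ.mapHairs θ).IsAdmissible c := by
  have hv (v : V) : (Sum.inl v : V ⊕ T) = Equiv.sumCongr (Equiv.refl V) θ (Sum.inl v) := rfl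
  have hs (t : T) : (Sum.inr t : V ⊕ T) =
      Equiv.sumCongr (Equiv.refl V) θ (Sum.inr (θ.symm t)) := by simp
  cases c with
  | undirected =>
    obtain ⟨h1, h2, h3⟩ := h
    refine ⟨h1.mapHairs θ, fun v => ?_, fun t => ?_⟩
    · rw [hv, valency_mapHairs]; exact h2 v
    · rw [hs, valency_mapHairs]; exact h3 _
  | oriented =>
    obtain ⟨h1, h2, h3, h4, h5, h6⟩ := h
    refine ⟨h1.mapHairs θ, fun t => ?_, fun v => ?_, fun v => ?_, fun v => ?_, fun x hx => ?_⟩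
    · rw [hs, outDeg_mapHairs, inDeg_mapHairs]; exact h2 _
    · rw [hv, valency_mapHairs]; exact h3 v
    · rw [hv, outDeg_mapHairs]; exact h4 v
    · rw [hv, outDeg_mapHairs, inDeg_mapHairs]; exact h5 v
    · refine h6 ((Equiv.sumCongr (Equiv.refl V) θ).symm x)
        (Relation.TransGen.lift (Equiv.sumCongr (Equiv.refl V) θ).symm ?_ _ _ hx)
      rintro y z ⟨a, rfl, rfl⟩
      exact ⟨a, (Equiv.symm_apply_apply _ _).symm, (Equiv.symm_apply_apply _ _).symm⟩

theorem mapHairs_relabel {V' E' : Type*} (σ : V ≃ V') (ρ : E ≃ E') (ε : E → Bool) :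
    (Γ.relabel σ ρ ε).mapHairs θ = (Γ.mapHairs θ).relabel σ ρ ε := by
  ext b <;> simp only [mapHairs, relabel] <;> split_ifs
  · cases Γ.tgt (ρ.symm b) <;> rfl
  · cases Γ.src (ρ.symm b) <;> rfl
  · cases Γ.src (ρ.symm b) <;> rfl
  · cases Γ.tgt (ρ.symm b) <;> rfl

end HairyGraph

/-- Renaming of external vertices on labelled graphs. -/
def LabelledGraph.mapHairs {c : Flavor} (θ : S ≃ T) (Γ : LabelledGraph c S) :
    LabelledGraph c T where
  v := Γ.v
  e := Γ.e
  graph := Γ.graph.mapHairs θ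
  adm := Γ.adm.mapHairs θ

variable (K : Type u) [Field K] (c : Flavor) (n : ℤ)

/-- Renaming of external vertices on formal linear combinations. -/
def mapFree (θ : S ≃ T) (k : ℤ) : FreeGraphs K c n S k →ₗ[K] FreeGraphs K c n T k :=
  Finsupp.lmapDomain K K fun Γ => ⟨Γ.1.mapHairs θ, Γ.2⟩

theorem signRelations_le_mapFree (θ : S ≃ T) (k : ℤ) :
    signRelations K c n S k ≤ (signRelations K c n T k).comap (mapFree K c n θ k) := by
  refine Submodule.span_le.2 ?_
  rintro _ ⟨v, e, Γ, Γ', h, h', hk, hk', σ, ρ, ε, hc, hΓ, rfl⟩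
  refine Submodule.subset_span
    ⟨v, e, Γ.mapHairs θ, Γ'.mapHairs θ, h.mapHairs θ, h'.mapHairs θ, hk, hk', σ, ρ, ε, hc, ?_, ?_⟩
  · rw [hΓ, HairyGraph.mapHairs_relabel]
  · rw [map_sub, map_smul]
    simp only [mapFree, Finsupp.lmapDomain_apply, Finsupp.mapDomain_single]
    rfl

/-- The action of a bijection of label sets on `HG_n`, respectively `HOG_n`. -/
def graphMap (θ : S ≃ T) (k : ℤ) : GraphSpace K c n S k →ₗ[K] GraphSpace K c n T k :=
  Submodule.mapQ _ _ (mapFree K c n θ k) (signRelations_le_mapFree K c n θ k)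

/-- The action of a bijection of label sets on `HGC_n`, respectively `HOGC_n`. -/
def dualGraphMap (θ : S ≃ T) (k : ℤ) :
    DualGraphSpace K c n S k →ₗ[K] DualGraphSpace K c n T k :=
  (graphMap K c n θ.symm (-k)).dualMap

/-- The part of loop order `g` of `HG^S_n`, respectively `HOG^S_n`, in degree `k`. -/
def loopPart (S : Type w) (g k : ℤ) : Submodule K (GraphSpace K c n S k) :=
  Submodule.span K
    {x | ∃ Γ : {Γ : LabelledGraph c S // Γ.degree n = k},
      Γ.1.loopOrder = g ∧ x = Submodule.Quotient.mk (Finsupp.single Γ 1)}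

/-- The part of loop order `g` of `HGC^S_n`, respectively `HOGC^S_n`, in degree `k`: the
functionals that vanish on all graphs of other loop orders. -/
def dualLoopPart (S : Type w) (g k : ℤ) : Submodule K (DualGraphSpace K c n S k) :=
  (⨆ g' : {g' : ℤ // g' ≠ g}, loopPart K c n S g' (-k)).dualAnnihilator

end Functoriality

/-! ### Spanning forests, and the maps `Φ` and `F` -/

namespace HairyGraph

variable {V E S : Type*} (Γ : HairyGraph V E S)

/-- A set `τ` of edges is (the set of edges of) a spanning forest, if the subgraph which consists
of `τ` and all vertices has no cycles (in particular no tadpoles and no multiple edges), and each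
of its connected components contains exactly one external vertex. -/
def IsSpanningForest (τ : Finset E) : Prop :=
  (∀ a ∈ τ, Γ.src a ≠ Γ.tgt a) ∧
  (∀ a ∈ τ, ∀ b ∈ τ, s(Γ.src a, Γ.tgt a) = s(Γ.src b, Γ.tgt b) → a = b) ∧
  (Γ.subgraph (τ : Set E)).IsAcyclic ∧
  ∀ x, ∃! s : S, (Γ.subgraph (τ : Set E)).Reachable x (Sum.inr s)

/-- The edge `a` of `τ` is the first edge on the way from `x` to the external vertex in its tree:
`a` is incident to `x`, and without `a` the forest does not connect `x` to an external vertex.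
Equivalently, `x` is the tail of `a` if the forest is directed towards the external vertices. -/
def LeavesThrough (τ : Finset E) (x : V) (a : E) : Prop :=
  a ∈ τ ∧ (Γ.src a = Sum.inl x ∨ Γ.tgt a = Sum.inl x) ∧
    ∀ s : S, ¬ (Γ.subgraph ((τ : Set E) \ {a})).Reachable (Sum.inl x) (Sum.inr s)

/-- The spanning forests of a graph, together with the function that sends an internal vertex to
the forest edge through which it is left in direction of the external vertex. (This function is
determined by the forest.) -/
def SpanningForest : Type _ :=
  {p : Finset E × (V → E) // Γ.IsSpanningForest p.1 ∧ ∀ x, Γ.LeavesThrough p.1 x (p.2 x)}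

instance [Finite V] [Finite E] : Finite Γ.SpanningForest := by
  unfold SpanningForest; infer_instance

instance [Finite V] [Finite E] : Fintype Γ.SpanningForest := Fintype.ofFinite _

variable {Γ}

/-- The edges of a spanning forest. -/
def SpanningForest.edges (τ : Γ.SpanningForest) : Finset E := τ.1.1

/-- The forest edge with tail `x`, if the forest is directed towards the external vertices. -/
def SpanningForest.out (τ : Γ.SpanningForest) : V → E := τ.1.2

variable (Γ)

open Classical in
/-- The directed graph that is obtained from `Γ` by directing the edges of the forest `τ` towards
the external vertices, and by replacing each other edge `a` by a zigzag `∙ ← m_a → ∙`.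

Its internal vertices are numbered by the edges of `Γ`: an internal vertex of `Γ` gets the number
of the forest edge that leaves it, and `m_a` gets the number of `a`. Its edges are ordered as
follows: first the forest edges, in the order of their tails in `Γ`, then the two halves
of the zigzags, in the order of the edges `a`, the half `m_a → src a` before the half
`m_a → tgt a`. -/
def forestGraph (τ : Γ.SpanningForest) :
    HairyGraph E (V ⊕ₗ ({a : E // a ∉ τ.edges} ×ₗ Bool)) S where
  src b := match ofLex b with
    | Sum.inl x => Sum.inl (τ.out x)
    | Sum.inr q => Sum.inl (ofLex q).1.1
  tgt b := Sum.map τ.out id <| match ofLex b with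
    | Sum.inl x => if Γ.src (τ.out x) = Sum.inl x then Γ.tgt (τ.out x) else Γ.src (τ.out x)
    | Sum.inr q => if (ofLex q).2 then Γ.tgt (ofLex q).1 else Γ.src (ofLex q).1

open Classical in
/-- The sign for the change of directions of forest edges: for odd `n`, a factor `-1` for each
forest edge whose direction in `Γ` is not the one towards the external vertex. -/
def forestSign (n : ℤ) [Fintype V] (τ : Γ.SpanningForest) : ℤ :=
  if Even n then 1 else ∏ x : V, if Γ.src (τ.out x) = Sum.inl x then 1 else -1

end HairyGraph

section Phi

variable (K : Type u) [Field K] (n : ℤ) (S : Type w)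

/-- The map `Φ Γ = ∑_τ Φ_τ(Γ)` on labelled graphs, with sum over all spanning forests. -/
def phiFree (k : ℤ) :
    FreeGraphs K .undirected n S k →ₗ[K] GraphSpace K .oriented (n + 1) S k :=
  Finsupp.linearCombination K fun Γ =>
    ∑ τ : Γ.1.graph.SpanningForest,
      (Γ.1.graph.forestSign n τ : K) • graphClass K .oriented (n + 1) k (Γ.1.graph.forestGraph τ)

variable {K n S}

/-- `Φ` passes to coinvariants, and is compatible with the differentials. -/
structure IsForestMap (hG : IsGraphComplex K .undirected n S)
    (hO : IsGraphComplex K .oriented (n + 1) S) : Prop where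
  descends : ∀ k, signRelations K .undirected n S k ≤ LinearMap.ker (phiFree K n S k)
  comm : ∀ i j, hO.d i j ∘ₗ Submodule.liftQ _ (phiFree K n S i) (descends i) =
    Submodule.liftQ _ (phiFree K n S j) (descends j) ∘ₗ hG.d i j

variable {hG : IsGraphComplex K .undirected n S} {hO : IsGraphComplex K .oriented (n + 1) S}

namespace IsForestMap

/-- The map `Φ : HG^S_n → HOG^S_{n+1}` in degree `k`. -/
def Φ (h : IsForestMap hG hO) (k : ℤ) :
    GraphSpace K .undirected n S k →ₗ[K] GraphSpace K .oriented (n + 1) S k :=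
  Submodule.liftQ _ (phiFree K n S k) (h.descends k)

/-- The map `F : HOGC^S_{n+1} → HGC^S_n` in degree `k`, the transpose of `Φ`. -/
def F (h : IsForestMap hG hO) (k : ℤ) :
    DualGraphSpace K .oriented (n + 1) S k →ₗ[K] DualGraphSpace K .undirected n S k :=
  (h.Φ (-k)).dualMap

/-- `Φ` as a map of complexes. -/
def ΦHom (h : IsForestMap hG hO) : hG.complex ⟶ hO.complex where
  f k := ModuleCat.ofHom (h.Φ k)
  comm' i j _ := congrArg ModuleCat.ofHom (h.comm i j)

/-- `F` as a map of complexes. -/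
def FHom (h : IsForestMap hG hO) : hO.dualComplex ⟶ hG.dualComplex where
  f k := ModuleCat.ofHom (h.F k)
  comm' i j _ := congrArg (fun f => ModuleCat.ofHom (LinearMap.dualMap f)) (h.comm (-j) (-i)).symm

end IsForestMap

end Phi

end

/-!
An oriented-admissible graph `Δ` arises in exactly one way, up to isomorphism, from an
undirected-admissible graph `Γ` in which some edges are directed and each other edge is replaced by
a zigzag `∙ ← m → ∙`: the midpoints `m` are the 2-valent vertices of `Δ`
(`HairyGraph.IsAdmissible.exists_zigzagGraph`, `exists_isStateIso`). Such a choice is encoded by a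
state `st : E → Option Bool`, where `none` stands for a zigzag and `some r` for a direction, and the
class of the resulting graph is `zigzagClass K n k Γ st`. It is zero unless `st` is good: a
directed edge leaves each internal vertex of `Γ`, none leaves an external vertex, and there is no
directed cycle.

The contraction differential of such a graph has two parts (`dMap_zigzagClass`): contraction of one
half of a zigzag turns an undirected edge of `Γ` into a directed one, in both possible ways, and
contraction of a directed edge of `Γ` lowers the number of vertices of `Γ`. The transpose of the
first part acts on functions of the states of the fixed graph `Γ` by `zigzagDiff`. Good states have
at least as many directed edges as `Γ` has vertices, and equality holds exactly for the states that
come from spanning forests (directed towards the hairs). So the sum over spanning forests is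
the sum of all `forestCoeff st • zigzagClass K n k Γ st` (`sum_forestGraph`), and a comparison of
the forests of `Γ` and of its contractions shows that `Φ` is a map of complexes (`isForestMap`).

The key point is that the functions on good states are acyclic with respect to `zigzagDiff`, up to
one class in the lowest degree, which is represented by `forestCoeff` (`exists_zigzagDiff_eq`). For
the proof, a breadth-first search forest `τ` from an external vertex is fixed. A cocycle with
value zero at `τ` is changed by coboundaries until it vanishes on all states in which, for each vertex `x`
of a set `R`, only the edge of `τ` leaves `x`. The set `R` is decreased from the set of all vertices
to the empty set, one vertex at a time, and each step uses the contracting homotopy that toggles the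
edge of `τ` at this vertex between a zigzag and its outgoing direction (`exists_zigzagDiff_step`).

As the characteristic is zero, the generators are well controlled by the pairing that counts
isomorphisms with signs (`pairing`): a sum over all relabellings is a projection to the part with
given numbers of vertices and edges of `Γ`. By descending induction on the number of vertices of
`Γ` one obtains that the mapping cone of `Φ` is acyclic (`exists_eq_phiMap_add_dMap`). The mapping
cone of `F` is its dual, and therefore it is acyclic as well.
-/

open CategoryTheory

noncomputable section

/-! ### Signs of bijections between finite linear orders -/

section Sgn

variable {A B C A₀ B₀ : Type*} [Fintype A] [LinearOrder A] [Fintype B] [LinearOrder B]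
  [Fintype C] [LinearOrder C] [Fintype A₀] [LinearOrder A₀] [Fintype B₀] [LinearOrder B₀]

/-- The sign of a bijection between finite linear orders: the sign of the permutation that it
becomes when both sides are numbered in increasing order. -/
def sgn (f : A ≃ B) : ℤ :=
  Equiv.Perm.sign (((monoEquivOfFin A rfl).toEquiv.trans f).trans
    (monoEquivOfFin B (Fintype.card_congr f).symm).symm.toEquiv)

/-- The number of elements below `x`. -/
def rk (x : A) : ℕ := (Finset.univ.filter (· < x)).card

theorem sgn_eq_sign_of_numbering {k : ℕ} (f : A ≃ B) (i : Fin k ≃o A) (j : Fin k ≃o B) :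
    sgn f = Equiv.Perm.sign ((i.toEquiv.trans f).trans j.symm.toEquiv) := by
  obtain rfl : k = Fintype.card A := by simpa using Fintype.card_congr i.toEquiv
  obtain rfl : i = monoEquivOfFin A rfl := Subsingleton.elim _ _
  obtain rfl : j = monoEquivOfFin B (Fintype.card_congr f).symm := Subsingleton.elim _ _
  rfl

theorem sgn_trans (f : A ≃ B) (g : B ≃ C) : sgn (f.trans g) = sgn f * sgn g := by
  have hB := (Fintype.card_congr f).symm
  have hC := (Fintype.card_congr (f.trans g)).symm
  rw [sgn_eq_sign_of_numbering f (monoEquivOfFin A rfl) (monoEquivOfFin B hB),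
    sgn_eq_sign_of_numbering g (monoEquivOfFin B hB) (monoEquivOfFin C hC),
    sgn_eq_sign_of_numbering (f.trans g) (monoEquivOfFin A rfl) (monoEquivOfFin C hC),
    mul_comm, ← Units.val_mul, ← Equiv.Perm.sign_mul]
  congr 2
  ext x
  simp [Equiv.Perm.mul_def]

theorem sgn_mul_self (f : A ≃ B) : sgn f * sgn f = 1 := by
  rw [sgn, ← Units.val_mul, Int.units_mul_self]; rfl

theorem sgn_eq_one_or (f : A ≃ B) : sgn f = 1 ∨ sgn f = -1 := by
  rcases Int.units_eq_one_or (Equiv.Perm.sign (((monoEquivOfFin A rfl).toEquiv.trans f).trans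
    (monoEquivOfFin B (Fintype.card_congr f).symm).symm.toEquiv)) with h | h <;>
    rw [sgn, h] <;> simp

theorem sgn_perm (f : Equiv.Perm A) : sgn f = Equiv.Perm.sign f := by
  rw [sgn_eq_sign_of_numbering f (monoEquivOfFin A rfl) (monoEquivOfFin A rfl)]
  exact congrArg _ (Equiv.Perm.sign_trans_trans_symm f (monoEquivOfFin A rfl).toEquiv)

theorem sgn_refl : sgn (Equiv.refl A) = 1 := by
  rw [sgn_perm]; simp

theorem sgn_symm (f : A ≃ B) : sgn f.symm = sgn f := by
  have h : sgn f * sgn f.symm = 1 := by rw [← sgn_trans, Equiv.self_trans_symm, sgn_refl]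
  rcases sgn_eq_one_or f with h1 | h1 <;> rw [h1] at h ⊢ <;> linarith

/-- The sign counts inversions. -/
theorem sgn_eq_prod (f : A ≃ B) :
    sgn f = ∏ a, ∏ b, if b < a ∧ f a < f b then (-1 : ℤ) else 1 := by
  rw [sgn, Equiv.Perm.sign_eq_prod_prod_Iio, Units.coe_prod]
  refine Fintype.prod_equiv (monoEquivOfFin A rfl).toEquiv _ _ fun i => ?_
  rw [Units.coe_prod, ← Finset.prod_subset (Finset.subset_univ
    ((Finset.Iio i).map (monoEquivOfFin A rfl).toEquiv.toEmbedding)), Finset.prod_map]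
  · refine Finset.prod_congr rfl fun j hj => ?_
    have hj' : monoEquivOfFin A rfl j < monoEquivOfFin A rfl i := by simpa using hj
    have hne : f (monoEquivOfFin A rfl j) ≠ f (monoEquivOfFin A rfl i) :=
      fun h => hj'.ne (f.injective h)
    simp only [Equiv.trans_apply, RelIso.coe_fn_toEquiv, OrderIso.lt_iff_lt,
      Equiv.coe_toEmbedding, hj', true_and]
    rcases hne.lt_or_gt with h | h
    · simp [h, h.not_gt]
    · simp [h, h.not_gt]
  · intro b _ hb
    rw [if_neg]
    rintro ⟨h, -⟩
    apply hb
    simp only [Finset.mem_map, Finset.mem_Iio]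
    exact ⟨(monoEquivOfFin A rfl).symm b, by
      rw [OrderIso.symm_apply_lt]; exact h, by simp⟩

theorem sgn_of_strictMono (f : A ≃ B) (hf : StrictMono f) : sgn f = 1 := by
  rw [sgn_eq_prod]
  refine Finset.prod_eq_one fun a _ => Finset.prod_eq_one fun b _ => if_neg ?_
  rintro ⟨h1, h2⟩
  exact (hf h1).not_gt h2

theorem neg_one_pow_rk (x : A) : (-1 : ℤ) ^ rk x = ∏ y, if y < x then -1 else 1 := by
  rw [rk, Finset.prod_ite, Finset.prod_const, Finset.prod_const_one, mul_one]

theorem prod_eq_mul_prod_compl {M : Type*} [CommMonoid M] {i : A₀ → A} (hi : StrictMono i) {x : A}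
    (hx : ∀ a, a ≠ x ↔ ∃ a₀, i a₀ = a) (F : A → M) : ∏ a, F a = F x * ∏ a, F (i a) := by
  have h : (Finset.univ : Finset A) = insert x (Finset.univ.map ⟨i, hi.injective⟩) := by
    ext a
    by_cases h : a = x
    · simp [h]
    · simpa [h] using (hx a).1 h
  rw [h, Finset.prod_insert, Finset.prod_map]
  · rfl
  · simp only [Finset.mem_map, not_exists, Finset.mem_univ, true_and]
    exact fun a ha => (hx x).2 ⟨a, ha⟩ rfl

/-- The effect on the sign of the deletion of an element `x` on the left and of its image `f x`
on the right. The remaining orders are given by order embeddings `i` and `j`. -/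
theorem sgn_eq_of_delete (f : A ≃ B) {x : A} {y : B} (hxy : f x = y) {i : A₀ → A} {j : B₀ → B}
    (hi : StrictMono i) (hj : StrictMono j) (hx : ∀ a, a ≠ x ↔ ∃ a₀, i a₀ = a)
    (f₀ : A₀ ≃ B₀) (hf : ∀ a, f (i a) = j (f₀ a)) :
    sgn f = (-1) ^ rk x * (-1) ^ rk y * sgn f₀ := by
  subst hxy
  have hy : ∀ b, b ≠ f x ↔ ∃ b₀, j b₀ = b := by
    intro b
    rw [← f.apply_symm_apply b, f.injective.ne_iff, hx]
    constructor
    · rintro ⟨a, ha⟩; exact ⟨f₀ a, by rw [← hf, ha]⟩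
    · rintro ⟨b₀, hb⟩
      exact ⟨f₀.symm b₀, f.injective (by rw [hf, Equiv.apply_symm_apply, hb])⟩
  have kA := fun F : A → ℤ => prod_eq_mul_prod_compl hi hx F
  have kB := fun F : B → ℤ => prod_eq_mul_prod_compl hj hy F
  rw [sgn_eq_prod f, sgn_eq_prod f₀, neg_one_pow_rk, neg_one_pow_rk, kB,
    ← f₀.prod_comp fun b => if j b < f x then (-1 : ℤ) else 1]
  simp only [kA, Finset.prod_mul_distrib, lt_irrefl, false_and, if_false, one_mul]
  simp only [← mul_assoc, ← Finset.prod_mul_distrib]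
  refine Finset.prod_congr rfl fun a _ => congrArg₂ (· * ·) ?_ ?_
  · have h1 : i a ≠ x := (hx _).2 ⟨a, rfl⟩
    have h2 : f (i a) ≠ f x := f.injective.ne h1
    rw [← hf]
    rcases h1.lt_or_gt with h1 | h1 <;> rcases h2.lt_or_gt with h2 | h2 <;>
      simp [h1, h2, h1.not_gt, h2.not_gt]
  · simp only [hf, hi.lt_iff_lt, hj.lt_iff_lt]

theorem sgn_delete (f : A ≃ B) {x : A} {y : B} (hxy : f x = y)
    (f₀ : {a // a ≠ x} ≃ {b // b ≠ y}) (hf : ∀ a : {a // a ≠ x}, f a = f₀ a) :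
    sgn f₀ = (-1) ^ rk x * (-1) ^ rk y * sgn f := by
  rw [sgn_eq_of_delete f hxy (Subtype.strictMono_coe _) (Subtype.strictMono_coe _) (by simp) f₀ hf]
  rcases neg_one_pow_eq_or ℤ (rk x) with h1 | h1 <;>
    rcases neg_one_pow_eq_or ℤ (rk y) with h2 | h2 <;> simp [h1, h2]

/-- The complement of `x` is compared with the complement of `y` by renaming `y` to `x`. -/
theorem sgn_replace {x y : A} (hxy : x ≠ y) (f₀ : {a // a ≠ x} ≃ {b // b ≠ y})
    (hf : ∀ a : {a // a ≠ x}, (f₀ a : A) = Equiv.swap x y a) :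
    sgn f₀ = -((-1) ^ rk x * (-1) ^ rk y) := by
  rw [sgn_delete (Equiv.swap x y) (Equiv.swap_apply_left x y) f₀ fun a => (hf a).symm, sgn_perm,
    Equiv.Perm.sign_swap hxy]
  simp

theorem sgn_sumCongr (f : A ≃ B) (g : A₀ ≃ B₀) (h : A ⊕ₗ A₀ ≃ B ⊕ₗ B₀)
    (hl : ∀ a, h (toLex (Sum.inl a)) = toLex (Sum.inl (f a)))
    (hr : ∀ a, h (toLex (Sum.inr a)) = toLex (Sum.inr (g a))) :
    sgn h = sgn f * sgn g := by
  have key : ∀ F : A ⊕ₗ A₀ → ℤ,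
      ∏ a, F a = (∏ a, F (toLex (Sum.inl a))) * ∏ a, F (toLex (Sum.inr a)) := fun F => by
    rw [← Fintype.prod_sum_type fun a => F (toLex a)]
    exact (Equiv.prod_comp toLex F).symm
  rw [sgn_eq_prod, sgn_eq_prod f, sgn_eq_prod g, key]
  simp only [key (fun b => ite _ _ _), hl, hr, Sum.Lex.inl_lt_inl_iff, Sum.Lex.inr_lt_inr_iff,
    Sum.Lex.not_inr_lt_inl, false_and, and_false, if_false, Finset.prod_const_one, one_mul, mul_one]

theorem rk_inl (a : A) : rk (toLex (Sum.inl a) : A ⊕ₗ A₀) = rk a := by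
  rw [rk, rk, ← Finset.card_map (Function.Embedding.inl.trans (toLex (α := A ⊕ A₀)).toEmbedding)]
  congr 1
  ext b
  induction b using Lex.rec with | _ b
  cases b <;> simp [Sum.Lex.toLex_lt_toLex]

theorem rk_inr (a : A₀) : rk (toLex (Sum.inr a) : A ⊕ₗ A₀) = Fintype.card A + rk a := by
  have : (Finset.univ.filter (· < (toLex (Sum.inr a) : A ⊕ₗ A₀))) =
      ((Finset.univ : Finset A).disjSum (Finset.univ.filter (· < a))).map
        (toLex (α := A ⊕ A₀)).toEmbedding := by
    ext b
    induction b using Lex.rec with | _ b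
    cases b <;> simp [Sum.Lex.toLex_lt_toLex]
  rw [rk, this, Finset.card_map, Finset.card_disjSum]
  rfl

theorem rk_prod_bool (a : A) (b : Bool) :
    rk (toLex (a, b) : A ×ₗ Bool) = 2 * rk a + (if b then 1 else 0) := by
  have : (Finset.univ.filter (· < (toLex (a, b) : A ×ₗ Bool))) =
      (((Finset.univ.filter (· < a)) ×ˢ (Finset.univ : Finset Bool)) ∪
        (if b then {(a, false)} else ∅)).map (toLex (α := A × Bool)).toEmbedding := by
    ext c
    induction c using Lex.rec with | _ c
    obtain ⟨c, d⟩ := c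
    cases b <;> cases d <;> simp [Prod.Lex.toLex_lt_toLex, or_comm]
  rw [rk, this, Finset.card_map, Finset.card_union_of_disjoint, Finset.card_product]
  · cases b <;> simp [rk, mul_comm]
  · cases b <;> simp

/-- A bijection between pairs of halves has as sign the number of pairs that are interchanged. -/
theorem sgn_prod_bool (f : A ≃ B) (ε : A → Bool) (h : A ×ₗ Bool ≃ B ×ₗ Bool)
    (hh : ∀ a b, h (toLex (a, b)) = toLex (f a, xor (ε a) b)) :
    sgn h = ∏ a, if ε a then -1 else 1 := by
  have key : ∀ F : A ×ₗ Bool → ℤ,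
      ∏ a, F a = ∏ a, F (toLex (a, true)) * F (toLex (a, false)) := fun F => by
    rw [← Equiv.prod_comp toLex F, Fintype.prod_prod_type]
    simp
  rw [sgn_eq_prod, key]
  refine Finset.prod_congr rfl fun a _ => ?_
  rw [key, key, ← Finset.prod_mul_distrib, Fintype.prod_eq_single a]
  · cases h : ε a <;> simp [hh, h, Prod.Lex.toLex_lt_toLex, Bool.lt_iff]
  · intro b hb
    have h2 : f b ≠ f a := f.injective.ne hb
    simp only [hh, Prod.Lex.toLex_lt_toLex, hb, h2.symm, false_and, or_false]
    split_ifs <;> simp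

theorem rk_subtype_ne {x : A} (a : {a // a ≠ x}) :
    (-1 : ℤ) ^ rk a = (-1) ^ rk (a : A) * if x < a then -1 else 1 := by
  rw [neg_one_pow_rk, neg_one_pow_rk,
    prod_eq_mul_prod_compl (Subtype.strictMono_coe (fun a => a ≠ x)) (x := x) (by simp)]
  simp only [Subtype.coe_lt_coe]
  split_ifs <;> simp

theorem rk_fin {m : ℕ} (i : Fin m) : rk i = i := by
  rw [rk, ← Fin.card_Iio]
  congr 1
  ext
  simp

end Sgn

/-! ### Relabelling of graphs -/

namespace HairyGraph

section Endpoint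

variable {V E S V' E' : Type*} (Γ : HairyGraph V E S)

/-- The two ends of an edge: the tail for `r = false`, the head for `r = true`. Equivalently, the
tail of the edge `a` after its direction has been reversed (`r = true`) or kept. -/
def endpoint (a : E) (r : Bool) : V ⊕ S := if r then Γ.tgt a else Γ.src a

@[simp] theorem endpoint_false (a : E) : Γ.endpoint a false = Γ.src a := rfl

@[simp] theorem endpoint_true (a : E) : Γ.endpoint a true = Γ.tgt a := rfl

theorem ext_endpoint {Γ Γ' : HairyGraph V E S} (h : ∀ a r, Γ.endpoint a r = Γ'.endpoint a r) :
    Γ = Γ' := by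
  ext a
  · exact h a false
  · exact h a true

theorem endpoint_relabel (σ : V ≃ V') (ρ : E ≃ E') (ε : E → Bool) (a : E) (r : Bool) :
    (Γ.relabel σ ρ ε).endpoint (ρ a) r = Sum.map σ id (Γ.endpoint a (xor (ε a) r)) := by
  cases r <;> cases h : ε a <;> simp [relabel, endpoint, h]

theorem eq_relabel {Γ : HairyGraph V E S} {Γ' : HairyGraph V' E' S} {σ : V ≃ V'} {ρ : E ≃ E'}
    {ε : E → Bool}
    (h : ∀ a r, Γ'.endpoint (ρ a) r = Sum.map σ id (Γ.endpoint a (xor (ε a) r))) :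
    Γ' = Γ.relabel σ ρ ε := by
  refine ext_endpoint fun b r => ?_
  obtain ⟨a, rfl⟩ := ρ.surjective b
  rw [h, endpoint_relabel]

/-- Two vertices are linked if they are the ends of an edge in `τ`. -/
def Link (τ : Set E) (x y : V ⊕ S) : Prop :=
  ∃ a ∈ τ, ∃ r, Γ.endpoint a r = x ∧ Γ.endpoint a (!r) = y

theorem subgraph_adj {τ : Set E} {x y : V ⊕ S} :
    (Γ.subgraph τ).Adj x y ↔ x ≠ y ∧ Γ.Link τ x y := by
  simp only [subgraph, SimpleGraph.fromRel_adj, Link, Bool.exists_bool, endpoint_false,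
    endpoint_true, Bool.not_false, Bool.not_true, and_congr_right_iff]
  intro _
  constructor
  · rintro (⟨a, h, h1, h2⟩ | ⟨a, h, h1, h2⟩)
    · exact ⟨a, h, Or.inl ⟨h1, h2⟩⟩
    · exact ⟨a, h, Or.inr ⟨h2, h1⟩⟩
  · rintro ⟨a, h, (⟨h1, h2⟩ | ⟨h1, h2⟩)⟩
    · exact Or.inl ⟨a, h, h1, h2⟩
    · exact Or.inr ⟨a, h, h2, h1⟩

theorem reachable_iff {τ : Set E} {x y : V ⊕ S} :
    (Γ.subgraph τ).Reachable x y ↔ Relation.ReflTransGen (Γ.Link τ) x y := by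
  rw [SimpleGraph.reachable_iff_reflTransGen]
  constructor
  · intro h
    exact h.lift id fun x y h => ((Γ.subgraph_adj).1 h).2
  · intro h
    induction h with
    | refl => exact .refl
    | @tail y z _ h2 ih =>
      by_cases h : y = z
      · exact h ▸ ih
      · exact ih.tail ((Γ.subgraph_adj).2 ⟨h, h2⟩)

theorem isConnected_iff : Γ.IsConnected ↔
    (∀ x y, Relation.ReflTransGen (Γ.Link Set.univ) x y) ∧ Nonempty (V ⊕ S) := by
  rw [IsConnected, SimpleGraph.connected_iff]
  simp only [SimpleGraph.Preconnected, reachable_iff]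

/-- A surjective map of vertices which sends edges to edges, or collapses them, preserves
connectedness. -/
theorem IsConnected.of_surjective {Γ : HairyGraph V E S} {Γ' : HairyGraph V' E' S}
    (h : Γ.IsConnected) (m : V ⊕ S → V' ⊕ S) (hm : Function.Surjective m)
    (he : ∀ a, Relation.ReflTransGen (Γ'.Link Set.univ) (m (Γ.src a)) (m (Γ.tgt a)) ∧
      Relation.ReflTransGen (Γ'.Link Set.univ) (m (Γ.tgt a)) (m (Γ.src a))) :
    Γ'.IsConnected := by
  rw [isConnected_iff] at h ⊢
  refine ⟨fun x y => ?_, h.2.map m⟩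
  obtain ⟨x, rfl⟩ := hm x
  obtain ⟨y, rfl⟩ := hm y
  have := h.1 x y
  clear h
  induction this with
  | refl => exact .refl
  | tail _ h2 ih =>
    obtain ⟨a, -, r, rfl, rfl⟩ := h2
    cases r
    · exact ih.trans (he a).1
    · exact ih.trans (he a).2

theorem valency_eq [Finite E] (x : V ⊕ S) :
    Γ.valency x = Nat.card {p : E × Bool // Γ.endpoint p.1 p.2 = x} := by
  rw [valency, outDeg, inDeg, ← Nat.card_sum]
  refine Nat.card_congr ⟨Sum.elim (fun a => ⟨(a.1, false), a.2⟩) (fun a => ⟨(a.1, true), a.2⟩),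
    fun p => match p with
      | ⟨(a, false), h⟩ => Sum.inl ⟨a, h⟩
      | ⟨(a, true), h⟩ => Sum.inr ⟨a, h⟩, ?_, ?_⟩
  · rintro (a | a) <;> rfl
  · rintro ⟨⟨a, _ | _⟩, h⟩ <;> rfl

theorem valency_relabel [Finite E] (σ : V ≃ V') (ρ : E ≃ E') (ε : E → Bool) (x : V ⊕ S) :
    (Γ.relabel σ ρ ε).valency (Sum.map σ id x) = Γ.valency x := by
  have : Finite E' := Finite.of_equiv _ ρ
  have hi : Function.Injective (Sum.map σ (id : S → S)) :=
    Sum.map_injective.2 ⟨σ.injective, Function.injective_id⟩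
  rw [valency_eq, valency_eq]
  symm
  refine Nat.card_congr (Equiv.subtypeEquiv
    ⟨fun p => (ρ p.1, xor (ε p.1) p.2), fun p => (ρ.symm p.1, xor (ε (ρ.symm p.1)) p.2),
      fun p => by simp, fun p => by simp⟩ fun p => ?_)
  simp [endpoint_relabel, hi.eq_iff]

theorem outDeg_relabel (σ : V ≃ V') (ρ : E ≃ E') (x : V ⊕ S) :
    (Γ.relabel σ ρ fun _ => false).outDeg (Sum.map σ id x) = Γ.outDeg x := by
  have hi : Function.Injective (Sum.map σ (id : S → S)) :=
    Sum.map_injective.2 ⟨σ.injective, Function.injective_id⟩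
  symm
  refine Nat.card_congr (Equiv.subtypeEquiv ρ fun a => ?_)
  simp [relabel, hi.eq_iff]

theorem inDeg_relabel (σ : V ≃ V') (ρ : E ≃ E') (x : V ⊕ S) :
    (Γ.relabel σ ρ fun _ => false).inDeg (Sum.map σ id x) = Γ.inDeg x := by
  have hi : Function.Injective (Sum.map σ (id : S → S)) :=
    Sum.map_injective.2 ⟨σ.injective, Function.injective_id⟩
  symm
  refine Nat.card_congr (Equiv.subtypeEquiv ρ fun a => ?_)
  simp [relabel, hi.eq_iff]

theorem IsConnected.relabel {Γ : HairyGraph V E S} (h : Γ.IsConnected) (σ : V ≃ V') (ρ : E ≃ E')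
    (ε : E → Bool) : (Γ.relabel σ ρ ε).IsConnected := by
  refine h.of_surjective (Sum.map σ id) (Sum.map_surjective.2 ⟨σ.surjective,
    Function.surjective_id⟩) fun a => ⟨.single ⟨ρ a, trivial, ε a, ?_⟩,
      .single ⟨ρ a, trivial, !(ε a), ?_⟩⟩ <;> simp [endpoint_relabel]

/-- There is no directed cycle. -/
def Acyclic : Prop := ∀ x, ¬ Relation.TransGen (fun y z => ∃ a, Γ.src a = y ∧ Γ.tgt a = z) x x

/-- Directed cycles are preserved by maps of graphs. -/
theorem Acyclic.comap {Γ : HairyGraph V E S} {Γ' : HairyGraph V' E' S} (h : Γ'.Acyclic)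
    (m : V ⊕ S → V' ⊕ S)
    (he : ∀ a, ∃ b, Γ'.src b = m (Γ.src a) ∧ Γ'.tgt b = m (Γ.tgt a)) : Γ.Acyclic := by
  intro x hx
  refine h (m x) (Relation.TransGen.lift m ?_ _ _ hx)
  rintro y z ⟨a, rfl, rfl⟩
  exact he a

theorem Acyclic.relabel {Γ : HairyGraph V E S} (h : Γ.Acyclic) (σ : V ≃ V') (ρ : E ≃ E') :
    (Γ.relabel σ ρ fun _ => false).Acyclic := by
  refine h.comap (Sum.map σ.symm id) fun b => ⟨ρ.symm b, ?_⟩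
  simp [HairyGraph.relabel]

theorem IsAdmissible.relabel [Finite E] {c : Flavor} {Γ : HairyGraph V E S}
    (h : Γ.IsAdmissible c) (σ : V ≃ V') (ρ : E ≃ E') (ε : E → Bool)
    (hε : c = .oriented → ∀ a, ε a = false) : (Γ.relabel σ ρ ε).IsAdmissible c := by
  have hv (v : V') : (Sum.inl v : V' ⊕ S) = Sum.map σ id (Sum.inl (σ.symm v)) := by simp
  have hs (s : S) : (Sum.inr s : V' ⊕ S) = Sum.map σ id (Sum.inr s) := rfl
  cases c with
  | undirected =>
    obtain ⟨h1, h2, h3⟩ := h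
    refine ⟨h1.relabel σ ρ ε, fun v => ?_, fun s => ?_⟩
    · rw [hv, valency_relabel]; exact h2 _
    · rw [hs, valency_relabel]; exact h3 _
  | oriented =>
    obtain rfl : ε = fun _ => false := funext (hε rfl)
    obtain ⟨h1, h2, h3, h4, h5, h6⟩ := h
    refine ⟨h1.relabel σ ρ _, fun s => ?_, fun v => ?_, fun v => ?_, fun v => ?_,
      Acyclic.relabel (Γ := Γ) h6 σ ρ⟩
    · rw [hs, outDeg_relabel, inDeg_relabel]; exact h2 _
    · rw [hv, valency_relabel]; exact h3 _
    · rw [hv, outDeg_relabel]; exact h4 _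
    · rw [hv, outDeg_relabel, inDeg_relabel]; exact h5 _

theorem relabel_relabel {V'' E'' : Type*} (σ : V ≃ V') (ρ : E ≃ E') (ε : E → Bool)
    (σ' : V' ≃ V'') (ρ' : E' ≃ E'') (ε' : E' → Bool) :
    (Γ.relabel σ ρ ε).relabel σ' ρ' ε' =
      Γ.relabel (σ.trans σ') (ρ.trans ρ') fun a => xor (ε a) (ε' (ρ a)) := by
  refine eq_relabel fun a r => ?_
  rw [Equiv.trans_apply, endpoint_relabel, endpoint_relabel, Sum.map_map]
  rcases h : Γ.endpoint a _ <;> simp [h]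

theorem relabel_symm (σ : V ≃ V') (ρ : E ≃ E') (ε : E → Bool) :
    (Γ.relabel σ ρ ε).relabel σ.symm ρ.symm (fun b => ε (ρ.symm b)) = Γ := by
  refine ext_endpoint fun a r => ?_
  rw [relabel_relabel]
  have := endpoint_relabel Γ (σ.trans σ.symm) (ρ.trans ρ.symm)
    (fun a => xor (ε a) (ε (ρ.symm (ρ a)))) a r
  simpa using this

theorem isAdmissible_relabel_iff [Finite E] {c : Flavor} {Γ : HairyGraph V E S}
    (σ : V ≃ V') (ρ : E ≃ E') (ε : E → Bool) (hε : c = .oriented → ∀ a, ε a = false) :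
    (Γ.relabel σ ρ ε).IsAdmissible c ↔ Γ.IsAdmissible c := by
  have : Finite E' := Finite.of_equiv _ ρ
  refine ⟨fun h => ?_, fun h => h.relabel σ ρ ε hε⟩
  rw [← relabel_symm Γ σ ρ ε]
  exact h.relabel _ _ _ fun hc b => hε hc _

end Endpoint

end HairyGraph

open HairyGraph

/-! ### Classes of graphs with ordered vertices and edges -/

/-- The sign of a relabelling of a graph with linearly ordered vertices and edges. -/
def orientSign (n : ℤ) {V E V' E' : Type*} [Fintype V] [LinearOrder V] [Fintype E] [LinearOrder E]
    [Fintype V'] [LinearOrder V'] [Fintype E'] [LinearOrder E'] (σ : V ≃ V') (ρ : E ≃ E')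
    (ε : E → Bool) : ℤ :=
  if Even n then sgn ρ else sgn σ * ∏ a, if ε a then -1 else 1

section Class

variable (K : Type u) [Field K] (c : Flavor) (n : ℤ) {S : Type w}

open Classical in
/-- The degree `k` component of the class of a graph with numbered vertices and edges. -/
def finClass (k : ℤ) {v e : ℕ} (Γ : HairyGraph (Fin v) (Fin e) S) : GraphSpace K c n S k :=
  if h : ∃ h : Γ.IsAdmissible c, LabelledGraph.degree n ⟨_, _, Γ, h⟩ = k then
    Submodule.Quotient.mk (Finsupp.single ⟨⟨_, _, Γ, h.1⟩, h.2⟩ 1)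
  else 0

theorem graphClass_eq_finClass (k : ℤ) {V E : Type*} [Fintype V] [LinearOrder V] [Fintype E]
    [LinearOrder E] (Γ : HairyGraph V E S) :
    graphClass K c n k Γ = finClass K c n k Γ.numbered := rfl

theorem orientSign_eq_relabelSign {v e : ℕ} (σ : Equiv.Perm (Fin v)) (ρ : Equiv.Perm (Fin e))
    (ε : Fin e → Bool) : orientSign n σ ρ ε = relabelSign n σ ρ ε := by
  rw [orientSign, relabelSign, sgn_perm, sgn_perm]

theorem finClass_relabel (k : ℤ) {v e v' e' : ℕ} (Γ : HairyGraph (Fin v) (Fin e) S)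
    (σ : Fin v ≃ Fin v') (ρ : Fin e ≃ Fin e') (ε : Fin e → Bool)
    (hε : c = .oriented → ∀ a, ε a = false) :
    finClass K c n k (Γ.relabel σ ρ ε) = (orientSign n σ ρ ε : K) • finClass K c n k Γ := by
  obtain rfl : v = v' := by simpa using Fintype.card_congr σ
  obtain rfl : e = e' := by simpa using Fintype.card_congr ρ
  by_cases h : ∃ h : Γ.IsAdmissible c, LabelledGraph.degree n ⟨_, _, Γ, h⟩ = k
  · have h' : ∃ h : (Γ.relabel σ ρ ε).IsAdmissible c, LabelledGraph.degree n ⟨_, _, _, h⟩ = k :=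
      ⟨h.1.relabel σ ρ ε hε, h.2⟩
    rw [finClass, finClass, dif_pos h, dif_pos h', orientSign_eq_relabelSign,
      ← Submodule.Quotient.mk_smul, Submodule.Quotient.eq]
    exact Submodule.subset_span ⟨v, e, Γ, _, h.1, h'.1, h.2, h'.2, σ, ρ, ε, hε, rfl, rfl⟩
  · rw [finClass, finClass, dif_neg h, dif_neg, smul_zero]
    rintro ⟨h1, h2⟩
    exact h ⟨(isAdmissible_relabel_iff σ ρ ε hε).1 h1, h2⟩

variable {V E V' E' : Type*} [Fintype V] [LinearOrder V] [Fintype E] [LinearOrder E]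
    [Fintype V'] [LinearOrder V'] [Fintype E'] [LinearOrder E']

theorem orientSign_mul_self (σ : V ≃ V') (ρ : E ≃ E') (ε : E → Bool) :
    orientSign n σ ρ ε * orientSign n σ ρ ε = 1 := by
  rw [orientSign]
  split_ifs
  · exact sgn_mul_self ρ
  · rw [mul_mul_mul_comm, sgn_mul_self, one_mul, ← Finset.prod_mul_distrib]
    exact Finset.prod_eq_one fun a _ => by split_ifs <;> rfl

theorem graphClass_relabel (k : ℤ) (Γ : HairyGraph V E S) (σ : V ≃ V') (ρ : E ≃ E')
    (ε : E → Bool) (hε : c = .oriented → ∀ a, ε a = false) :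
    graphClass K c n k (Γ.relabel σ ρ ε) =
      (orientSign n σ ρ ε : K) • graphClass K c n k Γ := by
  let iV := (monoEquivOfFin V rfl)
  let iE := (monoEquivOfFin E rfl)
  let iV' := (monoEquivOfFin V' rfl)
  let iE' := (monoEquivOfFin E' rfl)
  have h : (Γ.relabel σ ρ ε).numbered = Γ.numbered.relabel
      ((iV.toEquiv.trans σ).trans iV'.symm.toEquiv) ((iE.toEquiv.trans ρ).trans iE'.symm.toEquiv)
      (fun i => ε (iE i)) := by
    refine eq_relabel fun a r => ?_
    obtain ⟨a, rfl⟩ := iE.symm.surjective a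
    simp only [Equiv.trans_apply, RelIso.coe_fn_toEquiv, OrderIso.apply_symm_apply, numbered]
    have h1 := endpoint_relabel (Γ.relabel σ ρ ε) iV'.symm.toEquiv iE'.symm.toEquiv
      (fun _ => false) (ρ a) r
    have h2 := endpoint_relabel Γ iV.symm.toEquiv iE.symm.toEquiv
      (fun _ => false) a (xor (ε a) r)
    simp only [RelIso.coe_fn_toEquiv, Bool.false_xor] at h1 h2
    refine h1.trans ?_
    refine Eq.trans ?_ (congrArg (Sum.map _ id) h2.symm)
    rw [endpoint_relabel]
    rcases Γ.endpoint a _ <;> simp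
  have hs : orientSign n ((iV.toEquiv.trans σ).trans iV'.symm.toEquiv)
      ((iE.toEquiv.trans ρ).trans iE'.symm.toEquiv) (fun i => ε (iE i)) =
      orientSign n σ ρ ε := by
    rw [orientSign, orientSign, sgn_trans, sgn_trans, sgn_trans, sgn_trans,
      sgn_of_strictMono iV.toEquiv iV.strictMono, sgn_of_strictMono iE.toEquiv iE.strictMono,
      sgn_of_strictMono iV'.symm.toEquiv iV'.symm.strictMono,
      sgn_of_strictMono iE'.symm.toEquiv iE'.symm.strictMono]
    simp only [one_mul, mul_one]
    congr 2
    exact iE.toEquiv.prod_comp fun a => if ε a then (-1 : ℤ) else 1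
  rw [graphClass_eq_finClass, graphClass_eq_finClass, h, finClass_relabel K c n k _ _ _ _
    fun hc a => hε hc _, hs]

/-- Isomorphic graphs have the same class up to the sign of the isomorphism. -/
theorem graphClass_eq_of_endpoint (k : ℤ) {Γ : HairyGraph V E S} {Γ' : HairyGraph V' E' S}
    (σ : V ≃ V') (ρ : E ≃ E') (ε : E → Bool) (hε : c = .oriented → ∀ a, ε a = false)
    (h : ∀ a r, Γ'.endpoint (ρ a) r = Sum.map σ id (Γ.endpoint a (xor (ε a) r))) :
    graphClass K c n k Γ' = (orientSign n σ ρ ε : K) • graphClass K c n k Γ := by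
  rw [eq_relabel h, graphClass_relabel K c n k Γ σ ρ ε hε]

theorem finClass_eq_graphClass (k : ℤ) {v e : ℕ} (Γ : HairyGraph (Fin v) (Fin e) S) :
    finClass K c n k Γ = graphClass K c n k Γ := by
  rw [graphClass_eq_finClass, numbered, finClass_relabel _ _ _ _ _ _ _ _ fun _ _ => rfl,
    orientSign, sgn_of_strictMono, sgn_of_strictMono]
  · simp
  · exact (monoEquivOfFin (Fin v) rfl).symm.strictMono
  · exact (monoEquivOfFin (Fin e) rfl).symm.strictMono

variable {K c n} in
theorem graphClass_eq_zero_of_not_isAdmissible {k : ℤ} {Γ : HairyGraph V E S}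
    (h : ¬ Γ.IsAdmissible c) : graphClass K c n k Γ = 0 := by
  refine dif_neg fun ⟨h1, _⟩ => h ?_
  rwa [numbered, isAdmissible_relabel_iff _ _ _ fun _ _ => rfl] at h1

end Class

/-! ### Contraction of edges -/

namespace HairyGraph

section Contract

variable {V E S V' E' : Type*} {Γ : HairyGraph V E S} {Γ' : HairyGraph V' E' S}

namespace Contractible

theorem src_edge (p : Γ.Contractible) : Γ.src p.edge = Sum.inl p.tail := p.2.1

theorem tgt_edge (p : Γ.Contractible) : Γ.tgt p.edge = Sum.inl p.head := p.2.2.1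

theorem head_ne_tail (p : Γ.Contractible) : p.head ≠ p.tail := p.2.2.2

/-- The contractible edge `a` from `x` to `y`. -/
def mk (a : E) (x y : V) (hx : Γ.src a = Sum.inl x) (hy : Γ.tgt a = Sum.inl y) (h : y ≠ x) :
    Γ.Contractible := ⟨(a, x, y), hx, hy, h⟩

theorem edge_injective : Function.Injective (Contractible.edge (Γ := Γ)) := by
  rintro ⟨⟨a, x, y⟩, hx, hy, h⟩ ⟨⟨b, x', y'⟩, hx', hy', h'⟩ hab
  obtain rfl : a = b := hab
  obtain rfl : x = x' := Sum.inl_injective (hx.symm.trans hx')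
  obtain rfl : y = y' := Sum.inl_injective (hy.symm.trans hy')
  rfl

open Classical in
/-- The map `merge` on internal vertices, with values in the vertices of the original graph. -/
def mergeVal (p : Γ.Contractible) (v : V) : V := if v = p.tail then p.head else v

theorem mergeVal_ne (p : Γ.Contractible) (v : V) : p.mergeVal v ≠ p.tail := by
  rw [mergeVal]
  split_ifs with h
  · exact p.head_ne_tail
  · exact h

theorem merge_inl (p : Γ.Contractible) (v : V) :
    p.merge (Sum.inl v : V ⊕ S) = Sum.inl ⟨p.mergeVal v, p.mergeVal_ne v⟩ := by
  simp only [merge, mergeVal]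
  split_ifs <;> rfl

theorem merge_inr (p : Γ.Contractible) (s : S) : p.merge (Sum.inr s : V ⊕ S) = Sum.inr s := rfl

theorem merge_surjective (p : Γ.Contractible) : Function.Surjective p.merge := by
  rintro (⟨v, hv⟩ | s)
  · exact ⟨Sum.inl v, by rw [merge_inl]; congr; exact if_neg hv⟩
  · exact ⟨Sum.inr s, rfl⟩

end Contractible

theorem endpoint_contract (p : Γ.Contractible) (b : {b : E // b ≠ p.edge}) (r : Bool) :
    (Γ.contract p).endpoint b r = p.merge (Γ.endpoint b r) := by
  cases r <;> rfl

/-- A bijection between two subtypes that is given by a bijection of the ambient types. -/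
theorem exists_restrict (f : V ≃ V') {x : V} {y : V'} (h : f x = y) :
    ∃ f₀ : {v // v ≠ x} ≃ {v // v ≠ y}, ∀ v, (f₀ v : V') = f v :=
  ⟨f.subtypeEquiv fun v => by rw [← h, f.injective.ne_iff], fun _ => rfl⟩

theorem exists_contractible_of_endpoint (σ : V ≃ V') (ρ : E ≃ E') (ε : E → Bool)
    (h : ∀ a r, Γ'.endpoint (ρ a) r = Sum.map σ id (Γ.endpoint a (xor (ε a) r)))
    (p : Γ.Contractible) : ∃ p' : Γ'.Contractible, p'.edge = ρ p.edge := by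
  have h1 := h p.edge false
  have h2 := h p.edge true
  cases hr : ε p.edge <;> simp only [hr, endpoint_false, endpoint_true, Bool.xor_false,
    Bool.false_xor, Bool.true_xor, Bool.not_true, p.src_edge, p.tgt_edge, Sum.map_inl] at h1 h2
  · exact ⟨.mk (ρ p.edge) _ _ h1 h2 (σ.injective.ne p.head_ne_tail), rfl⟩
  · exact ⟨.mk (ρ p.edge) _ _ h1 h2 (σ.injective.ne p.head_ne_tail.symm), rfl⟩

end Contract

/-- The sign of the contraction of an edge: the odd edge (for even `n`), respectively the odd
vertex which is merged into its neighbour (for odd `n`), is first moved to the front. -/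
def rkSign (n : ℤ) {V E S : Type*} [Fintype V] [LinearOrder V] [Fintype E] [LinearOrder E]
    {Γ : HairyGraph V E S} (p : Γ.Contractible) : ℤ :=
  if Even n then (-1) ^ rk p.edge else (-1) ^ rk p.tail

end HairyGraph

theorem contractSign_eq (n : ℤ) {v e : ℕ} {S : Type*} {Γ : HairyGraph (Fin v) (Fin e) S}
    (p : Γ.Contractible) : contractSign n p = rkSign n p := by
  rw [contractSign, rkSign, rk_fin, rk_fin]

section Boundary

variable (K : Type u) [Field K] (c : Flavor) (n : ℤ) {S : Type w}
variable {V E V' E' : Type*} [Fintype V] [LinearOrder V] [Fintype E] [LinearOrder E]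
    [Fintype V'] [LinearOrder V'] [Fintype E'] [LinearOrder E']

/-- Corresponding contractions of isomorphic graphs agree up to the sign of the isomorphism. -/
theorem rkSign_smul_graphClass_contract (k : ℤ) {Γ : HairyGraph V E S} {Γ' : HairyGraph V' E' S}
    (σ : V ≃ V') (ρ : E ≃ E') (ε : E → Bool) (hε : c = .oriented → ∀ a, ε a = false)
    (h : ∀ a r, Γ'.endpoint (ρ a) r = Sum.map σ id (Γ.endpoint a (xor (ε a) r)))
    (p : Γ.Contractible) (p' : Γ'.Contractible) (hp : p'.edge = ρ p.edge) :
    (rkSign n p' : K) • graphClass K c n k (Γ'.contract p') =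
      (orientSign n σ ρ ε : K) • (rkSign n p : K) • graphClass K c n k (Γ.contract p) := by
  classical
  have h1 : Sum.inl p'.tail = Sum.map σ id (Γ.endpoint p.edge (ε p.edge)) := by
    rw [← p'.src_edge, hp]
    simpa using h p.edge false
  have h2 : Sum.inl p'.head = Sum.map σ id (Γ.endpoint p.edge (!(ε p.edge))) := by
    rw [← p'.tgt_edge, hp]
    simpa using h p.edge true
  -- If the edge is reversed, then the other one of its two ends is deleted.
  obtain ⟨π, hπ, hπt, hπm⟩ : ∃ π : Equiv.Perm V,
      (sgn π = if ε p.edge then -1 else 1) ∧ σ (π p.tail) = p'.tail ∧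
      ∀ v, p'.mergeVal (σ v) = σ (π (p.mergeVal v)) := by
    have hne := p.head_ne_tail
    cases hr : ε p.edge
    · rw [hr, endpoint_false, p.src_edge] at h1
      rw [hr, Bool.not_false, endpoint_true, p.tgt_edge] at h2
      refine ⟨Equiv.refl V, by simp [sgn_refl], (Sum.inl_injective h1).symm, fun v => ?_⟩
      simp only [Contractible.mergeVal, Sum.inl_injective h1, Sum.inl_injective h2,
        σ.injective.eq_iff, Equiv.refl_apply]
      split_ifs <;> rfl
    · rw [hr, endpoint_true, p.tgt_edge] at h1
      rw [hr, Bool.not_true, endpoint_false, p.src_edge] at h2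
      refine ⟨Equiv.swap p.tail p.head, ?_, ?_, fun v => ?_⟩
      · rw [sgn_perm, Equiv.Perm.sign_swap p.head_ne_tail.symm]; simp
      · rw [Equiv.swap_apply_left]; exact (Sum.inl_injective h1).symm
      · simp only [Contractible.mergeVal, Sum.inl_injective h1, Sum.inl_injective h2,
          σ.injective.eq_iff]
        by_cases hv : v = p.head
        · rw [if_pos hv, if_neg (hv ▸ hne), hv, Equiv.swap_apply_right]
        · rw [if_neg hv]
          split_ifs with hv'
          · rw [hv', Equiv.swap_apply_right]
          · rw [Equiv.swap_apply_of_ne_of_ne hv' hv]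
  obtain ⟨σ₀, hσ₀⟩ := exists_restrict (π.trans σ) (x := p.tail) hπt
  obtain ⟨ρ₀, hρ₀⟩ := exists_restrict ρ (x := p.edge) hp.symm
  have hm : ∀ z : V ⊕ S, p'.merge (Sum.map σ id z) = Sum.map σ₀ id (p.merge z) := by
    rintro (v | s)
    · rw [Sum.map_inl, Contractible.merge_inl, Contractible.merge_inl, Sum.map_inl]
      congr 1
      ext
      rw [hσ₀, Equiv.trans_apply]
      exact hπm v
    · rfl
  rw [graphClass_eq_of_endpoint K c n k σ₀ ρ₀ (fun b => ε b) (fun hc b => hε hc b)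
    (Γ := Γ.contract p) (Γ' := Γ'.contract p'), smul_smul, smul_smul]
  · congr 1
    rw [← Int.cast_mul, ← Int.cast_mul]
    congr 1
    have hprod := prod_eq_mul_prod_compl (Subtype.strictMono_coe (fun b => b ≠ p.edge))
      (x := p.edge) (by simp) fun a => if ε a then (-1 : ℤ) else 1
    rw [orientSign, orientSign, rkSign, rkSign, hprod,
      sgn_delete ρ hp.symm ρ₀ fun b => (hρ₀ b).symm,
      sgn_delete (π.trans σ) hπt σ₀ fun b => (hσ₀ b).symm, sgn_trans, hπ]
    rcases neg_one_pow_eq_or ℤ (rk p.edge) with h3 | h3 <;>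
    rcases neg_one_pow_eq_or ℤ (rk p'.edge) with h4 | h4 <;>
    rcases neg_one_pow_eq_or ℤ (rk p.tail) with h5 | h5 <;>
    rcases neg_one_pow_eq_or ℤ (rk p'.tail) with h6 | h6 <;>
    split_ifs <;> simp [h3, h4, h5, h6]
  · intro b r
    rw [endpoint_contract, hρ₀, h, hm, endpoint_contract]

/-- The signed sum of all contractions of a graph. -/
def boundary (k : ℤ) (Γ : HairyGraph V E S) : GraphSpace K c n S k :=
  ∑ p : Γ.Contractible, (rkSign n p : K) • graphClass K c n k (Γ.contract p)

theorem boundary_relabel (k : ℤ) (Γ : HairyGraph V E S)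
    (σ : V ≃ V') (ρ : E ≃ E') (ε : E → Bool) (hε : c = .oriented → ∀ a, ε a = false) :
    boundary K c n k (Γ.relabel σ ρ ε) = (orientSign n σ ρ ε : K) • boundary K c n k Γ := by
  have h := endpoint_relabel Γ σ ρ ε
  have h' : ∀ a r, Γ.endpoint (ρ.symm a) r = Sum.map σ.symm id
      ((Γ.relabel σ ρ ε).endpoint a (xor (ε (ρ.symm a)) r)) := by
    intro a r
    obtain ⟨a, rfl⟩ := ρ.surjective a
    rw [h, Sum.map_map]
    simp
  choose f hf using exists_contractible_of_endpoint σ ρ ε h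
  choose g hg using exists_contractible_of_endpoint σ.symm ρ.symm (fun a => ε (ρ.symm a)) h'
  rw [boundary, boundary, Finset.smul_sum]
  symm
  refine Finset.sum_bij' (fun p _ => f p) (fun p _ => g p) (by simp) (by simp) ?_ ?_ ?_
  · intro p _
    exact Contractible.edge_injective (by rw [hg, hf, Equiv.symm_apply_apply])
  · intro p _
    exact Contractible.edge_injective (by rw [hf, hg, Equiv.apply_symm_apply])
  · intro p _
    exact (rkSign_smul_graphClass_contract K c n k σ ρ ε hε h p (f p) (hf p)).symm

theorem contractFree_single {i j : ℤ} {v e : ℕ} {Γ : HairyGraph (Fin v) (Fin e) S}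
    (h : Γ.IsAdmissible c) (hi : LabelledGraph.degree n ⟨v, e, Γ, h⟩ = i) :
    contractFree K c n S i j (Finsupp.single ⟨⟨v, e, Γ, h⟩, hi⟩ 1) = boundary K c n j Γ := by
  rw [contractFree, Finsupp.linearCombination_single, one_smul, boundary]
  simp only [contractSign_eq]

theorem contractFree_descends (i j : ℤ) :
    signRelations K c n S i ≤ LinearMap.ker (contractFree K c n S i j) := by
  refine Submodule.span_le.2 ?_
  rintro _ ⟨v, e, Γ, Γ', h, h', hk, hk', σ, ρ, ε, hc, rfl, rfl⟩
  simp only [SetLike.mem_coe, LinearMap.mem_ker, map_sub, map_smul, contractFree_single,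
    boundary_relabel K c n j Γ σ ρ ε hc, orientSign_eq_relabelSign, sub_self]

/-- The contraction differential on classes of graphs, before it is known to square to zero. -/
def dMap (i j : ℤ) : GraphSpace K c n S i →ₗ[K] GraphSpace K c n S j :=
  Submodule.liftQ _ (contractFree K c n S i j) (contractFree_descends K c n i j)

theorem dMap_graphClass {i j : ℤ} {Γ : HairyGraph V E S} (h : Γ.IsAdmissible c)
    (hi : (n - 1) * (Fintype.card E : ℤ) - n * (Fintype.card V : ℤ) = i) :
    dMap K c n i j (graphClass K c n i Γ) = boundary K c n j Γ := by
  have h1 : ∃ h : Γ.numbered.IsAdmissible c, LabelledGraph.degree n ⟨_, _, Γ.numbered, h⟩ = i :=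
    ⟨h.relabel _ _ _ fun _ _ => rfl, hi⟩
  rw [graphClass, dif_pos h1, dMap]
  erw [Submodule.liftQ_apply]
  rw [contractFree_single, numbered, boundary_relabel _ _ _ _ _ _ _ _ fun _ _ => rfl,
    orientSign, sgn_of_strictMono, sgn_of_strictMono]
  · simp
  · exact (monoEquivOfFin V rfl).symm.strictMono
  · exact (monoEquivOfFin E rfl).symm.strictMono

end Boundary

/-! ### Iterated contractions -/

namespace HairyGraph

section Twice

variable {V E S : Type*} {Γ : HairyGraph V E S}

open Classical in
theorem Contractible.coe_mergeVal {P : V → Prop} {Γ : HairyGraph {v // P v} E S}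
    (p : Γ.Contractible) (v : {v // P v}) :
    (p.mergeVal v : V) = if (v : V) = p.tail then (p.head : V) else v := by
  rw [mergeVal, apply_ite Subtype.val]
  simp only [Subtype.ext_iff]

theorem Contractible.inl_tail (p : Γ.Contractible) (q : (Γ.contract p).Contractible)
    (p' : Γ.Contractible) (h : p'.edge = q.edge) :
    (q.tail : V) = p.mergeVal p'.tail ∧ (q.head : V) = p.mergeVal p'.head := by
  have h1 := q.src_edge
  have h2 := q.tgt_edge
  rw [← endpoint_false, endpoint_contract, ← h, endpoint_false, p'.src_edge, p.merge_inl] at h1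
  rw [← endpoint_true, endpoint_contract, ← h, endpoint_true, p'.tgt_edge, p.merge_inl] at h2
  exact ⟨congrArg Subtype.val (Sum.inl_injective h1).symm,
    congrArg Subtype.val (Sum.inl_injective h2).symm⟩

theorem Contractible.exists_swap (p : Γ.Contractible) (q : (Γ.contract p).Contractible) :
    ∃ (p' : Γ.Contractible) (q' : (Γ.contract p').Contractible),
      p'.edge = q.edge ∧ (q'.edge : E) = p.edge := by
  have h1 := q.src_edge
  have h2 := q.tgt_edge
  rw [← endpoint_false, endpoint_contract, endpoint_false] at h1
  rw [← endpoint_true, endpoint_contract, endpoint_true] at h2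
  obtain ⟨x, hx⟩ : ∃ x, Γ.src q.edge = Sum.inl x := by
    rcases h : Γ.src q.edge with x | s
    · exact ⟨x, rfl⟩
    · rw [h] at h1; cases h1
  obtain ⟨y, hy⟩ : ∃ x, Γ.tgt q.edge = Sum.inl x := by
    rcases h : Γ.tgt q.edge with x | s
    · exact ⟨x, rfl⟩
    · rw [h] at h2; cases h2
  rw [hx, p.merge_inl] at h1
  rw [hy, p.merge_inl] at h2
  have h3 : p.mergeVal y ≠ p.mergeVal x := fun h => q.head_ne_tail
    ((Sum.inl_injective h2).symm.trans ((Subtype.ext h).trans (Sum.inl_injective h1)))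
  let p' : Γ.Contractible := .mk q.edge x y hx hy fun h => h3 (h ▸ rfl)
  have ht : p'.tail = x := rfl
  have hh : p'.head = y := rfl
  have h4 : p'.mergeVal p.head ≠ p'.mergeVal p.tail := by
    have := p.head_ne_tail
    simp only [Contractible.mergeVal, ht, hh] at h3 ⊢
    grind
  have hpe : p.edge ≠ p'.edge := fun h => q.edge.2 h.symm
  refine ⟨p', .mk ⟨p.edge, hpe⟩ ⟨_, p'.mergeVal_ne p.tail⟩ ⟨_, p'.mergeVal_ne p.head⟩ ?_ ?_
    fun h => h4 (congrArg Subtype.val h), rfl, rfl⟩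
  · rw [← endpoint_false, endpoint_contract, endpoint_false, p.src_edge, p'.merge_inl]
  · rw [← endpoint_true, endpoint_contract, endpoint_true, p.tgt_edge, p'.merge_inl]

end Twice

end HairyGraph

section Twice

variable (K : Type u) [Field K] (c : Flavor) (n : ℤ) {S : Type w}
variable {V E : Type*} [Fintype V] [LinearOrder V] [Fintype E] [LinearOrder E]

/-- A bijection between iterated complements that is the identity on values. -/
theorem exists_restrict_two {A : Type*} [Fintype A] [LinearOrder A] {x z : A}
    (t : {a // a ≠ x}) (u : {a // a ≠ z}) (ht : (t : A) = z) (hu : (u : A) = x) :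
    ∃ f : {a : {a // a ≠ x} // a ≠ t} ≃ {a : {a // a ≠ z} // a ≠ u},
      (∀ a, ((f a : {a // a ≠ z}) : A) = a) ∧ sgn f = 1 ∧
      (-1 : ℤ) ^ rk x * (-1) ^ rk t = -((-1) ^ rk z * (-1) ^ rk u) := by
  obtain ⟨t, ht'⟩ := t
  obtain ⟨u, hu'⟩ := u
  obtain rfl : t = z := ht
  obtain rfl : u = x := hu
  let f : {a : {a // a ≠ u} // a ≠ ⟨t, ht'⟩} ≃ {a : {a // a ≠ t} // a ≠ ⟨u, hu'⟩} :=
    ⟨fun a => ⟨⟨a, fun h => a.2 (Subtype.ext h)⟩, fun h => a.1.2 (congrArg Subtype.val h)⟩,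
      fun a => ⟨⟨a, fun h => a.2 (Subtype.ext h)⟩, fun h => a.1.2 (congrArg Subtype.val h)⟩,
      fun _ => rfl, fun _ => rfl⟩
  refine ⟨f, fun _ => rfl, sgn_of_strictMono f fun a b h => h, ?_⟩
  rw [rk_subtype_ne, rk_subtype_ne]
  rcases hu'.lt_or_gt with h | h <;> simp [h, h.not_gt, mul_comm]

theorem exists_restrict_swap {A : Type*} [Fintype A] [LinearOrder A] {x z : A}
    (t : {a // a ≠ x}) (u : {a // a ≠ z}) (hz : z = x) (htu : (t : A) ≠ u) :
    ∃ f : {a : {a // a ≠ x} // a ≠ t} ≃ {a : {a // a ≠ z} // a ≠ u},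
      (∀ a, ((f a : {a // a ≠ z}) : A) = Equiv.swap (t : A) u a) ∧
      (-1 : ℤ) ^ rk x * (-1) ^ rk t = -((-1) ^ rk z * (-1) ^ rk u) * sgn f := by
  subst hz
  have htu' : t ≠ u := fun h => htu (congrArg Subtype.val h)
  obtain ⟨f, hf⟩ := exists_restrict (Equiv.swap t u) (Equiv.swap_apply_left t u)
  refine ⟨f, fun a => ?_, ?_⟩
  · rw [hf]
    exact (Subtype.val_injective.map_swap t u (a : {a // a ≠ z}))
  · have hs : sgn f = -((-1) ^ rk t * (-1) ^ rk u) := by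
      convert sgn_replace htu' f hf
    rw [hs]
    rcases neg_one_pow_eq_or ℤ (rk z) with h1 | h1 <;>
    rcases neg_one_pow_eq_or ℤ (rk t) with h2 | h2 <;>
    rcases neg_one_pow_eq_or ℤ (rk u) with h3 | h3 <;> simp [h1, h2, h3]

/-- Two edges can be contracted in either order; the signs of the two contractions differ. -/
theorem contract_contract (k : ℤ) {Γ : HairyGraph V E S} (p : Γ.Contractible)
    (q : (Γ.contract p).Contractible) (p' : Γ.Contractible) (q' : (Γ.contract p').Contractible)
    (hq : p'.edge = q.edge) (hp : (q'.edge : E) = p.edge) :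
    (rkSign n p : K) • (rkSign n q : K) • graphClass K c n k ((Γ.contract p).contract q) =
      -((rkSign n p' : K) • (rkSign n q' : K) •
        graphClass K c n k ((Γ.contract p').contract q')) := by
  obtain ⟨ht, hh⟩ := p.inl_tail q p' hq
  obtain ⟨ht', hh'⟩ := p'.inl_tail q' p hp.symm
  obtain ⟨ρ, hρ, hρs, hρr⟩ := exists_restrict_two q.edge q'.edge hq.symm hp
  have hne := p.head_ne_tail
  have hne' := p'.head_ne_tail
  have hqn : (q.head : V) ≠ q.tail := fun h => q.head_ne_tail (Subtype.ext h)
  have hqn' : (q'.head : V) ≠ q'.tail := fun h => q'.head_ne_tail (Subtype.ext h)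
  -- The vertices of the two graphs are identified by `π`, a restriction of a permutation of `V`.
  classical
  obtain ⟨σ, π, hσ, hσs, hπ⟩ : ∃ (σ : {v : {v // v ≠ p.tail} // v ≠ q.tail} ≃
      {v : {v // v ≠ p'.tail} // v ≠ q'.tail}) (π : V → V),
      (∀ a, ((σ a : {a // a ≠ p'.tail}) : V) = π a) ∧
      (-1 : ℤ) ^ rk p.tail * (-1) ^ rk q.tail = -((-1) ^ rk p'.tail * (-1) ^ rk q'.tail) * sgn σ ∧
      ∀ v : V, (if p'.mergeVal v = q'.tail then (q'.head : V) else p'.mergeVal v) =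
        π (if p.mergeVal v = q.tail then (q.head : V) else p.mergeVal v) := by
    by_cases hx : p'.tail = p.tail
    · have e1 : (q.tail : V) = p.head := by rw [ht, hx, Contractible.mergeVal, if_pos rfl]
      have e2 : (q'.tail : V) = p'.head := by rw [ht', ← hx, Contractible.mergeVal, if_pos rfl]
      have e3 : (q.head : V) = p'.head := by
        rw [hh, Contractible.mergeVal, if_neg (hx ▸ hne')]
      have e4 : (q'.head : V) = p.head := by
        rw [hh', Contractible.mergeVal, if_neg (hx ▸ hne)]
      obtain ⟨σ, hσ, hσs⟩ := exists_restrict_swap q.tail q'.tail hx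
        (by rw [e1, e2]; rw [e3, e1] at hqn; exact hqn.symm)
      refine ⟨σ, Equiv.swap (q.tail : V) q'.tail, hσ, hσs, fun v => ?_⟩
      rw [e1, e2, e3, e4, Equiv.swap_apply_def]
      unfold Contractible.mergeVal
      grind
    · have e1 : (q.tail : V) = p'.tail := by rw [ht, Contractible.mergeVal, if_neg hx]
      have e2 : (q'.tail : V) = p.tail := by rw [ht', Contractible.mergeVal, if_neg (Ne.symm hx)]
      obtain ⟨σ, hσ, hσs, hσr⟩ := exists_restrict_two q.tail q'.tail e1 e2
      refine ⟨σ, id, hσ, by rw [hσr, hσs, mul_one], fun v => ?_⟩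
      rw [e1, hh] at hqn
      rw [e2, hh'] at hqn'
      rw [e1, e2, hh, hh']
      simp only [Contractible.mergeVal, id] at hqn hqn' ⊢
      grind
  have hm : ∀ z : V ⊕ S, q'.merge (p'.merge z) = Sum.map σ id (q.merge (p.merge z)) := by
    rintro (v | s)
    · rw [p.merge_inl, p'.merge_inl, q.merge_inl, q'.merge_inl, Sum.map_inl]
      congr 1
      ext
      rw [hσ]
      simp only [Contractible.coe_mergeVal]
      exact hπ v
    · rfl
  rw [graphClass_eq_of_endpoint K c n k σ ρ (fun _ => false) (fun _ _ => rfl)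
    (Γ := (Γ.contract p).contract q) (Γ' := (Γ.contract p').contract q'),
    smul_smul, smul_smul, smul_smul, ← neg_smul]
  · congr 1
    rw [← Int.cast_mul, ← Int.cast_mul, ← Int.cast_mul, ← Int.cast_neg]
    congr 1
    rw [orientSign, hρs, rkSign, rkSign, rkSign, rkSign]
    simp only [Bool.false_eq_true, if_false, Finset.prod_const_one, mul_one]
    split_ifs
    · rw [hρr, mul_one]
    · rw [hσs, neg_mul, mul_assoc]
  · intro b r
    simp only [endpoint_contract, hρ, hm, Bool.false_xor]

theorem sum_boundary_contract [CharZero K] (k : ℤ) (Γ : HairyGraph V E S) :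
    ∑ p : Γ.Contractible, (rkSign n p : K) • boundary K c n k (Γ.contract p) = 0 := by
  let T (x : Σ p : Γ.Contractible, (Γ.contract p).Contractible) : GraphSpace K c n S k :=
    (rkSign n x.1 : K) • (rkSign n x.2 : K) • graphClass K c n k ((Γ.contract x.1).contract x.2)
  have hinj : ∀ x y : Σ p : Γ.Contractible, (Γ.contract p).Contractible,
      x.1.edge = y.1.edge → (x.2.edge : E) = y.2.edge → x = y := by
    rintro ⟨p, q⟩ ⟨p', q'⟩ h1 h2
    obtain rfl := Contractible.edge_injective h1
    obtain rfl := Contractible.edge_injective (Subtype.ext h2)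
    rfl
  have hs : ∀ x : Σ p : Γ.Contractible, (Γ.contract p).Contractible,
      ∃ y : Σ p : Γ.Contractible, (Γ.contract p).Contractible,
        y.1.edge = x.2.edge ∧ (y.2.edge : E) = x.1.edge := by
    rintro ⟨p, q⟩
    obtain ⟨p', q', h1, h2⟩ := p.exists_swap q
    exact ⟨⟨p', q'⟩, h1, h2⟩
  choose f hf1 hf2 using hs
  have hff : Function.Involutive f := fun x =>
    hinj _ _ (by rw [hf1, hf2]) (by rw [hf2, hf1])
  have hT : ∀ x, T x = -T (f x) := fun x =>
    contract_contract K c n k x.1 x.2 (f x).1 (f x).2 (hf1 x) (hf2 x)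
  have h1 : ∑ x, T x = -∑ x, T x := by
    conv_lhs => rw [Finset.sum_congr rfl fun x _ => hT x, Finset.sum_neg_distrib]
    exact congrArg Neg.neg (Equiv.sum_comp hff.toPerm T)
  have h2 : ∑ x, T x = 0 := by
    have h3 : (2 : K) • ∑ x, T x = 0 := by
      rw [two_smul]
      nth_rewrite 2 [h1]
      exact add_neg_cancel _
    exact (smul_eq_zero.1 h3).resolve_left two_ne_zero
  rw [Fintype.sum_sigma] at h2
  simp only [boundary, Finset.smul_sum]
  exact h2

end Twice

/-! ### Admissibility of contracted graphs -/

namespace HairyGraph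

section ContractAdmissible

variable {V E S : Type*} {Γ : HairyGraph V E S}

theorem Acyclic.of_rank (h : V ⊕ S → ℕ) (hh : ∀ a, h (Γ.tgt a) < h (Γ.src a)) : Γ.Acyclic := by
  have key : ∀ x y, Relation.TransGen (fun y z => ∃ a, Γ.src a = y ∧ Γ.tgt a = z) x y →
      h y < h x := by
    intro x y hxy
    induction hxy with
    | single h1 => obtain ⟨a, rfl, rfl⟩ := h1; exact hh a
    | tail _ h1 ih => obtain ⟨a, rfl, rfl⟩ := h1; exact (hh a).trans ih
  exact fun x hx => lt_irrefl _ (key x x hx)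

theorem Acyclic.exists_rank [Finite V] [Finite S] (hΓ : Γ.Acyclic) :
    ∃ h : V ⊕ S → ℕ, ∀ a, h (Γ.tgt a) < h (Γ.src a) := by
  refine ⟨fun x =>
      Set.ncard {y | Relation.TransGen (fun y z => ∃ a, Γ.src a = y ∧ Γ.tgt a = z) x y},
    fun a => Set.ncard_lt_ncard ⟨fun y hy => .head ⟨a, rfl, rfl⟩ hy, fun hsub => ?_⟩
      (Set.toFinite _)⟩
  exact hΓ (Γ.tgt a) (hsub (.single ⟨a, rfl, rfl⟩))

/-- A directed cycle survives the contraction of an edge. -/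
theorem Acyclic.of_contract [Finite V] [Finite S] (p : Γ.Contractible)
    (h : (Γ.contract p).Acyclic) : Γ.Acyclic := by
  classical
  obtain ⟨h, hh⟩ := h.exists_rank
  refine .of_rank (fun x => 2 * h (p.merge x) + if x = Sum.inl p.tail then 1 else 0) fun a => ?_
  by_cases ha : a = p.edge
  · subst ha
    rw [p.src_edge, p.tgt_edge, p.merge_inl, p.merge_inl, if_pos rfl,
      if_neg (Sum.inl_injective.ne p.head_ne_tail)]
    simp [Contractible.mergeVal]
  · have := hh ⟨a, ha⟩
    simp only [contract] at this
    split_ifs <;> omega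

theorem card_subtype_eq_card_ne_add [Finite E] (a : E) (P : E → Prop) [Decidable (P a)] :
    Nat.card {b // P b} = Nat.card {b : {b // b ≠ a} // P b} + if P a then 1 else 0 := by
  rw [Nat.card_congr (Equiv.subtypeSubtypeEquivSubtypeInter (fun b => b ≠ a) P)]
  have h1 : Nat.card {b // P b} = Set.ncard {b | P b} := rfl
  have h2 : Nat.card {b // b ≠ a ∧ P b} = Set.ncard {b | b ≠ a ∧ P b} := rfl
  have h3 : {b | b ≠ a ∧ P b} = {b | P b} \ {a} := by ext; simp [and_comm]
  rw [h1, h2, h3]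
  split_ifs with h
  · exact (Set.ncard_sdiff_singleton_add_one (s := {b | P b}) h (Set.toFinite _)).symm
  · rw [Set.sdiff_singleton_eq_self (s := {b | P b}) h, add_zero]

theorem card_subtype_or [Finite E] {P Q : E → Prop} (h : ∀ b, P b → ¬ Q b) :
    Nat.card {b // P b ∨ Q b} = Nat.card {b // P b} + Nat.card {b // Q b} :=
  Set.ncard_union_eq (s := {b | P b}) (t := {b | Q b})
    (Set.disjoint_left.2 h) (Set.toFinite _) (Set.toFinite _)

namespace Contractible

variable (p : Γ.Contractible)

theorem merge_eq_inr {x : V ⊕ S} {s : S} : p.merge x = Sum.inr s ↔ x = Sum.inr s := by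
  rcases x with v | t
  · simp [merge_inl]
  · simp [merge_inr]

theorem merge_eq_inl {x : V ⊕ S} {v : {v // v ≠ p.tail}} :
    p.merge x = Sum.inl v ↔
      x = Sum.inl (v : V) ∨ ((v : V) = p.head ∧ x = Sum.inl p.tail) := by
  obtain ⟨v, hv⟩ := v
  rcases x with x | s
  · simp only [merge_inl, Sum.inl.injEq, Subtype.mk.injEq, mergeVal]
    split_ifs with h
    · subst h
      simp [Ne.symm hv, eq_comm]
    · simp [h]
  · simp [merge_inr]

theorem outDeg_contract_inr [Finite E] (s : S) :
    (Γ.contract p).outDeg (Sum.inr s) = Γ.outDeg (Sum.inr s) := by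
  classical
  have := card_subtype_eq_card_ne_add p.edge (fun b => Γ.src b = Sum.inr s)
  rw [if_neg (by rw [p.src_edge]; simp)] at this
  simp only [outDeg, this, contract, merge_eq_inr, add_zero]

theorem inDeg_contract_inr [Finite E] (s : S) :
    (Γ.contract p).inDeg (Sum.inr s) = Γ.inDeg (Sum.inr s) := by
  classical
  have := card_subtype_eq_card_ne_add p.edge (fun b => Γ.tgt b = Sum.inr s)
  rw [if_neg (by rw [p.tgt_edge]; simp)] at this
  simp only [inDeg, this, contract, merge_eq_inr, add_zero]

theorem outDeg_contract_inl [Finite E] {v : {v // v ≠ p.tail}} (hv : (v : V) ≠ p.head) :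
    (Γ.contract p).outDeg (Sum.inl v) = Γ.outDeg (Sum.inl (v : V)) := by
  classical
  have := card_subtype_eq_card_ne_add p.edge (fun b => Γ.src b = Sum.inl (v : V))
  rw [if_neg (by rw [p.src_edge]; simpa using v.2.symm)] at this
  simp only [outDeg, this, contract, merge_eq_inl, hv, false_and, or_false, add_zero]

theorem inDeg_contract_inl [Finite E] {v : {v // v ≠ p.tail}} (hv : (v : V) ≠ p.head) :
    (Γ.contract p).inDeg (Sum.inl v) = Γ.inDeg (Sum.inl (v : V)) := by
  classical
  have := card_subtype_eq_card_ne_add p.edge (fun b => Γ.tgt b = Sum.inl (v : V))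
  rw [if_neg (by rw [p.tgt_edge]; simpa using hv.symm)] at this
  simp only [inDeg, this, contract, merge_eq_inl, hv, false_and, or_false, add_zero]

theorem outDeg_contract_head [Finite E] {v : {v // v ≠ p.tail}} (hv : (v : V) = p.head) :
    (Γ.contract p).outDeg (Sum.inl v) + 1 =
      Γ.outDeg (Sum.inl p.head) + Γ.outDeg (Sum.inl p.tail) := by
  classical
  have h1 := card_subtype_eq_card_ne_add p.edge
    (fun b => Γ.src b = Sum.inl p.head ∨ Γ.src b = Sum.inl p.tail)
  rw [if_pos (Or.inr p.src_edge), card_subtype_or fun b h h' =>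
    p.head_ne_tail (Sum.inl_injective (h.symm.trans h'))] at h1
  simp only [outDeg, contract, merge_eq_inl, hv, true_and]
  exact h1.symm

theorem inDeg_contract_head [Finite E] {v : {v // v ≠ p.tail}} (hv : (v : V) = p.head) :
    (Γ.contract p).inDeg (Sum.inl v) + 1 =
      Γ.inDeg (Sum.inl p.head) + Γ.inDeg (Sum.inl p.tail) := by
  classical
  have h1 := card_subtype_eq_card_ne_add p.edge
    (fun b => Γ.tgt b = Sum.inl p.head ∨ Γ.tgt b = Sum.inl p.tail)
  rw [if_pos (Or.inl p.tgt_edge), card_subtype_or fun b h h' =>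
    p.head_ne_tail (Sum.inl_injective (h.symm.trans h'))] at h1
  simp only [inDeg, contract, merge_eq_inl, hv, true_and]
  exact h1.symm

theorem outDeg_tail_pos [Finite E] : 1 ≤ Γ.outDeg (Sum.inl p.tail) := by
  have : Nonempty {a // Γ.src a = Sum.inl p.tail} := ⟨⟨p.edge, p.src_edge⟩⟩
  exact Nat.card_pos

theorem inDeg_head_pos [Finite E] : 1 ≤ Γ.inDeg (Sum.inl p.head) := by
  have : Nonempty {a // Γ.tgt a = Sum.inl p.head} := ⟨⟨p.edge, p.tgt_edge⟩⟩
  exact Nat.card_pos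

end Contractible

theorem IsConnected.contract (h : Γ.IsConnected) (p : Γ.Contractible) :
    (Γ.contract p).IsConnected := by
  refine h.of_surjective p.merge p.merge_surjective fun a => ?_
  by_cases ha : a = p.edge
  · subst ha
    rw [p.src_edge, p.tgt_edge, p.merge_inl, p.merge_inl]
    simp only [Contractible.mergeVal, if_true, if_neg p.head_ne_tail]
    exact ⟨.refl, .refl⟩
  · exact ⟨.single ⟨⟨a, ha⟩, trivial, false, rfl, rfl⟩,
      .single ⟨⟨a, ha⟩, trivial, true, rfl, rfl⟩⟩

theorem IsAdmissible.contract_undirected [Finite E] (h : Γ.IsAdmissible .undirected)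
    (p : Γ.Contractible) : (Γ.contract p).IsAdmissible .undirected := by
  obtain ⟨h1, h2, h3⟩ := h
  refine ⟨h1.contract p, fun v => ?_, fun s => ?_⟩
  · by_cases hv : (v : V) = p.head
    · have := p.outDeg_contract_head hv
      have := p.inDeg_contract_head hv
      have := h2 p.head
      have := h2 p.tail
      simp only [valency] at *
      omega
    · rw [valency, p.outDeg_contract_inl hv, p.inDeg_contract_inl hv]
      exact h2 v
  · rw [valency, p.outDeg_contract_inr, p.inDeg_contract_inr]
    exact h3 s

theorem IsAdmissible.contract_oriented [Finite E] (h : Γ.IsAdmissible .oriented)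
    (p : Γ.Contractible) (hp : (Γ.contract p).Acyclic) :
    (Γ.contract p).IsAdmissible .oriented := by
  obtain ⟨h1, h2, h3, h4, h5, -⟩ := h
  have ht := p.outDeg_tail_pos
  have hh := p.inDeg_head_pos
  have ht3 := h3 p.tail
  have ht5 := h5 p.tail
  have hh4 := h4 p.head
  refine ⟨h1.contract p, fun s => ?_, fun v => ?_, fun v => ?_, fun v => ?_, hp⟩
  · rw [p.outDeg_contract_inr, p.inDeg_contract_inr]
    exact h2 s
  all_goals
    by_cases hv : (v : V) = p.head
    · have := p.outDeg_contract_head hv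
      have := p.inDeg_contract_head hv
      have := h3 p.head
      simp only [valency] at *
      omega
    · simp only [valency, p.outDeg_contract_inl hv, p.inDeg_contract_inl hv]
      first | exact h3 v | exact h4 v | exact h5 v

/-- If a contraction is not admissible, then it has a directed cycle, and this is not repaired
by a further contraction. -/
theorem IsAdmissible.of_contract_contract [Finite V] [Finite E] [Finite S] {c : Flavor}
    (h : Γ.IsAdmissible c) (p : Γ.Contractible) (q : (Γ.contract p).Contractible)
    (hq : ((Γ.contract p).contract q).IsAdmissible c) : (Γ.contract p).IsAdmissible c := by
  cases c with
  | undirected => exact h.contract_undirected p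
  | oriented => exact h.contract_oriented p (Acyclic.of_contract q hq.2.2.2.2.2)

end ContractAdmissible

end HairyGraph

/-! ### The differential squares to zero -/

section Square

variable (K : Type u) [Field K] (c : Flavor) (n : ℤ) (S : Type w)
variable {V E : Type*} [Fintype V] [LinearOrder V] [Fintype E] [LinearOrder E]

theorem dMap_boundary [CharZero K] [Finite S] {j k : ℤ} {Γ : HairyGraph V E S}
    (h : Γ.IsAdmissible c)
    (hj : (n - 1) * (Fintype.card E : ℤ) - n * (Fintype.card V : ℤ) + 1 = j) :
    dMap K c n j k (boundary K c n j Γ) = 0 := by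
  rw [← sum_boundary_contract K c n k Γ, boundary, map_sum]
  refine Finset.sum_congr rfl fun p _ => ?_
  rw [map_smul]
  congr 1
  by_cases hp : (Γ.contract p).IsAdmissible c
  · refine dMap_graphClass K c n hp ?_
    have hV : 0 < Fintype.card V := Fintype.card_pos_iff.2 ⟨p.tail⟩
    have hE : 0 < Fintype.card E := Fintype.card_pos_iff.2 ⟨p.edge⟩
    rw [← hj]
    simp only [ne_eq, Fintype.card_subtype_compl, Fintype.card_subtype_eq, Nat.cast_sub hV,
      Nat.cast_sub hE]
    push_cast
    ring
  · rw [graphClass_eq_zero_of_not_isAdmissible hp, map_zero, boundary]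
    exact (Finset.sum_eq_zero fun q _ => smul_eq_zero_of_right _
      (graphClass_eq_zero_of_not_isAdmissible fun hq => hp (h.of_contract_contract p q hq))).symm

theorem isGraphComplex [CharZero K] [Finite S] : IsGraphComplex K c n S where
  descends := contractFree_descends K c n
  sq_zero i j k := by
    by_cases hij : i + 1 = j
    · refine Submodule.linearMap_qext _ (Finsupp.lhom_ext' fun Γ => LinearMap.ext_ring ?_)
      obtain ⟨⟨v, e, Γ, h⟩, hi⟩ := Γ
      simp only [LinearMap.comp_apply, Finsupp.lsingle_apply, Submodule.mkQ_apply,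
        Submodule.liftQ_apply, LinearMap.zero_apply]
      rw [contractFree_single]
      refine dMap_boundary K c n S h ?_
      rw [← hij, ← hi]
      simp [LabelledGraph.degree]
    · rw [show (Submodule.liftQ _ (contractFree K c n S i j) (contractFree_descends K c n i j)) = 0
        from ?_, LinearMap.comp_zero]
      refine Submodule.linearMap_qext _ ?_
      simp [contractFree_eq_zero K c n S hij]

end Square

/-! ### Partially directed graphs and their zigzag graphs -/

namespace HairyGraph

section Zigzag

variable {V E S V' E' : Type*} (Γ : HairyGraph V E S) (st : E → Option Bool)

/-- The directed graph which belongs to a state `st` of the edges of `Γ`: an edge `a` with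
`st a = some r` is directed with tail `Γ.endpoint a r`, and an edge `a` with `st a = none` is
replaced by a zigzag `∙ ← m_a → ∙`, with halves `(a, false)` towards the tail and `(a, true)`
towards the head of `a` in `Γ`. -/
def zigzagGraph : HairyGraph (V ⊕ₗ {a // st a = none})
    ({a // st a ≠ none} ⊕ₗ ({a // st a = none} ×ₗ Bool)) S where
  src b := match ofLex b with
    | Sum.inl a => Sum.map (fun v => toLex (Sum.inl v)) id (Γ.endpoint a.1 ((st a.1).getD false))
    | Sum.inr q => Sum.inl (toLex (Sum.inr (ofLex q).1))
  tgt b := match ofLex b with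
    | Sum.inl a => Sum.map (fun v => toLex (Sum.inl v)) id (Γ.endpoint a.1 !((st a.1).getD false))
    | Sum.inr q => Sum.map (fun v => toLex (Sum.inl v)) id (Γ.endpoint (ofLex q).1.1 (ofLex q).2)

/-- The vertices of `Γ` as vertices of a zigzag graph. -/
def coreVertex : V ⊕ S → (V ⊕ₗ {a // st a = none}) ⊕ S :=
  Sum.map (fun v => toLex (Sum.inl v)) id

theorem coreVertex_inl (v : V) :
    coreVertex st (Sum.inl v : V ⊕ S) = Sum.inl (toLex (Sum.inl v)) := rfl

theorem coreVertex_inr (s : S) : coreVertex st (Sum.inr s : V ⊕ S) = Sum.inr s := rfl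

theorem coreVertex_injective :
    Function.Injective (coreVertex st : V ⊕ S → (V ⊕ₗ {a // st a = none}) ⊕ S) :=
  Sum.map_injective.2 ⟨fun _ _ h => Sum.inl_injective (toLex.injective h), Function.injective_id⟩

theorem coreVertex_ne (x : V ⊕ S) (z : {a // st a = none}) :
    coreVertex st x ≠ Sum.inl (toLex (Sum.inr z)) := by
  rcases x with v | s
  · rw [coreVertex_inl]
    intro h
    cases toLex.injective (Sum.inl_injective h)
  · rw [coreVertex_inr]
    exact Sum.inr_ne_inl

variable {st}

theorem zigzagGraph_endpoint_inl {a : E} {r : Bool} (h : st a = some r) (b : Bool) :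
    (Γ.zigzagGraph st).endpoint (toLex (Sum.inl ⟨a, by simp [h]⟩)) b =
      coreVertex st (Γ.endpoint a (xor r b)) := by
  cases b <;> simp [zigzagGraph, endpoint, h, coreVertex]

theorem zigzagGraph_endpoint_inr_false (q : {a // st a = none} × Bool) :
    (Γ.zigzagGraph st).endpoint (toLex (Sum.inr (toLex q))) false =
      Sum.inl (toLex (Sum.inr q.1)) := rfl

theorem zigzagGraph_endpoint_inr_true (q : {a // st a = none} × Bool) :
    (Γ.zigzagGraph st).endpoint (toLex (Sum.inr (toLex q))) true =
      coreVertex st (Γ.endpoint q.1.1 q.2) := rfl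

/-- The edges of a zigzag graph: directed edges and halves of zigzags. -/
@[elab_as_elim]
theorem zigzag_edge_cases {motive : {a // st a ≠ none} ⊕ₗ ({a // st a = none} ×ₗ Bool) → Prop}
    (hl : ∀ (a : E) (r : Bool) (h : st a = some r), motive (toLex (Sum.inl ⟨a, by simp [h]⟩)))
    (hr : ∀ (z : {a // st a = none}) (b : Bool), motive (toLex (Sum.inr (toLex (z, b))))) (e) :
    motive e := by
  induction e using Lex.rec with | _ e
  rcases e with ⟨a, ha⟩ | q
  · obtain ⟨r, hr⟩ := Option.ne_none_iff_exists'.1 ha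
    exact hl a r hr
  · exact hr (ofLex q).1 (ofLex q).2

/-- The vertices of a zigzag graph: vertices of `Γ` and midpoints of zigzags. -/
@[elab_as_elim]
theorem zigzag_vertex_cases {motive : (V ⊕ₗ {a // st a = none}) ⊕ S → Prop}
    (hl : ∀ x : V ⊕ S, motive (coreVertex st x))
    (hr : ∀ z : {a // st a = none}, motive (Sum.inl (toLex (Sum.inr z)))) (x) : motive x := by
  rcases x with x | s
  · induction x using Lex.rec with | _ x
    rcases x with v | z
    · exact hl (Sum.inl v)
    · exact hr z
  · exact hl (Sum.inr s)

variable (st) in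
/-- There is a directed edge from `x` to `y`. -/
def Arrow (x y : V ⊕ S) : Prop :=
  ∃ a r, st a = some r ∧ Γ.endpoint a r = x ∧ Γ.endpoint a (!r) = y

variable (st) in
/-- The states whose zigzag graphs are oriented-admissible: no directed edge leaves an external
vertex, every internal vertex is left by a directed edge, and there is no directed cycle. -/
def IsGood : Prop :=
  (∀ s y, ¬ Γ.Arrow st (Sum.inr s) y) ∧ (∀ v, ∃ y, Γ.Arrow st (Sum.inl v) y) ∧
    ∀ x, ¬ Relation.TransGen (Γ.Arrow st) x x

theorem valency_zigzagGraph [Finite E] (x : V ⊕ S) :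
    (Γ.zigzagGraph st).valency (coreVertex st x) = Γ.valency x := by
  have : Finite ({a // st a ≠ none} ⊕ₗ ({a // st a = none} ×ₗ Bool)) :=
    inferInstanceAs (Finite ({a // st a ≠ none} ⊕ ({a // st a = none} × Bool)))
  rw [valency_eq, valency_eq]
  symm
  refine Nat.card_congr (Equiv.ofBijective (fun p => ⟨if h : st p.1.1 = none then
    (toLex (Sum.inr (toLex (⟨p.1.1, h⟩, p.1.2))), true) else
    (toLex (Sum.inl ⟨p.1.1, h⟩), xor ((st p.1.1).getD false) p.1.2), ?_⟩) ⟨?_, ?_⟩)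
  · obtain ⟨⟨a, b⟩, h⟩ := p
    simp only at h ⊢
    by_cases ha : st a = none
    · rw [dif_pos ha, zigzagGraph_endpoint_inr_true, h]
    · obtain ⟨r, hr⟩ := Option.ne_none_iff_exists'.1 ha
      rw [dif_neg ha, zigzagGraph_endpoint_inl Γ hr]
      simp [hr, h]
  · rintro ⟨⟨a, b⟩, h⟩ ⟨⟨a', b'⟩, h'⟩ hh
    simp only [Subtype.mk.injEq] at hh ⊢
    split_ifs at hh with h1 h2 h2
    · simp only [Prod.mk.injEq, and_true, EmbeddingLike.apply_eq_iff_eq, Sum.inr.injEq,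
        Subtype.mk.injEq] at hh
      exact Prod.ext hh.1 hh.2
    · simp at hh
    · simp at hh
    · simp only [Prod.mk.injEq, EmbeddingLike.apply_eq_iff_eq, Sum.inl.injEq,
        Subtype.mk.injEq] at hh
      obtain ⟨rfl, hh⟩ := hh
      exact Prod.ext rfl (by simpa using hh)
  · rintro ⟨⟨e, b⟩, h⟩
    revert h
    refine zigzag_edge_cases (fun a r hr => ?_) (fun z b' => ?_) e <;> intro h
    · rw [zigzagGraph_endpoint_inl Γ hr] at h
      refine ⟨⟨(a, xor r b), coreVertex_injective st h⟩, Subtype.ext ?_⟩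
      simp [hr]
    · cases b
      · exact absurd h.symm (coreVertex_ne st x z)
      · refine ⟨⟨(z, b'), coreVertex_injective st h⟩, Subtype.ext ?_⟩
        simp [z.2]

theorem outDeg_zigzagGraph_pos_iff [Finite E] (x : V ⊕ S) :
    0 < (Γ.zigzagGraph st).outDeg (coreVertex st x) ↔ ∃ y, Γ.Arrow st x y := by
  have : Finite ({a // st a ≠ none} ⊕ₗ ({a // st a = none} ×ₗ Bool)) :=
    inferInstanceAs (Finite ({a // st a ≠ none} ⊕ ({a // st a = none} × Bool)))
  rw [outDeg, Nat.card_pos_iff, and_iff_left (Subtype.finite), nonempty_subtype]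
  constructor
  · rintro ⟨e, h⟩
    revert h
    refine zigzag_edge_cases (fun a r hr => ?_) (fun z b' => ?_) e <;> intro h
    · rw [← endpoint_false, zigzagGraph_endpoint_inl Γ hr] at h
      exact ⟨_, a, r, hr, by simpa using coreVertex_injective st h, rfl⟩
    · exact absurd h.symm (coreVertex_ne st x z)
  · rintro ⟨y, a, r, hr, rfl, rfl⟩
    exact ⟨_, by rw [← endpoint_false, zigzagGraph_endpoint_inl Γ hr, Bool.xor_false]⟩

theorem inDeg_zigzagGraph_midpoint (z : {a // st a = none}) :
    (Γ.zigzagGraph st).inDeg (Sum.inl (toLex (Sum.inr z))) = 0 := by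
  rw [inDeg, Nat.card_eq_zero]
  left
  constructor
  rintro ⟨e, h⟩
  revert h
  refine zigzag_edge_cases (fun a r hr => ?_) (fun z' b' => ?_) e <;> intro h
  · rw [← endpoint_true, zigzagGraph_endpoint_inl Γ hr] at h
    exact coreVertex_ne st _ z h
  · exact coreVertex_ne st _ z h

theorem outDeg_zigzagGraph_midpoint (z : {a // st a = none}) :
    (Γ.zigzagGraph st).outDeg (Sum.inl (toLex (Sum.inr z))) = 2 := by
  rw [outDeg, ← Fintype.card_bool, ← Nat.card_eq_fintype_card]
  symm
  refine Nat.card_congr (Equiv.ofBijective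
    (fun b => ⟨toLex (Sum.inr (toLex (z, b))), rfl⟩) ⟨?_, ?_⟩)
  · intro b b' h
    have := toLex.injective (Sum.inr_injective (toLex.injective (congrArg Subtype.val h)))
    exact congrArg Prod.snd this
  · rintro ⟨e, h⟩
    revert h
    refine zigzag_edge_cases (fun a r hr => ?_) (fun z' b' => ?_) e <;> intro h
    · rw [← endpoint_false, zigzagGraph_endpoint_inl Γ hr] at h
      exact absurd h (coreVertex_ne st _ z)
    · obtain rfl : z' = z := by
        have := toLex.injective (Sum.inl_injective h)
        exact Sum.inr_injective this
      exact ⟨b', rfl⟩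

theorem acyclic_zigzagGraph_iff :
    (Γ.zigzagGraph st).Acyclic ↔ ∀ x, ¬ Relation.TransGen (Γ.Arrow st) x x := by
  constructor
  · intro h x hx
    refine h (coreVertex st x) (Relation.TransGen.lift (coreVertex st) ?_ _ _ hx)
    rintro y z ⟨a, r, hr, rfl, rfl⟩
    exact ⟨_, by rw [← endpoint_false, zigzagGraph_endpoint_inl Γ hr, Bool.xor_false],
      by rw [← endpoint_true, zigzagGraph_endpoint_inl Γ hr, Bool.xor_true]⟩
  · intro h x hx
    have hstep : ∀ x y, (∃ e, (Γ.zigzagGraph st).src e = x ∧ (Γ.zigzagGraph st).tgt e = y) →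
        ∃ y', y = coreVertex st y' ∧ ∀ x', x = coreVertex st x' → Γ.Arrow st x' y' := by
      rintro _ _ ⟨e, rfl, rfl⟩
      refine zigzag_edge_cases (fun a r hr => ?_) (fun z' b' => ?_) e
      · rw [← endpoint_false, ← endpoint_true, zigzagGraph_endpoint_inl Γ hr,
          zigzagGraph_endpoint_inl Γ hr]
        exact ⟨_, rfl, fun x' h => ⟨a, r, hr, by simpa using coreVertex_injective st h, by simp⟩⟩
      · exact ⟨_, rfl, fun x' h => absurd h.symm (coreVertex_ne st _ z')⟩
    have key : ∀ x y, Relation.TransGen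
        (fun x y => ∃ e, (Γ.zigzagGraph st).src e = x ∧ (Γ.zigzagGraph st).tgt e = y) x y →
        ∃ y', y = coreVertex st y' ∧
          ∀ x', x = coreVertex st x' → Relation.TransGen (Γ.Arrow st) x' y' := by
      intro x y hxy
      induction hxy with
      | single h1 =>
        obtain ⟨y', rfl, h2⟩ := hstep _ _ h1
        exact ⟨y', rfl, fun x' hx' => .single (h2 x' hx')⟩
      | tail _ h1 ih =>
        obtain ⟨z', rfl, h3⟩ := ih
        obtain ⟨y', rfl, h2⟩ := hstep _ _ h1
        exact ⟨y', rfl, fun x' hx' => (h3 x' hx').tail (h2 z' rfl)⟩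
    obtain ⟨x', rfl, h1⟩ := key x x hx
    exact h x' (h1 x' rfl)

theorem Link.symm {τ : Set E} {x y : V ⊕ S} (h : Γ.Link τ x y) : Γ.Link τ y x := by
  obtain ⟨a, ha, r, rfl, rfl⟩ := h
  exact ⟨a, ha, !r, rfl, by simp⟩

theorem isConnected_zigzagGraph_iff : (Γ.zigzagGraph st).IsConnected ↔ Γ.IsConnected := by
  constructor
  · intro h
    let m : (V ⊕ₗ {a // st a = none}) ⊕ S → V ⊕ S := Sum.elim
      (fun x => Sum.elim Sum.inl (fun z : {a // st a = none} => Γ.endpoint z.1 false) (ofLex x))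
      Sum.inr
    have hm : ∀ x, m (coreVertex st x) = x := by rintro (v | s) <;> rfl
    have hlink : ∀ a b b', Relation.ReflTransGen (Γ.Link Set.univ) (Γ.endpoint a b)
        (Γ.endpoint a b') := by
      intro a b b'
      by_cases hb : b' = b
      · rw [hb]
      · exact .single ⟨a, trivial, b, rfl, by rw [← Bool.eq_not.2 hb]⟩
    refine h.of_surjective m (fun x => ⟨_, hm x⟩) fun e => ?_
    rw [← endpoint_false, ← endpoint_true]
    refine zigzag_edge_cases (fun a r hr => ?_) (fun z b' => ?_) e
    · rw [zigzagGraph_endpoint_inl Γ hr, zigzagGraph_endpoint_inl Γ hr, hm, hm]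
      exact ⟨hlink _ _ _, hlink _ _ _⟩
    · rw [zigzagGraph_endpoint_inr_true, hm]
      exact ⟨hlink z.1 false b', hlink z.1 b' false⟩
  · intro h
    rw [isConnected_iff] at h ⊢
    have hz : ∀ (z : {a // st a = none}) (b : Bool), (Γ.zigzagGraph st).Link Set.univ
        (Sum.inl (toLex (Sum.inr z))) (coreVertex st (Γ.endpoint z.1 b)) :=
      fun z b => ⟨toLex (Sum.inr (toLex (z, b))), trivial, false, rfl, rfl⟩
    have h1 : ∀ x y, Relation.ReflTransGen ((Γ.zigzagGraph st).Link Set.univ)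
        (coreVertex st x) (coreVertex st y) := by
      intro x y
      have := h.1 x y
      clear h
      induction this with
      | refl => exact .refl
      | tail _ h2 ih =>
        obtain ⟨a, -, r, rfl, rfl⟩ := h2
        refine ih.trans ?_
        rcases ha : st a with _ | r'
        · exact (Relation.ReflTransGen.single (Link.symm _ (hz ⟨a, ha⟩ r))).tail (hz ⟨a, ha⟩ _)
        · refine .single ⟨toLex (Sum.inl ⟨a, by simp [ha]⟩), trivial, xor r' r, ?_, ?_⟩ <;>
            rw [zigzagGraph_endpoint_inl Γ ha] <;> simp
    refine ⟨fun x y => ?_, ⟨coreVertex st h.2.some⟩⟩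
    refine zigzag_vertex_cases (fun x => ?_) (fun z => ?_) x <;>
    refine zigzag_vertex_cases (fun y => ?_) (fun z' => ?_) y
    · exact h1 x y
    · exact (h1 _ _).tail (Link.symm _ (hz z' false))
    · exact .head (hz z false) (h1 _ _)
    · exact .head (hz z false) ((h1 _ _).tail (Link.symm _ (hz z' false)))

theorem IsGood.isAdmissible_zigzagGraph [Finite E] {Γ : HairyGraph V E S}
    (h : Γ.IsAdmissible .undirected) (hst : Γ.IsGood st) :
    (Γ.zigzagGraph st).IsAdmissible .oriented := by
  obtain ⟨h1, h2, h3⟩ := h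
  have hpos := fun v => (Γ.outDeg_zigzagGraph_pos_iff (st := st) (Sum.inl v)).2 (hst.2.1 v)
  have hval := fun v => (Γ.valency_zigzagGraph (st := st) (Sum.inl v)).trans_ge (h2 v)
  have hv : ∀ P : (V ⊕ₗ {a // st a = none}) → Prop, (∀ v, P (toLex (Sum.inl v))) →
      (∀ z, P (toLex (Sum.inr z))) → ∀ v, P v := by
    intro P h1 h2 v
    induction v using Lex.rec with | _ v
    rcases v with v | z
    · exact h1 v
    · exact h2 z
  refine ⟨Γ.isConnected_zigzagGraph_iff.2 h1, fun s => ?_, hv _ (fun v => ?_) (fun z => ?_),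
    hv _ (fun v => ?_) (fun z => ?_), hv _ (fun v => ?_) (fun z => ?_),
    Γ.acyclic_zigzagGraph_iff.2 hst.2.2⟩
  · have h4 : (Γ.zigzagGraph st).outDeg (Sum.inr s) = 0 := by
      by_contra h5
      obtain ⟨y, hy⟩ := (Γ.outDeg_zigzagGraph_pos_iff (st := st) (Sum.inr s)).1
        (Nat.pos_of_ne_zero h5)
      exact hst.1 s y hy
    have h5 := (Γ.valency_zigzagGraph (st := st) (Sum.inr s)).trans (h3 s)
    rw [valency, coreVertex_inr, h4, zero_add] at h5
    exact ⟨h4, h5⟩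
  · exact (hval v).trans' (by norm_num)
  · rw [valency, outDeg_zigzagGraph_midpoint]; omega
  · exact hpos v
  · rw [outDeg_zigzagGraph_midpoint]; omega
  · have := hval v
    rw [valency, coreVertex_inl] at this
    omega
  · rw [outDeg_zigzagGraph_midpoint]; omega

theorem IsGood.of_isAdmissible_zigzagGraph [Finite E]
    (h : (Γ.zigzagGraph st).IsAdmissible .oriented) : Γ.IsGood st := by
  obtain ⟨h1, h2, h3, h4, h5, h6⟩ := h
  refine ⟨fun s y hy => ?_, fun v => ?_, Γ.acyclic_zigzagGraph_iff.1 h6⟩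
  · have := (Γ.outDeg_zigzagGraph_pos_iff (st := st) (Sum.inr s)).2 ⟨y, hy⟩
    exact this.ne' (h2 s).1
  · exact (Γ.outDeg_zigzagGraph_pos_iff (st := st) (Sum.inl v)).1 (h4 _)

/-- The midpoints of zigzags are precisely the bivalent vertices, so a graph is
undirected-admissible if a zigzag graph of it is oriented-admissible with no other bivalent
vertices. -/
theorem IsAdmissible.of_zigzagGraph [Finite E]
    (h : (Γ.zigzagGraph st).IsAdmissible .oriented) (h3 : ∀ v, Γ.valency (Sum.inl v) ≠ 2) :
    Γ.IsAdmissible .undirected := by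
  obtain ⟨h1, h2, h4, -⟩ := h
  refine ⟨Γ.isConnected_zigzagGraph_iff.1 h1, fun v => ?_, fun s => ?_⟩
  · have h5 := h4 (toLex (Sum.inl v))
    have h6 := h3 v
    rw [← coreVertex_inl, valency_zigzagGraph] at h5
    omega
  · rw [← Γ.valency_zigzagGraph (st := st), valency, coreVertex_inr, (h2 s).1, (h2 s).2]

end Zigzag

end HairyGraph

/-! ### The class of a partially directed graph -/

section Split

variable {E : Type*}

/-- The edges, split into directed edges and zigzags. -/
def splitEquiv (st : E → Option Bool) : E ≃ {a // st a ≠ none} ⊕ₗ {a // st a = none} where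
  toFun a := if h : st a = none then toLex (Sum.inr ⟨a, h⟩) else toLex (Sum.inl ⟨a, h⟩)
  invFun x := Sum.elim Subtype.val Subtype.val (ofLex x)
  left_inv a := by
    by_cases h : st a = none <;> simp [h]
  right_inv x := by
    induction x using Lex.rec with | _ x
    rcases x with ⟨a, h⟩ | ⟨a, h⟩ <;> simp [h]

theorem splitEquiv_none {st : E → Option Bool} {a : E} (h : st a = none) :
    splitEquiv st a = toLex (Sum.inr ⟨a, h⟩) := dif_pos h

theorem splitEquiv_ne_none {st : E → Option Bool} {a : E} (h : st a ≠ none) :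
    splitEquiv st a = toLex (Sum.inl ⟨a, h⟩) := dif_neg h

end Split

section ZigzagClass

variable {V E V' E' : Type*} [Fintype V] [LinearOrder V] [Fintype E] [LinearOrder E]
    [Fintype V'] [LinearOrder V'] [Fintype E'] [LinearOrder E'] {S : Type w}

/-- With this sign, the signs of all operations on partially directed graphs become
independent of the parity of `n`, up to the signs in the undirected graph complex. -/
def normSign (n : ℤ) (st : E → Option Bool) : ℤ :=
  if Even n then sgn (splitEquiv st) else ∏ a, if st a = some true then -1 else 1

theorem normSign_mul_self (n : ℤ) (st : E → Option Bool) : normSign n st * normSign n st = 1 := by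
  rw [normSign]
  split_ifs
  · exact sgn_mul_self _
  · rw [← Finset.prod_mul_distrib]
    exact Finset.prod_eq_one fun a _ => by split_ifs <;> rfl

theorem Finset.prod_subtype_none {E : Type*} [Fintype E] (st : E → Option Bool) (f : E → ℤ) :
    ∏ a : {a // st a = none}, f a = ∏ a, if st a = none then f a else 1 := by
  rw [Finset.prod_ite, Finset.prod_const_one, mul_one]
  exact (Finset.prod_subtype _ (by simp) f).symm

end ZigzagClass

section Iso

variable {V E V' E' : Type*} {S : Type w}

variable {st : E → Option Bool} {st' : E' → Option Bool} (σ : V ≃ V') (ρ : E ≃ E') (ε : E → Bool)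
    (ρD : {a // st a ≠ none} ≃ {b // st' b ≠ none}) (ρZ : {a // st a = none} ≃ {b // st' b = none})

/-- The map on vertices of zigzag graphs, for an isomorphism of partially directed graphs. -/
def zigzagVertexEquiv : V ⊕ₗ {a // st a = none} ≃ V' ⊕ₗ {b // st' b = none} :=
  ofLex.trans ((Equiv.sumCongr σ ρZ).trans toLex)

/-- The map on halves of zigzags: the halves of `a` are exchanged if the direction of `a` is
reversed. -/
def zigzagHalfEquiv : {a // st a = none} ×ₗ Bool ≃ {b // st' b = none} ×ₗ Bool where
  toFun q := toLex (ρZ (ofLex q).1, xor (ε (ofLex q).1) (ofLex q).2)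
  invFun q := toLex (ρZ.symm (ofLex q).1, xor (ε (ρZ.symm (ofLex q).1)) (ofLex q).2)
  left_inv q := by simp
  right_inv q := by simp

/-- The map on edges of zigzag graphs, for an isomorphism of partially directed graphs. -/
def zigzagEdgeEquiv : {a // st a ≠ none} ⊕ₗ ({a // st a = none} ×ₗ Bool) ≃
    {b // st' b ≠ none} ⊕ₗ ({b // st' b = none} ×ₗ Bool) :=
  ofLex.trans ((Equiv.sumCongr ρD (zigzagHalfEquiv ε ρZ)).trans toLex)

variable {σ ρ ε ρD ρZ}

theorem zigzagEquiv_endpoint {Γ : HairyGraph V E S} {Γ' : HairyGraph V' E' S}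
    (h : ∀ a r, Γ'.endpoint (ρ a) r = Sum.map σ id (Γ.endpoint a (xor (ε a) r)))
    (hst : ∀ a, st' (ρ a) = (st a).map (xor (ε a))) (hρD : ∀ a, (ρD a : E') = ρ a)
    (hρZ : ∀ a, (ρZ a : E') = ρ a) (e) (r : Bool) :
    (Γ'.zigzagGraph st').endpoint (zigzagEdgeEquiv ε ρD ρZ e) r =
      Sum.map (zigzagVertexEquiv σ ρZ) id ((Γ.zigzagGraph st).endpoint e r) := by
  have hcore : ∀ x : V ⊕ S, coreVertex st' (Sum.map σ id x) =
      Sum.map (zigzagVertexEquiv σ ρZ) id (coreVertex st x) := by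
    rintro (v | s) <;> rfl
  refine zigzag_edge_cases (fun a r' hr => ?_) (fun z b => ?_) e
  · have hr' : st' (ρ a) = some (xor (ε a) r') := by rw [hst, hr]; rfl
    have : zigzagEdgeEquiv ε ρD ρZ (toLex (Sum.inl ⟨a, by simp [hr]⟩)) =
        toLex (Sum.inl ⟨ρ a, by simp [hr']⟩) :=
      congrArg (fun x => toLex (Sum.inl x)) (Subtype.ext (hρD ⟨a, by simp [hr]⟩))
    rw [this, zigzagGraph_endpoint_inl Γ' hr', zigzagGraph_endpoint_inl Γ hr, ← hcore, h]
    congr 3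
    cases ε a <;> cases r' <;> cases r <;> rfl
  · have : zigzagEdgeEquiv ε ρD ρZ (toLex (Sum.inr (toLex (z, b)))) =
      toLex (Sum.inr (toLex (ρZ z, xor (ε z) b))) := rfl
    rw [this]
    cases r
    · rfl
    · rw [zigzagGraph_endpoint_inr_true, zigzagGraph_endpoint_inr_true, ← hcore]
      refine congrArg (coreVertex st') ?_
      simp only [hρZ]
      refine (h z.1 _).trans ?_
      simp

variable [Fintype V] [LinearOrder V] [Fintype E] [LinearOrder E] [Fintype V'] [LinearOrder V']
  [Fintype E'] [LinearOrder E']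

/-- The sign of an isomorphism of zigzag graphs. The factor besides the normalizing signs and the
sign in the undirected graph complex does not depend on `n`. -/
theorem orientSign_zigzagEquiv (n : ℤ) (hst : ∀ a, st' (ρ a) = (st a).map (xor (ε a)))
    (hρD : ∀ a, (ρD a : E') = ρ a) (hρZ : ∀ a, (ρZ a : E') = ρ a) :
    orientSign (n + 1) (zigzagVertexEquiv σ ρZ) (zigzagEdgeEquiv ε ρD ρZ) (fun _ => false) =
      normSign n st * normSign n st' * (orientSign n σ ρ ε * (sgn σ * sgn ρD)) := by
  have hs1 : sgn (zigzagVertexEquiv σ ρZ) = sgn σ * sgn ρZ :=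
    sgn_sumCongr σ ρZ _ (fun _ => rfl) fun _ => rfl
  have hs2 : sgn (zigzagHalfEquiv ε ρZ) = ∏ a : {a // st a = none}, if ε a then -1 else 1 :=
    sgn_prod_bool ρZ (fun a => ε a) _ fun _ _ => rfl
  have hs3 : sgn (zigzagEdgeEquiv ε ρD ρZ) = sgn ρD * sgn (zigzagHalfEquiv ε ρZ) :=
    sgn_sumCongr ρD (zigzagHalfEquiv ε ρZ) _ (fun _ => rfl) fun _ => rfl
  have hs4 : sgn (splitEquiv st) * (sgn ρD * sgn ρZ) = sgn ρ * sgn (splitEquiv st') := by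
    let τ : {a // st a ≠ none} ⊕ₗ {a // st a = none} ≃
      {b // st' b ≠ none} ⊕ₗ {b // st' b = none} :=
      ofLex.trans ((Equiv.sumCongr ρD ρZ).trans toLex)
    rw [← sgn_sumCongr ρD ρZ τ (fun _ => rfl) fun _ => rfl, ← sgn_trans, ← sgn_trans]
    congr 1
    ext a : 1
    change τ (splitEquiv st a) = splitEquiv st' (ρ a)
    by_cases ha : st a = none
    · rw [splitEquiv_none ha, splitEquiv_none (by rw [hst, ha]; rfl)]
      exact congrArg (fun x => toLex (Sum.inr x)) (Subtype.ext (hρZ ⟨a, ha⟩))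
    · rw [splitEquiv_ne_none ha, splitEquiv_ne_none (by rw [hst]; simpa using ha)]
      exact congrArg (fun x => toLex (Sum.inl x)) (Subtype.ext (hρD ⟨a, ha⟩))
  simp only [orientSign, normSign, Bool.false_eq_true, if_false, Finset.prod_const_one, mul_one,
    Int.even_add_one]
  by_cases hn : Even n
  · simp only [hn, if_true, not_true_eq_false, if_false, hs1]
    rcases sgn_eq_one_or σ with h1 | h1 <;> rcases sgn_eq_one_or ρ with h2 | h2 <;>
      rcases sgn_eq_one_or ρD with h3 | h3 <;> rcases sgn_eq_one_or ρZ with h4 | h4 <;>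
      rcases sgn_eq_one_or (splitEquiv st) with h5 | h5 <;>
      rw [h2, h3, h4, h5] at hs4 <;> rw [h1, h2, h3, h4, h5] <;> linarith
  · simp only [hn, if_false, not_false_eq_true, if_true, hs3, hs2]
    have h5 : (∏ b, if st' b = some true then (-1 : ℤ) else 1) *
        (∏ a : {a // st a = none}, if ε a then -1 else 1) =
        (∏ a, if ε a then -1 else 1) * ∏ a, if st a = some true then -1 else 1 := by
      rw [Finset.prod_subtype_none st fun a => if ε a then (-1 : ℤ) else 1, ← ρ.prod_comp,
        ← Finset.prod_mul_distrib, ← Finset.prod_mul_distrib]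
      refine Finset.prod_congr rfl fun a _ => ?_
      rw [hst]
      rcases st a with _ | _ | _ <;> cases ε a <;> simp
    have h6 := sgn_mul_self σ
    have h7 := normSign_mul_self 1 st
    rw [normSign, if_neg (by decide)] at h7
    have h8 := normSign_mul_self 1 st'
    rw [normSign, if_neg (by decide)] at h8
    linear_combination (sgn ρD * ∏ b, if st' b = some true then (-1 : ℤ) else 1) * h5 -
      (sgn ρD * (∏ a : {a // st a = none}, if ε a then (-1 : ℤ) else 1)) * h8 -
      (sgn ρD * (∏ a, if st a = some true then (-1 : ℤ) else 1) *
        (∏ b, if st' b = some true then (-1 : ℤ) else 1) * (∏ a, if ε a then (-1 : ℤ) else 1)) * h6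

end Iso

section ZigzagClass

variable {V E V' E' : Type*} [Fintype V] [LinearOrder V] [Fintype E] [LinearOrder E]
    [Fintype V'] [LinearOrder V'] [Fintype E'] [LinearOrder E'] {S : Type w}

variable (K : Type u) [Field K] (n : ℤ)

/-- The class of a partially directed graph in the oriented graph complex. -/
def zigzagClass (k : ℤ) (Γ : HairyGraph V E S) (st : E → Option Bool) :
    GraphSpace K .oriented (n + 1) S k :=
  (normSign n st : K) • graphClass K .oriented (n + 1) k (Γ.zigzagGraph st)

theorem zigzagClass_eq_zero {k : ℤ} {Γ : HairyGraph V E S} {st : E → Option Bool}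
    (h : ¬ Γ.IsGood st) : zigzagClass K n k Γ st = 0 := by
  rw [zigzagClass, graphClass_eq_zero_of_not_isAdmissible fun h' =>
    h (IsGood.of_isAdmissible_zigzagGraph Γ h'), smul_zero]

theorem graphClass_zigzagGraph (k : ℤ) (Γ : HairyGraph V E S) (st : E → Option Bool) :
    graphClass K .oriented (n + 1) k (Γ.zigzagGraph st) =
      (normSign n st : K) • zigzagClass K n k Γ st := by
  rw [zigzagClass, smul_smul, ← Int.cast_mul, normSign_mul_self, Int.cast_one, one_smul]

/-- An isomorphism of partially directed graphs changes the class by the sign in the undirected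
graph complex and a factor which does not depend on `n`. -/
theorem zigzagClass_relabel (k : ℤ) {Γ : HairyGraph V E S} {Γ' : HairyGraph V' E' S}
    {st : E → Option Bool} {st' : E' → Option Bool} (σ : V ≃ V') (ρ : E ≃ E') (ε : E → Bool)
    (h : ∀ a r, Γ'.endpoint (ρ a) r = Sum.map σ id (Γ.endpoint a (xor (ε a) r)))
    (hst : ∀ a, st' (ρ a) = (st a).map (xor (ε a)))
    (ρD : {a // st a ≠ none} ≃ {b // st' b ≠ none}) (hρD : ∀ a, (ρD a : E') = ρ a) :
    zigzagClass K n k Γ' st' =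
      ((orientSign n σ ρ ε * (sgn σ * sgn ρD) : ℤ) : K) • zigzagClass K n k Γ st := by
  have hZ : ∀ a, st a = none ↔ st' (ρ a) = none := fun a => by rw [hst]; simp
  let ρZ : {a // st a = none} ≃ {b // st' b = none} := ρ.subtypeEquiv hZ
  have hρZ : ∀ a, (ρZ a : E') = ρ a := fun _ => rfl
  rw [zigzagClass, graphClass_eq_of_endpoint K .oriented (n + 1) k (zigzagVertexEquiv σ ρZ)
    (zigzagEdgeEquiv ε ρD ρZ) (fun _ => false) (fun _ _ => rfl) (Γ := Γ.zigzagGraph st)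
    (Γ' := Γ'.zigzagGraph st') (fun e r => (zigzagEquiv_endpoint h hst hρD hρZ e r).trans
      (by rw [Bool.false_xor])), graphClass_zigzagGraph, orientSign_zigzagEquiv n hst hρD hρZ,
    smul_smul, smul_smul, ← Int.cast_mul, ← Int.cast_mul]
  congr 2
  linear_combination (orientSign n σ ρ ε * (sgn σ * sgn ρD) * normSign n st' * normSign n st') *
    normSign_mul_self n st + (orientSign n σ ρ ε * (sgn σ * sgn ρD)) * normSign_mul_self n st'

end ZigzagClass

/-! ### Contraction of edges in zigzag graphs -/

section Extend

variable {A B A₀ : Type*} [Fintype A] [LinearOrder A] [Fintype B] [LinearOrder B]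
  [Fintype A₀] [LinearOrder A₀]

theorem exists_equiv_of_compl {i : A₀ → A} {j : A₀ → B} {x : A} {y : B} (hi : StrictMono i)
    (hj : StrictMono j) (hx : ∀ a, a ≠ x ↔ ∃ a₀, i a₀ = a) (hy : ∀ b, b ≠ y ↔ ∃ a₀, j a₀ = b) :
    ∃ f : A ≃ B, f x = y ∧ (∀ a, f (i a) = j a) ∧ sgn f = (-1) ^ rk x * (-1) ^ rk y := by
  classical
  let f₁ : Option A₀ ≃ A := Equiv.ofBijective (fun o => o.elim x i) ⟨?_, ?_⟩
  · let f₂ : Option A₀ ≃ B := Equiv.ofBijective (fun o => o.elim y j) ⟨?_, ?_⟩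
    · refine ⟨f₁.symm.trans f₂, ?_, ?_, ?_⟩
      · have : f₁ none = x := rfl
        rw [← this, Equiv.trans_apply, Equiv.symm_apply_apply]
        rfl
      · intro a
        have : f₁ (some a) = i a := rfl
        rw [← this, Equiv.trans_apply, Equiv.symm_apply_apply]
        rfl
      · rw [sgn_eq_of_delete (f₁.symm.trans f₂) (x := x) (y := y) ?_ hi hj hx (Equiv.refl A₀) ?_,
          sgn_refl, mul_one]
        · have : f₁ none = x := rfl
          rw [← this, Equiv.trans_apply, Equiv.symm_apply_apply]
          rfl
        · intro a
          have : f₁ (some a) = i a := rfl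
          rw [← this, Equiv.trans_apply, Equiv.symm_apply_apply]
          rfl
    · rintro (_ | a) (_ | b) h
      · rfl
      · exact absurd h.symm ((hy _).2 ⟨b, rfl⟩)
      · exact absurd h ((hy _).2 ⟨a, rfl⟩)
      · exact congrArg some (hj.injective h)
    · intro b
      by_cases hb : b = y
      · exact ⟨none, hb.symm⟩
      · obtain ⟨a, rfl⟩ := (hy b).1 hb
        exact ⟨some a, rfl⟩
  · rintro (_ | a) (_ | b) h
    · rfl
    · exact absurd h.symm ((hx _).2 ⟨b, rfl⟩)
    · exact absurd h ((hx _).2 ⟨a, rfl⟩)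
    · exact congrArg some (hi.injective h)
  · intro b
    by_cases hb : b = x
    · exact ⟨none, hb.symm⟩
    · obtain ⟨a, rfl⟩ := (hx b).1 hb
      exact ⟨some a, rfl⟩

theorem exists_equiv_restrict (f : A ≃ B) {x : A} {y : B} (hxy : f x = y) {i : A₀ → A}
    (hi : StrictMono i) (hx : ∀ a, a ≠ x ↔ ∃ a₀, i a₀ = a) :
    ∃ f₀ : A₀ ≃ {b // b ≠ y}, (∀ a, (f₀ a : B) = f (i a)) ∧
      sgn f₀ = (-1) ^ rk x * (-1) ^ rk y * sgn f := by
  let f₀ : A₀ ≃ {b // b ≠ y} := Equiv.ofBijective (fun a => ⟨f (i a), fun h => by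
    rw [← hxy, f.apply_eq_iff_eq] at h; exact (hx _).2 ⟨a, rfl⟩ h⟩) ⟨?_, ?_⟩
  · refine ⟨f₀, fun _ => rfl, ?_⟩
    rw [sgn_eq_of_delete f hxy hi (Subtype.strictMono_coe _) hx f₀ fun _ => rfl]
    rcases neg_one_pow_eq_or ℤ (rk x) with h1 | h1 <;>
      rcases neg_one_pow_eq_or ℤ (rk y) with h2 | h2 <;> simp [h1, h2]
  · intro a b h
    exact hi.injective (f.injective (congrArg Subtype.val h))
  · rintro ⟨b, hb⟩
    obtain ⟨a, ha⟩ := (hx (f.symm b)).1 fun h => hb (by rw [← hxy, ← h, f.apply_symm_apply])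
    exact ⟨a, Subtype.ext (by simp [ha])⟩

theorem rk_subtype {P : A → Prop} [DecidablePred P] (a : {a // P a}) :
    rk a = (Finset.univ.filter fun b => P b ∧ b < a).card := by
  rw [rk, ← Finset.card_map (Function.Embedding.subtype _)]
  congr 1
  ext b
  simp only [Finset.mem_map, Finset.mem_filter, Finset.mem_univ, true_and,
    Function.Embedding.coe_subtype]
  exact ⟨fun ⟨c, hc, h⟩ => h ▸ ⟨c.2, hc⟩, fun h => ⟨⟨b, h.1⟩, h.2, rfl⟩⟩

end Extend

section Lex

variable {A B A₀ : Type*} [LinearOrder A] [LinearOrder B] [LinearOrder A₀]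

/-- A shortcut for the search of instances. -/
instance decidableEqSumLex : DecidableEq (A ⊕ₗ B) := LinearOrder.toDecidableEq

theorem strictMono_sumLex {A₁ B₁ : Type*} [LinearOrder A₁] [LinearOrder B₁] {i : A₀ → A}
    {j : A₁ → B₁} (hi : StrictMono i) (hj : StrictMono j) :
    StrictMono fun x : A₀ ⊕ₗ A₁ => (toLex (Sum.map i j (ofLex x)) : A ⊕ₗ B₁) := by
  intro x y
  induction x using Lex.rec with | _ x
  induction y using Lex.rec with | _ y
  rcases x with x | x <;> rcases y with y | y <;>
    simp [Sum.Lex.toLex_lt_toLex, hi.lt_iff_lt, hj.lt_iff_lt]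

theorem strictMono_prodLex {i : A₀ → A} (hi : StrictMono i) :
    StrictMono fun x : A₀ ×ₗ Bool => (toLex (i (ofLex x).1, (ofLex x).2) : A ×ₗ Bool) := by
  intro x y
  induction x using Lex.rec with | _ x
  induction y using Lex.rec with | _ y
  simp [Prod.Lex.toLex_lt_toLex, hi.lt_iff_lt, hi.injective.eq_iff]

end Lex

section DirRk

variable {E : Type*} [Fintype E] [LinearOrder E]

/-- The number of directed edges below `a`. -/
def dirRk (st : E → Option Bool) (a : E) : ℕ :=
  (Finset.univ.filter fun b => st b ≠ none ∧ b < a).card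

theorem rk_dir {st : E → Option Bool} (a : {a // st a ≠ none}) : rk a = dirRk st a := by
  rw [rk_subtype, dirRk]

theorem dirRk_update (st : E → Option Bool) (a : E) (o : Option Bool) :
    dirRk (Function.update st a o) a = dirRk st a := by
  rw [dirRk, dirRk]
  congr 1
  ext b
  simp only [Finset.mem_filter, Finset.mem_univ, true_and]
  refine and_congr_left fun h => ?_
  rw [Function.update_of_ne h.ne]

end DirRk

namespace HairyGraph

section ContractHalf

variable {V E S : Type*} {Γ : HairyGraph V E S} {st : E → Option Bool}

theorem exists_tail_of_contractible_half {a : E} (ha : st a = none) {β : Bool}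
    (q : (Γ.zigzagGraph st).Contractible)
    (hq : q.edge = toLex (Sum.inr (toLex (⟨a, ha⟩, β)))) :
    q.tail = toLex (Sum.inr ⟨a, ha⟩) ∧ ∃ v, Γ.endpoint a β = Sum.inl v ∧
      q.head = toLex (Sum.inl v) := by
  have h1 := q.src_edge
  have h2 := q.tgt_edge
  rw [hq] at h1 h2
  rw [← endpoint_true, zigzagGraph_endpoint_inr_true] at h2
  refine ⟨(Sum.inl_injective h1).symm, ?_⟩
  rcases h3 : Γ.endpoint a β with v | s
  · rw [h3] at h2
    exact ⟨v, rfl, (Sum.inl_injective h2).symm⟩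
  · rw [h3] at h2
    cases h2

theorem exists_contractible_half {a : E} (ha : st a = none) {β : Bool} {v : V}
    (hv : Γ.endpoint a β = Sum.inl v) :
    ∃ q : (Γ.zigzagGraph st).Contractible,
      q.edge = toLex (Sum.inr (toLex (⟨a, ha⟩, β))) :=
  ⟨Contractible.mk _ (toLex (Sum.inr ⟨a, ha⟩)) (toLex (Sum.inl v)) rfl
    (by rw [← endpoint_true, zigzagGraph_endpoint_inr_true]; simp only [hv]; rfl)
    (by simp), rfl⟩

end ContractHalf

end HairyGraph

section ContractZigzag

variable (K : Type u) [Field K] (n : ℤ) (k : ℤ) {S : Type w}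
variable {V E : Type*} [Fintype V] [LinearOrder V] [Fintype E] [LinearOrder E]
    {Γ : HairyGraph V E S} {st : E → Option Bool}

/-- The sign in front of the part of the differential that turns zigzags into directed edges. -/
def zigzagSign (n : ℤ) (V : Type*) {E : Type*} [Fintype V] [Fintype E] (st : E → Option Bool) : ℤ :=
  if Even n then (-1) ^ (Fintype.card V + Fintype.card {a // st a ≠ none}) else 1

/-- The contraction of one half of a zigzag turns it into a directed edge. -/
theorem rkSign_smul_graphClass_contract_half {a : E} (ha : st a = none) {β : Bool}
    (q : (Γ.zigzagGraph st).Contractible)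
    (hq : q.edge = toLex (Sum.inr (toLex (⟨a, ha⟩, β)))) :
    ((normSign n st * rkSign (n + 1) q : ℤ) : K) •
        graphClass K .oriented (n + 1) k ((Γ.zigzagGraph st).contract q) =
      ((zigzagSign n V st * (-1) ^ dirRk st a : ℤ) : K) •
        zigzagClass K n k Γ (Function.update st a (some β)) := by
  obtain ⟨ht, v, hv, hh⟩ := exists_tail_of_contractible_half ha q hq
  set st' := Function.update st a (some β) with hst'
  have hst'a : st' a = some β := by simp [hst']
  have hst'b : ∀ b, b ≠ a → st' b = st b := fun b hb => Function.update_of_ne hb _ _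
  -- inclusions of the common part of the edge sets
  let iD : {b // st b ≠ none} → {b // st' b ≠ none} := fun b => ⟨b, by
    rw [hst'b _ (by rintro h; exact b.2 (h ▸ ha))]; exact b.2⟩
  let iZ : {b // st' b = none} → {b // st b = none} := fun b => ⟨b, by
    rw [← hst'b _ (by rintro h; have := b.2; rw [h, hst'a] at this; cases this)]; exact b.2⟩
  have hiD : StrictMono iD := fun _ _ h => h
  have hiZ : StrictMono iZ := fun _ _ h => h
  have hDa : ∀ b : {b // st' b ≠ none}, b ≠ ⟨a, by simp [hst'a]⟩ ↔ ∃ b₀, iD b₀ = b := by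
    intro b
    constructor
    · intro h
      have h1 : (b : E) ≠ a := fun h2 => h (Subtype.ext h2)
      exact ⟨⟨b, by rw [← hst'b _ h1]; exact b.2⟩, rfl⟩
    · rintro ⟨b₀, rfl⟩ h
      exact b₀.2 ((congrArg Subtype.val h : (b₀ : E) = a) ▸ ha)
  have hZa : ∀ b : {b // st b = none}, b ≠ ⟨a, ha⟩ ↔ ∃ b₀, iZ b₀ = b := by
    intro b
    constructor
    · intro h
      have h1 : (b : E) ≠ a := fun h2 => h (Subtype.ext h2)
      exact ⟨⟨b, by rw [hst'b _ h1]; exact b.2⟩, rfl⟩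
    · rintro ⟨b₀, rfl⟩ h
      have := b₀.2
      rw [show (b₀ : E) = a from congrArg Subtype.val h, hst'a] at this
      cases this
  -- the sign of the change of the order of the edges
  have hsplit : sgn (splitEquiv st) = sgn (splitEquiv st') *
      ((-1) ^ dirRk st a * (-1) ^ (Fintype.card {a // st a ≠ none} +
        rk (⟨a, ha⟩ : {a // st a = none}))) := by
    obtain ⟨f, hf1, hf2, hf3⟩ := exists_equiv_of_compl
      (A₀ := {b // st b ≠ none} ⊕ₗ {b // st' b = none})
      (x := (toLex (Sum.inl ⟨a, by simp [hst'a]⟩) : {b // st' b ≠ none} ⊕ₗ {b // st' b = none}))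
      (y := (toLex (Sum.inr ⟨a, ha⟩) : {b // st b ≠ none} ⊕ₗ {b // st b = none}))
      (strictMono_sumLex hiD strictMono_id) (strictMono_sumLex strictMono_id hiZ) (by
        intro b
        induction b using Lex.rec with | _ b
        rcases b with b | b
        · simpa [Lex.exists] using hDa b
        · simp [Lex.exists]) (by
        intro b
        induction b using Lex.rec with | _ b
        rcases b with b | b
        · simp [Lex.exists]
        · simpa [Lex.exists] using hZa b)
    rw [rk_inl, rk_inr, rk_dir, dirRk_update] at hf3
    rw [← hf3, ← sgn_trans]
    congr 1
    ext b : 1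
    rw [Equiv.trans_apply]
    by_cases hb : b = a
    · subst hb
      rw [splitEquiv_none ha, splitEquiv_ne_none (by simp [hst'a]), hf1]
    · by_cases hb' : st b = none
      · rw [splitEquiv_none hb', splitEquiv_none ((hst'b b hb).trans hb')]
        exact (hf2 (toLex (Sum.inr ⟨b, (hst'b b hb).trans hb'⟩))).symm
      · rw [splitEquiv_ne_none hb', splitEquiv_ne_none (by rwa [hst'b b hb])]
        exact (hf2 (toLex (Sum.inl ⟨b, hb'⟩))).symm
  have hprod : (∏ b, if st' b = some true then (-1 : ℤ) else 1) =
      (if β then -1 else 1) * ∏ b, if st b = some true then -1 else 1 := by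
    rw [← Finset.mul_prod_erase _ _ (Finset.mem_univ a),
      ← Finset.mul_prod_erase Finset.univ (fun b => if st b = some true then (-1 : ℤ) else 1)
        (Finset.mem_univ a), ha, hst'a]
    simp only [Option.some.injEq, reduceCtorEq, if_false, one_mul]
    congr 1
    exact Finset.prod_congr rfl fun b hb => by rw [hst'b b (Finset.ne_of_mem_erase hb)]
  -- the isomorphism of graphs
  obtain ⟨σ, hσ, hσs⟩ := exists_equiv_restrict (A := V ⊕ₗ {b // st b = none})
    (A₀ := V ⊕ₗ {b // st' b = none}) (Equiv.refl _) (x := toLex (Sum.inr ⟨a, ha⟩)) ht.symm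
    (strictMono_sumLex strictMono_id hiZ) (by
      intro b
      induction b using Lex.rec with | _ b
      rcases b with b | b
      · simp [Lex.exists]
      · simpa [Lex.exists] using hZa b)
  have hσs : sgn σ = 1 := by
    rw [hσs, sgn_refl, mul_one, ← pow_add, ht, ← two_mul, pow_mul]
    norm_num
  have hmem : toLex (Sum.inr (toLex (⟨a, ha⟩, !β))) ≠ q.edge := by rw [hq]; simp
  have hmem1 : ∀ x : {b // st b ≠ none} ⊕ₗ ({b // st' b = none} ×ₗ Bool),
      (toLex (Sum.map id (fun x => toLex (iZ (ofLex x).1, (ofLex x).2)) (ofLex x)) :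
        {b // st b ≠ none} ⊕ₗ ({b // st b = none} ×ₗ Bool)) ≠ q.edge := by
    intro x
    induction x using Lex.rec with | _ x
    rw [hq]
    rcases x with x | x
    · simp
    · have : iZ (ofLex x).1 ≠ ⟨a, ha⟩ := (hZa _).2 ⟨_, rfl⟩
      simp [this]
  obtain ⟨ρ, hρ1, hρ2, hρs⟩ := exists_equiv_of_compl
      (A₀ := {b // st b ≠ none} ⊕ₗ ({b // st' b = none} ×ₗ Bool))
      (x := (toLex (Sum.inl ⟨a, by simp [hst'a]⟩) :
        {b // st' b ≠ none} ⊕ₗ ({b // st' b = none} ×ₗ Bool)))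
      (y := (⟨toLex (Sum.inr (toLex (⟨a, ha⟩, !β))), hmem⟩ : {e // e ≠ q.edge}))
      (j := fun x => ⟨_, hmem1 x⟩)
      (strictMono_sumLex hiD strictMono_id)
      (strictMono_sumLex strictMono_id (strictMono_prodLex hiZ)) (by
        intro b
        induction b using Lex.rec with | _ b
        rcases b with b | b
        · simpa [Lex.exists] using hDa b
        · simp [Lex.exists]) (by
        rintro ⟨b, hb⟩
        revert hb
        induction b using Lex.rec with | _ b
        rcases b with b | b
        · simp [Lex.exists]
        · intro hb
          induction b using Lex.rec with | _ b
          obtain ⟨z, b⟩ := b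
          have := hZa z
          rw [hq] at hb
          simp only [ne_eq, EmbeddingLike.apply_eq_iff_eq, Sum.inr.injEq, Prod.mk.injEq] at hb
          simp only [ne_eq, Subtype.mk.injEq, EmbeddingLike.apply_eq_iff_eq, Sum.inr.injEq,
            Prod.mk.injEq]
          constructor
          · intro h
            obtain ⟨b₀, h2⟩ := this.1 fun hz =>
              h ⟨hz, Bool.eq_not.2 fun hb' => hb ⟨hz, hb'⟩⟩
            exact ⟨toLex (Sum.inr (toLex (b₀, b))), by simp [h2]⟩
          · rintro ⟨b₀, hb₀⟩ h
            refine this.2 ?_ h.1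
            induction b₀ using Lex.rec with | _ b₀
            rcases b₀ with b₀ | b₀
            · cases toLex.injective hb₀
            · exact ⟨(ofLex b₀).1, congrArg Prod.fst
                (toLex.injective (Sum.inr_injective (toLex.injective hb₀)))⟩)
  rw [rk_inl, rk_dir, dirRk_update, rk_subtype_ne, rk_inr, rk_prod_bool, pow_add, pow_add,
    pow_mul] at hρs
  have hρs' : sgn ρ = (-1) ^ dirRk st a * (-1) ^ Fintype.card {a // st a ≠ none} := by
    rw [hρs]
    simp only [hq]
    cases β <;> simp [Sum.Lex.toLex_lt_toLex, Prod.Lex.toLex_lt_toLex]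
  have hcore : ∀ x : V ⊕ S, q.merge (coreVertex st x) = Sum.map σ id (coreVertex st' x) := by
    rintro (x | s)
    · rw [coreVertex_inl, Contractible.merge_inl, coreVertex_inl]
      refine congrArg Sum.inl (Subtype.ext ?_)
      rw [hσ]
      exact if_neg (by rw [ht]; simp)
    · rfl
  have hmid : q.merge (Sum.inl (toLex (Sum.inr ⟨a, ha⟩))) =
      Sum.map σ id (coreVertex st' (Γ.endpoint a β)) := by
    rw [← hcore, hv, coreVertex_inl, Contractible.merge_inl, Contractible.merge_inl]
    refine congrArg Sum.inl (Subtype.ext ?_)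
    exact (if_pos ht.symm).trans (hh.trans (if_neg (by rw [ht]; simp)).symm)
  rw [graphClass_eq_of_endpoint K .oriented (n + 1) k σ ρ (fun _ => false)
    (fun _ _ => rfl) (Γ := Γ.zigzagGraph st') (Γ' := (Γ.zigzagGraph st).contract q),
    graphClass_zigzagGraph, smul_smul, smul_smul, ← Int.cast_mul, ← Int.cast_mul]
  · congr 2
    simp only [orientSign, normSign, rkSign, zigzagSign, Bool.false_eq_true, if_false,
      Finset.prod_const_one, mul_one, Int.even_add_one]
    by_cases hn : Even n
    · simp only [hn, if_true, not_true_eq_false, if_false, hσs, ht, hsplit, rk_inr, pow_add]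
      have h1 := sgn_mul_self (splitEquiv st')
      rcases neg_one_pow_eq_or ℤ (rk (⟨a, ha⟩ : {a // st a = none})) with h2 | h2 <;>
        rw [h2] <;> linear_combination ((-1) ^ dirRk st a *
          (-1) ^ Fintype.card {a // st a ≠ none} * (-1) ^ Fintype.card V) * h1
    · simp only [hn, if_false, not_false_eq_true, if_true, hρs', hq, rk_inr, rk_prod_bool, pow_add,
        pow_mul, hprod]
      have h1 := normSign_mul_self 1 st
      rw [normSign, if_neg (by decide)] at h1
      rcases neg_one_pow_eq_or ℤ (Fintype.card {a // st a ≠ none}) with h2 | h2 <;> rw [h2] <;>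
        cases β <;> simp <;> linear_combination ((-1) ^ dirRk st a) * h1
  · intro e r
    rw [Bool.false_xor]
    refine zigzag_edge_cases (fun b r' hr => ?_) (fun z b => ?_) e
    · by_cases hb : b = a
      · subst hb
        rw [hst'a] at hr
        obtain rfl := Option.some.inj hr
        rw [hρ1, zigzagGraph_endpoint_inl Γ hst'a, endpoint_contract]
        cases r
        · rw [zigzagGraph_endpoint_inr_false, hmid, Bool.xor_false]
        · rw [zigzagGraph_endpoint_inr_true, hcore, Bool.xor_true]
      · have hr' := hr
        rw [hst'b b hb] at hr'
        have h1 := hρ2 (toLex (Sum.inl ⟨b, by simp [hr']⟩))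
        simp only [ofLex_toLex, Sum.map_inl] at h1
        rw [zigzagGraph_endpoint_inl Γ hr]
        refine (congrArg (fun e => ((Γ.zigzagGraph st).contract q).endpoint e r) h1).trans ?_
        rw [endpoint_contract, ← hcore, ← zigzagGraph_endpoint_inl Γ hr']
        rfl
    · have h1 := hρ2 (toLex (Sum.inr (toLex (z, b))))
      simp only [ofLex_toLex, Sum.map_inr, id_eq] at h1
      rw [h1, endpoint_contract]
      cases r
      · rw [zigzagGraph_endpoint_inr_false]
        refine congrArg Sum.inl (Subtype.ext ?_)
        rw [hσ]
        refine (congrArg Subtype.val (dif_neg ?_)).trans rfl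
        rw [ht]
        have : iZ z ≠ ⟨a, ha⟩ := (hZa _).2 ⟨_, rfl⟩
        simpa using this
      · exact hcore _

end ContractZigzag

/-! ### The differential of a zigzag graph -/

namespace HairyGraph

section ContractDirected

variable {V E S : Type*} {Γ : HairyGraph V E S} {st : E → Option Bool}

/-- The end `r` of a contractible edge is the tail for `r = false`, and the head for `r = true`. -/
def Contractible.endVertex (p : Γ.Contractible) (r : Bool) : V := if r then p.head else p.tail

theorem Contractible.endpoint_edge (p : Γ.Contractible) (r : Bool) :
    Γ.endpoint p.edge r = Sum.inl (p.endVertex r) := by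
  cases r
  · exact p.src_edge
  · exact p.tgt_edge

theorem Contractible.swap_mergeVal [DecidableEq V] (p : Γ.Contractible) (r : Bool) (x : V) :
    (if r then Equiv.swap p.tail p.head else Equiv.refl V) (p.mergeVal x) =
      if x = p.endVertex r then p.endVertex (!r) else x := by
  have h2 := p.head_ne_tail
  have h3 : p.mergeVal x = if x = p.tail then p.head else x := by
    rw [mergeVal]
    congr
  rw [h3, endVertex, endVertex]
  cases r
  · rfl
  · by_cases h3 : x = p.tail
    · rw [if_pos h3, if_pos rfl, if_pos rfl, Equiv.swap_apply_right, h3, if_neg h2.symm]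
    · rw [if_neg h3, if_pos rfl, if_pos rfl]
      by_cases h4 : x = p.head
      · rw [if_pos h4, h4, Equiv.swap_apply_right]
        rfl
      · rw [if_neg h4, Equiv.swap_apply_of_ne_of_ne h3 h4]

theorem exists_contractible_of_directed {a : E} {r : Bool} (ha : st a = some r)
    (q : (Γ.zigzagGraph st).Contractible)
    (hq : q.edge = toLex (Sum.inl ⟨a, by simp [ha]⟩)) :
    ∃ p : Γ.Contractible, p.edge = a := by
  have h1 := q.src_edge
  have h2 := q.tgt_edge
  rw [hq, ← endpoint_false, zigzagGraph_endpoint_inl Γ ha] at h1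
  rw [hq, ← endpoint_true, zigzagGraph_endpoint_inl Γ ha] at h2
  have h3 : ∀ b, ∃ v, Γ.endpoint a (xor r b) = Sum.inl v := by
    intro b
    rcases h4 : Γ.endpoint a (xor r b) with v | s
    · exact ⟨v, rfl⟩
    · cases b
      · rw [h4] at h1; cases h1
      · rw [h4] at h2; cases h2
  have h4 : ∀ b, ∃ v, Γ.endpoint a b = Sum.inl v := fun b => by
    simpa using h3 (xor r b)
  obtain ⟨x, hx⟩ := h4 false
  obtain ⟨y, hy⟩ := h4 true
  refine ⟨Contractible.mk a x y hx hy ?_, rfl⟩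
  rintro rfl
  have h5 : ∀ b, Γ.endpoint a b = Sum.inl y := by
    rintro (_ | _)
    exacts [hx, hy]
  rw [h5] at h1 h2
  exact q.head_ne_tail (Sum.inl_injective (h2.symm.trans h1))

theorem exists_contractible_directed {r : Bool} (p : Γ.Contractible) (hr : st p.edge = some r) :
    ∃ q : (Γ.zigzagGraph st).Contractible,
      q.edge = toLex (Sum.inl ⟨p.edge, by simp [hr]⟩) := by
  refine ⟨Contractible.mk _ (toLex (Sum.inl (p.endVertex r))) (toLex (Sum.inl (p.endVertex (!r))))
    ?_ ?_ ?_, rfl⟩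
  · rw [← endpoint_false, zigzagGraph_endpoint_inl Γ hr, Bool.xor_false, p.endpoint_edge]
    rfl
  · rw [← endpoint_true, zigzagGraph_endpoint_inl Γ hr, Bool.xor_true, p.endpoint_edge]
    rfl
  · simp only [ne_eq, EmbeddingLike.apply_eq_iff_eq, Sum.inl.injEq]
    cases r
    · exact p.head_ne_tail
    · exact p.head_ne_tail.symm

theorem directed_tail_head {r : Bool} (p : Γ.Contractible) (hr : st p.edge = some r)
    (q : (Γ.zigzagGraph st).Contractible)
    (hq : q.edge = toLex (Sum.inl ⟨p.edge, by simp [hr]⟩)) :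
    q.tail = toLex (Sum.inl (p.endVertex r)) ∧ q.head = toLex (Sum.inl (p.endVertex (!r))) := by
  have h1 := q.src_edge
  have h2 := q.tgt_edge
  rw [hq, ← endpoint_false, zigzagGraph_endpoint_inl Γ hr, Bool.xor_false, p.endpoint_edge] at h1
  rw [hq, ← endpoint_true, zigzagGraph_endpoint_inl Γ hr, Bool.xor_true, p.endpoint_edge] at h2
  exact ⟨(Sum.inl_injective h1).symm, (Sum.inl_injective h2).symm⟩

end ContractDirected

end HairyGraph

section ContractZigzag

variable (K : Type u) [Field K] (n : ℤ) (k : ℤ) {S : Type w}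
variable {V E : Type*} [Fintype V] [LinearOrder V] [Fintype E] [LinearOrder E]
    {Γ : HairyGraph V E S} {st : E → Option Bool}

/-- The sign which belongs to the contraction of a directed edge of a partially directed graph,
besides the sign in the undirected graph complex. -/
def directedSign (st : E → Option Bool) (p : Γ.Contractible) : ℤ :=
  (-1) ^ dirRk st p.edge * (-1) ^ rk p.tail * if st p.edge = some true then -1 else 1

/-- The contraction of a directed edge is the zigzag graph of the contraction of the underlying
graph. -/
theorem rkSign_smul_graphClass_contract_directed {r : Bool} (p : Γ.Contractible)
    (hr : st p.edge = some r) (q : (Γ.zigzagGraph st).Contractible)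
    (hq : q.edge = toLex (Sum.inl ⟨p.edge, by simp [hr]⟩)) :
    ((normSign n st * rkSign (n + 1) q : ℤ) : K) •
        graphClass K .oriented (n + 1) k ((Γ.zigzagGraph st).contract q) =
      ((rkSign n p * directedSign st p : ℤ) : K) •
        zigzagClass K n k (Γ.contract p) (fun b => st b) := by
  obtain ⟨ht, hh⟩ := directed_tail_head p hr q hq
  let st₀ : {b // b ≠ p.edge} → Option Bool := fun b => st b
  have hne : ∀ b, st b = none → b ≠ p.edge := by rintro b h rfl; rw [hr] at h; cases h
  let iD : {b // st₀ b ≠ none} → {b // st b ≠ none} := fun b => ⟨b.1, b.2⟩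
  let iZ : {b // st₀ b = none} → {b // st b = none} := fun b => ⟨b.1, b.2⟩
  have hiD : StrictMono iD := fun _ _ h => h
  have hiZ : StrictMono iZ := fun _ _ h => h
  have hDa : ∀ b : {b // st b ≠ none}, b ≠ ⟨p.edge, by simp [hr]⟩ ↔ ∃ b₀, iD b₀ = b := by
    intro b
    constructor
    · exact fun h => ⟨⟨⟨b, fun h2 => h (Subtype.ext h2)⟩, b.2⟩, rfl⟩
    · rintro ⟨b₀, rfl⟩ h
      exact b₀.1.2 (congrArg Subtype.val h)
  have hZs : ∀ b, ∃ b₀, iZ b₀ = b := fun b => ⟨⟨⟨b, hne b b.2⟩, b.2⟩, rfl⟩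
  have hsplit : sgn (splitEquiv st) =
      (-1) ^ rk p.edge * (-1) ^ dirRk st p.edge * sgn (splitEquiv st₀) := by
    rw [sgn_eq_of_delete (splitEquiv st) (splitEquiv_ne_none (a := p.edge) (by simp [hr]))
      (Subtype.strictMono_coe _) (strictMono_sumLex hiD hiZ) (by simp) (splitEquiv st₀), rk_inl,
      rk_dir]
    intro b
    by_cases hb : st₀ b = none
    · rw [splitEquiv_none hb, splitEquiv_none (show st b = none from hb)]
      rfl
    · rw [splitEquiv_ne_none hb, splitEquiv_ne_none (show st b ≠ none from hb)]
      rfl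
  have hprod : (∏ b, if st b = some true then (-1 : ℤ) else 1) =
      (if r then -1 else 1) * ∏ b, if st₀ b = some true then -1 else 1 := by
    rw [prod_eq_mul_prod_compl (Subtype.strictMono_coe fun b => b ≠ p.edge) (x := p.edge)
      (by simp), hr]
    simp [st₀]
  -- the isomorphism of graphs
  classical
  let π : Equiv.Perm V := if r then Equiv.swap p.tail p.head else Equiv.refl V
  have hπ : sgn π = if r then -1 else 1 := by
    rw [sgn_perm]
    cases r
    · simp [π]
    · simp [π, Equiv.Perm.sign_swap p.head_ne_tail.symm]
  have hπt : π p.tail = p.endVertex r := by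
    cases r <;> simp [π, Contractible.endVertex]
  let f : V ⊕ₗ {b // st b = none} ≃ V ⊕ₗ {b // st b = none} :=
    ofLex.trans ((Equiv.sumCongr π (Equiv.refl _)).trans toLex)
  have hf : sgn f = if r then -1 else 1 := by
    rw [sgn_sumCongr π (Equiv.refl _) f (fun _ => rfl) (fun _ => rfl), sgn_refl, mul_one, hπ]
  have hft : f (toLex (Sum.inl p.tail)) = q.tail := by
    rw [ht, ← hπt]
    rfl
  obtain ⟨σ, hσ, hσs⟩ := exists_equiv_restrict (A₀ := {v // v ≠ p.tail} ⊕ₗ {b // st₀ b = none})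
    f hft (strictMono_sumLex (Subtype.strictMono_coe _) hiZ) (by
      intro b
      induction b using Lex.rec with | _ b
      rcases b with b | b
      · simp [Lex.exists]
      · simpa [Lex.exists] using hZs b)
  rw [hf, rk_inl] at hσs
  have hjmono := strictMono_sumLex hiD (strictMono_prodLex hiZ)
  obtain ⟨ρ, hρ, hρs⟩ : ∃ ρ : {b // st₀ b ≠ none} ⊕ₗ ({b // st₀ b = none} ×ₗ Bool) ≃
      {e // e ≠ q.edge}, (∀ e, (ρ e : {b // st b ≠ none} ⊕ₗ ({b // st b = none} ×ₗ Bool)) =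
        toLex (Sum.map iD (fun x => toLex (iZ (ofLex x).1, (ofLex x).2)) (ofLex e))) ∧
      sgn ρ = 1 := by
    obtain ⟨ρ, hρ, hρs⟩ := exists_equiv_restrict
      (A₀ := {b // st₀ b ≠ none} ⊕ₗ ({b // st₀ b = none} ×ₗ Bool))
      (Equiv.refl ({b // st b ≠ none} ⊕ₗ ({b // st b = none} ×ₗ Bool)))
      (x := q.edge) (y := q.edge) rfl hjmono (by
        rw [hq]
        intro b
        induction b using Lex.rec with | _ b
        rcases b with b | b
        · simpa [Lex.exists] using hDa b
        · induction b using Lex.rec with | _ b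
          obtain ⟨z, b⟩ := b
          obtain ⟨z, rfl⟩ := hZs z
          refine iff_of_true (by simp) ⟨toLex (Sum.inr (toLex (z, b))), rfl⟩)
    refine ⟨ρ, hρ, sgn_of_strictMono _ fun x y hxy => ?_⟩
    rw [← Subtype.coe_lt_coe, hρ, hρ]
    exact hjmono hxy
  have hcore : ∀ x : V ⊕ S, q.merge (coreVertex st x) =
      Sum.map σ id (coreVertex st₀ (p.merge x)) := by
    rintro (x | s)
    · rw [coreVertex_inl, Contractible.merge_inl, Contractible.merge_inl, coreVertex_inl]
      refine congrArg Sum.inl (Subtype.ext ?_)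
      rw [hσ]
      have h1 : f (toLex (Sum.inl (p.mergeVal x))) = toLex (Sum.inl (π (p.mergeVal x))) := rfl
      refine Eq.trans ?_ h1.symm
      rw [p.swap_mergeVal r x]
      by_cases h3 : x = p.endVertex r
      · rw [if_pos h3, ← hh]
        exact if_pos (by rw [ht, h3])
      · rw [if_neg h3]
        exact if_neg fun h4 => h3 (Sum.inl_injective (toLex.injective (h4.trans ht)))
    · rfl
  rw [graphClass_eq_of_endpoint K .oriented (n + 1) k σ ρ (fun _ => false)
    (fun _ _ => rfl) (Γ := (Γ.contract p).zigzagGraph st₀) (Γ' := (Γ.zigzagGraph st).contract q),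
    graphClass_zigzagGraph, smul_smul, smul_smul, ← Int.cast_mul, ← Int.cast_mul]
  · congr 2
    have h4 : (if st p.edge = some true then (-1 : ℤ) else 1) = if r then -1 else 1 := by
      rw [hr]; cases r <;> rfl
    simp only [orientSign, normSign, rkSign, directedSign, Bool.false_eq_true, if_false,
      Finset.prod_const_one, mul_one, Int.even_add_one, h4]
    by_cases hn : Even n
    · simp only [hn, if_true, not_true_eq_false, if_false, hσs, hsplit]
      have h1 := sgn_mul_self (splitEquiv st₀)
      have h2 : (-1 : ℤ) ^ rk q.tail * (-1) ^ rk q.tail = 1 := by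
        rw [← pow_add, ← two_mul, pow_mul]; norm_num
      linear_combination ((-1) ^ rk p.edge * (-1) ^ dirRk st p.edge * (-1) ^ rk p.tail *
          if r = true then -1 else 1) * h1 +
        ((-1) ^ rk p.edge * (-1) ^ dirRk st p.edge * (-1) ^ rk p.tail *
          (if r = true then -1 else 1) * sgn (splitEquiv st₀) * sgn (splitEquiv st₀)) * h2
    · simp only [hn, if_false, not_false_eq_true, if_true, hρs, hprod]
      rw [show rk q.edge = dirRk st p.edge by rw [hq, rk_inl, rk_dir]]
      have h1 := normSign_mul_self 1 st₀
      rw [normSign, if_neg (by decide)] at h1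
      have h2 : (-1 : ℤ) ^ rk p.tail * (-1) ^ rk p.tail = 1 := by
        rw [← pow_add, ← two_mul, pow_mul]; norm_num
      linear_combination ((-1) ^ dirRk st p.edge * if r = true then -1 else 1) * (h1 - h2)
  · intro e b
    rw [Bool.false_xor, endpoint_contract, hρ]
    refine zigzag_edge_cases (fun a r' hr' => ?_) (fun z b' => ?_) e
    · rw [zigzagGraph_endpoint_inl (Γ.contract p) hr', endpoint_contract, ← hcore,
        ← zigzagGraph_endpoint_inl Γ (show st a = some r' from hr')]
      rfl
    · cases b
      · rw [zigzagGraph_endpoint_inr_false]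
        refine congrArg Sum.inl (Subtype.ext ?_)
        rw [hσ]
        refine (congrArg Subtype.val (dif_neg ?_)).trans rfl
        rw [ht]
        simp
      · rw [zigzagGraph_endpoint_inr_true, endpoint_contract, ← hcore]
        rfl

end ContractZigzag

section SumContractible

theorem sum_contractible {V E S M : Type*} [Fintype V] [Fintype E] [AddCommMonoid M]
    {Γ : HairyGraph V E S} (G : Γ.Contractible → M) (F : E → M)
    (h : ∀ q, G q = F q.edge) (h0 : ∀ e, (¬ ∃ q : Γ.Contractible, q.edge = e) → F e = 0) :
    ∑ q, G q = ∑ e, F e := by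
  rw [← Finset.sum_subset (Finset.subset_univ
    ((Finset.univ : Finset Γ.Contractible).map ⟨_, Contractible.edge_injective⟩)), Finset.sum_map]
  · exact Finset.sum_congr rfl fun q _ => h q
  · intro e _ he
    refine h0 e fun ⟨q, hq⟩ => he ?_
    simpa using ⟨q, hq⟩

theorem sum_subtype_ite {E M : Type*} [Fintype E] [AddCommMonoid M] (P : E → Prop)
    [DecidablePred P] (F : E → M) : ∑ a : {a // P a}, F a = ∑ a, if P a then F a else 0 := by
  rw [← Finset.sum_filter]
  exact (Finset.sum_subtype _ (by simp) F).symm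

theorem HairyGraph.not_isGood_of_external {V E S : Type*} {Γ : HairyGraph V E S}
    {st : E → Option Bool} {a : E} {β : Bool} {s : S}
    (h : Γ.endpoint a β = Sum.inr s) (hst : st a = some β) : ¬ Γ.IsGood st :=
  fun h1 => h1.1 s _ ⟨a, β, hst, h, rfl⟩

end SumContractible

section ContractZigzag

variable (K : Type u) [Field K] (n : ℤ) (k : ℤ) {S : Type w}
variable {V E : Type*} [Fintype V] [LinearOrder V] [Fintype E] [LinearOrder E]
    {Γ : HairyGraph V E S} {st : E → Option Bool}

theorem normSign_smul_boundary_zigzagGraph (Γ : HairyGraph V E S) (st : E → Option Bool) :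
    (normSign n st : K) • boundary K .oriented (n + 1) k (Γ.zigzagGraph st) =
      (zigzagSign n V st : K) • (∑ a, if st a = none then ∑ β, (((-1) ^ dirRk st a : ℤ) : K) •
        zigzagClass K n k Γ (Function.update st a (some β)) else 0) +
      ∑ p : Γ.Contractible, if st p.edge = none then 0 else
        ((rkSign n p * directedSign st p : ℤ) : K) •
          zigzagClass K n k (Γ.contract p) (fun b => st b) := by
  classical
  let D : E → GraphSpace K .oriented (n + 1) S k := fun a =>
    if h : st a ≠ none ∧ ∃ p : Γ.Contractible, p.edge = a then
      ((rkSign n h.2.choose * directedSign st h.2.choose : ℤ) : K) •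
          zigzagClass K n k (Γ.contract h.2.choose) (fun b => st b) else 0
  have hD : ∀ p : Γ.Contractible, st p.edge ≠ none → D p.edge =
      ((rkSign n p * directedSign st p : ℤ) : K) •
        zigzagClass K n k (Γ.contract p) (fun b => st b) := by
    intro p hp
    have h : st p.edge ≠ none ∧ ∃ p' : Γ.Contractible, p'.edge = p.edge := ⟨hp, p, rfl⟩
    simp only [D]
    rw [dif_pos h, Contractible.edge_injective h.2.choose_spec]
  let H : {a // st a = none} × Bool → GraphSpace K .oriented (n + 1) S k := fun q =>
    ((zigzagSign n V st * (-1) ^ dirRk st q.1 : ℤ) : K) •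
        zigzagClass K n k Γ (Function.update st q.1 (some q.2))
  rw [boundary, Finset.smul_sum, sum_contractible (Γ := Γ.zigzagGraph st) _
    (fun e => Sum.elim (fun a => D a.1) (fun q => H (ofLex q)) (ofLex e))]
  · refine Eq.trans ?_ (add_comm _ _)
    rw [← Equiv.sum_comp toLex, Fintype.sum_sum_type]
    simp only [ofLex_toLex, Sum.elim_inl, Sum.elim_inr]
    congr 1
    · rw [sum_contractible (Γ := Γ) _ D]
      · rw [sum_subtype_ite (fun a => st a ≠ none) D]
        refine Finset.sum_congr rfl fun a _ => ?_
        split_ifs with h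
        · rfl
        · simp only [D]
          rw [dif_neg fun h' => h h'.1]
      · intro p
        split_ifs with h
        · simp only [D]
          rw [dif_neg fun h' => h'.1 h]
        · exact (hD p h).symm
      · intro e he
        exact dif_neg fun h => he h.2
    · rw [Equiv.sum_comp ofLex H, Fintype.sum_prod_type, Finset.smul_sum,
        sum_subtype_ite (fun a => st a = none) fun a => ∑ β,
          ((zigzagSign n V st * (-1) ^ dirRk st a : ℤ) : K) •
            zigzagClass K n k Γ (Function.update st a (some β))]
      refine Finset.sum_congr rfl fun a _ => ?_
      split_ifs with h
      · rw [Finset.smul_sum]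
        exact Finset.sum_congr rfl fun β _ => by rw [smul_smul, ← Int.cast_mul]
      · rw [smul_zero]
  · intro q
    rw [smul_smul, ← Int.cast_mul]
    suffices h : ∀ e, q.edge = e → ((normSign n st * rkSign (n + 1) q : ℤ) : K) •
        graphClass K .oriented (n + 1) k ((Γ.zigzagGraph st).contract q) =
        Sum.elim (fun a : {a // st a ≠ none} => D a.1) (fun q => H (ofLex q)) (ofLex e) from
      h _ rfl
    intro e
    refine zigzag_edge_cases (fun a r hr => ?_) (fun z b => ?_) e <;> intro hq
    · obtain ⟨p, rfl⟩ := exists_contractible_of_directed hr q hq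
      rw [rkSign_smul_graphClass_contract_directed K n k p hr q hq]
      exact (hD p (by simp [hr])).symm
    · exact rkSign_smul_graphClass_contract_half K n k z.2 q hq
  · intro e
    refine zigzag_edge_cases (fun a r hr => ?_) (fun z b => ?_) e <;> intro he
    · refine dif_neg fun ⟨_, p, hp⟩ => he ?_
      subst hp
      exact exists_contractible_directed p hr
    · rcases h : Γ.endpoint z b with v | s
      · exact absurd (exists_contractible_half z.2 h) he
      · exact smul_eq_zero_of_right _ (zigzagClass_eq_zero K n
          (not_isGood_of_external h (by simp)))

theorem card_eq_card_dir_add {E : Type*} [Fintype E] (st : E → Option Bool) :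
    Fintype.card E = Fintype.card {a // st a ≠ none} + Fintype.card {a // st a = none} := by
  rw [Fintype.card_congr (splitEquiv st), Fintype.card_lex, Fintype.card_sum]

variable {n k} in
theorem zigzagClass_eq_zero_of_degree
    (h : (n - 1) * (Fintype.card E : ℤ) - n * Fintype.card V +
      (Fintype.card {a // st a ≠ none} - Fintype.card V) ≠ k) :
    zigzagClass K n k Γ st = 0 := by
  rw [zigzagClass, graphClass_eq_zero, smul_zero]
  contrapose! h
  rw [← h]
  have := card_eq_card_dir_add st
  simp only [Fintype.card_lex, Fintype.card_sum, Fintype.card_prod, Fintype.card_bool]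
  rw [this]
  push_cast
  ring

variable {n} in
/-- The differential of the class of a partially directed graph: a zigzag is directed in one of
the two possible ways, or a directed edge of the underlying graph is contracted. -/
theorem dMap_zigzagClass {i j : ℤ} (h : Γ.IsAdmissible .undirected)
    (hst : Γ.IsGood st)
    (hi : (n - 1) * (Fintype.card E : ℤ) - n * Fintype.card V +
      (Fintype.card {a // st a ≠ none} - Fintype.card V) = i) :
    dMap K .oriented (n + 1) i j (zigzagClass K n i Γ st) =
      (zigzagSign n V st : K) • (∑ a, if st a = none then ∑ β, (((-1) ^ dirRk st a : ℤ) : K) •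
        zigzagClass K n j Γ (Function.update st a (some β)) else 0) +
      ∑ p : Γ.Contractible, if st p.edge = none then 0 else
        ((rkSign n p * directedSign st p : ℤ) : K) •
          zigzagClass K n j (Γ.contract p) (fun b => st b) := by
  rw [← normSign_smul_boundary_zigzagGraph, zigzagClass, map_smul,
    dMap_graphClass K .oriented (n + 1) (hst.isAdmissible_zigzagGraph h)]
  rw [← hi]
  have := card_eq_card_dir_add st
  simp only [Fintype.card_lex, Fintype.card_sum, Fintype.card_prod, Fintype.card_bool]
  rw [this]
  push_cast
  ring

end ContractZigzag

/-! ### Directing the zigzags of a fixed graph -/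

section ZigzagDiff

variable {K : Type u} [CommRing K] {E : Type*} [Fintype E] [LinearOrder E]

/-- The part of the differential which directs zigzags, on the coefficients of states of a fixed
graph: the value at `t` comes from the states in which one directed edge of `t` is a zigzag. -/
def zigzagDiff (y : (E → Option Bool) → K) (t : E → Option Bool) : K :=
  ∑ a, if t a = none then 0 else (-1) ^ dirRk t a * y (Function.update t a none)

theorem zigzagDiff_sub (y y' : (E → Option Bool) → K) (t : E → Option Bool) :
    zigzagDiff (fun s => y s - y' s) t = zigzagDiff y t - zigzagDiff y' t := by
  rw [zigzagDiff, zigzagDiff, zigzagDiff, ← Finset.sum_sub_distrib]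
  refine Finset.sum_congr rfl fun a _ => ?_
  split_ifs <;> ring

theorem zigzagDiff_add (y y' : (E → Option Bool) → K) (t : E → Option Bool) :
    zigzagDiff (fun s => y s + y' s) t = zigzagDiff y t + zigzagDiff y' t := by
  rw [zigzagDiff, zigzagDiff, zigzagDiff, ← Finset.sum_add_distrib]
  refine Finset.sum_congr rfl fun a _ => ?_
  split_ifs <;> ring

theorem zigzagDiff_mul (c : K) (y : (E → Option Bool) → K) (t : E → Option Bool) :
    zigzagDiff (fun s => c * y s) t = c * zigzagDiff y t := by
  rw [zigzagDiff, zigzagDiff, Finset.mul_sum]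
  refine Finset.sum_congr rfl fun a _ => ?_
  split_ifs <;> ring

theorem zigzagDiff_zero (t : E → Option Bool) : zigzagDiff (fun _ => (0 : K)) t = 0 := by
  simp [zigzagDiff]

theorem neg_one_pow_dirRk_update {t : E → Option Bool} {b : E} (hb : t b ≠ none) (c : E) :
    (-1 : K) ^ dirRk (Function.update t b none) c =
      (-1) ^ dirRk t c * if b < c then -1 else 1 := by
  by_cases h : b < c
  · have : dirRk t c = dirRk (Function.update t b none) c + 1 := by
      rw [dirRk, dirRk, ← Finset.card_erase_add_one (a := b) (by simp [hb, h])]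
      congr 2
      ext d
      by_cases hd : d = b <;> simp [hd]
    rw [this, if_pos h, pow_succ]
    ring
  · have : dirRk (Function.update t b none) c = dirRk t c := by
      rw [dirRk, dirRk]
      congr 1
      ext d
      by_cases hd : d = b <;> simp [hd, h]
    rw [this, if_neg h, mul_one]

theorem zigzagDiff_zigzagDiff (y : (E → Option Bool) → K) (t : E → Option Bool) :
    zigzagDiff (zigzagDiff y) t = 0 := by
  let F : E × E → K := fun p => if t p.1 = none then 0 else (-1) ^ dirRk t p.1 *
    if Function.update t p.1 none p.2 = none then 0 else
      (-1) ^ dirRk (Function.update t p.1 none) p.2 *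
        y (Function.update (Function.update t p.1 none) p.2 none)
  have h1 : zigzagDiff (zigzagDiff y) t = ∑ p, F p := by
    rw [Fintype.sum_prod_type]
    refine Finset.sum_congr rfl fun b _ => ?_
    simp only [F]
    split_ifs with h
    · simp
    · rw [zigzagDiff, Finset.mul_sum]
  have h2 : ∀ p : E × E, F p ≠ 0 → p.1 ≠ p.2 ∧ t p.1 ≠ none ∧ t p.2 ≠ none := by
    rintro ⟨b, c⟩ h
    have h3 : t b ≠ none := fun h' => h (if_pos h')
    have h4 : Function.update t b none c ≠ none := fun h' => h (by simp [F, h'])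
    have h5 : b ≠ c := by rintro rfl; simp at h4
    rw [Function.update_of_ne h5.symm] at h4
    exact ⟨h5, h3, h4⟩
  have h3 : ∀ b c, b ≠ c → t b ≠ none → t c ≠ none → F (b, c) + F (c, b) = 0 := by
    intro b c hbc hb hc
    simp only [F, hb, hc, Function.update_of_ne hbc, Function.update_of_ne hbc.symm, if_false,
      neg_one_pow_dirRk_update hb, neg_one_pow_dirRk_update hc]
    rw [Function.update_comm hbc]
    rcases lt_or_gt_of_ne hbc with h | h
    · rw [if_pos h, if_neg h.not_gt]; ring
    · rw [if_pos h, if_neg h.not_gt]; ring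
  rw [h1]
  refine Finset.sum_involution (fun p _ => p.swap) (fun p _ => ?_) (fun p _ hp => ?_)
    (fun _ _ => Finset.mem_univ _) fun _ _ => Prod.swap_swap _
  · by_cases hp : F p = 0
    · by_cases hp' : F p.swap = 0
      · rw [hp, hp', add_zero]
      · have := h2 _ hp'
        rw [add_comm]
        exact h3 _ _ this.1 this.2.1 this.2.2
    · have := h2 _ hp
      exact h3 _ _ this.1 this.2.1 this.2.2
  · intro h
    exact (h2 p hp).1 (congrArg Prod.snd h)

end ZigzagDiff

namespace HairyGraph

section Forest

variable {V E S : Type*} {Γ : HairyGraph V E S} {st : E → Option Bool}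

/-- A state that lies between two good ones is good: the condition on outgoing edges is inherited
from below, and acyclicity from above. -/
theorem IsGood.of_between {w m t : E → Option Bool} (hw : Γ.IsGood w) (ht : Γ.IsGood t)
    (h1 : ∀ b r, w b = some r → m b = some r) (h2 : ∀ b r, m b = some r → t b = some r) :
    Γ.IsGood m := by
  have h3 : ∀ x y, Γ.Arrow m x y → Γ.Arrow t x y :=
    fun x y ⟨a, r, h, hx, hy⟩ => ⟨a, r, h2 _ _ h, hx, hy⟩
  refine ⟨fun s y h => ht.1 s y (h3 _ _ h), fun v => ?_, fun x hx => ?_⟩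
  · obtain ⟨y, a, r, h, hx, hy⟩ := hw.2.1 v
    exact ⟨y, a, r, h1 _ _ h, hx, hy⟩
  · exact ht.2.2 x (Relation.TransGen.mono h3 _ _ hx)

variable (Γ) in
/-- The forest states: good states in which exactly one directed edge leaves each internal
vertex. -/
def IsForestState (st : E → Option Bool) : Prop :=
  Γ.IsGood st ∧ ∀ a r b r', st a = some r → st b = some r' →
    Γ.endpoint a r = Γ.endpoint b r' → a = b

/-- In a connected graph with an external vertex, each internal vertex has an edge towards a fixed
external vertex. -/
theorem exists_descent (h : Γ.IsConnected) [Nonempty S] :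
    ∃ (d : V ⊕ S → ℕ) (f : V → E × Bool), ∀ v, Γ.endpoint (f v).1 (f v).2 = Sum.inl v ∧
      d (Γ.endpoint (f v).1 !(f v).2) < d (Sum.inl v) := by
  obtain ⟨s⟩ := ‹Nonempty S›
  let d : V ⊕ S → ℕ := fun x => (Γ.subgraph Set.univ).dist x (Sum.inr s)
  suffices h : ∀ v, ∃ p : E × Bool, Γ.endpoint p.1 p.2 = Sum.inl v ∧
      d (Γ.endpoint p.1 !p.2) < d (Sum.inl v) by
    choose f hf using h
    exact ⟨d, f, hf⟩
  intro v
  obtain ⟨p, hp⟩ := (h.preconnected (Sum.inl v) (Sum.inr s)).exists_walk_length_eq_dist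
  cases p with
  | cons h1 p =>
    obtain ⟨-, a, -, r, ha, hb⟩ := Γ.subgraph_adj.1 h1
    refine ⟨(a, r), ha, ?_⟩
    simp only [d]
    rw [hb, ← hp, SimpleGraph.Walk.length_cons]
    exact Nat.lt_succ_of_le (SimpleGraph.dist_le p)

/-- The forest state in which the edges of a descent are directed. -/
theorem exists_forestState_of_descent {d : V ⊕ S → ℕ} {f : V → E × Bool}
    (hf : ∀ v, Γ.endpoint (f v).1 (f v).2 = Sum.inl v ∧
      d (Γ.endpoint (f v).1 !(f v).2) < d (Sum.inl v)) :
    ∃ τ, Γ.IsForestState τ ∧ ∀ a r, τ a = some r ↔ ∃ v, f v = (a, r) := by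
  classical
  have huniq : ∀ a v r v' r', f v = (a, r) → f v' = (a, r') → r = r' := by
    intro a v r v' r' h h'
    by_contra hne
    obtain ⟨h1, h2⟩ := hf v
    obtain ⟨h3, h4⟩ := hf v'
    rw [h] at h1 h2
    rw [h'] at h3 h4
    obtain rfl : r' = !r := Bool.eq_not.2 (Ne.symm hne)
    simp only [Bool.not_not] at h1 h2 h3 h4
    rw [h3] at h2
    rw [h1] at h4
    omega
  let τ : E → Option Bool := fun a => if h : ∃ v r, f v = (a, r) then some h.choose_spec.choose
    else none
  have hτ : ∀ a r, τ a = some r ↔ ∃ v, f v = (a, r) := by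
    intro a r
    simp only [τ]
    constructor
    · intro h
      split_ifs at h with h'
      refine ⟨_, (h'.choose_spec.choose_spec).trans ?_⟩
      rw [Option.some.inj h]
    · rintro ⟨v, hv⟩
      have h' : ∃ v r, f v = (a, r) := ⟨v, r, hv⟩
      rw [dif_pos h', huniq a _ _ _ _ h'.choose_spec.choose_spec hv]
  have hend : ∀ a r, τ a = some r → ∃ v, f v = (a, r) ∧ Γ.endpoint a r = Sum.inl v ∧
      d (Γ.endpoint a !r) < d (Sum.inl v) := by
    intro a r h
    obtain ⟨v, hv⟩ := (hτ a r).1 h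
    have := hf v
    rw [hv] at this
    exact ⟨v, hv, this⟩
  have hdec : ∀ x y, Γ.Arrow τ x y → d y < d x := by
    rintro _ _ ⟨a, r, h, rfl, rfl⟩
    obtain ⟨v, -, h1, h2⟩ := hend a r h
    rwa [h1]
  refine ⟨τ, ⟨⟨fun s y ⟨a, r, h, h1, h2⟩ => ?_, fun v => ?_, fun x hx => ?_⟩, ?_⟩, hτ⟩
  · obtain ⟨v, -, h3, -⟩ := hend a r h
    rw [h1] at h3
    cases h3
  · exact ⟨_, (f v).1, (f v).2, (hτ _ _).2 ⟨v, rfl⟩, (hf v).1, rfl⟩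
  · have : ∀ x y, Relation.TransGen (Γ.Arrow τ) x y → d y < d x := by
      intro x y h
      induction h with
      | single h => exact hdec _ _ h
      | tail _ h ih => exact (hdec _ _ h).trans ih
    exact lt_irrefl _ (this x x hx)
  · intro a r b r' ha hb hab
    obtain ⟨v, hv, h1, -⟩ := hend a r ha
    obtain ⟨v', hv', h1', -⟩ := hend b r' hb
    rw [h1, h1'] at hab
    obtain rfl := Sum.inl_injective hab
    rw [hv] at hv'
    exact congrArg Prod.fst hv'

/-- For a descent `f`: only the edge `f x` leaves `x`. -/
def OnlyOut (Γ : HairyGraph V E S) (f : V → E × Bool) (st : E → Option Bool) (x : V) : Prop :=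
  ∀ a r, st a = some r → Γ.endpoint a r = Sum.inl x → f x = (a, r)

variable {d : V ⊕ S → ℕ} {f : V → E × Bool}

theorem OnlyOut.eq_some {st : E → Option Bool} {x : V} (h : OnlyOut Γ f st x)
    (hst : Γ.IsGood st) : st (f x).1 = some (f x).2 := by
  obtain ⟨y, a, r, h1, h2, -⟩ := hst.2.1 x
  rw [h a r h1 h2]
  exact h1

theorem OnlyOut.mono {w t : E → Option Bool} {x : V} (h : OnlyOut Γ f t x)
    (hwt : ∀ b r, w b = some r → t b = some r) : OnlyOut Γ f w x :=
  fun a r h1 h2 => h a r (hwt a r h1) h2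

theorem erase_eq_some {E : Type*} [DecidableEq E] {t : E → Option Bool} {a b : E} {r : Bool}
    (h : Function.update t a none b = some r) : t b = some r := by
  by_cases hb : b = a
  · rw [hb, Function.update_self] at h; cases h
  · rwa [Function.update_of_ne hb] at h

/-- The edge `f x` can be directed, if `x` is a vertex of least height among the vertices that are
not in a set `R` of vertices with only one outgoing edge. -/
theorem IsGood.update_descent [DecidableEq E] (hf : ∀ v, Γ.endpoint (f v).1 (f v).2 = Sum.inl v ∧
      d (Γ.endpoint (f v).1 !(f v).2) < d (Sum.inl v)) {R : Finset V} {x : V}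
    (hmin : ∀ y, y ∉ R → d (Sum.inl x) ≤ d (Sum.inl y)) {st : E → Option Bool}
    (hst : Γ.IsGood st) (hR : ∀ y ∈ R, OnlyOut Γ f st y) (hx : st (f x).1 = none) (hxR : x ∉ R) :
    Γ.IsGood (Function.update st (f x).1 (some (f x).2)) ∧
      ∀ y ∈ R, OnlyOut Γ f (Function.update st (f x).1 (some (f x).2)) y := by
  set st' := Function.update st (f x).1 (some (f x).2) with hst'
  have harrow : ∀ a r, st' a = some r → a = (f x).1 ∧ r = (f x).2 ∨ st a = some r := by
    intro a r h
    by_cases ha : a = (f x).1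
    · rw [ha, hst', Function.update_self] at h
      exact .inl ⟨ha, (Option.some.inj h).symm⟩
    · rw [hst', Function.update_of_ne ha] at h
      exact .inr h
  have hR' : ∀ y ∈ R, OnlyOut Γ f st' y := by
    intro y hy a r h h1
    rcases harrow a r h with ⟨rfl, rfl⟩ | h
    · rw [(hf x).1] at h1
      exact absurd (Sum.inl_injective h1 ▸ hy) hxR
    · exact hR y hy a r h h1
  have hlow : ∀ p q, Γ.Arrow st' p q → d p < d (Sum.inl x) → d q < d p := by
    rintro _ _ ⟨a, r, h, rfl, rfl⟩ hp
    rcases harrow a r h with ⟨rfl, rfl⟩ | h'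
    · rw [(hf x).1] at hp
      exact absurd hp (lt_irrefl _)
    · rcases h1 : Γ.endpoint a r with v | s
      · rw [h1] at hp
        have hv : v ∈ R := by
          by_contra hv
          exact (hmin v hv).not_gt hp
        have := hR v hv a r h' h1
        have h2 := (hf v).2
        rw [this] at h2
        exact h2
      · exact absurd ⟨a, r, h', h1, rfl⟩ (hst.1 s _)
  refine ⟨⟨?_, ?_, ?_⟩, hR'⟩
  · rintro s y ⟨a, r, h, h1, h2⟩
    rcases harrow a r h with ⟨rfl, rfl⟩ | h
    · rw [(hf x).1] at h1; cases h1
    · exact hst.1 s y ⟨a, r, h, h1, h2⟩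
  · intro v
    obtain ⟨y, a, r, h1, h2⟩ := hst.2.1 v
    refine ⟨y, a, r, ?_, h2⟩
    rw [hst', Function.update_of_ne (by rintro rfl; rw [hx] at h1; cases h1), h1]
  · have key : ∀ p q, Relation.TransGen (Γ.Arrow st') p q →
        Relation.TransGen (Γ.Arrow st) p q ∨ d q < d (Sum.inl x) := by
      have hstep : ∀ p q, Γ.Arrow st' p q → Γ.Arrow st p q ∨ d q < d (Sum.inl x) := by
        rintro _ _ ⟨a, r, h, rfl, rfl⟩
        rcases harrow a r h with ⟨rfl, rfl⟩ | h
        · exact .inr (hf x).2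
        · exact .inl ⟨a, r, h, rfl, rfl⟩
      intro p q h
      induction h with
      | single h => exact (hstep _ _ h).imp .single id
      | tail _ h ih =>
        rcases ih with ih | ih
        · exact (hstep _ _ h).imp ih.tail id
        · exact .inr ((hlow _ _ h ih).trans ih)
    have key2 : ∀ p q, Relation.TransGen (Γ.Arrow st') p q → d p < d (Sum.inl x) → d q < d p := by
      intro p q h hp
      induction h with
      | single h => exact hlow _ _ h hp
      | tail _ h ih => exact (hlow _ _ h (ih.trans hp)).trans ih
    intro p hp
    rcases key p p hp with h | h
    · exact hst.2.2 p h
    · exact lt_irrefl _ (key2 p p hp h)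

end Forest

section Acyclicity

variable {K : Type u} [Field K]
variable {V E S : Type*} [Fintype E] [LinearOrder E] {Γ : HairyGraph V E S}

variable {d : V ⊕ S → ℕ} {f : V → E × Bool}

/-- One step of the contraction: a cocycle that vanishes on the states in which only `f y` leaves
`y` for all `y ∈ R ∪ {x}` is cohomologous to one which vanishes on the states in which this holds
for all `y ∈ R`. The cochain directs, respectively undirects, the edge `f x`. -/
theorem exists_zigzagDiff_step (hf : ∀ v, Γ.endpoint (f v).1 (f v).2 = Sum.inl v ∧
      d (Γ.endpoint (f v).1 !(f v).2) < d (Sum.inl v)) {R : Finset V} {x : V}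
    (hmin : ∀ y, y ∉ R → d (Sum.inl x) ≤ d (Sum.inl y)) (hxR : x ∉ R)
    (u : (E → Option Bool) → K) (hu : ∀ t, Γ.IsGood t → zigzagDiff u t = 0)
    (hu0 : ∀ t, ¬ Γ.IsGood t → u t = 0)
    (huR : ∀ t, Γ.IsGood t → (∀ y ∈ R, OnlyOut Γ f t y) → OnlyOut Γ f t x → u t = 0) :
    ∃ y z : (E → Option Bool) → K, (∀ t, ¬ Γ.IsGood t → y t = 0) ∧
      (∀ t, ¬ Γ.IsGood t → z t = 0) ∧
      (∀ t, Γ.IsGood t → zigzagDiff z t = 0) ∧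
      (∀ t, Γ.IsGood t → u t = zigzagDiff y t + z t) ∧
      ∀ t, Γ.IsGood t → (∀ y ∈ R, OnlyOut Γ f t y) → z t = 0 := by
  classical
  let M : (E → Option Bool) → Prop := fun t =>
    Γ.IsGood t ∧ (∀ y ∈ R, OnlyOut Γ f t y) ∧ ¬ OnlyOut Γ f t x
  -- `M` is the set of states on which `f x` is toggled; `y` is the contracting homotopy
  -- applied to `u`
  set a := (f x).1 with ha
  set r := (f x).2 with hr
  let y : (E → Option Bool) → K := fun w =>
    if M w ∧ w a = none then (-1) ^ dirRk w a * u (Function.update w a (some r)) else 0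
  have hy0 : ∀ t, ¬ Γ.IsGood t → y t = 0 := fun t ht => if_neg fun h => ht h.1.1
  let z : (E → Option Bool) → K := fun t => if Γ.IsGood t then u t - zigzagDiff y t else 0
  have hz : ∀ t, Γ.IsGood t → zigzagDiff z t = 0 := by
    intro t ht
    have h1 : zigzagDiff z t = zigzagDiff (fun s => u s - zigzagDiff y s) t := by
      rw [zigzagDiff, zigzagDiff]
      refine Finset.sum_congr rfl fun b _ => ?_
      split_ifs with hb
      · rfl
      congr 1
      simp only [z]
      split_ifs with hg
      · rfl
      rw [hu0 _ hg, zero_sub, eq_comm, neg_eq_zero]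
      refine Finset.sum_eq_zero fun c _ => ?_
      split_ifs with hc
      · rfl
      rw [hy0, mul_zero]
      exact fun hg' => hg (hg'.of_between ht (fun _ _ h => erase_eq_some h)
        fun _ _ h => erase_eq_some h)
    rw [h1, zigzagDiff_sub, hu t ht, zigzagDiff_zigzagDiff, sub_zero]
  -- the edge `f x` has no other direction
  have hdir : ∀ t, M t → t a = none ∨ t a = some r := by
    intro t ht
    rcases h : t a with _ | r'
    · exact .inl rfl
    · right
      by_contra hne
      obtain rfl : r' = !r := Bool.eq_not.2 fun h' => hne (by rw [h'])
      obtain ⟨h1, h2⟩ := hf x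
      rcases h3 : Γ.endpoint a (!r) with v | s
      · rw [h3] at h2
        have hv : v ∈ R := by
          by_contra hv
          exact (hmin v hv).not_gt h2
        have h4 := ht.2.1 v hv a _ h h3
        have h5 := (hf v).2
        rw [h4] at h5
        simp only [Bool.not_not] at h5
        rw [h1] at h5
        exact h5.not_gt h2
      · exact ht.1.1 s _ ⟨a, _, h, h3, rfl⟩
  -- by the choice of `y`, `z` vanishes on the states of `M` in which `f x` is directed
  have hzout : ∀ t, M t → t a = some r → z t = 0 := by
    intro t ht hta
    simp only [z]
    rw [if_pos ht.1, sub_eq_zero, zigzagDiff, Finset.sum_eq_single a]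
    · have hnot : ∃ b r', t b = some r' ∧ Γ.endpoint b r' = Sum.inl x ∧ f x ≠ (b, r') := by
        by_contra! hcon
        exact ht.2.2 hcon
      obtain ⟨b, r', hb1, hb2, hb3⟩ := hnot
      have hba : b ≠ a := by
        rintro rfl
        rw [hta] at hb1
        exact hb3 (Prod.ext rfl (Option.some.inj hb1))
      have hM : M (Function.update t a none) := by
        refine ⟨⟨fun s y' ⟨c, r'', hc⟩ => ht.1.1 s y' ⟨c, r'', erase_eq_some hc.1, hc.2⟩,
          fun v => ?_, fun p hp => ht.1.2.2 p (Relation.TransGen.mono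
            (fun _ _ ⟨c, r'', hc⟩ => ⟨c, r'', erase_eq_some hc.1, hc.2⟩) _ _ hp)⟩,
          fun v hv => (ht.2.1 v hv).mono fun _ _ => erase_eq_some, fun hcon => ?_⟩
        · by_cases hv : v = x
          · exact ⟨_, b, r', by rw [Function.update_of_ne hba, hb1], hv ▸ hb2, rfl⟩
          · obtain ⟨y', c, r'', h1, h2, h3⟩ := ht.1.2.1 v
            refine ⟨y', c, r'', ?_, h2, h3⟩
            rw [Function.update_of_ne, h1]
            rintro rfl
            rw [hta] at h1
            rw [← Option.some.inj h1, (hf x).1] at h2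
            exact hv (Sum.inl_injective h2).symm
        · exact hb3 (hcon b r' (by rw [Function.update_of_ne hba, hb1]) hb2)
      rw [if_neg (by simp [hta])]
      simp only [y]
      rw [if_pos ⟨hM, by simp⟩, dirRk_update, Function.update_idem, ← mul_assoc, ← pow_add,
        ← two_mul, pow_mul, neg_one_sq, one_pow, one_mul, ← hta, Function.update_eq_self]
    · intro b _ hb
      split_ifs with hb'
      · rfl
      · simp only [y]
        rw [if_neg, mul_zero]
        rintro ⟨-, h⟩
        rw [Function.update_of_ne hb.symm, hta] at h
        cases h
    · simp
  have hzonly : ∀ t, Γ.IsGood t → (∀ y ∈ R, OnlyOut Γ f t y) → OnlyOut Γ f t x → z t = 0 := by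
    intro t ht hR hx
    simp only [z]
    rw [if_pos ht, huR t ht hR hx, zero_sub, neg_eq_zero]
    refine Finset.sum_eq_zero fun b _ => ?_
    split_ifs with hb'
    · rfl
    · simp only [y]
      rw [if_neg, mul_zero]
      exact fun h => h.1.2.2 (hx.mono fun _ _ => erase_eq_some)
  refine ⟨y, z, hy0, fun t ht => if_neg ht, hz, fun t ht => ?_, fun t ht hR => ?_⟩
  · simp only [z]
    rw [if_pos ht]
    ring
  · by_cases hx : OnlyOut Γ f t x
    · exact hzonly t ht hR hx
    · rcases hdir t ⟨ht, hR, hx⟩ with hta | hta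
      · -- if `f x` is a zigzag of `t`, then `z t` is the only remaining term of the
        -- cocycle condition at the state in which `f x` is directed
        obtain ⟨h1, h2⟩ := IsGood.update_descent hf hmin ht hR hta hxR
        set s := Function.update t (f x).1 (some (f x).2) with hs
        have h3 := hz s h1
        rw [zigzagDiff, Finset.sum_eq_single a] at h3
        · rw [if_neg (by simp [hs, ha]), hs, Function.update_idem, ← ha, ← hta,
            Function.update_eq_self] at h3
          exact (mul_eq_zero.1 h3).resolve_left (pow_ne_zero _ (neg_ne_zero.2 one_ne_zero))
        · intro b _ hb
          split_ifs with hb'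
          · rfl
          by_cases hg : Γ.IsGood (Function.update s b none)
          · rw [mul_eq_zero]
            right
            have hR' : ∀ y ∈ R, OnlyOut Γ f (Function.update s b none) y :=
              fun y hy => (h2 y hy).mono fun _ _ => erase_eq_some
            by_cases hx' : OnlyOut Γ f (Function.update s b none) x
            · exact hzonly _ hg hR' hx'
            · refine hzout _ ⟨hg, hR', hx'⟩ ?_
              rw [Function.update_of_ne hb.symm, hs, ← ha, Function.update_self]
          · simp only [z]
            rw [if_neg hg, mul_zero]
        · simp
      · exact hzout t ⟨ht, hR, hx⟩ hta

/-- For a connected graph with an external vertex, every cocycle on good states is determined up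
to coboundaries by its value at one forest state. -/
theorem exists_zigzagDiff_eq [Finite V] [Nonempty S] (h : Γ.IsConnected) :
    ∃ τ, Γ.IsForestState τ ∧ ∀ u : (E → Option Bool) → K,
      (∀ t, Γ.IsGood t → zigzagDiff u t = 0) → (∀ t, ¬ Γ.IsGood t → u t = 0) → u τ = 0 →
      ∃ y : (E → Option Bool) → K, (∀ t, ¬ Γ.IsGood t → y t = 0) ∧
        ∀ t, Γ.IsGood t → u t = zigzagDiff y t := by
  classical
  have := Fintype.ofFinite V
  obtain ⟨d, f, hf⟩ := exists_descent h
  obtain ⟨τ, hτ, hτf⟩ := exists_forestState_of_descent hf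
  refine ⟨τ, hτ, ?_⟩
  -- the sets `R` consist of `k` vertices that are nearest to the chosen external vertex
  have key : ∀ k ≤ Fintype.card V, ∃ R : Finset V, R.card = k ∧ ∀ u : (E → Option Bool) → K,
      (∀ t, Γ.IsGood t → zigzagDiff u t = 0) → (∀ t, ¬ Γ.IsGood t → u t = 0) →
      (∀ t, Γ.IsGood t → (∀ y ∈ R, OnlyOut Γ f t y) → u t = 0) →
      ∃ y : (E → Option Bool) → K, (∀ t, ¬ Γ.IsGood t → y t = 0) ∧
        ∀ t, Γ.IsGood t → u t = zigzagDiff y t := by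
    intro k
    induction k with
    | zero =>
      intro _
      refine ⟨∅, rfl, fun u _ _ hu => ⟨fun _ => 0, fun _ _ => rfl, fun t ht => ?_⟩⟩
      rw [hu t ht (by simp), zigzagDiff_zero]
    | succ k ih =>
      intro hk
      obtain ⟨R, hR, hR'⟩ := ih (by omega)
      obtain ⟨x, hx, hmin⟩ := Finset.exists_min_image Rᶜ (fun y => d (Sum.inl y)) (by
        rw [← Finset.card_pos, Finset.card_compl]
        omega)
      rw [Finset.mem_compl] at hx
      refine ⟨insert x R, by rw [Finset.card_insert_of_notMem hx, hR], fun u hu hu0 huR => ?_⟩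
      obtain ⟨y, z, hy0, hz0, hz, huz, hzR⟩ := exists_zigzagDiff_step hf
        (fun y hy => hmin y (Finset.mem_compl.2 hy)) hx u hu hu0
        fun t ht h1 h2 => huR t ht (by
          intro y hy
          rcases Finset.mem_insert.1 hy with rfl | hy
          · exact h2
          · exact h1 y hy)
      obtain ⟨y', hy'0, hy'⟩ := hR' z hz hz0 hzR
      refine ⟨fun s => y s + y' s, fun t ht => by
        simp only [hy0 t ht, hy'0 t ht, add_zero],
        fun t ht => ?_⟩
      rw [zigzagDiff_add, huz t ht, hy' t ht]
  obtain ⟨R, hR, hR'⟩ := key _ le_rfl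
  obtain rfl : R = Finset.univ := Finset.card_eq_iff_eq_univ R |>.1 hR
  intro u hu hu0 huτ
  refine hR' u hu hu0 fun t ht hR => ?_
  rw [← huτ]
  -- `τ` is the only state in which just `f v` leaves `v`, for all `v`
  congr 1
  have h1 : ∀ b r, t b = some r ↔ τ b = some r := by
    intro b r
    rw [hτf]
    constructor
    · intro hb
      rcases h2 : Γ.endpoint b r with v | s
      · exact ⟨v, hR v (Finset.mem_univ v) b r hb h2⟩
      · exact absurd ⟨b, r, hb, h2, rfl⟩ (ht.1 s _)
    · rintro ⟨v, hv⟩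
      have := (hR v (Finset.mem_univ v)).eq_some ht
      rwa [hv] at this
  ext b r
  exact h1 b r

end Acyclicity

end HairyGraph

/-! ### Forest states and their signs -/

namespace HairyGraph

section OutEquiv

variable {V E V' E' S : Type*} {Γ : HairyGraph V E S} {st : E → Option Bool}

variable (Γ st) in
/-- A bijection between the internal vertices and the directed edges that sends a vertex to an
edge which leaves it. -/
def IsOut (o : V ≃ {a // st a ≠ none}) : Prop :=
  ∀ v r, st (o v) = some r → Γ.endpoint (o v) r = Sum.inl v

theorem IsOut.ext {o o' : V ≃ {a // st a ≠ none}} (h : Γ.IsOut st o) (h' : Γ.IsOut st o') :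
    o = o' := by
  ext v
  obtain ⟨r, hr⟩ := Option.ne_none_iff_exists'.1 (o v).2
  have h1 := h v r hr
  have h2 := h' (o'.symm (o v)) r (by rwa [Equiv.apply_symm_apply])
  rw [Equiv.apply_symm_apply, h1] at h2
  rw [Sum.inl_injective h2, Equiv.apply_symm_apply]
  rw [← Sum.inl_injective h2]

theorem IsOut.eq_apply {o : V ≃ {a // st a ≠ none}} (h : Γ.IsOut st o) {a : E} {r : Bool}
    (ha : st a = some r) {v : V} (hv : Γ.endpoint a r = Sum.inl v) : a = o v := by
  have h2 := h (o.symm ⟨a, by simp [ha]⟩) r (by rwa [Equiv.apply_symm_apply])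
  rw [Equiv.apply_symm_apply, hv] at h2
  rw [Sum.inl_injective h2, Equiv.apply_symm_apply]

theorem IsOut.exists_tail {o : V ≃ {a // st a ≠ none}} (h : Γ.IsOut st o) {a : E} {r : Bool}
    (ha : st a = some r) : ∃ v, Γ.endpoint a r = Sum.inl v ∧ (o v : E) = a := by
  have h2 := h (o.symm ⟨a, by simp [ha]⟩) r (by rwa [Equiv.apply_symm_apply])
  rw [Equiv.apply_symm_apply] at h2
  exact ⟨_, h2, by rw [Equiv.apply_symm_apply]⟩

variable (Γ st) in
/-- A directed path leads from `x` to an external vertex. -/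
def Reaches (x : V ⊕ S) : Prop := ∃ s, Relation.ReflTransGen (Γ.Arrow st) x (Sum.inr s)

theorem IsGood.reaches [Finite V] [Finite S] (h : Γ.IsGood st) (x : V ⊕ S) : Γ.Reaches st x := by
  have : IsTrans (V ⊕ S) fun x y => Relation.TransGen (Γ.Arrow st) y x :=
    ⟨fun _ _ _ h1 h2 => h2.trans h1⟩
  have : Std.Irrefl fun x y : V ⊕ S => Relation.TransGen (Γ.Arrow st) y x := ⟨h.2.2⟩
  have hwf := Finite.wellFounded_of_trans_of_irrefl
    fun x y : V ⊕ S => Relation.TransGen (Γ.Arrow st) y x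
  induction x using hwf.induction with
  | _ x ih =>
    rcases x with v | s
    · obtain ⟨y, hy⟩ := h.2.1 v
      obtain ⟨s, hs⟩ := ih y (.single hy)
      exact ⟨s, .head hy hs⟩
    · exact ⟨s, .refl⟩

theorem IsOut.isGood {o : V ≃ {a // st a ≠ none}} (h : Γ.IsOut st o)
    (hr : ∀ x, Γ.Reaches st x) : Γ.IsGood st := by
  have hext : ∀ s y, ¬ Γ.Arrow st (Sum.inr s) y := by
    rintro s y ⟨a, r, ha, h1, -⟩
    obtain ⟨v, hv, -⟩ := h.exists_tail ha
    rw [h1] at hv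
    cases hv
  have hdet : ∀ x y y', Γ.Arrow st x y → Γ.Arrow st x y' → y = y' := by
    rintro x _ _ ⟨a, r, ha, h1, rfl⟩ ⟨b, r', hb, h2, rfl⟩
    obtain ⟨v, hv, rfl⟩ := h.exists_tail ha
    rw [h1] at hv
    have h3 := h.eq_apply hb (h2.trans hv)
    subst h3
    rw [ha] at hb
    rw [Option.some.inj hb]
  refine ⟨hext, fun v => ?_, fun x hx => ?_⟩
  · obtain ⟨r, hr⟩ := Option.ne_none_iff_exists'.1 (o v).2
    exact ⟨_, o v, r, hr, h v r hr, rfl⟩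
  · obtain ⟨s, hs⟩ := hr x
    -- a directed cycle cannot be left
    have key : Relation.TransGen (Γ.Arrow st) (Sum.inr s) (Sum.inr s) := by
      generalize (Sum.inr s : V ⊕ S) = z at hs
      induction hs with
      | refl => exact hx
      | tail _ h1 ih =>
        obtain ⟨z, hz, hz'⟩ := Relation.TransGen.head'_iff.1 ih
        rw [hdet _ _ _ hz h1] at hz'
        exact Relation.TransGen.tail' hz' h1
    obtain ⟨z, hz, -⟩ := Relation.TransGen.head'_iff.1 key
    exact hext s z hz

theorem IsForestState.exists_isOut (h : Γ.IsForestState st) : ∃ o, Γ.IsOut st o := by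
  have h1 : ∀ v, ∃ a : {a // st a ≠ none}, ∀ r, st a = some r → Γ.endpoint a r = Sum.inl v := by
    intro v
    obtain ⟨y, a, r, ha, h1, -⟩ := h.1.2.1 v
    refine ⟨⟨a, by simp [ha]⟩, fun r' hr' => ?_⟩
    rw [ha] at hr'
    rw [← Option.some.inj hr', h1]
  choose o ho using h1
  have ho' : ∀ v, ∃ r, st (o v) = some r ∧ Γ.endpoint (o v) r = Sum.inl v := fun v => by
    obtain ⟨r, hr⟩ := Option.ne_none_iff_exists'.1 (o v).2
    exact ⟨r, hr, ho v r hr⟩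
  refine ⟨Equiv.ofBijective o ⟨fun v w hvw => ?_, fun ⟨a, ha⟩ => ?_⟩, ho⟩
  · obtain ⟨r, hr, h2⟩ := ho' v
    rw [hvw] at hr h2
    rw [ho w r hr] at h2
    exact (Sum.inl_injective h2).symm
  · obtain ⟨r, hr⟩ := Option.ne_none_iff_exists'.1 ha
    rcases h2 : Γ.endpoint a r with v | s
    · obtain ⟨r', hr', h3⟩ := ho' v
      exact ⟨v, Subtype.ext (h.2 _ _ _ _ hr' hr (h3.trans h2.symm))⟩
    · exact absurd ⟨a, r, hr, h2, rfl⟩ (h.1.1 s _)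

/-- An isomorphism of partially directed graphs. -/
structure IsStateIso (Γ : HairyGraph V E S) (st : E → Option Bool) (Γ' : HairyGraph V' E' S)
    (st' : E' → Option Bool) (σ : V ≃ V') (ρ : E ≃ E') (ε : E → Bool) : Prop where
  endpoint a r : Γ'.endpoint (ρ a) r = Sum.map σ id (Γ.endpoint a (xor (ε a) r))
  state a : st' (ρ a) = (st a).map (xor (ε a))

namespace IsStateIso

variable {Γ' : HairyGraph V' E' S} {st' : E' → Option Bool} {σ : V ≃ V'} {ρ : E ≃ E'}
    {ε : E → Bool}

theorem symm (h : IsStateIso Γ st Γ' st' σ ρ ε) :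
    IsStateIso Γ' st' Γ st σ.symm ρ.symm fun b => ε (ρ.symm b) where
  endpoint b r := by
    obtain ⟨a, rfl⟩ := ρ.surjective b
    rw [h.endpoint, Equiv.symm_apply_apply]
    simp
  state b := by
    obtain ⟨a, rfl⟩ := ρ.surjective b
    rw [h.state, Equiv.symm_apply_apply]
    rcases st a with _ | r <;> simp

theorem arrow (h : IsStateIso Γ st Γ' st' σ ρ ε) {x y : V ⊕ S} (hxy : Γ.Arrow st x y) :
    Γ'.Arrow st' (Sum.map σ id x) (Sum.map σ id y) := by
  obtain ⟨a, r, ha, rfl, rfl⟩ := hxy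
  refine ⟨ρ a, xor (ε a) r, by rw [h.state, ha]; rfl, ?_, ?_⟩ <;> rw [h.endpoint] <;> simp

theorem isGood (h : IsStateIso Γ st Γ' st' σ ρ ε) (hg : Γ.IsGood st) : Γ'.IsGood st' := by
  have hm : ∀ x : V' ⊕ S, Sum.map σ id (Sum.map σ.symm id x) = x := by rintro (x | x) <;> simp
  refine ⟨fun s y hy => hg.1 s _ (h.symm.arrow hy), fun v => ?_, fun x hx => ?_⟩
  · obtain ⟨y, hy⟩ := hg.2.1 (σ.symm v)
    have := h.arrow hy
    rw [Sum.map_inl, Equiv.apply_symm_apply] at this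
    exact ⟨_, this⟩
  · exact hg.2.2 (Sum.map σ.symm id x)
      (Relation.TransGen.lift (Sum.map σ.symm id) (fun _ _ => h.symm.arrow) _ _ hx)

theorem exists_dirEquiv (h : IsStateIso Γ st Γ' st' σ ρ ε) :
    ∃ ρD : {a // st a ≠ none} ≃ {b // st' b ≠ none}, ∀ a, (ρD a : E') = ρ a :=
  ⟨ρ.subtypeEquiv fun a => by rw [h.state]; simp, fun _ => rfl⟩

theorem isOut (h : IsStateIso Γ st Γ' st' σ ρ ε) {o : V ≃ {a // st a ≠ none}}
    (ho : Γ.IsOut st o) {ρD : {a // st a ≠ none} ≃ {b // st' b ≠ none}}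
    (hρD : ∀ a, (ρD a : E') = ρ a) : Γ'.IsOut st' ((σ.symm.trans o).trans ρD) := by
  intro v r hr
  simp only [Equiv.trans_apply, hρD] at hr ⊢
  rw [h.state, Option.map_eq_some_iff] at hr
  obtain ⟨r', h1, rfl⟩ := hr
  rw [h.endpoint]
  simp only [Bool.xor_self, Bool.false_xor, ← Bool.xor_assoc]
  rw [ho _ _ h1, Sum.map_inl, Equiv.apply_symm_apply]

end IsStateIso

end OutEquiv

section ForestCoeff

variable {V E V' E' S : Type*} [Fintype V] [LinearOrder V] [Fintype E] [LinearOrder E]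
    [Fintype V'] [LinearOrder V'] [Fintype E'] [LinearOrder E']
    {Γ : HairyGraph V E S} {st : E → Option Bool}

open Classical in
variable (Γ st) in
/-- The coefficient of a state in the sum over all forests: the sign of the bijection between
vertices and directed edges for forest states, and zero for other states. -/
def forestCoeff : ℤ :=
  if h : Γ.IsGood st ∧ ∃ o, Γ.IsOut st o then sgn h.2.choose else 0

theorem forestCoeff_eq {o : V ≃ {a // st a ≠ none}} (hg : Γ.IsGood st) (ho : Γ.IsOut st o) :
    Γ.forestCoeff st = sgn o := by
  have h : Γ.IsGood st ∧ ∃ o, Γ.IsOut st o := ⟨hg, o, ho⟩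
  rw [forestCoeff, dif_pos h, h.2.choose_spec.ext ho]

theorem exists_isOut_of_forestCoeff_ne_zero (h : Γ.forestCoeff st ≠ 0) :
    Γ.IsGood st ∧ ∃ o, Γ.IsOut st o := by
  by_contra h'
  exact h (dif_neg h')

theorem forestCoeff_eq_zero_of_not_isGood (h : ¬ Γ.IsGood st) : Γ.forestCoeff st = 0 :=
  dif_neg fun h' => h h'.1

theorem IsForestState.forestCoeff_mul_self (h : Γ.IsForestState st) :
    Γ.forestCoeff st * Γ.forestCoeff st = 1 := by
  obtain ⟨o, ho⟩ := h.exists_isOut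
  rw [forestCoeff_eq h.1 ho, sgn_mul_self]

theorem card_dir_of_forestCoeff_ne_zero (h : Γ.forestCoeff st ≠ 0) :
    Fintype.card {a // st a ≠ none} = Fintype.card V := by
  obtain ⟨-, o, -⟩ := exists_isOut_of_forestCoeff_ne_zero h
  exact (Fintype.card_congr o).symm

theorem IsStateIso.forestCoeff {Γ' : HairyGraph V' E' S} {st' : E' → Option Bool} {σ : V ≃ V'}
    {ρ : E ≃ E'} {ε : E → Bool} (h : IsStateIso Γ st Γ' st' σ ρ ε)
    {ρD : {a // st a ≠ none} ≃ {b // st' b ≠ none}} (hρD : ∀ a, (ρD a : E') = ρ a) :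
    Γ'.forestCoeff st' = sgn σ * sgn ρD * Γ.forestCoeff st := by
  by_cases hst : Γ.forestCoeff st = 0
  · by_cases hst' : Γ'.forestCoeff st' = 0
    · rw [hst, hst', mul_zero]
    · obtain ⟨hg, o, ho⟩ := exists_isOut_of_forestCoeff_ne_zero hst'
      have := forestCoeff_eq (h.symm.isGood hg) (h.symm.isOut ho (ρD := ρD.symm) fun b => by
        obtain ⟨a, rfl⟩ := ρD.surjective b
        rw [Equiv.symm_apply_apply, hρD, Equiv.symm_apply_apply])
      rw [hst] at this
      have h1 := sgn_mul_self ((σ.symm.symm.trans o).trans ρD.symm)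
      rw [← this] at h1
      simp at h1
  · obtain ⟨hg, o, ho⟩ := exists_isOut_of_forestCoeff_ne_zero hst
    rw [forestCoeff_eq hg ho, forestCoeff_eq (h.isGood hg) (h.isOut ho hρD), sgn_trans, sgn_trans,
      sgn_symm]
    ring

theorem _root_.sgn_swap {A : Type*} [Fintype A] [LinearOrder A] [dec : DecidableEq A] {x y : A}
    (h : x ≠ y) : sgn (Equiv.swap x y) = -1 := by
  obtain rfl : dec = LinearOrder.toDecidableEq := Subsingleton.elim _ _
  rw [sgn_perm, Equiv.Perm.sign_swap h]
  rfl

theorem sgn_add_point {a₀ : E} {o : V ≃ {a // Function.update st a₀ none a ≠ none}}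
    (ha₀ : st a₀ ≠ none) {F : V ⊕ₗ Unit ≃ {a // st a ≠ none}}
    (hF : ∀ v, (F (toLex (Sum.inl v)) : E) = o v) (hF' : F (toLex (Sum.inr ())) = ⟨a₀, ha₀⟩) :
    sgn F = (-1) ^ Fintype.card V * (-1) ^ dirRk st a₀ * sgn o := by
  have h1 : ∀ a, Function.update st a₀ none a ≠ none → st a ≠ none := by
    intro a h
    by_cases ha : a = a₀
    · rw [ha]; exact ha₀
    · rwa [Function.update_of_ne ha] at h
  rw [sgn_eq_of_delete F hF' (i := fun v => toLex (Sum.inl v))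
    (j := fun a : {a // Function.update st a₀ none a ≠ none} => ⟨a, h1 _ a.2⟩)
    (fun a b h => Sum.Lex.inl_lt_inl_iff.2 h) (fun a b h => h) (by
      intro b
      induction b using Lex.rec with | _ b
      rcases b with b | b <;> simp) o fun v => Subtype.ext (hF v), rk_inr, rk_dir]
  simp [rk]

/-- The sum over all forests is a cocycle: removing either of two directed edges that leave the
same vertex gives two forests with opposite signs. -/
theorem zigzagDiff_forestCoeff {K : Type u} [CommRing K] (hst : Γ.IsGood st) :
    zigzagDiff (fun t => (Γ.forestCoeff t : K)) st = 0 := by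
  by_cases h0 : ∀ a, st a ≠ none → Γ.forestCoeff (Function.update st a none) = 0
  · refine Finset.sum_eq_zero fun a _ => ?_
    split_ifs with ha
    · rfl
    · simp only [h0 a ha, Int.cast_zero, mul_zero]
  push Not at h0
  obtain ⟨a, ha, h⟩ := h0
  obtain ⟨hg, o, ho⟩ := exists_isOut_of_forestCoeff_ne_zero h
  obtain ⟨r, hr⟩ := Option.ne_none_iff_exists'.1 ha
  obtain ⟨v, hv⟩ : ∃ v, Γ.endpoint a r = Sum.inl v := by
    rcases h1 : Γ.endpoint a r with v | s
    · exact ⟨v, rfl⟩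
    · exact absurd ⟨a, r, hr, h1, rfl⟩ (hst.1 s _)
  set b : E := (o v).1 with hb
  obtain ⟨r', hr'⟩ := Option.ne_none_iff_exists'.1 (o v).2
  have hbr : st b = some r' := erase_eq_some hr'
  have hbv : Γ.endpoint b r' = Sum.inl v := ho v r' hr'
  have hab : a ≠ b := by
    intro h1
    have := (o v).2
    rw [← hb, ← h1, Function.update_self] at this
    exact this rfl
  have hb0 : st b ≠ none := by simp [hbr]
  have hne : ∀ w, (o w : E) ≠ a := by
    intro w hw
    have := (o w).2
    rw [hw, Function.update_self] at this
    exact this rfl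
  have hone : ∀ w, w ≠ v → (o w : E) ≠ b := fun w hw h1 => hw (o.injective (Subtype.ext h1))
  have hstne : ∀ c, Function.update st a none c ≠ none → st c ≠ none := by
    intro c hc
    obtain ⟨r, hr⟩ := Option.ne_none_iff_exists'.1 hc
    simp [erase_eq_some hr]
  -- the bijections for the two forests
  let F : V ⊕ₗ Unit ≃ {a // st a ≠ none} := Equiv.ofBijective
    (fun x => Sum.elim (fun w => ⟨o w, hstne _ (o w).2⟩) (fun _ => ⟨a, ha⟩) (ofLex x)) ⟨by
      intro x y hxy
      induction x using Lex.rec with | _ x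
      induction y using Lex.rec with | _ y
      rcases x with x | x <;> rcases y with y | y
      · have := congrArg Subtype.val hxy
        rw [o.injective (Subtype.ext this)]
      · exact absurd (congrArg Subtype.val hxy) (hne x)
      · exact absurd (congrArg Subtype.val hxy).symm (hne y)
      · rfl, by
      rintro ⟨c, hc⟩
      by_cases hca : c = a
      · exact ⟨toLex (Sum.inr ()), Subtype.ext hca.symm⟩
      · refine ⟨toLex (Sum.inl (o.symm ⟨c, by rwa [Function.update_of_ne hca]⟩)),
          Subtype.ext ?_⟩
        simp⟩
  have hF : ∀ w, (F (toLex (Sum.inl w)) : E) = o w := fun w => rfl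
  have hF' : F (toLex (Sum.inr ())) = ⟨a, ha⟩ := rfl
  let F' : V ⊕ₗ Unit ≃ {a // st a ≠ none} := F.trans (Equiv.swap ⟨a, ha⟩ ⟨b, hb0⟩)
  have hF'1 : F' (toLex (Sum.inr ())) = ⟨b, hb0⟩ := by
    simp only [F', Equiv.trans_apply, hF', Equiv.swap_apply_left]
  have hFv : F (toLex (Sum.inl v)) = ⟨b, hb0⟩ := Subtype.ext (hF v)
  have hF'2 : F' (toLex (Sum.inl v)) = ⟨a, ha⟩ := by
    simp only [F', Equiv.trans_apply, hFv, Equiv.swap_apply_right]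
  have hF'3 : ∀ w, w ≠ v → F' (toLex (Sum.inl w)) = F (toLex (Sum.inl w)) := by
    intro w hw
    refine Equiv.swap_apply_of_ne_of_ne (fun h1 => ?_) fun h1 => ?_
    · exact hne w (congrArg Subtype.val h1)
    · have h2 := congrArg Subtype.val h1
      exact hone w hw h2
  have hF'ne : ∀ w, (F' (toLex (Sum.inl w)) : E) ≠ b := fun w h1 => by
    have : F' (toLex (Sum.inl w)) = F' (toLex (Sum.inr ())) := by
      rw [hF'1]; exact Subtype.ext h1
    cases toLex.injective (F'.injective this)
  let o' : V ≃ {c // Function.update st b none c ≠ none} := Equiv.ofBijective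
    (fun w => ⟨F' (toLex (Sum.inl w)), by
      rw [Function.update_of_ne (hF'ne w)]; exact (F' _).2⟩) ⟨fun w w' hw => by
        have h1 := congrArg Subtype.val hw
        have := F'.injective (Subtype.ext h1)
        exact Sum.inl_injective (toLex.injective this), fun ⟨c, hc⟩ => by
        have hcb : c ≠ b := by rintro rfl; exact hc (Function.update_self _ _ _)
        have hc' : st c ≠ none := by rwa [Function.update_of_ne hcb] at hc
        obtain ⟨x, hx⟩ := F'.surjective ⟨c, hc'⟩
        induction x using Lex.rec with | _ x
        rcases x with x | x
        · have h1 := congrArg Subtype.val hx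
          exact ⟨x, Subtype.ext h1⟩
        · rw [hF'1] at hx
          exact absurd (congrArg Subtype.val hx).symm hcb⟩
  have ho' : Γ.IsOut (Function.update st b none) o' := by
    intro w r'' hw
    have hw' : st (F' (toLex (Sum.inl w))) = some r'' := erase_eq_some hw
    change Γ.endpoint (F' (toLex (Sum.inl w))) r'' = _
    by_cases hwv : w = v
    · subst hwv
      rw [hF'2] at hw' ⊢
      rw [hr] at hw'
      rw [← Option.some.inj hw', hv]
    · rw [hF'3 w hwv, hF] at hw' ⊢
      exact ho w r'' (by rwa [Function.update_of_ne (hne w)])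
  have hg' : Γ.IsGood (Function.update st b none) := by
    refine ⟨fun s y ⟨c, r'', hc⟩ => hst.1 s y ⟨c, r'', erase_eq_some hc.1, hc.2⟩, fun w => ?_,
      fun p hp => hst.2.2 p (Relation.TransGen.mono
        (fun _ _ ⟨c, r'', hc⟩ => ⟨c, r'', erase_eq_some hc.1, hc.2⟩) _ _ hp)⟩
    obtain ⟨r'', hr''⟩ := Option.ne_none_iff_exists'.1 (o' w).2
    exact ⟨_, o' w, r'', hr'', ho' w r'' hr'', rfl⟩
  have hs1 := sgn_add_point (st := st) (o := o) ha hF hF'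
  have hs2 := sgn_add_point (st := st) (o := o') hb0 (F := F') (fun _ => rfl) hF'1
  have hs3 : sgn F' = - sgn F := by
    have h1 : (⟨a, ha⟩ : {a // st a ≠ none}) ≠ ⟨b, hb0⟩ := fun h1 => hab (Subtype.ext_iff.1 h1)
    rw [sgn_trans, sgn_swap h1, mul_neg_one]
  simp only [zigzagDiff]
  rw [Finset.sum_eq_add a b hab]
  · rw [if_neg ha, if_neg hb0, forestCoeff_eq hg ho, forestCoeff_eq hg' ho']
    have : (-1) ^ dirRk st a * sgn o + (-1) ^ dirRk st b * sgn o' = 0 := by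
      rw [hs3, hs1] at hs2
      rcases neg_one_pow_eq_or ℤ (Fintype.card V) with h1 | h1 <;> rw [h1] at hs2 <;> linarith
    exact_mod_cast congrArg (Int.cast (R := K)) this
  · rintro c - ⟨hca, hcb⟩
    split_ifs with hc
    · rfl
    rw [mul_eq_zero_of_right]
    by_contra h1
    obtain ⟨-, o'', ho''⟩ := exists_isOut_of_forestCoeff_ne_zero (Γ := Γ)
      (st := Function.update st c none) (by rintro h2; rw [h2, Int.cast_zero] at h1; exact h1 rfl)
    have h2 := ho''.eq_apply (by rwa [Function.update_of_ne hca.symm]) hv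
    have h3 := ho''.eq_apply (by rwa [Function.update_of_ne hcb.symm]) hbv
    exact hab (h2.trans h3.symm)
  · simp
  · simp

end ForestCoeff

end HairyGraph

/-! ### Forests and contractions -/

namespace HairyGraph

section ForestContract

variable {V E S : Type*} {Γ : HairyGraph V E S} (p : Γ.Contractible)

open Classical in
/-- The state that extends a state of the edges of `Γ/a` by a direction of `a`. -/
def Contractible.extendState (t : {b // b ≠ p.edge} → Option Bool) (r : Bool) : E → Option Bool :=
  fun b => if h : b = p.edge then some r else t ⟨b, h⟩

namespace Contractible

variable {p}

theorem extendState_edge (t : {b // b ≠ p.edge} → Option Bool) (r : Bool) :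
    p.extendState t r p.edge = some r := dif_pos rfl

theorem extendState_coe (t : {b // b ≠ p.edge} → Option Bool) (r : Bool) (b : {b // b ≠ p.edge}) :
    p.extendState t r b = t b := dif_neg b.2

theorem eq_extendState {st : E → Option Bool} {r : Bool} (h : st p.edge = some r) :
    p.extendState (fun b => st b) r = st := by
  ext1 b
  by_cases hb : b = p.edge
  · rw [hb, extendState_edge, h]
  · exact extendState_coe _ _ ⟨b, hb⟩

theorem merge_endVertex (r : Bool) :
    p.merge (Sum.inl (p.endVertex r) : V ⊕ S) = Sum.inl ⟨p.head, p.head_ne_tail⟩ := by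
  rw [merge_inl]
  refine congrArg Sum.inl (Subtype.ext ?_)
  cases r
  · exact if_pos rfl
  · exact if_neg p.head_ne_tail

theorem arrow_contract {t : {b // b ≠ p.edge} → Option Bool} {r : Bool} {x y : V ⊕ S}
    (h : Γ.Arrow (p.extendState t r) x y) :
    p.merge x = p.merge y ∨ (Γ.contract p).Arrow t (p.merge x) (p.merge y) := by
  obtain ⟨b, r', hb, rfl, rfl⟩ := h
  by_cases hbp : b = p.edge
  · left
    rw [hbp, p.endpoint_edge, p.endpoint_edge, merge_endVertex, merge_endVertex]
  · right
    refine ⟨⟨b, hbp⟩, r', ?_, endpoint_contract _ _ _, endpoint_contract _ _ _⟩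
    rw [← hb]
    exact (extendState_coe t r ⟨b, hbp⟩).symm

theorem reaches_contract {t : {b // b ≠ p.edge} → Option Bool} {r : Bool}
    (h : ∀ x, Γ.Reaches (p.extendState t r) x) (X : {v // v ≠ p.tail} ⊕ S) :
    (Γ.contract p).Reaches t X := by
  obtain ⟨x, rfl⟩ := p.merge_surjective X
  obtain ⟨s, hs⟩ := h x
  refine ⟨s, ?_⟩
  rw [← p.merge_inr s]
  generalize (Sum.inr s : V ⊕ S) = z at hs ⊢
  induction hs with
  | refl => exact .refl
  | tail _ h ih =>
    rcases arrow_contract h with h | h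
    · rwa [h] at ih
    · exact ih.tail h

theorem eq_or_of_merge_eq {x y : V ⊕ S} (h : p.merge x = p.merge y) :
    x = y ∨ ∃ r, x = Sum.inl (p.endVertex r) ∧ y = Sum.inl (p.endVertex !r) := by
  rcases hX : p.merge y with w | s
  · rw [hX] at h
    rcases p.merge_eq_inl.1 h with h1 | ⟨h1, h1'⟩ <;> rcases p.merge_eq_inl.1 hX with h2 | ⟨h2, h2'⟩
    · exact .inl (h1.trans h2.symm)
    · exact .inr ⟨true, by rw [h1, h2]; rfl, h2'⟩
    · exact .inr ⟨false, h1', by rw [h2, h1]; rfl⟩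
    · exact .inl (h1'.trans h2'.symm)
  · rw [hX] at h
    exact .inl ((p.merge_eq_inr.1 h).trans (p.merge_eq_inr.1 hX).symm)

theorem reaches_of_contract {t : {b // b ≠ p.edge} → Option Bool}
    (h : ∀ X, (Γ.contract p).Reaches t X)
    {o₀ : {v // v ≠ p.tail} ≃ {b // t b ≠ none}} (ho₀ : (Γ.contract p).IsOut t o₀) {r r' : Bool}
    (hr' : t (o₀ ⟨p.head, p.head_ne_tail⟩) = some r')
    (hr : Γ.endpoint (o₀ ⟨p.head, p.head_ne_tail⟩ : {b // b ≠ p.edge}) r' =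
      Sum.inl (p.endVertex !r)) (x : V ⊕ S) :
    Γ.Reaches (p.extendState t r) x := by
  obtain ⟨s, hs⟩ := h (p.merge x)
  refine ⟨s, ?_⟩
  generalize hX : p.merge x = X at hs
  induction hs using Relation.ReflTransGen.head_induction_on generalizing x with
  | refl => rw [p.merge_eq_inr.1 hX]
  | head h1 _ ih =>
    obtain ⟨b, r'', hb, h2, h3⟩ := h1
    rw [endpoint_contract] at h2 h3
    have h4 := ih _ h3
    have h5 : Γ.Arrow (p.extendState t r) (Γ.endpoint b r'') (Γ.endpoint b !r'') :=
      ⟨b, r'', (extendState_coe _ _ _).trans hb, rfl, rfl⟩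
    rcases eq_or_of_merge_eq (hX.trans h2.symm) with rfl | ⟨r₁, rfl, h6⟩
    · exact .head h5 h4
    · rw [h6, merge_endVertex] at h2
      have h7 : b = o₀ ⟨p.head, p.head_ne_tail⟩ := ho₀.eq_apply hb (by
        rw [endpoint_contract, h6, merge_endVertex])
      subst h7
      rw [hr'] at hb
      obtain rfl := Option.some.inj hb
      rw [hr] at h6
      refine .head (b := Sum.inl (p.endVertex !r)) ⟨p.edge, r, extendState_edge _ _, ?_,
        p.endpoint_edge _⟩ ?_
      · rw [p.endpoint_edge]
        have := Sum.inl_injective h6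
        have h8 : (!r) = !r₁ := by
          revert this
          have := p.head_ne_tail
          cases r <;> cases r₁ <;> simp [endVertex, this, this.symm]
        rw [Bool.not_inj h8]
      · rw [← hr]
        exact .head h5 h4

/-- The permutation that moves the start of the directed edge to the place of the tail. -/
def startPerm [DecidableEq V] (p : Γ.Contractible) (r : Bool) : Equiv.Perm V :=
  if r then Equiv.swap p.tail p.head else Equiv.refl V

theorem startPerm_tail [DecidableEq V] (r : Bool) : p.startPerm r p.tail = p.endVertex r := by
  cases r
  · rfl
  · exact Equiv.swap_apply_left _ _

theorem startPerm_head [DecidableEq V] (r : Bool) : p.startPerm r p.head = p.endVertex !r := by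
  cases r
  · rfl
  · exact Equiv.swap_apply_right _ _

theorem startPerm_of_ne [DecidableEq V] (r : Bool) {v : V} (h1 : v ≠ p.tail) (h2 : v ≠ p.head) :
    p.startPerm r v = v := by
  cases r
  · rfl
  · exact Equiv.swap_apply_of_ne_of_ne h1 h2

theorem startPerm_startPerm [DecidableEq V] (r : Bool) (v : V) :
    p.startPerm r (p.startPerm r v) = v := by
  cases r
  · rfl
  · exact Equiv.swap_apply_self _ _ _

theorem merge_startPerm [DecidableEq V] (r : Bool) (v : {v // v ≠ p.tail}) :
    p.merge (Sum.inl (p.startPerm r v) : V ⊕ S) = Sum.inl v := by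
  by_cases h : (v : V) = p.head
  · rw [h, startPerm_head, merge_endVertex]
    exact congrArg Sum.inl (Subtype.ext h.symm)
  · rw [startPerm_of_ne r v.2 h]
    exact p.merge_eq_inl.2 (.inl rfl)

theorem sgn_startPerm [Fintype V] [LinearOrder V] (r : Bool) :
    sgn (p.startPerm r) = if r then -1 else 1 := by
  cases r
  · exact sgn_refl
  · exact sgn_swap p.head_ne_tail.symm

end Contractible

section Sign

variable [Fintype V] [LinearOrder V] [Fintype E] [LinearOrder E] {p}

theorem IsOut.exists_contract {t : {b // b ≠ p.edge} → Option Bool} {r : Bool}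
    {o : V ≃ {a // p.extendState t r a ≠ none}} (ho : Γ.IsOut (p.extendState t r) o) :
    ∃ o₀, (Γ.contract p).IsOut t o₀ ∧ sgn o = directedSign (p.extendState t r) p * sgn o₀ := by
  classical
  let f := (p.startPerm r).trans o
  have hf : f p.tail = ⟨p.edge, by simp [Contractible.extendState_edge]⟩ := by
    refine Subtype.ext ?_
    simp only [f, Equiv.trans_apply, Contractible.startPerm_tail]
    exact (ho.eq_apply (Contractible.extendState_edge t r) (p.endpoint_edge r)).symm
  have hne : ∀ v : {v // v ≠ p.tail}, (f v : E) ≠ p.edge := fun v h => v.2 (f.injective (by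
    rw [hf]; exact Subtype.ext h))
  have hst : ∀ b : {b // b ≠ p.edge}, (p.extendState t r) b = t b :=
    Contractible.extendState_coe t r
  let o₀ : {v // v ≠ p.tail} ≃ {b // t b ≠ none} := Equiv.ofBijective
    (fun v => ⟨⟨f v, hne v⟩, by rw [← hst]; exact (f v).2⟩) ⟨fun v w hvw => by
      have h1 := congrArg (fun x => (x.1.1 : E)) hvw
      exact Subtype.ext (f.injective (Subtype.ext h1)), fun b => by
      obtain ⟨v, hv⟩ := f.surjective ⟨b.1, by rw [hst]; exact b.2⟩
      have hv' : v ≠ p.tail := by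
        rintro rfl
        rw [hf] at hv
        have h1 := congrArg Subtype.val hv
        exact b.1.2 h1.symm
      have h1 := congrArg Subtype.val hv
      exact ⟨⟨v, hv'⟩, Subtype.ext (Subtype.ext h1)⟩⟩
  refine ⟨o₀, fun v r' hr' => ?_, ?_⟩
  · have h1 : (p.extendState t r) (f v) = some r' := (hst ⟨f v, hne v⟩).trans hr'
    rw [endpoint_contract]
    change p.merge (Γ.endpoint (o (p.startPerm r v)) r') = _
    rw [ho _ _ h1, Contractible.merge_startPerm]
  · have h1 := sgn_eq_of_delete f hf (Subtype.strictMono_coe fun v => v ≠ p.tail)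
      (j := fun b : {b : {b // b ≠ p.edge} // t b ≠ none} => ⟨b.1, by rw [hst]; exact b.2⟩)
      (fun _ _ h => h) (by simp) o₀ fun _ => rfl
    rw [sgn_trans, Contractible.sgn_startPerm, rk_dir] at h1
    have h2 : directedSign (p.extendState t r) p =
      (-1) ^ dirRk (p.extendState t r) p.edge * (-1) ^ rk p.tail *
        if r then -1 else 1 := by
      rw [directedSign, show (p.extendState t r) p.edge = some r from
        Contractible.extendState_edge t r]
      cases r <;> rfl
    rw [h2]
    cases r <;> simp only [if_true, Bool.false_eq_true, if_false] at h1 ⊢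
    · linear_combination h1
    · linear_combination -h1

end Sign

section Extend

variable [LinearOrder V] [LinearOrder E] {p}

theorem IsOut.exists_extend {t : {b // b ≠ p.edge} → Option Bool}
    {o₀ : {v // v ≠ p.tail} ≃ {b // t b ≠ none}} (ho₀ : (Γ.contract p).IsOut t o₀) {r r' : Bool}
    (hr' : t (o₀ ⟨p.head, p.head_ne_tail⟩) = some r')
    (hr : Γ.endpoint (o₀ ⟨p.head, p.head_ne_tail⟩ : {b // b ≠ p.edge}) r' =
      Sum.inl (p.endVertex !r)) :
    ∃ o, Γ.IsOut (p.extendState t r) o := by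
  classical
  have hst : ∀ b : {b // b ≠ p.edge}, (p.extendState t r) b = t b :=
    Contractible.extendState_coe t r
  have hste : (p.extendState t r) p.edge = some r := Contractible.extendState_edge t r
  let g : V → {b // (p.extendState t r) b ≠ none} := fun v => if h : v = p.tail then
    ⟨p.edge, by simp [hste]⟩ else ⟨(o₀ ⟨v, h⟩).1, by rw [hst]; exact (o₀ ⟨v, h⟩).2⟩
  have hf1 : (g p.tail : E) = p.edge := congrArg Subtype.val (dif_pos rfl)
  have hf2 : ∀ v : {v // v ≠ p.tail}, (g v : E) = (o₀ v).1 := fun v =>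
    congrArg Subtype.val (dif_neg v.2)
  have hg : Function.Bijective g := by
    constructor
    · intro v w hvw
      have h1 : (g v : E) = g w := by rw [hvw]
      by_cases hv : v = p.tail <;> by_cases hw : w = p.tail
      · rw [hv, hw]
      · rw [hv, hf1, hf2 ⟨w, hw⟩] at h1
        exact absurd h1.symm (o₀ ⟨w, hw⟩).1.2
      · rw [hw, hf1, hf2 ⟨v, hv⟩] at h1
        exact absurd h1 (o₀ ⟨v, hv⟩).1.2
      · rw [hf2 ⟨v, hv⟩, hf2 ⟨w, hw⟩] at h1
        have h2 := o₀.injective (Subtype.ext (Subtype.ext h1))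
        exact congrArg Subtype.val h2
    · intro b
      by_cases hb : (b : E) = p.edge
      · exact ⟨p.tail, Subtype.ext (hf1.trans hb.symm)⟩
      · obtain ⟨v, hv⟩ := o₀.surjective ⟨⟨b, hb⟩, by rw [← hst]; exact b.2⟩
        refine ⟨v, Subtype.ext ?_⟩
        rw [hf2, hv]
  let f : V ≃ {b // (p.extendState t r) b ≠ none} := Equiv.ofBijective g hg
  replace hf1 : (f p.tail : E) = p.edge := hf1
  replace hf2 : ∀ v : {v // v ≠ p.tail}, (f v : E) = (o₀ v).1 := hf2
  refine ⟨(p.startPerm r).trans f, fun v r₁ hr₁ => ?_⟩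
  rw [Equiv.trans_apply] at hr₁ ⊢
  obtain ⟨w, rfl⟩ : ∃ w, v = p.startPerm r w := ⟨_, (p.startPerm_startPerm r v).symm⟩
  rw [p.startPerm_startPerm] at hr₁ ⊢
  by_cases hw : w = p.tail
  · subst hw
    rw [hf1, hste] at hr₁
    rw [hf1, ← Option.some.inj hr₁, p.endpoint_edge, Contractible.startPerm_tail]
  · rw [hf2 ⟨w, hw⟩] at hr₁ ⊢
    by_cases hw' : w = p.head
    · subst hw'
      rw [hst, hr'] at hr₁
      rw [← Option.some.inj hr₁, hr, Contractible.startPerm_head]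
    · have h1 := ho₀ ⟨w, hw⟩ r₁ ((hst _).symm.trans hr₁)
      rw [endpoint_contract] at h1
      rw [p.startPerm_of_ne r hw hw']
      exact (p.merge_eq_inl.1 h1).resolve_right fun h => hw' h.1

end Extend

section Sign

variable [Fintype V] [LinearOrder V] [Fintype E] [LinearOrder E] {p}

/-- A forest of `Γ/a` comes from a unique forest of `Γ` that contains `a`. -/
theorem forestCoeff_contract [Finite S] (t : {b // b ≠ p.edge} → Option Bool) :
    ∑ r, directedSign (p.extendState t r) p * Γ.forestCoeff (p.extendState t r) =
      (Γ.contract p).forestCoeff t := by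
  have hdown : ∀ r, Γ.forestCoeff (p.extendState t r) ≠ 0 →
      directedSign (p.extendState t r) p * Γ.forestCoeff (p.extendState t r) =
        (Γ.contract p).forestCoeff t := by
    intro r h
    obtain ⟨hg, o, ho⟩ := exists_isOut_of_forestCoeff_ne_zero h
    obtain ⟨o₀, ho₀, hs⟩ := ho.exists_contract
    rw [forestCoeff_eq hg ho, hs,
      forestCoeff_eq (ho₀.isGood (Contractible.reaches_contract hg.reaches)) ho₀, ← mul_assoc]
    have : directedSign (p.extendState t r) p * directedSign (p.extendState t r) p = 1 := by
      rw [directedSign]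
      rcases neg_one_pow_eq_or ℤ (dirRk (p.extendState t r) p.edge) with h1 | h1 <;>
        rcases neg_one_pow_eq_or ℤ (rk p.tail) with h2 | h2 <;> rw [h1, h2] <;>
        split_ifs <;> rfl
    rw [this, one_mul]
  by_cases ht : (Γ.contract p).forestCoeff t = 0
  · rw [ht]
    refine Finset.sum_eq_zero fun r _ => ?_
    by_cases h : Γ.forestCoeff (p.extendState t r) = 0
    · rw [h, mul_zero]
    · rw [hdown r h, ht]
  · obtain ⟨hg, o₀, ho₀⟩ := exists_isOut_of_forestCoeff_ne_zero ht
    obtain ⟨r', hr'⟩ := Option.ne_none_iff_exists'.1 (o₀ ⟨p.head, p.head_ne_tail⟩).2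
    obtain ⟨r, hr⟩ : ∃ r, Γ.endpoint (o₀ ⟨p.head, p.head_ne_tail⟩ : {b // b ≠ p.edge}) r' =
        Sum.inl (p.endVertex !r) := by
      have h1 := ho₀ _ r' hr'
      rw [endpoint_contract] at h1
      rcases p.merge_eq_inl.1 h1 with h2 | ⟨-, h2⟩
      · exact ⟨false, h2⟩
      · exact ⟨true, h2⟩
    obtain ⟨o, ho⟩ := ho₀.exists_extend hr' hr
    have hg' := ho.isGood (Contractible.reaches_of_contract hg.reaches ho₀ hr' hr)
    -- for the other direction of `a`, two directed edges would leave the same vertex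
    have h1 : Γ.forestCoeff (p.extendState t !r) = 0 := by
      by_contra h
      obtain ⟨-, o', ho'⟩ := exists_isOut_of_forestCoeff_ne_zero h
      have h2 := ho'.eq_apply (Contractible.extendState_edge t _) (p.endpoint_edge _)
      have h3 := ho'.eq_apply ((Contractible.extendState_coe t _ _).trans hr') hr
      exact (o₀ ⟨p.head, p.head_ne_tail⟩).1.2 (h3.trans h2.symm)
    have h2 : Γ.forestCoeff (p.extendState t r) ≠ 0 := by
      rw [forestCoeff_eq hg' ho]
      rcases sgn_eq_one_or o with h | h <;> rw [h] <;> decide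
    rw [← hdown r h2]
    rw [Finset.sum_eq_single r]
    · intro r₁ _ h3
      rw [Bool.eq_not.2 h3, h1, mul_zero]
    · simp

end Sign

end ForestContract

end HairyGraph

/-! ### The sum over all forests is compatible with the differentials -/

section SumStates

variable {V E S : Type*} [Fintype E] [LinearOrder E]

theorem sum_ite_zero_left {ι M : Type*} [Fintype ι] [AddCommMonoid M] (P : ι → Prop)
    [DecidablePred P] (f : ι → M) :
    (∑ x, if P x then 0 else f x) = ∑ x with ¬ P x, f x := by
  rw [Finset.sum_filter]
  exact Finset.sum_congr rfl fun x _ => by split_ifs <;> rfl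

/-- Sums over the states with a directed edge `a` are sums over states of `Γ/a` and directions. -/
theorem sum_extendState {M : Type*} [AddCommMonoid M] {Γ : HairyGraph V E S} (p : Γ.Contractible)
    (F : (E → Option Bool) → M) :
    (∑ st, if st p.edge = none then 0 else F st) = ∑ t, ∑ r, F (p.extendState t r) := by
  rw [sum_ite_zero_left, ← Finset.sum_product']
  refine Finset.sum_nbij' (fun st => ((fun b => st b), (st p.edge).getD false))
    (fun q => p.extendState q.1 q.2) ?_ ?_ ?_ ?_ ?_
  · simp
  · simp [Contractible.extendState_edge]
  · intro st h
    obtain ⟨r, hr⟩ := Option.ne_none_iff_exists'.1 (Finset.mem_filter.1 h).2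
    simp only [hr, Option.getD_some, Contractible.eq_extendState hr]
  · rintro ⟨t, r⟩ -
    simp only [Contractible.extendState_edge, Contractible.extendState_coe, Option.getD_some]
  · intro st h
    obtain ⟨r, hr⟩ := Option.ne_none_iff_exists'.1 (Finset.mem_filter.1 h).2
    simp only [hr, Option.getD_some, Contractible.eq_extendState hr]

end SumStates

section PhiClass

variable (K : Type u) [Field K] (n : ℤ) (k : ℤ) {S : Type w}
variable {V E V' E' : Type*} [Fintype V] [LinearOrder V] [Fintype E] [LinearOrder E]
    [Fintype V'] [LinearOrder V'] [Fintype E'] [LinearOrder E']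

/-- Directing the zigzags is adjoint to `zigzagDiff`. -/
theorem sum_smul_update {M : Type*} [AddCommGroup M] [Module K M] (u : (E → Option Bool) → K)
    (Z : (E → Option Bool) → M) :
    ∑ st, u st • (∑ a, if st a = none then ∑ β, (((-1) ^ dirRk st a : ℤ) : K) •
      Z (Function.update st a (some β)) else 0) = ∑ t, zigzagDiff u t • Z t := by
  simp only [Finset.smul_sum, zigzagDiff, Finset.sum_smul]
  rw [Finset.sum_comm, Finset.sum_comm (s := Finset.univ (α := E → Option Bool))]
  refine Finset.sum_congr rfl fun a _ => ?_
  simp only [smul_ite, smul_zero, ite_smul, zero_smul]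
  rw [← Finset.sum_filter, sum_ite_zero_left]
  simp only [Finset.smul_sum]
  rw [← Finset.sum_product']
  refine Finset.sum_nbij' (fun q => Function.update q.1 a (some q.2))
    (fun t => (Function.update t a none, (t a).getD false)) ?_ ?_ ?_ ?_ ?_
  · simp
  · simp
  · rintro ⟨st, β⟩ h
    simp only [Finset.mem_product, Finset.mem_filter, Finset.mem_univ, true_and, and_true] at h
    rw [Function.update_idem, Function.update_self, ← h, Function.update_eq_self]
    rfl
  · intro t h
    obtain ⟨r, hr⟩ := Option.ne_none_iff_exists'.1 (Finset.mem_filter.1 h).2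
    simp only [Function.update_idem, hr, Option.getD_some]
    rw [← hr, Function.update_eq_self]
  · rintro ⟨st, β⟩ h
    simp only [Finset.mem_product, Finset.mem_filter, Finset.mem_univ, true_and, and_true] at h
    simp only [Function.update_idem, dirRk_update]
    rw [← h, Function.update_eq_self, smul_smul]
    push_cast
    rw [mul_comm]

/-- The sum over all forest states: the image of `Γ` under the map `Φ`. -/
def phiClass (Γ : HairyGraph V E S) : GraphSpace K .oriented (n + 1) S k :=
  ∑ st, (Γ.forestCoeff st : K) • zigzagClass K n k Γ st

theorem dMap_phiClass [Finite S] {i j : ℤ} {Γ : HairyGraph V E S} (h : Γ.IsAdmissible .undirected)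
    (hi : (n - 1) * (Fintype.card E : ℤ) - n * Fintype.card V = i) :
    dMap K .oriented (n + 1) i j (phiClass K n i Γ) =
      ∑ p : Γ.Contractible, (rkSign n p : K) • phiClass K n j (Γ.contract p) := by
  have h1 : ∀ st, dMap K .oriented (n + 1) i j
      ((Γ.forestCoeff st : K) • zigzagClass K n i Γ st) = (Γ.forestCoeff st : K) •
      (∑ a, if st a = none then ∑ β, (((-1) ^ dirRk st a : ℤ) : K) •
        zigzagClass K n j Γ (Function.update st a (some β)) else 0) +
      ∑ p : Γ.Contractible, if st p.edge = none then 0 else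
        ((rkSign n p * (directedSign st p * Γ.forestCoeff st) : ℤ) : K) •
          zigzagClass K n j (Γ.contract p) (fun b => st b) := by
    intro st
    by_cases h0 : Γ.forestCoeff st = 0
    · simp [h0]
    · have hc := card_dir_of_forestCoeff_ne_zero h0
      rw [map_smul, dMap_zigzagClass K h (exists_isOut_of_forestCoeff_ne_zero h0).1
        (by rw [hc, sub_self, add_zero, hi]), smul_add]
      have hz : zigzagSign n V st = 1 := by
        rw [zigzagSign, hc, ← two_mul, pow_mul]
        simp
      rw [hz, Int.cast_one, one_smul, Finset.smul_sum (s := (Finset.univ : Finset Γ.Contractible))]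
      congr 1
      refine Finset.sum_congr rfl fun p _ => ?_
      split_ifs
      · rw [smul_zero]
      · rw [smul_smul, ← Int.cast_mul]
        congr 2
        ring
  rw [phiClass, map_sum, Finset.sum_congr rfl fun st _ => h1 st, Finset.sum_add_distrib,
    sum_smul_update K (fun st => (Γ.forestCoeff st : K)) fun st => zigzagClass K n j Γ st,
    Finset.sum_eq_zero, zero_add, Finset.sum_comm]
  · refine Finset.sum_congr rfl fun p _ => ?_
    rw [sum_extendState p fun st =>
      ((rkSign n p * (directedSign st p * Γ.forestCoeff st) : ℤ) : K) •
          zigzagClass K n j (Γ.contract p) (fun b => st b), phiClass, Finset.smul_sum]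
    refine Finset.sum_congr rfl fun t _ => ?_
    simp only [Contractible.extendState_coe]
    rw [← Finset.sum_smul, ← Int.cast_sum, ← Finset.mul_sum, forestCoeff_contract, Int.cast_mul,
      mul_smul]
  · intro t _
    by_cases ht : Γ.IsGood t
    · rw [zigzagDiff_forestCoeff ht, zero_smul]
    · rw [zigzagClass_eq_zero K n ht, smul_zero]

theorem phiClass_relabel {Γ : HairyGraph V E S} {Γ' : HairyGraph V' E' S}
    (σ : V ≃ V') (ρ : E ≃ E') (ε : E → Bool)
    (h : ∀ a r, Γ'.endpoint (ρ a) r = Sum.map σ id (Γ.endpoint a (xor (ε a) r))) :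
    phiClass K n k Γ' = (orientSign n σ ρ ε : K) • phiClass K n k Γ := by
  let T : (E → Option Bool) ≃ (E' → Option Bool) :=
    { toFun := fun st b => (st (ρ.symm b)).map (xor (ε (ρ.symm b)))
      invFun := fun st a => (st (ρ a)).map (xor (ε a))
      left_inv := fun st => by
        ext1 a
        rcases h : st a with _ | r <;> simp [h]
      right_inv := fun st => by
        ext1 a
        rcases h : st a with _ | r <;> simp [h] }
  rw [phiClass, phiClass, Finset.smul_sum, ← T.sum_comp]
  refine Finset.sum_congr rfl fun st _ => ?_
  have hiso : IsStateIso Γ st Γ' (T st) σ ρ ε := ⟨h, fun a => by simp [T]⟩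
  obtain ⟨ρD, hρD⟩ := hiso.exists_dirEquiv
  rw [hiso.forestCoeff hρD, zigzagClass_relabel K n k σ ρ ε h hiso.state ρD hρD, smul_smul,
    smul_smul, ← Int.cast_mul, ← Int.cast_mul]
  congr 2
  linear_combination (orientSign n σ ρ ε * sgn ρD * sgn ρD * Γ.forestCoeff st) * sgn_mul_self σ +
    (orientSign n σ ρ ε * Γ.forestCoeff st) * sgn_mul_self ρD

end PhiClass

/-! ### Spanning forests and forest states -/

namespace HairyGraph

section Determinism

variable {V E S : Type*} {Γ : HairyGraph V E S} {st : E → Option Bool}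

theorem IsOut.arrow_unique {o : V ≃ {a // st a ≠ none}} (h : Γ.IsOut st o) {x y y' : V ⊕ S}
    (h1 : Γ.Arrow st x y) (h2 : Γ.Arrow st x y') : y = y' := by
  obtain ⟨a, r, ha, h1, rfl⟩ := h1
  obtain ⟨b, r', hb, h2, rfl⟩ := h2
  obtain ⟨v, hv, rfl⟩ := h.exists_tail ha
  rw [h1] at hv
  have h3 := h.eq_apply hb (h2.trans hv)
  subst h3
  rw [ha] at hb
  rw [Option.some.inj hb]

theorem IsGood.exists_rank [Finite V] [Finite E] [Finite S] (h : Γ.IsGood st) :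
    ∃ d : V ⊕ S → ℕ, ∀ x y, Γ.Arrow st x y → d y < d x := by
  have : Finite (V ⊕ₗ {a // st a = none}) := inferInstanceAs (Finite (V ⊕ {a // st a = none}))
  obtain ⟨d, hd⟩ := (Γ.acyclic_zigzagGraph_iff.2 h.2.2).exists_rank
  refine ⟨d ∘ coreVertex st, ?_⟩
  rintro _ _ ⟨a, r, ha, rfl, rfl⟩
  have := hd (toLex (Sum.inl ⟨a, by simp [ha]⟩))
  rw [← endpoint_false, ← endpoint_true, zigzagGraph_endpoint_inl Γ ha,
    zigzagGraph_endpoint_inl Γ ha, Bool.xor_false, Bool.xor_true] at this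
  exact this

theorem link_dir_iff {x y : V ⊕ S} :
    Γ.Link {a | st a ≠ none} x y ↔ Γ.Arrow st x y ∨ Γ.Arrow st y x := by
  constructor
  · rintro ⟨a, ha, r, rfl, rfl⟩
    obtain ⟨r', hr'⟩ := Option.ne_none_iff_exists'.1 ha
    by_cases hr : r' = r
    · exact .inl ⟨a, r, hr ▸ hr', rfl, rfl⟩
    · exact .inr ⟨a, r', hr', by rw [Bool.eq_not.2 hr], by rw [Bool.eq_not.2 hr, Bool.not_not]⟩
  · rintro (⟨a, r, ha, rfl, rfl⟩ | ⟨a, r, ha, rfl, rfl⟩)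
    · exact ⟨a, by simp [ha], r, rfl, rfl⟩
    · exact ⟨a, by simp [ha], !r, rfl, by simp⟩

theorem IsOut.root_iff {o : V ≃ {a // st a ≠ none}} (ho : Γ.IsOut st o) (hg : Γ.IsGood st)
    {x y : V ⊕ S} (h : Γ.Arrow st x y) (s : S) :
    Relation.ReflTransGen (Γ.Arrow st) x (Sum.inr s) ↔
      Relation.ReflTransGen (Γ.Arrow st) y (Sum.inr s) := by
  refine ⟨fun h1 => ?_, fun h1 => .head h h1⟩
  rcases Relation.ReflTransGen.cases_head h1 with rfl | ⟨z, hz, h2⟩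
  · exact absurd h (hg.1 s y)
  · rwa [ho.arrow_unique h hz]

theorem IsOut.root_unique {o : V ≃ {a // st a ≠ none}} (ho : Γ.IsOut st o) (hg : Γ.IsGood st)
    {x : V ⊕ S} {s s' : S} (h : Relation.ReflTransGen (Γ.Arrow st) x (Sum.inr s))
    (h' : Relation.ReflTransGen (Γ.Arrow st) x (Sum.inr s')) : s = s' := by
  induction h using Relation.ReflTransGen.head_induction_on with
  | refl =>
    rcases Relation.ReflTransGen.cases_head h' with h1 | ⟨z, hz, -⟩
    · exact Sum.inr_injective h1
    · exact absurd hz (hg.1 s z)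
  | head h1 _ ih => exact ih ((ho.root_iff hg h1 s').1 h')

theorem IsOut.reachable_iff_root {o : V ≃ {a // st a ≠ none}} (ho : Γ.IsOut st o)
    (hg : Γ.IsGood st) {x : V ⊕ S} {s : S} :
    (Γ.subgraph {a | st a ≠ none}).Reachable x (Sum.inr s) ↔
      Relation.ReflTransGen (Γ.Arrow st) x (Sum.inr s) := by
  rw [reachable_iff]
  constructor
  · intro h
    induction h using Relation.ReflTransGen.head_induction_on with
    | refl => exact .refl
    | head h1 _ ih =>
      rcases link_dir_iff.1 h1 with h1 | h1
      · exact (ho.root_iff hg h1 s).2 ih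
      · exact (ho.root_iff hg h1 s).1 ih
  · intro h
    exact h.lift id fun _ _ h1 => link_dir_iff.2 (.inl h1)

theorem IsOut.isAcyclic [Finite V] [Finite E] [Finite S] {o : V ≃ {a // st a ≠ none}}
    (ho : Γ.IsOut st o) (hg : Γ.IsGood st) : (Γ.subgraph {a | st a ≠ none}).IsAcyclic := by
  obtain ⟨d, hd⟩ := hg.exists_rank
  intro u c hc
  classical
  -- at a vertex of maximal rank, both neighbours in the cycle are reached by the outgoing edge
  obtain ⟨x, hx, hmax⟩ := Finset.exists_max_image c.support.toFinset d ⟨u, by simp⟩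
  rw [List.mem_toFinset] at hx
  have hc' := hc.rotate hx
  set c' := c.rotate x hx with hc'_def
  have hsupp : ∀ y ∈ c'.support, d y ≤ d x := fun y hy => hmax y (by
    rw [List.mem_toFinset]
    exact (c.mem_support_rotate_iff x hx).1 hy)
  have harrow : ∀ y, (Γ.subgraph {a | st a ≠ none}).Adj x y → d y ≤ d x → Γ.Arrow st x y := by
    intro y hy hle
    rcases link_dir_iff.1 (Γ.subgraph_adj.1 hy).2 with h | h
    · exact h
    · exact absurd (hd _ _ h) hle.not_gt
  have hnil : ¬ c'.Nil := hc'.not_nil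
  refine hc'.snd_ne_penultimate (ho.arrow_unique (harrow _ (c'.adj_snd hnil) (hsupp _ ?_))
    (harrow _ (c'.adj_penultimate hnil).symm (hsupp _ ?_)))
  · exact c'.getVert_mem_support _
  · exact c'.getVert_mem_support _

theorem IsOut.leaves {o : V ≃ {a // st a ≠ none}} (ho : Γ.IsOut st o)
    (hg : Γ.IsGood st) (x : V) (s : S) :
    ¬ (Γ.subgraph ({a | st a ≠ none} \ {(o x : E)})).Reachable (Sum.inl x) (Sum.inr s) := by
  intro h
  rw [reachable_iff] at h
  -- the vertices from which `x` is reached are separated from the others by the edge `o x`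
  have key : Relation.ReflTransGen (Γ.Arrow st) (Sum.inr s) (Sum.inl x) := by
    generalize (Sum.inr s : V ⊕ S) = z at h
    induction h with
    | refl => exact .refl
    | @tail y z _ h1 ih =>
      obtain ⟨a, ⟨ha, hao⟩, r, rfl, rfl⟩ := h1
      obtain ⟨r', hr'⟩ := Option.ne_none_iff_exists'.1 ha
      by_cases hr : r' = r
      · subst hr
        have harr : Γ.Arrow st (Γ.endpoint a r') (Γ.endpoint a !r') := ⟨a, r', hr', rfl, rfl⟩
        rcases Relation.ReflTransGen.cases_head ih with h2 | ⟨w, hw, h2⟩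
        · exact absurd (ho.eq_apply hr' h2) hao
        · rwa [ho.arrow_unique harr hw]
      · rw [Bool.eq_not.2 hr] at hr'
        exact .head ⟨a, !r, hr', rfl, rfl⟩ (by rwa [Bool.not_not])
  rcases Relation.ReflTransGen.cases_head key with h2 | ⟨w, hw, -⟩
  · cases h2
  · exact hg.1 s w hw

end Determinism

section SpanningForest

variable {V E S : Type*} {Γ : HairyGraph V E S} {st : E → Option Bool}

/-- The directed edges of a forest state form a spanning forest. -/
theorem IsOut.isSpanningForest [Finite V] [Finite E] [Finite S] {o : V ≃ {a // st a ≠ none}}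
    (ho : Γ.IsOut st o) (hg : Γ.IsGood st) {τ : Finset E} (hτ : ∀ a, a ∈ τ ↔ st a ≠ none) :
    Γ.IsSpanningForest τ ∧ ∀ x, Γ.LeavesThrough τ x (o x) := by
  have hτ' : (τ : Set E) = {a | st a ≠ none} := Set.ext hτ
  have harr : ∀ a ∈ τ, ∃ r, st a = some r ∧ Γ.Arrow st (Γ.endpoint a r) (Γ.endpoint a !r) := by
    intro a ha
    obtain ⟨r, hr⟩ := Option.ne_none_iff_exists'.1 ((hτ a).1 ha)
    exact ⟨r, hr, a, r, hr, rfl, rfl⟩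
  have hends : ∀ a r, s(Γ.src a, Γ.tgt a) = s(Γ.endpoint a r, Γ.endpoint a !r) := by
    rintro a (_ | _)
    · rfl
    · exact Sym2.eq_swap
  refine ⟨⟨fun a ha h => ?_, fun a ha b hb h => ?_, hτ' ▸ ho.isAcyclic hg, fun x => ?_⟩,
    fun x => ⟨(hτ _).2 (o x).2, ?_, fun s => hτ' ▸ ho.leaves hg x s⟩⟩
  · obtain ⟨r, hr, h1⟩ := harr a ha
    have h2 : Γ.endpoint a (!r) = Γ.endpoint a r := by cases r <;> simp [h]
    rw [h2] at h1
    exact hg.2.2 _ (.single h1)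
  · obtain ⟨r, hr, h1⟩ := harr a ha
    obtain ⟨r', hr', h2⟩ := harr b hb
    rw [hends a r, hends b r', Sym2.eq_iff] at h
    rcases h with ⟨h3, -⟩ | ⟨h3, h4⟩
    · obtain ⟨v, hv, rfl⟩ := ho.exists_tail hr
      exact (ho.eq_apply hr' (h3.symm.trans hv)).symm
    · rw [← h3, ← h4] at h2
      exact absurd (Relation.TransGen.tail (.single h1) h2) (hg.2.2 _)
  · obtain ⟨s, hs⟩ := hg.reaches x
    rw [hτ']
    exact ⟨s, (ho.reachable_iff_root hg).2 hs, fun s' hs' =>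
      ho.root_unique hg ((ho.reachable_iff_root hg).1 hs') hs⟩
  · obtain ⟨r, hr⟩ := Option.ne_none_iff_exists'.1 (o x).2
    have := ho x r hr
    cases r
    · exact .inl this
    · exact .inr this

/-- A spanning forest is the set of directed edges of a forest state: the edge through which a
vertex is left leads closer to the external vertex. -/
theorem IsSpanningForest.exists_state [Finite V] {τ : Finset E} (h : Γ.IsSpanningForest τ)
    {out : V → E} (hout : ∀ x, Γ.LeavesThrough τ x (out x)) :
    ∃ st o, Γ.IsGood st ∧ Γ.IsOut st o ∧ (∀ a, a ∈ τ ↔ st a ≠ none) ∧ ∀ x, (o x : E) = out x := by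
  obtain ⟨htad, hmult, hacyc, hroot⟩ := h
  choose root hr hru using hroot
  have hroot_adj : ∀ x y, (Γ.subgraph (τ : Set E)).Adj x y → root y = root x :=
    fun x y hxy => hru x _ (hxy.reachable.trans (hr y))
  have hroot_inr : ∀ s, root (Sum.inr s) = s := fun s => (hru _ s .rfl).symm
  let d : V ⊕ S → ℕ := fun x => (Γ.subgraph (τ : Set E)).dist x (Sum.inr (root x))
  have hstep : ∀ v : V, ∃ y, (Γ.subgraph (τ : Set E)).Adj (Sum.inl v) y ∧ d y < d (Sum.inl v) := by
    intro v
    obtain ⟨p, hp⟩ := (hr (Sum.inl v)).exists_walk_length_eq_dist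
    cases p with
    | cons hxy p =>
      refine ⟨_, hxy, ?_⟩
      simp only [d]
      rw [← hp, SimpleGraph.Walk.length_cons, hroot_adj _ _ hxy]
      exact Nat.lt_succ_of_le (SimpleGraph.dist_le p)
  have hlt : ∀ v y, d y < d (Sum.inl v) → ∃ s,
      (Γ.subgraph ((τ : Set E) \ {out v})).Reachable y (Sum.inr s) := by
    intro v y
    induction hk : d y using Nat.strong_induction_on generalizing y with
    | _ k ih =>
      intro hd
      rcases y with w | s
      · obtain ⟨z, hz, hlt⟩ := hstep w
        obtain ⟨s, hs⟩ := ih (d z) (hk ▸ hlt) z rfl (by omega)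
        refine ⟨s, SimpleGraph.Reachable.trans (SimpleGraph.Adj.reachable ?_) hs⟩
        rw [subgraph_adj] at hz ⊢
        obtain ⟨hne, a, ha, r, h1, h2⟩ := hz
        refine ⟨hne, a, ⟨ha, ?_⟩, r, h1, h2⟩
        rintro rfl
        -- the edge `out v` ends at `v`, which is farther from the external vertex
        have h3 : Γ.endpoint (out v) r = Sum.inl v ∨ Γ.endpoint (out v) (!r) = Sum.inl v := by
          cases r
          · exact (hout v).2.1
          · exact (hout v).2.1.symm
        rw [h1, h2] at h3
        rcases h3 with h3 | h3
        · rw [h3] at hk; omega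
        · rw [h3] at hlt; omega
      · exact ⟨s, .rfl⟩
  have hdesc : ∀ v, ∃ r, Γ.endpoint (out v) r = Sum.inl v ∧
      d (Γ.endpoint (out v) !r) < d (Sum.inl v) := by
    intro v
    obtain ⟨y, hy, hyd⟩ := hstep v
    have hy' := hy
    rw [subgraph_adj] at hy'
    obtain ⟨hne, a, ha, r, h1, rfl⟩ := hy'
    have hav : a = out v := by
      by_contra hav
      obtain ⟨s, hs⟩ := hlt v _ hyd
      refine (hout v).2.2 s (SimpleGraph.Reachable.trans (SimpleGraph.Adj.reachable ?_) hs)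
      rw [subgraph_adj]
      exact ⟨hne, a, ⟨ha, hav⟩, r, h1, rfl⟩
    subst hav
    exact ⟨r, h1, hyd⟩
  choose r hr1 hr2 using hdesc
  have hfor := exists_forestState_of_descent (Γ := Γ) (d := d) (f := fun v => (out v, r v))
    fun v => ⟨hr1 v, hr2 v⟩
  obtain ⟨st, hst, hstf⟩ := hfor
  obtain ⟨o, ho⟩ := hst.exists_isOut
  have hoo : ∀ x, (o x : E) = out x := fun x =>
    (ho.eq_apply ((hstf _ _).2 ⟨x, rfl⟩) (hr1 x)).symm
  refine ⟨st, o, hst.1, ho, fun a => ⟨fun ha hnone => ?_, fun ha => ?_⟩, hoo⟩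
  · -- both ends of an edge of `τ` without direction are connected to the same external vertex
    have hreach : ∀ x, (Γ.subgraph ((τ : Set E) \ {a})).Reachable x (Sum.inr (root x)) := by
      intro x
      induction hk : d x using Nat.strong_induction_on generalizing x with
      | _ k ih =>
        rcases x with w | s
        · have hadj : ∀ τ' : Set E, out w ∈ τ' →
              (Γ.subgraph τ').Adj (Sum.inl w) (Γ.endpoint (out w) !(r w)) := by
            intro τ' h'
            rw [subgraph_adj]
            refine ⟨fun h => ?_, out w, h', r w, hr1 w, rfl⟩
            have := hr2 w
            rw [← h] at this
            exact lt_irrefl _ this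
          have h1 := ih _ (hk ▸ hr2 w) _ rfl
          rw [hroot_adj _ _ (hadj _ (hout w).1)] at h1
          refine (hadj ((τ : Set E) \ {a}) ⟨(hout w).1, fun h => ?_⟩).reachable.trans h1
          rw [Set.mem_singleton_iff] at h
          rw [← h, (hstf _ _).2 ⟨w, rfl⟩] at hnone
          cases hnone
        · rw [hroot_inr]
    have hadj : (Γ.subgraph (τ : Set E)).Adj (Γ.src a) (Γ.tgt a) := by
      rw [subgraph_adj]
      exact ⟨htad a ha, a, ha, false, rfl, rfl⟩
    have hbridge := SimpleGraph.isBridge_iff.1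
      (SimpleGraph.isAcyclic_iff_forall_adj_isBridge.1 hacyc hadj)
    have h1 := hreach (Γ.tgt a)
    rw [hroot_adj _ _ hadj] at h1
    refine hbridge (SimpleGraph.Reachable.mono (fun x y hxy => ?_) ((hreach _).trans h1.symm))
    rw [subgraph_adj] at hxy
    obtain ⟨hne, b, ⟨hb, hba⟩, r, rfl, rfl⟩ := hxy
    rw [SimpleGraph.deleteEdges_adj, subgraph_adj]
    refine ⟨⟨hne, b, hb, r, rfl, rfl⟩, fun h => hba (hmult b hb a ha ?_)⟩
    rw [← Set.mem_singleton_iff.1 h]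
    cases r
    · rfl
    · exact Sym2.eq_swap
  · obtain ⟨r', hr'⟩ := Option.ne_none_iff_exists'.1 ha
    obtain ⟨v, hv⟩ := (hstf _ _).1 hr'
    have h1 : out v = a := congrArg Prod.fst hv
    exact h1 ▸ (hout v).1

end SpanningForest

end HairyGraph

/-! ### The map `Φ` as a sum over forest states -/

section ForestGraph

variable {V E : Type*} [Fintype V] [LinearOrder V] [Fintype E] [LinearOrder E] {S : Type w}
variable (K : Type u) [Field K] (n k : ℤ)

/-- The graph `Φ_τ(Γ)` is the zigzag graph of the forest state, with vertices numbered by edges. -/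
theorem graphClass_forestGraph [Finite S] {Γ : HairyGraph V E S} (τ : Γ.SpanningForest)
    {st : E → Option Bool} (hg : Γ.IsGood st) {o : V ≃ {a // st a ≠ none}} (ho : Γ.IsOut st o)
    (hτ : ∀ a, a ∈ τ.edges ↔ st a ≠ none) (hout : ∀ x, (o x : E) = τ.out x) :
    (Γ.forestSign n τ : K) • graphClass K .oriented (n + 1) k (Γ.forestGraph τ) =
      (Γ.forestCoeff st : K) • zigzagClass K n k Γ st := by
  classical
  let σ : V ⊕ₗ {a // st a = none} ≃ E :=
    (ofLex.trans ((Equiv.sumCongr o (Equiv.refl _)).trans toLex)).trans (splitEquiv st).symm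
  have hσ : sgn σ = sgn o * sgn (splitEquiv st) := by
    rw [sgn_trans, sgn_symm, sgn_sumCongr o (Equiv.refl _) _ (fun _ => rfl) (fun _ => rfl),
      sgn_refl, mul_one]
  have hσl : ∀ v, σ (toLex (Sum.inl v)) = τ.out v := fun v => hout v
  have hσr : ∀ z : {a // st a = none}, σ (toLex (Sum.inr z)) = z := fun z => rfl
  have hmap : ∀ x : V ⊕ S, Sum.map σ id (coreVertex st x) = Sum.map τ.out id x := by
    rintro (v | s)
    · exact congrArg Sum.inl (hσl v)
    · rfl
  have hsrc : ∀ v a r, τ.out v = a → st a = some r → Γ.endpoint a r = Sum.inl v →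
      (Γ.src a = Sum.inl v ↔ r = false) := by
    intro v a r _ h hv
    cases r
    · simpa using hv
    · refine ⟨fun h1 => ?_, fun h1 => by cases h1⟩
      -- the edge `a` would be a tadpole
      refine absurd ⟨a, true, h, hv, h1⟩ fun h2 => hg.2.2 (Sum.inl v) (.single h2)
  have hZ : ∀ a, st a = none ↔ a ∉ τ.edges := fun a => by rw [hτ, not_not]
  let ζ : {a // st a = none} ≃ {a // a ∉ τ.edges} := Equiv.subtypeEquivRight hZ
  let ζ' : {a // st a = none} ×ₗ Bool ≃ {a // a ∉ τ.edges} ×ₗ Bool :=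
    ofLex.trans ((Equiv.prodCongr ζ (Equiv.refl _)).trans toLex)
  let ρ : {a // st a ≠ none} ⊕ₗ ({a // st a = none} ×ₗ Bool) ≃
      V ⊕ₗ ({a // a ∉ τ.edges} ×ₗ Bool) :=
    ofLex.trans ((Equiv.sumCongr o.symm ζ').trans toLex)
  have hζ' : sgn ζ' = 1 := by
    rw [sgn_prod_bool ζ (fun _ => false) ζ' fun a b => by simp [ζ']]
    simp
  have hζ : sgn ζ = 1 := sgn_of_strictMono ζ fun _ _ h => h
  have hρ : sgn ρ = sgn o := by
    rw [sgn_sumCongr o.symm ζ' ρ (fun _ => rfl) (fun _ => rfl), sgn_symm, hζ', mul_one]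
  have hend : ∀ a r, (Γ.forestGraph τ).endpoint (ρ a) r =
      Sum.map σ id ((Γ.zigzagGraph st).endpoint a (xor ((fun _ => false) a) r)) := by
    intro e r
    induction e using zigzag_edge_cases with
    | hl a r' h =>
      obtain ⟨v, hv, hva⟩ := ho.exists_tail h
      have hρa : ρ (toLex (Sum.inl ⟨a, by simp [h]⟩)) = toLex (Sum.inl v) := by
        have h1 : o.symm ⟨a, by simp [h]⟩ = v := (Equiv.symm_apply_eq o).2 (Subtype.ext hva.symm)
        exact congrArg (fun x => toLex (Sum.inl x)) h1
      have hva' : τ.out v = a := (hout v).symm.trans hva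
      rw [hρa, Bool.false_xor, zigzagGraph_endpoint_inl Γ h, hmap]
      have hif := hsrc v a r' hva' h hv
      cases r
      · rw [Bool.xor_false, hv]
        rfl
      · simp only [forestGraph, endpoint_true, ofLex_toLex, hva', Bool.xor_true]
        cases r'
        · rw [if_pos (hif.2 rfl)]
          rfl
        · rw [if_neg fun h => by simpa using hif.1 h]
          rfl
    | hr z b =>
      cases r
      · rw [Bool.false_xor, zigzagGraph_endpoint_inr_false]
        exact congrArg Sum.inl (hσr z).symm
      · rw [Bool.false_xor, zigzagGraph_endpoint_inr_true, hmap]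
        cases b <;> rfl
  rw [graphClass_eq_of_endpoint K .oriented (n + 1) k σ ρ (fun _ => false) (fun _ _ => rfl) hend,
    graphClass_zigzagGraph, smul_smul, smul_smul, ← Int.cast_mul, ← Int.cast_mul,
    forestCoeff_eq hg ho]
  congr 2
  simp only [orientSign, normSign, Bool.false_eq_true, if_false, Finset.prod_const_one,
    mul_one, Int.even_add_one]
  by_cases hn : Even n
  · simp only [hn, if_true, not_true_eq_false, if_false, hσ, forestSign]
    linear_combination sgn o * sgn_mul_self (splitEquiv st)
  · simp only [hn, if_true, not_false_eq_true, if_false, hρ]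
    have h1 : Γ.forestSign n τ = ∏ a, if st a = some true then -1 else 1 := by
      have h2 := Finset.prod_subset (f := fun a => if st a = some true then (-1 : ℤ) else 1)
        (Finset.subset_univ (Finset.univ.filter fun a => st a ≠ none)) fun a _ ha => by
          simp only [ne_eq, Finset.mem_filter, Finset.mem_univ, true_and, not_not] at ha
          simp [ha]
      rw [forestSign, if_neg hn, ← h2, Finset.prod_subtype (p := fun a => st a ≠ none) _ (by simp)]
      refine Fintype.prod_equiv o _ _ fun x => ?_
      obtain ⟨r, hr⟩ := Option.ne_none_iff_exists'.1 (o x).2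
      have h3 := hsrc x _ r (hout x).symm hr (ho x r hr)
      rw [← hout x]
      cases r <;> simp [hr, h3]
    rw [h1]
    have h2 := normSign_mul_self n st
    simp only [normSign, hn, if_false] at h2
    linear_combination (sgn o) * h2

/-- The sum over spanning forests, written as a sum over states. -/
theorem sum_forestGraph [Finite S] (Γ : HairyGraph V E S) :
    ∑ τ : Γ.SpanningForest, (Γ.forestSign n τ : K) •
      graphClass K .oriented (n + 1) k (Γ.forestGraph τ) = phiClass K n k Γ := by
  classical
  have hex := fun τ : Γ.SpanningForest => τ.2.1.exists_state τ.2.2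
  choose st o hg ho hτ hout using hex
  rw [phiClass, ← Finset.sum_subset (Finset.subset_univ
    (Finset.univ.filter fun s => Γ.forestCoeff s ≠ 0)) fun s _ hs => by
      simp only [ne_eq, Finset.mem_filter, Finset.mem_univ, true_and, not_not] at hs
      rw [hs, Int.cast_zero, zero_smul]]
  refine Finset.sum_bij (fun τ _ => st τ) (fun τ _ => ?_) (fun τ _ τ' _ h => ?_)
    (fun s hs => ?_) fun τ _ => graphClass_forestGraph K n k τ (hg τ) (ho τ) (hτ τ) (hout τ)
  · rw [Finset.mem_filter, forestCoeff_eq (hg τ) (ho τ)]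
    refine ⟨Finset.mem_univ _, fun h => ?_⟩
    have := sgn_mul_self (o τ)
    rw [h] at this
    simp at this
  · have h1 : τ.edges = τ'.edges := by
      ext a
      exact (hτ τ a).trans ((by rw [h] : _ ↔ _).trans (hτ τ' a).symm)
    refine Subtype.ext (Prod.ext h1 (funext fun x => ?_))
    obtain ⟨r, hr⟩ := Option.ne_none_iff_exists'.1 (o τ x).2
    have h2 := (ho τ').eq_apply (h ▸ hr) (ho τ x r hr)
    rw [hout, hout] at h2
    exact h2
  · obtain ⟨hgs, os, hos⟩ := exists_isOut_of_forestCoeff_ne_zero (Finset.mem_filter.1 hs).2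
    have hfor := hos.isSpanningForest hgs (τ := Finset.univ.filter fun a => s a ≠ none) (by simp)
    let τ : Γ.SpanningForest := ⟨(_, fun x => os x), hfor⟩
    refine ⟨τ, Finset.mem_univ _, funext fun a => ?_⟩
    by_cases ha : s a = none
    · have h1 := (hτ τ a).not.1 (show a ∉ Finset.univ.filter fun a => s a ≠ none by simp [ha])
      rw [ha, not_not.1 h1]
    · obtain ⟨r, hr⟩ := Option.ne_none_iff_exists'.1 ha
      obtain ⟨v, hv, hva⟩ := hos.exists_tail hr
      have h1 : (o τ v : E) = a := (hout τ v).trans hva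
      obtain ⟨r', hr'⟩ := Option.ne_none_iff_exists'.1 (o τ v).2
      have h2 := ho τ v r' hr'
      rw [h1] at h2 hr'
      rw [hr, hr']
      by_contra hne
      obtain rfl : r' = !r := Bool.eq_not.2 fun h => hne (by rw [h])
      -- the edge `a` would be a tadpole
      exact hgs.2.2 (Sum.inl v) (.single ⟨a, r, hr, hv, h2⟩)

end ForestGraph

section Descent

variable {K : Type u} [Field K] {n : ℤ} {S : Type w} [Finite S]

theorem phiFree_single {k : ℤ} (Γ : {Γ : LabelledGraph .undirected S // Γ.degree n = k}) :
    phiFree K n S k (Finsupp.single Γ 1) = phiClass K n k Γ.1.graph := by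
  rw [phiFree, Finsupp.linearCombination_single, one_smul, ← sum_forestGraph]

theorem phiFree_descends (k : ℤ) :
    signRelations K .undirected n S k ≤ LinearMap.ker (phiFree K n S k) := by
  refine Submodule.span_le.2 ?_
  rintro _ ⟨v, e, Γ, Γ', h, h', hk, hk', σ, ρ, ε, -, rfl, rfl⟩
  rw [SetLike.mem_coe, LinearMap.mem_ker, map_sub, map_smul, phiFree_single, phiFree_single,
    sub_eq_zero, ← orientSign_eq_relabelSign]
  exact phiClass_relabel K n k σ ρ ε fun a r => endpoint_relabel ..

/-- The map `Φ` on coinvariants. -/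
def phiMap (K : Type u) [Field K] (n : ℤ) (S : Type w) [Finite S] (k : ℤ) :
    GraphSpace K .undirected n S k →ₗ[K] GraphSpace K .oriented (n + 1) S k :=
  Submodule.liftQ _ (phiFree K n S k) (phiFree_descends k)

theorem phiMap_mk {k : ℤ} (Γ : {Γ : LabelledGraph .undirected S // Γ.degree n = k}) :
    phiMap K n S k (Submodule.Quotient.mk (Finsupp.single Γ 1)) = phiClass K n k Γ.1.graph :=
  phiFree_single Γ

theorem phiMap_graphClass {V E : Type*} [Fintype V] [LinearOrder V] [Fintype E] [LinearOrder E]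
    {k : ℤ} {Γ : HairyGraph V E S} (h : Γ.IsAdmissible .undirected)
    (hk : (n - 1) * (Fintype.card E : ℤ) - n * (Fintype.card V : ℤ) = k) :
    phiMap K n S k (graphClass K .undirected n k Γ) = phiClass K n k Γ := by
  have h1 : Γ.numbered.IsAdmissible .undirected := by
    rwa [numbered, isAdmissible_relabel_iff _ _ _ fun _ _ => rfl]
  rw [graphClass, dif_pos ⟨h1, hk⟩, phiMap_mk]
  refine (phiClass_relabel K n k _ _ (fun _ => false) fun a r => endpoint_relabel ..).trans ?_
  rw [orientSign, sgn_of_strictMono, sgn_of_strictMono]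
  · simp
  · exact (monoEquivOfFin V rfl).symm.strictMono
  · exact (monoEquivOfFin E rfl).symm.strictMono

theorem dMap_phiMap [CharZero K] (i j : ℤ) (x : GraphSpace K .undirected n S i) :
    dMap K .oriented (n + 1) i j (phiMap K n S i x) =
      phiMap K n S j (dMap K .undirected n i j x) := by
  by_cases hij : i + 1 = j
  · suffices h : dMap K .oriented (n + 1) i j ∘ₗ phiMap K n S i =
        phiMap K n S j ∘ₗ dMap K .undirected n i j from LinearMap.congr_fun h x
    refine Submodule.linearMap_qext _ (Finsupp.lhom_ext' fun Γ => LinearMap.ext_ring ?_)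
    simp only [LinearMap.comp_apply, Finsupp.lsingle_apply, Submodule.mkQ_apply]
    rw [phiMap_mk]
    obtain ⟨⟨v, e, Γ, h⟩, hi⟩ := Γ
    have hi' : (n - 1) * (Fintype.card (Fin e) : ℤ) - n * (Fintype.card (Fin v) : ℤ) = i := by
      rw [← hi]
      simp [LabelledGraph.degree]
    rw [dMap_phiClass K n h hi']
    have h1 : dMap K .undirected n i j (Submodule.Quotient.mk (Finsupp.single ⟨⟨v, e, Γ, h⟩, hi⟩ 1))
        = boundary K .undirected n j Γ := contractFree_single ..
    rw [h1, boundary, map_sum]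
    refine Finset.sum_congr rfl fun p _ => ?_
    rw [map_smul, phiMap_graphClass (h.contract_undirected p)]
    rw [← hij, ← hi']
    have hv : 0 < Fintype.card (Fin v) := Fintype.card_pos_iff.2 ⟨p.tail⟩
    have he : 0 < Fintype.card (Fin e) := Fintype.card_pos_iff.2 ⟨p.edge⟩
    simp only [ne_eq, Fintype.card_subtype_compl, Fintype.card_subtype_eq, Nat.cast_sub hv,
      Nat.cast_sub he]
    push_cast
    ring
  · have h1 : dMap K .oriented (n + 1) i j (S := S) = 0 := (isGraphComplex K _ _ S).d_eq_zero hij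
    have h2 : dMap K .undirected n i j (S := S) = 0 := (isGraphComplex K _ _ S).d_eq_zero hij
    rw [h1, h2]
    simp

theorem isForestMap [CharZero K] (hG : IsGraphComplex K .undirected n S)
    (hO : IsGraphComplex K .oriented (n + 1) S) : IsForestMap hG hO where
  descends := phiFree_descends
  comm i j := LinearMap.ext fun x => dMap_phiMap i j x

end Descent

/-! ### The pairing that counts isomorphisms -/

namespace HairyGraph

variable {V E V' E' V'' E'' S : Type*}

/-- The triple `(σ, ρ, ε)` is an isomorphism. In the oriented case it has to preserve the
directions of edges. -/
structure IsIso (c : Flavor) (Γ : HairyGraph V E S) (Γ' : HairyGraph V' E' S)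
    (g : (V ≃ V') × (E ≃ E') × (E → Bool)) : Prop where
  direction : c = .oriented → ∀ a, g.2.2 a = false
  endpoint a r : Γ'.endpoint (g.2.1 a) r = Sum.map g.1 id (Γ.endpoint a (xor (g.2.2 a) r))

/-- The composition of relabellings, where the first one is fixed. -/
def relabelTrans (g : (V ≃ V') × (E ≃ E') × (E → Bool)) :
    (V' ≃ V'') × (E' ≃ E'') × (E' → Bool) ≃ (V ≃ V'') × (E ≃ E'') × (E → Bool) where
  toFun h := (g.1.trans h.1, g.2.1.trans h.2.1, fun a => xor (g.2.2 a) (h.2.2 (g.2.1 a)))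
  invFun h := (g.1.symm.trans h.1, g.2.1.symm.trans h.2.1,
    fun b => xor (g.2.2 (g.2.1.symm b)) (h.2.2 (g.2.1.symm b)))
  left_inv h := by
    refine Prod.ext (by ext; simp) (Prod.ext (by ext; simp) (by ext; simp))
  right_inv h := by
    refine Prod.ext (by ext; simp) (Prod.ext (by ext; simp) (by ext; simp))

/-- The inversion of relabellings. -/
def relabelSymm : (V ≃ V') × (E ≃ E') × (E → Bool) ≃ (V' ≃ V) × (E' ≃ E) × (E' → Bool) where
  toFun g := (g.1.symm, g.2.1.symm, fun b => g.2.2 (g.2.1.symm b))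
  invFun g := (g.1.symm, g.2.1.symm, fun b => g.2.2 (g.2.1.symm b))
  left_inv g := by
    refine Prod.ext (by ext; simp) (Prod.ext (by ext; simp) (by ext; simp))
  right_inv g := by
    refine Prod.ext (by ext; simp) (Prod.ext (by ext; simp) (by ext; simp))

variable {c : Flavor} {Γ : HairyGraph V E S} {Γ' : HairyGraph V' E' S} {Γ'' : HairyGraph V'' E'' S}

theorem IsIso.relabelTrans_iff {g : (V ≃ V') × (E ≃ E') × (E → Bool)} (hg : IsIso c Γ Γ' g)
    (h : (V' ≃ V'') × (E' ≃ E'') × (E' → Bool)) :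
    IsIso c Γ Γ'' (relabelTrans g h) ↔ IsIso c Γ' Γ'' h := by
  constructor
  · intro hh
    refine ⟨fun hc b => ?_, fun b r => ?_⟩
    · obtain ⟨a, rfl⟩ := g.2.1.surjective b
      have := hh.direction hc a
      simpa [relabelTrans, hg.direction hc a] using this
    · obtain ⟨a, rfl⟩ := g.2.1.surjective b
      refine (hh.endpoint a r).trans ?_
      rw [hg.endpoint, Sum.map_map]
      simp only [relabelTrans, Equiv.coe_fn_mk, Equiv.coe_trans, Bool.xor_assoc, Function.id_comp]
  · intro hh
    refine ⟨fun hc a => ?_, fun a r => ?_⟩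
    · simp [relabelTrans, hg.direction hc a, hh.direction hc]
    · refine (hh.endpoint (g.2.1 a) r).trans ?_
      rw [hg.endpoint, Sum.map_map]
      simp only [relabelTrans, Equiv.coe_fn_mk, Equiv.coe_trans, Bool.xor_assoc, Function.id_comp]

theorem IsIso.symm {g : (V ≃ V') × (E ≃ E') × (E → Bool)} (hg : IsIso c Γ Γ' g) :
    IsIso c Γ' Γ (relabelSymm g) := by
  refine ⟨fun hc b => hg.direction hc _, fun b r => ?_⟩
  obtain ⟨a, rfl⟩ := g.2.1.surjective b
  simp only [relabelSymm, Equiv.coe_fn_mk, Equiv.symm_apply_apply]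
  rw [hg.endpoint, Sum.map_map]
  simp

theorem isIso_relabel (g : (V ≃ V') × (E ≃ E') × (E → Bool))
    (hg : c = .oriented → ∀ a, g.2.2 a = false) : IsIso c Γ (Γ.relabel g.1 g.2.1 g.2.2) g :=
  ⟨hg, fun _ _ => endpoint_relabel ..⟩

theorem IsIso.eq_relabel {g : (V ≃ V') × (E ≃ E') × (E → Bool)} (hg : IsIso c Γ Γ' g) :
    Γ' = Γ.relabel g.1 g.2.1 g.2.2 := HairyGraph.eq_relabel hg.endpoint

theorem IsIso.isAdmissible_iff [Finite E] {g : (V ≃ V') × (E ≃ E') × (E → Bool)}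
    (hg : IsIso c Γ Γ' g) : Γ'.IsAdmissible c ↔ Γ.IsAdmissible c := by
  rw [hg.eq_relabel, isAdmissible_relabel_iff _ _ _ hg.direction]

end HairyGraph

section Sign

variable {V E V' E' V'' E'' : Type*} [Fintype V] [LinearOrder V] [Fintype E] [LinearOrder E]
    [Fintype V'] [LinearOrder V'] [Fintype E'] [LinearOrder E']
    [Fintype V''] [LinearOrder V''] [Fintype E''] [LinearOrder E''] (n : ℤ)

theorem orientSign_relabelTrans (g : (V ≃ V') × (E ≃ E') × (E → Bool))
    (h : (V' ≃ V'') × (E' ≃ E'') × (E' → Bool)) :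
    orientSign n (relabelTrans g h).1 (relabelTrans g h).2.1 (relabelTrans g h).2.2 =
      orientSign n g.1 g.2.1 g.2.2 * orientSign n h.1 h.2.1 h.2.2 := by
  simp only [orientSign, relabelTrans, Equiv.coe_fn_mk, sgn_trans]
  split_ifs
  · rfl
  · rw [← g.2.1.prod_comp fun b => if h.2.2 b = true then (-1 : ℤ) else 1, mul_mul_mul_comm,
      ← Finset.prod_mul_distrib]
    congr 1
    refine Finset.prod_congr rfl fun a _ => ?_
    rcases Bool.eq_false_or_eq_true (g.2.2 a) with h1 | h1 <;>
      rcases Bool.eq_false_or_eq_true (h.2.2 (g.2.1 a)) with h2 | h2 <;> simp [h1, h2]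

theorem orientSign_relabelSymm (g : (V ≃ V') × (E ≃ E') × (E → Bool)) :
    orientSign n (relabelSymm g).1 (relabelSymm g).2.1 (relabelSymm g).2.2 =
      orientSign n g.1 g.2.1 g.2.2 := by
  simp only [orientSign, relabelSymm, Equiv.coe_fn_mk, sgn_symm]
  rw [← g.2.1.prod_comp]
  simp

end Sign

section IsoSum

variable {V E V' E' V'' E'' : Type*} [Fintype V] [LinearOrder V] [Fintype E] [LinearOrder E]
    [Fintype V'] [LinearOrder V'] [Fintype E'] [LinearOrder E']
    [Fintype V''] [LinearOrder V''] [Fintype E''] [LinearOrder E''] {S : Type w}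
    (c : Flavor) (n : ℤ)

open Classical in
/-- The sum of the signs of all isomorphisms. -/
def isoSum (Γ : HairyGraph V E S) (Γ' : HairyGraph V' E' S) : ℤ :=
  ∑ g : (V ≃ V') × (E ≃ E') × (E → Bool),
    if IsIso c Γ Γ' g then orientSign n g.1 g.2.1 g.2.2 else 0

variable {c n} {Γ : HairyGraph V E S} {Γ' : HairyGraph V' E' S} {Γ'' : HairyGraph V'' E'' S}

theorem isoSum_comm : isoSum c n Γ Γ' = isoSum c n Γ' Γ := by
  classical
  refine Fintype.sum_equiv relabelSymm _ _ fun g => ?_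
  rw [orientSign_relabelSymm]
  refine if_congr ⟨IsIso.symm, fun h => ?_⟩ rfl rfl
  have := h.symm
  rwa [show relabelSymm (relabelSymm g) = g from relabelSymm.left_inv g] at this

theorem isoSum_eq_of_isIso {g : (V ≃ V') × (E ≃ E') × (E → Bool)} (hg : IsIso c Γ Γ' g) :
    isoSum c n Γ' Γ'' = orientSign n g.1 g.2.1 g.2.2 * isoSum c n Γ Γ'' := by
  classical
  rw [isoSum, isoSum, Finset.mul_sum]
  refine Fintype.sum_equiv (relabelTrans g) _ _ fun h => ?_
  rw [orientSign_relabelTrans, mul_ite, mul_zero, ← mul_assoc, orientSign_mul_self, one_mul]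
  exact if_congr (hg.relabelTrans_iff h).symm rfl rfl

theorem isoSum_eq_zero (h : ∀ g, ¬ IsIso c Γ Γ' g) : isoSum c n Γ Γ' = 0 :=
  Finset.sum_eq_zero fun g _ => if_neg (h g)

end IsoSum

section Pairing

variable (K : Type u) [Field K] (c : Flavor) (n : ℤ) {S : Type w}

/-- The pairing of two labelled graphs is the sum of the signs of their isomorphisms. -/
def pairingFree (k : ℤ) {V E : Type*} [Fintype V] [LinearOrder V] [Fintype E] [LinearOrder E]
    (Γ : HairyGraph V E S) : FreeGraphs K c n S k →ₗ[K] K :=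
  Finsupp.linearCombination K fun Δ => (isoSum c n Γ Δ.1.graph : K)

theorem signRelations_le_ker {M : Type*} [AddCommGroup M] [Module K M] {k : ℤ}
    (f : FreeGraphs K c n S k →ₗ[K] M)
    (hf : ∀ (v e : ℕ) (Γ Γ' : HairyGraph (Fin v) (Fin e) S)
      (h : Γ.IsAdmissible c) (h' : Γ'.IsAdmissible c)
      (hk : LabelledGraph.degree n ⟨v, e, Γ, h⟩ = k)
      (hk' : LabelledGraph.degree n ⟨v, e, Γ', h'⟩ = k) (g), IsIso c Γ Γ' g →
      f (Finsupp.single ⟨⟨v, e, Γ', h'⟩, hk'⟩ 1) = (orientSign n g.1 g.2.1 g.2.2 : K) •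
        f (Finsupp.single ⟨⟨v, e, Γ, h⟩, hk⟩ 1)) :
    signRelations K c n S k ≤ LinearMap.ker f := by
  refine Submodule.span_le.2 ?_
  rintro _ ⟨v, e, Γ, Γ', h, h', hk, hk', σ, ρ, ε, hc, rfl, rfl⟩
  rw [SetLike.mem_coe, LinearMap.mem_ker, map_sub, map_smul, sub_eq_zero,
    ← orientSign_eq_relabelSign]
  exact hf v e Γ _ h h' hk hk' (σ, ρ, ε) (isIso_relabel (c := c) (Γ := Γ) (σ, ρ, ε) hc)

/-- The functional on a graph complex which is given by the pairing with a graph. -/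
def pairingWith (k : ℤ) {V E : Type*} [Fintype V] [LinearOrder V] [Fintype E] [LinearOrder E]
    (Γ : HairyGraph V E S) : GraphSpace K c n S k →ₗ[K] K :=
  Submodule.liftQ _ (pairingFree K c n k Γ) <|
    signRelations_le_ker K c n _ fun v e Δ Δ' _ _ _ _ g hg => by
    simp only [pairingFree, Finsupp.linearCombination_single, one_smul]
    rw [isoSum_comm, isoSum_eq_of_isIso hg, isoSum_comm, Int.cast_mul, smul_eq_mul]

theorem pairingWith_mk {k : ℤ} {V E : Type*} [Fintype V] [LinearOrder V] [Fintype E] [LinearOrder E]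
    (Γ : HairyGraph V E S) (Δ : {Γ : LabelledGraph c S // Γ.degree n = k}) :
    pairingWith K c n k Γ (Submodule.Quotient.mk (Finsupp.single Δ 1)) =
      isoSum c n Γ Δ.1.graph := by
  refine (Finsupp.linearCombination_single ..).trans ?_
  rw [one_smul]

/-- The symmetric bilinear form that counts isomorphisms with signs. -/
def pairing (k : ℤ) : GraphSpace K c n S k →ₗ[K] GraphSpace K c n S k →ₗ[K] K :=
  Submodule.liftQ _ (Finsupp.linearCombination K fun Δ => pairingWith K c n k Δ.1.graph) <|
    signRelations_le_ker K c n _ fun v e Δ Δ' _ _ _ _ g hg => by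
      simp only [Finsupp.linearCombination_single, one_smul]
      refine Submodule.linearMap_qext _ (Finsupp.lhom_ext' fun Γ => LinearMap.ext_ring ?_)
      simp only [LinearMap.comp_apply, Finsupp.lsingle_apply, Submodule.mkQ_apply,
        LinearMap.smul_apply]
      rw [pairingWith_mk, pairingWith_mk, isoSum_eq_of_isIso hg, Int.cast_mul, smul_eq_mul]

variable {K c n}
variable {V E V' E' : Type*} [Fintype V] [LinearOrder V] [Fintype E] [LinearOrder E]
    [Fintype V'] [LinearOrder V'] [Fintype E'] [LinearOrder E']

theorem pairing_comm {k : ℤ} (x y : GraphSpace K c n S k) :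
    pairing K c n k x y = pairing K c n k y x := by
  suffices h : pairing K c n k = (pairing K c n k (S := S)).flip by
    conv_lhs => rw [h]
    rfl
  refine Submodule.linearMap_qext _ (Finsupp.lhom_ext' fun Γ => LinearMap.ext_ring ?_)
  refine Submodule.linearMap_qext _ (Finsupp.lhom_ext' fun Γ' => LinearMap.ext_ring ?_)
  have h : ∀ Γ Γ' : {Γ : LabelledGraph c S // Γ.degree n = k},
      pairing K c n k (Submodule.Quotient.mk (Finsupp.single Γ 1))
        (Submodule.Quotient.mk (Finsupp.single Γ' 1)) = isoSum c n Γ.1.graph Γ'.1.graph := by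
    intro Γ Γ'
    rw [← pairingWith_mk K c n Γ.1.graph Γ']
    refine LinearMap.congr_fun ((Finsupp.linearCombination_single ..).trans ?_) _
    rw [one_smul]
  refine (h Γ Γ').trans ?_
  rw [isoSum_comm]
  exact (h Γ' Γ).symm

theorem isIso_numbered (Γ : HairyGraph V E S) : IsIso c Γ Γ.numbered
    ((monoEquivOfFin V rfl).symm.toEquiv, (monoEquivOfFin E rfl).symm.toEquiv, fun _ => false) :=
  isIso_relabel (c := c) (Γ := Γ) ((monoEquivOfFin V rfl).symm.toEquiv,
    (monoEquivOfFin E rfl).symm.toEquiv, fun _ => false) fun _ _ => rfl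

theorem isoSum_numbered (Γ : HairyGraph V E S) (Γ' : HairyGraph V' E' S) :
    isoSum c n Γ.numbered Γ' = isoSum c n Γ Γ' := by
  rw [isoSum_eq_of_isIso (isIso_numbered Γ), orientSign, sgn_of_strictMono, sgn_of_strictMono]
  · simp
  · exact (monoEquivOfFin V rfl).symm.strictMono
  · exact (monoEquivOfFin E rfl).symm.strictMono

theorem pairing_graphClass {k : ℤ} {Γ : HairyGraph V E S} {Γ' : HairyGraph V' E' S}
    (h' : Γ'.IsAdmissible c)
    (hk' : (n - 1) * (Fintype.card E' : ℤ) - n * (Fintype.card V' : ℤ) = k) :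
    pairing K c n k (graphClass K c n k Γ) (graphClass K c n k Γ') = isoSum c n Γ Γ' := by
  by_cases hΓ : Γ.IsAdmissible c ∧
      (n - 1) * (Fintype.card E : ℤ) - n * (Fintype.card V : ℤ) = k
  · have h1 := (isIso_numbered (c := c) Γ).isAdmissible_iff.2 hΓ.1
    have h2 := (isIso_numbered (c := c) Γ').isAdmissible_iff.2 h'
    rw [graphClass, dif_pos ⟨h1, hΓ.2⟩, graphClass, dif_pos ⟨h2, hk'⟩, ← isoSum_numbered,
      isoSum_comm, ← isoSum_numbered, isoSum_comm]
    refine (LinearMap.congr_fun ((Finsupp.linearCombination_single ..).trans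
      (one_smul ..)) _).trans ?_
    exact pairingWith_mk ..
  · rw [isoSum_eq_zero, Int.cast_zero]
    · rw [show graphClass K c n k Γ = 0 from ?_, map_zero, LinearMap.zero_apply]
      by_cases h1 : Γ.IsAdmissible c
      · exact graphClass_eq_zero K c n (S := S) Γ fun h2 => hΓ ⟨h1, h2⟩
      · exact graphClass_eq_zero_of_not_isAdmissible h1
    · intro g hg
      refine hΓ ⟨hg.isAdmissible_iff.1 h', ?_⟩
      rw [Fintype.card_congr g.1, Fintype.card_congr g.2.1, hk']

end Pairing

/-! ### Isomorphisms of zigzag graphs -/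

theorem exists_sumCongr_eq {A B A' B' : Type*} (f : A ⊕ₗ B ≃ A' ⊕ₗ B')
    (hl : ∀ a, ∃ a', f (toLex (Sum.inl a)) = toLex (Sum.inl a'))
    (hr : ∀ b, ∃ b', f (toLex (Sum.inr b)) = toLex (Sum.inr b')) :
    ∃ (σ : A ≃ A') (τ : B ≃ B'), (∀ a, f (toLex (Sum.inl a)) = toLex (Sum.inl (σ a))) ∧
      ∀ b, f (toLex (Sum.inr b)) = toLex (Sum.inr (τ b)) := by
  choose σ hσ using hl
  choose τ hτ using hr
  have hbij : Function.Bijective σ := by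
    refine ⟨fun a b hab => ?_, fun a' => ?_⟩
    · have := f.injective ((hσ a).trans (hab ▸ (hσ b).symm))
      simpa using this
    · obtain ⟨x, hx⟩ := f.surjective (toLex (Sum.inl a'))
      induction x using Lex.rec with | _ x
      rcases x with a | b
      · rw [hσ] at hx
        exact ⟨a, by simpa using hx⟩
      · rw [hτ] at hx
        simp at hx
  have hbij' : Function.Bijective τ := by
    refine ⟨fun a b hab => ?_, fun a' => ?_⟩
    · have := f.injective ((hτ a).trans (hab ▸ (hτ b).symm))
      simpa using this
    · obtain ⟨x, hx⟩ := f.surjective (toLex (Sum.inr a'))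
      induction x using Lex.rec with | _ x
      rcases x with a | b
      · rw [hσ] at hx
        simp at hx
      · rw [hτ] at hx
        exact ⟨b, by simpa using hx⟩
  exact ⟨Equiv.ofBijective σ hbij, Equiv.ofBijective τ hbij', hσ, hτ⟩

namespace HairyGraph

variable {V E V' E' S : Type*} {Γ : HairyGraph V E S} {Γ' : HairyGraph V' E' S}
    {st : E → Option Bool} {st' : E' → Option Bool}

/-- An isomorphism of zigzag graphs comes from an isomorphism of the underlying partially directed
graphs, because the midpoints of zigzags are the bivalent vertices. -/
theorem exists_isStateIso [Finite E] [Finite E'] (h3 : ∀ v, Γ.valency (Sum.inl v) ≠ 2)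
    (h3' : ∀ v, Γ'.valency (Sum.inl v) ≠ 2)
    (g' : (V ⊕ₗ {a // st a = none} ≃ V' ⊕ₗ {b // st' b = none}) ×
      ({a // st a ≠ none} ⊕ₗ ({a // st a = none} ×ₗ Bool) ≃
        {b // st' b ≠ none} ⊕ₗ ({b // st' b = none} ×ₗ Bool)) ×
      ({a // st a ≠ none} ⊕ₗ ({a // st a = none} ×ₗ Bool) → Bool))
    (hg' : IsIso .oriented (Γ.zigzagGraph st) (Γ'.zigzagGraph st') g') :
    ∃ (σ : V ≃ V') (ρ : E ≃ E') (ε : E → Bool) (ρD : {a // st a ≠ none} ≃ {b // st' b ≠ none})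
      (ρZ : {a // st a = none} ≃ {b // st' b = none}), IsStateIso Γ st Γ' st' σ ρ ε ∧
        (∀ a, (ρD a : E') = ρ a) ∧
      (∀ a, (ρZ a : E') = ρ a) ∧ zigzagVertexEquiv σ ρZ = g'.1 ∧
      zigzagEdgeEquiv ε ρD ρZ = g'.2.1 ∧ ∀ a, g'.2.2 a = false := by
  obtain ⟨σ', ρ', ε'⟩ := g'
  have hε' : ∀ a, ε' a = false := hg'.direction rfl
  have hend : ∀ e r, (Γ'.zigzagGraph st').endpoint (ρ' e) r =
      Sum.map σ' id ((Γ.zigzagGraph st).endpoint e r) := fun e r => by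
    have := hg'.endpoint e r
    simpa only [hε', Bool.false_xor] using this
  have hval : ∀ x, (Γ'.zigzagGraph st').valency (Sum.inl (σ' x)) =
      (Γ.zigzagGraph st).valency (Sum.inl x) := by
    intro x
    have : Finite ({a // st a ≠ none} ⊕ₗ ({a // st a = none} ×ₗ Bool)) :=
      inferInstanceAs (Finite ({a // st a ≠ none} ⊕ ({a // st a = none} × Bool)))
    rw [hg'.eq_relabel]
    exact valency_relabel _ σ' ρ' ε' (Sum.inl x)
  have hmid : ∀ (z : {a // st a = none}),
      (Γ.zigzagGraph st).valency (Sum.inl (toLex (Sum.inr z))) = 2 := fun z => by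
    rw [valency, outDeg_zigzagGraph_midpoint, inDeg_zigzagGraph_midpoint]
  have hmid' : ∀ (z : {a // st' a = none}),
      (Γ'.zigzagGraph st').valency (Sum.inl (toLex (Sum.inr z))) = 2 := fun z => by
    rw [valency, outDeg_zigzagGraph_midpoint, inDeg_zigzagGraph_midpoint]
  obtain ⟨σ, ρZ, hσ, hρZ⟩ := exists_sumCongr_eq σ' (fun v => by
    rcases h : ofLex (σ' (toLex (Sum.inl v))) with v' | z
    · exact ⟨v', h⟩
    · have h1 := hval (toLex (Sum.inl v))
      rw [show σ' (toLex (Sum.inl v)) = toLex (Sum.inr z) from h, hmid',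
        ← coreVertex_inl, valency_zigzagGraph] at h1
      exact absurd h1.symm (h3 v)) fun z => by
    rcases h : ofLex (σ' (toLex (Sum.inr z))) with v' | z
    · have h1 := hval (toLex (Sum.inr z))
      rw [show σ' (toLex (Sum.inr z)) = toLex (Sum.inl v') from h, hmid,
        ← coreVertex_inl, valency_zigzagGraph] at h1
      exact absurd h1 (h3' v')
    · exact ⟨z, h⟩
  have hcore : ∀ x : V ⊕ S, Sum.map σ' id (coreVertex st x) = coreVertex st' (Sum.map σ id x) := by
    rintro (v | s)
    · exact congrArg Sum.inl (hσ v)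
    · rfl
  obtain ⟨ρD, ρ2, hρD, hρ2⟩ := exists_sumCongr_eq ρ' (fun a => by
    rcases h : ofLex (ρ' (toLex (Sum.inl a))) with d | q
    · exact ⟨d, h⟩
    · obtain ⟨r, hr⟩ := Option.ne_none_iff_exists'.1 a.2
      have h1 := hend (toLex (Sum.inl a)) false
      rw [show ρ' (toLex (Sum.inl a)) = toLex (Sum.inr (toLex (ofLex q))) from h,
        zigzagGraph_endpoint_inr_false, zigzagGraph_endpoint_inl Γ hr, hcore] at h1
      exact absurd h1.symm (coreVertex_ne st' _ _)) fun q => by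
    rcases h : ofLex (ρ' (toLex (Sum.inr q))) with d | q'
    · obtain ⟨r, hr⟩ := Option.ne_none_iff_exists'.1 d.2
      have h1 := hend (toLex (Sum.inr (toLex (ofLex q)))) false
      rw [show ρ' (toLex (Sum.inr (toLex (ofLex q)))) = toLex (Sum.inl d) from h,
        zigzagGraph_endpoint_inr_false, zigzagGraph_endpoint_inl Γ' hr, Sum.map_inl, hρZ] at h1
      exact absurd h1 (coreVertex_ne st' _ _)
    · exact ⟨q', h⟩
  have hfst : ∀ z b, (ofLex (ρ2 (toLex (z, b)))).1 = ρZ z := by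
    intro z b
    have h1 := hend (toLex (Sum.inr (toLex (z, b)))) false
    rw [hρ2, ← toLex_ofLex (ρ2 (toLex (z, b))), zigzagGraph_endpoint_inr_false,
      zigzagGraph_endpoint_inr_false, Sum.map_inl, hρZ] at h1
    simpa using h1
  let η : {a // st a = none} → Bool := fun z => (ofLex (ρ2 (toLex (z, false)))).2
  have hρ2' : ∀ z b, ρ2 (toLex (z, b)) = toLex (ρZ z, xor (η z) b) := by
    have h1 : ∀ z b, ρ2 (toLex (z, b)) = toLex (ρZ z, (ofLex (ρ2 (toLex (z, b)))).2) :=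
      fun z b => by rw [← hfst z b]; rfl
    intro z b
    rw [h1]
    cases b
    · simp [η]
    · by_contra hne
      have h2 : (ofLex (ρ2 (toLex (z, true)))).2 = η z := by
        by_contra h3
        exact hne (by rw [Bool.eq_not.2 h3, Bool.xor_true])
      have h4 := h1 z true
      rw [h2, ← h1 z false] at h4
      simpa using ρ2.injective h4
  let ρ : E ≃ E' := ((splitEquiv st).trans (ofLex.trans ((Equiv.sumCongr ρD ρZ).trans toLex))).trans
    (splitEquiv st').symm
  have hρd : ∀ a, (ρD a : E') = ρ a := fun a => by
    simp only [ρ, Equiv.trans_apply, splitEquiv_ne_none a.2]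
    rfl
  have hρz : ∀ a, (ρZ a : E') = ρ a := fun a => by
    simp only [ρ, Equiv.trans_apply, splitEquiv_none a.2]
    rfl
  let ε : E → Bool := fun a => if h : st a = none then η ⟨a, h⟩
    else xor ((st a).getD false) ((st' (ρ a)).getD false)
  have hεz : ∀ z : {a // st a = none}, ε z = η z := fun z => dif_pos z.2
  refine ⟨σ, ρ, ε, ρD, ρZ, ⟨fun a r => ?_, fun a => ?_⟩, hρd, hρz, ?_, ?_, hε'⟩
  · by_cases ha : st a = none
    · have h1 := hend (toLex (Sum.inr (toLex (⟨a, ha⟩, xor (ε a) r)))) true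
      rw [hρ2, hρ2', zigzagGraph_endpoint_inr_true, zigzagGraph_endpoint_inr_true, hcore] at h1
      have h2 := coreVertex_injective st' h1
      rw [← hεz] at h2
      simpa [hρz] using h2
    · obtain ⟨r1, hr1⟩ := Option.ne_none_iff_exists'.1 ha
      obtain ⟨r2, hr2⟩ := Option.ne_none_iff_exists'.1 (ρD ⟨a, ha⟩).2
      have h1 := hend (toLex (Sum.inl ⟨a, ha⟩)) (xor r2 r)
      rw [hρD, zigzagGraph_endpoint_inl Γ hr1] at h1
      have h1' := (zigzagGraph_endpoint_inl Γ' hr2 (xor r2 r)).symm.trans h1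
      rw [hcore] at h1'
      have h2 := coreVertex_injective st' h1'
      rw [hρd] at h2 hr2
      simp only [ε, dif_neg ha]
      rw [hr1, hr2]
      rw [← Bool.xor_assoc, Bool.xor_self, Bool.false_xor, ← Bool.xor_assoc] at h2
      exact h2
  · by_cases ha : st a = none
    · rw [ha, ← hρz ⟨a, ha⟩]
      exact (ρZ ⟨a, ha⟩).2
    · obtain ⟨r1, hr1⟩ := Option.ne_none_iff_exists'.1 ha
      obtain ⟨r2, hr2⟩ := Option.ne_none_iff_exists'.1 (ρD ⟨a, ha⟩).2
      rw [hρd] at hr2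
      simp only [ε, dif_neg ha]
      rw [hr1, hr2]
      cases r1 <;> cases r2 <;> rfl
  · ext x
    induction x using Lex.rec with | _ x
    rcases x with v | z
    · exact (hσ v).symm
    · exact (hρZ z).symm
  · ext x
    induction x using Lex.rec with | _ x
    rcases x with d | q
    · exact (hρD d).symm
    · refine Eq.trans ?_ (hρ2 q).symm
      rw [← toLex_ofLex q, hρ2' (ofLex q).1 (ofLex q).2, ← hεz]
      rfl

end HairyGraph

section StateSum

variable {V E V' E' : Type*} [Fintype V] [LinearOrder V] [Fintype E] [LinearOrder E]
    [Fintype V'] [LinearOrder V'] [Fintype E'] [LinearOrder E'] {S : Type w}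

open Classical in
/-- The sign of the bijection between directed edges that is induced by a bijection of edges. -/
def dirSgn (st : E → Option Bool) (st' : E' → Option Bool) (ρ : E ≃ E') : ℤ :=
  if h : ∀ a, st a ≠ none ↔ st' (ρ a) ≠ none then
    sgn (ρ.subtypeEquiv (p := fun a => st a ≠ none) (q := fun b => st' b ≠ none) h) else 0

theorem dirSgn_eq {st : E → Option Bool} {st' : E' → Option Bool} {ρ : E ≃ E'}
    {ρD : {a // st a ≠ none} ≃ {b // st' b ≠ none}} (hρD : ∀ a, (ρD a : E') = ρ a) :
    dirSgn st st' ρ = sgn ρD := by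
  have h : ∀ a, st a ≠ none ↔ st' (ρ a) ≠ none := fun a => by
    refine ⟨fun ha => hρD ⟨a, ha⟩ ▸ (ρD ⟨a, ha⟩).2, fun ha => ?_⟩
    obtain ⟨b, hb⟩ := ρD.surjective ⟨ρ a, ha⟩
    have h1 := hρD b
    rw [hb] at h1
    exact ρ.injective h1 ▸ b.2
  rw [dirSgn, dif_pos h]
  congr 1
  ext a : 1
  exact Subtype.ext (hρD a).symm

/-- The sign by which an isomorphism of partially directed graphs acts. -/
def stateSign (n : ℤ) (st : E → Option Bool) (st' : E' → Option Bool)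
    (g : (V ≃ V') × (E ≃ E') × (E → Bool)) : ℤ :=
  orientSign n g.1 g.2.1 g.2.2 * (sgn g.1 * dirSgn st st' g.2.1)

variable {Γ : HairyGraph V E S} {Γ' : HairyGraph V' E' S} {st : E → Option Bool}
    {st' : E' → Option Bool} (n : ℤ)

theorem HairyGraph.IsStateIso.stateSign_mul_self {g : (V ≃ V') × (E ≃ E') × (E → Bool)}
    (h : IsStateIso Γ st Γ' st' g.1 g.2.1 g.2.2) :
    stateSign n st st' g * stateSign n st st' g = 1 := by
  obtain ⟨ρD, hρD⟩ := h.exists_dirEquiv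
  rw [stateSign, dirSgn_eq hρD, mul_mul_mul_comm, orientSign_mul_self, mul_mul_mul_comm,
    sgn_mul_self, sgn_mul_self]
  rfl

variable (K : Type u) [Field K] in
theorem HairyGraph.IsStateIso.zigzagClass_eq {k : ℤ} {g : (V ≃ V') × (E ≃ E') × (E → Bool)}
    (h : IsStateIso Γ st Γ' st' g.1 g.2.1 g.2.2) :
    zigzagClass K n k Γ' st' = (stateSign n st st' g : K) • zigzagClass K n k Γ st := by
  obtain ⟨ρD, hρD⟩ := h.exists_dirEquiv
  rw [stateSign, dirSgn_eq hρD]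
  exact zigzagClass_relabel K n k _ _ _ h.endpoint h.state ρD hρD

open Classical in
/-- The sum of the signs of all isomorphisms of partially directed graphs. -/
def stateSum (Γ : HairyGraph V E S) (st : E → Option Bool) (Γ' : HairyGraph V' E' S)
    (st' : E' → Option Bool) : ℤ :=
  ∑ g : (V ≃ V') × (E ≃ E') × (E → Bool),
    if IsStateIso Γ st Γ' st' g.1 g.2.1 g.2.2 then stateSign n st st' g else 0

theorem isoSum_zigzagGraph (h3 : ∀ v, Γ.valency (Sum.inl v) ≠ 2)
    (h3' : ∀ v, Γ'.valency (Sum.inl v) ≠ 2) :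
    isoSum .oriented (n + 1) (Γ.zigzagGraph st) (Γ'.zigzagGraph st') =
      normSign n st * normSign n st' * stateSum n Γ st Γ' st' := by
  classical
  rw [stateSum, Finset.mul_sum, isoSum, ← Finset.sum_filter]
  simp only [mul_ite, mul_zero]
  rw [← Finset.sum_filter]
  symm
  have hD : ∀ g : (V ≃ V') × (E ≃ E') × (E → Bool),
      IsStateIso Γ st Γ' st' g.1 g.2.1 g.2.2 → ∀ a, st a ≠ none ↔ st' (g.2.1 a) ≠ none :=
    fun g hg a => by rw [hg.state]; simp
  have hZ : ∀ g : (V ≃ V') × (E ≃ E') × (E → Bool),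
      IsStateIso Γ st Γ' st' g.1 g.2.1 g.2.2 → ∀ a, st a = none ↔ st' (g.2.1 a) = none :=
    fun g hg a => by rw [hg.state]; simp
  have hm : ∀ g : (V ≃ V') × (E ≃ E') × (E → Bool), g ∈ Finset.univ.filter
      (fun g => IsStateIso Γ st Γ' st' g.1 g.2.1 g.2.2) →
      IsStateIso Γ st Γ' st' g.1 g.2.1 g.2.2 := fun g hg => (Finset.mem_filter.1 hg).2
  refine Finset.sum_bij (fun g hg => (zigzagVertexEquiv g.1 (g.2.1.subtypeEquiv (hZ g (hm g hg))),
    zigzagEdgeEquiv g.2.2 (g.2.1.subtypeEquiv (hD g (hm g hg)))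
      (g.2.1.subtypeEquiv (hZ g (hm g hg))), fun _ => false)) ?_ ?_ ?_ ?_
  · intro g hg
    refine Finset.mem_filter.2 ⟨Finset.mem_univ _, fun _ _ => rfl, fun e r => ?_⟩
    rw [Bool.false_xor]
    exact zigzagEquiv_endpoint (hm g hg).endpoint (hm g hg).state (fun _ => rfl) (fun _ => rfl) e r
  · intro g hg g' hg' h
    have h1 := congrArg Prod.fst h
    have h2 := congrArg (fun x => x.2.1) h
    simp only at h1 h2
    have hD2 : ∀ a, st a ≠ none → g.2.1 a = g'.2.1 a := fun a ha => by
      have := Equiv.congr_fun h2 (toLex (Sum.inl ⟨a, ha⟩))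
      exact congrArg Subtype.val (Sum.inl_injective (toLex.injective this))
    have hZ2 : ∀ a, st a = none → g.2.1 a = g'.2.1 a ∧ g.2.2 a = g'.2.2 a := fun a ha => by
      have h3 := Equiv.congr_fun h2 (toLex (Sum.inr (toLex (⟨a, ha⟩, false))))
      have h4 := toLex.injective (Sum.inr_injective (toLex.injective h3))
      have h5 := congrArg Subtype.val (congrArg Prod.fst h4)
      have h6 : xor (g.2.2 a) false = xor (g'.2.2 a) false := congrArg Prod.snd h4
      exact ⟨h5, by simpa using h6⟩
    refine Prod.ext (Equiv.ext fun v => ?_) (Prod.ext (Equiv.ext fun a => ?_) (funext fun a => ?_))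
    · have := Equiv.congr_fun h1 (toLex (Sum.inl v))
      exact Sum.inl_injective (toLex.injective this)
    · by_cases ha : st a = none
      · exact (hZ2 a ha).1
      · exact hD2 a ha
    · by_cases ha : st a = none
      · exact (hZ2 a ha).2
      · have h3 := (hm g hg).state a
        rw [hD2 a ha, (hm g' hg').state] at h3
        obtain ⟨r, hr⟩ := Option.ne_none_iff_exists'.1 ha
        rw [hr] at h3
        simpa using h3.symm
  · intro g' hg'
    obtain ⟨σ, ρ, ε, ρD, ρZ, hiso, hρD, hρZ, h1, h2, h4⟩ :=
      exists_isStateIso h3 h3' g' (Finset.mem_filter.1 hg').2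
    refine ⟨(σ, ρ, ε), Finset.mem_filter.2 ⟨Finset.mem_univ _, hiso⟩, ?_⟩
    have hZ' : ρ.subtypeEquiv (hZ (σ, ρ, ε) hiso) = ρZ :=
      Equiv.ext fun a => Subtype.ext (hρZ a).symm
    have hD' : ρ.subtypeEquiv (hD (σ, ρ, ε) hiso) = ρD :=
      Equiv.ext fun a => Subtype.ext (hρD a).symm
    simp only [hZ', hD', h1, h2]
    exact Prod.ext rfl (Prod.ext rfl (funext fun a => (h4 a).symm))
  · intro g hg
    rw [stateSign, dirSgn_eq (ρD := g.2.1.subtypeEquiv (hD g (hm g hg))) fun _ => rfl]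
    exact (orientSign_zigzagEquiv n (hm g hg).state (fun _ => rfl) fun _ => rfl).symm

variable {n} in
theorem pairing_zigzagClass {K : Type u} [Field K] {k : ℤ} (h3 : ∀ v, Γ.valency (Sum.inl v) ≠ 2)
    (h3' : ∀ v, Γ'.valency (Sum.inl v) ≠ 2)
    (hadm : (Γ'.zigzagGraph st').IsAdmissible .oriented)
    (hk : (n - 1) * (Fintype.card E' : ℤ) - n * Fintype.card V' +
      (Fintype.card {a // st' a ≠ none} - Fintype.card V') = k) :
    pairing K .oriented (n + 1) k (zigzagClass K n k Γ st) (zigzagClass K n k Γ' st') =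
      stateSum n Γ st Γ' st' := by
  rw [zigzagClass, zigzagClass, map_smul, map_smul, LinearMap.smul_apply,
    pairing_graphClass hadm, isoSum_zigzagGraph n h3 h3', smul_smul, smul_eq_mul,
    ← Int.cast_mul, ← Int.cast_mul]
  · congr 1
    linear_combination (stateSum n Γ st Γ' st' * normSign n st' * normSign n st') *
      normSign_mul_self n st + stateSum n Γ st Γ' st' * normSign_mul_self n st'
  · rw [← hk]
    have := card_eq_card_dir_add st'
    simp only [Fintype.card_lex, Fintype.card_sum, Fintype.card_prod, Fintype.card_bool]
    rw [this]
    push_cast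
    ring

end StateSum

/-! ### Every oriented graph is a zigzag graph -/

namespace HairyGraph

section Unzip

variable {V₀ E₀ : Type} {S : Type w} {Δ : HairyGraph V₀ E₀ S}

theorem IsAdmissible.bivalent_isSource [Finite E₀] (h : Δ.IsAdmissible .oriented) {x : V₀}
    (hx : Δ.valency (Sum.inl x) = 2) :
    Δ.outDeg (Sum.inl x) = 2 ∧ ∀ b, Δ.tgt b ≠ Sum.inl x := by
  obtain ⟨-, -, -, h4, h5, -⟩ := h
  have h1 := h4 x
  have h2 := h5 x
  rw [valency] at hx
  have h3 : Δ.inDeg (Sum.inl x) = 0 := by omega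
  refine ⟨by omega, fun b hb => ?_⟩
  rw [inDeg, Finite.card_eq_zero_iff] at h3
  exact h3.elim ⟨b, hb⟩

/-- An oriented-admissible graph is a zigzag graph, with the bivalent vertices as midpoints of
zigzags. -/
theorem IsAdmissible.exists_zigzagGraph [Finite V₀] [Finite E₀] (h : Δ.IsAdmissible .oriented) :
    ∃ (V E : Type) (_ : Finite V) (_ : Finite E) (Γ : HairyGraph V E S) (st : E → Option Bool)
      (σ : V ⊕ₗ {a // st a = none} ≃ V₀)
      (ρ : {a // st a ≠ none} ⊕ₗ ({a // st a = none} ×ₗ Bool) ≃ E₀),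
      Γ.IsAdmissible .undirected ∧
        IsIso .oriented (Γ.zigzagGraph st) Δ (σ, ρ, fun _ => false) := by
  classical
  let p : V₀ → Prop := fun x => Δ.valency (Sum.inl x) ≠ 2
  let P : E₀ → Prop := fun a => ∃ z : {x // ¬ p x}, Δ.src a = Sum.inl z.1
  have hsource : ∀ z : {x // ¬ p x}, Δ.outDeg (Sum.inl z.1) = 2 ∧ ∀ b, Δ.tgt b ≠ Sum.inl z.1 :=
    fun z => h.bivalent_isSource (not_not.1 z.2)
  have hhalf : ∀ z : {x // ¬ p x}, Nonempty (Bool ≃ {a // Δ.src a = Sum.inl z.1}) := by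
    intro z
    have := Fintype.ofFinite {a // Δ.src a = Sum.inl z.1}
    have h1 := (hsource z).1
    rw [outDeg, Nat.card_eq_fintype_card] at h1
    exact ⟨Fintype.equivOfCardEq (by rw [h1, Fintype.card_bool])⟩
  let half := fun z => (hhalf z).some
  have hcore : ∀ x : V₀ ⊕ S, (∀ z : {x // ¬ p x}, x ≠ Sum.inl z.1) →
      ∃ y : {x // p x} ⊕ S, Sum.map Subtype.val id y = x := by
    rintro (x | s) hx
    · by_cases hp : p x
      · exact ⟨Sum.inl ⟨x, hp⟩, rfl⟩
      · exact absurd rfl (hx ⟨x, hp⟩)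
    · exact ⟨Sum.inr s, rfl⟩
  choose s hs using fun d : {a // ¬ P a} => hcore (Δ.src d) fun z hz => d.2 ⟨z, hz⟩
  choose t ht using fun a : E₀ => hcore (Δ.tgt a) fun z => (hsource z).2 a
  let Γ : HairyGraph {x // p x} ({a // ¬ P a} ⊕ {x // ¬ p x}) S :=
    { src := Sum.elim s fun z => t (half z false)
      tgt := Sum.elim (fun d => t d) fun z => t (half z true) }
  let st : {a // ¬ P a} ⊕ {x // ¬ p x} → Option Bool := Sum.elim (fun _ => some false) fun _ => none
  let ζ : {x // ¬ p x} ≃ {a // st a = none} := Equiv.ofBijective (fun z => ⟨Sum.inr z, rfl⟩) (by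
    refine ⟨fun x y hxy => Sum.inr_injective (congrArg Subtype.val hxy), ?_⟩
    rintro ⟨d | z, h⟩
    · cases h
    · exact ⟨z, rfl⟩)
  let δ : {a // ¬ P a} ≃ {a // st a ≠ none} :=
    Equiv.ofBijective (fun d => ⟨Sum.inl d, fun h => by cases h⟩) (by
    refine ⟨fun x y hxy => Sum.inl_injective (congrArg Subtype.val hxy), ?_⟩
    rintro ⟨d | z, h⟩
    · exact ⟨d, rfl⟩
    · exact absurd rfl h)
  let η : {x // ¬ p x} × Bool ≃ {a // P a} :=
    Equiv.ofBijective (fun q => ⟨half q.1 q.2, q.1, (half q.1 q.2).2⟩) (by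
    refine ⟨?_, ?_⟩
    · rintro ⟨z, b⟩ ⟨z', b'⟩ hh
      have h1 := congrArg Subtype.val hh
      simp only at h1
      have h2 := (half z b).2.symm.trans ((congrArg Δ.src h1).trans (half z' b').2)
      obtain rfl : z = z' := Subtype.ext (Sum.inl_injective h2)
      rw [(half z).injective (Subtype.ext h1)]
    · rintro ⟨a, z, hz⟩
      obtain ⟨b, hb⟩ := (half z).surjective ⟨a, hz⟩
      have h1 := congrArg Subtype.val hb
      exact ⟨(z, b), Subtype.ext h1⟩)
  let σ : {x // p x} ⊕ₗ {a // st a = none} ≃ V₀ :=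
    (ofLex.trans (Equiv.sumCongr (Equiv.refl _) ζ.symm)).trans (Equiv.sumCompl p)
  let ρ : {a // st a ≠ none} ⊕ₗ ({a // st a = none} ×ₗ Bool) ≃ E₀ :=
    ((ofLex.trans (Equiv.sumCongr δ.symm
      (ofLex.trans ((Equiv.prodCongr ζ.symm (Equiv.refl Bool)).trans η)))).trans
      (Equiv.sumComm _ _)).trans (Equiv.sumCompl P)
  have hσ : ∀ x : {x // p x} ⊕ S, Sum.map σ id (coreVertex st x) = Sum.map Subtype.val id x := by
    rintro (v | s)
    · rfl
    · rfl
  have hσz : ∀ z, σ (toLex (Sum.inr (ζ z))) = z.1 := fun z => by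
    simp only [σ, Equiv.trans_apply, ofLex_toLex, Equiv.sumCongr_apply, Sum.map_inr,
      Equiv.symm_apply_apply]
    rfl
  have hρd : ∀ d, ρ (toLex (Sum.inl (δ d))) = d.1 := fun d => by
    simp only [ρ, Equiv.trans_apply, ofLex_toLex, Equiv.sumCongr_apply, Sum.map_inl,
      Equiv.symm_apply_apply]
    rfl
  have hρz : ∀ z b, ρ (toLex (Sum.inr (toLex (ζ z, b)))) = half z b := fun z b => by
    simp only [ρ, Equiv.trans_apply, ofLex_toLex, Equiv.sumCongr_apply, Sum.map_inr,
      Equiv.prodCongr_apply, Prod.map_apply, Equiv.symm_apply_apply]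
    rfl
  have hiso : IsIso .oriented (Γ.zigzagGraph st) Δ (σ, ρ, fun _ => false) := by
    refine ⟨fun _ _ => rfl, fun e r => ?_⟩
    simp only [Bool.false_xor]
    induction e using Lex.rec with | _ e
    rcases e with d | q
    · obtain ⟨d, rfl⟩ := δ.surjective d
      rw [hρd]
      refine Eq.trans ?_ (congrArg (Sum.map σ id)
        (zigzagGraph_endpoint_inl Γ (st := st) (a := Sum.inl d) (r := false) rfl r)).symm
      rw [hσ, Bool.false_xor]
      cases r
      · exact (hs d).symm
      · exact (ht d).symm
    · obtain ⟨⟨q, b⟩, rfl⟩ := toLex.surjective q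
      obtain ⟨z, rfl⟩ := ζ.surjective q
      rw [hρz]
      cases r
      · rw [zigzagGraph_endpoint_inr_false, Sum.map_inl, hσz]
        exact (half z b).2
      · rw [zigzagGraph_endpoint_inr_true, hσ]
        cases b <;> exact (ht _).symm
  have hfin : Finite ({a // st a ≠ none} ⊕ₗ ({a // st a = none} ×ₗ Bool)) :=
    Finite.of_equiv _ ρ.symm
  have hadm := hiso.isAdmissible_iff.1 h
  refine ⟨_, _, inferInstance, inferInstance, Γ, st, σ, ρ,
    IsAdmissible.of_zigzagGraph (Γ := Γ) (st := st) hadm fun v => ?_, hiso⟩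
  have h1 : Δ.valency (Sum.inl (v : V₀)) =
      (Γ.zigzagGraph st).valency (coreVertex st (Sum.inl v)) := by
    rw [hiso.eq_relabel]
    exact valency_relabel _ σ ρ _ (coreVertex st (Sum.inl v))
  rw [← valency_zigzagGraph (st := st), ← h1]
  exact v.2

end Unzip

end HairyGraph

/-! ### Decomposition by the numbers of vertices and edges -/

section Levels

variable {K M ι : Type*} [Field K] [AddCommGroup M] [Module K M] {W : ι → Type*}
    (g : ∀ i, W i → M)

variable (K) in
/-- The span of the families with indices in `A`. -/
def levelSpan (A : Finset ι) : Submodule K M :=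
  Submodule.span K {x | ∃ i ∈ A, ∃ w, g i w = x}

variable {g}

theorem mem_levelSpan {A : Finset ι} {i : ι} (hi : i ∈ A) (w : W i) : g i w ∈ levelSpan K g A :=
  Submodule.subset_span ⟨i, hi, w, rfl⟩

theorem levelSpan_mono {A B : Finset ι} (h : A ⊆ B) : levelSpan K g A ≤ levelSpan K g B :=
  Submodule.span_mono fun _ ⟨i, hi, w, hw⟩ => ⟨i, h hi, w, hw⟩

theorem levelSpan_le {A : Finset ι} {P : Submodule K M} (h : ∀ i ∈ A, ∀ w, g i w ∈ P) :
    levelSpan K g A ≤ P :=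
  Submodule.span_le.2 fun _ ⟨i, hi, w, hw⟩ => hw ▸ h i hi w

variable {q : ∀ i, W i → M →ₗ[K] K}

theorem eq_zero_of_mem_levelSpan (hq : ∀ i j w w', i ≠ j → q i w (g j w') = 0)
    {A : Finset ι} {i : ι} (hi : i ∉ A) (w : W i) {x : M}
    (hx : x ∈ levelSpan K g A) : q i w x = 0 :=
  levelSpan_le (P := LinearMap.ker (q i w))
    (fun j hj w' => hq i j w w' fun h => hi (h ▸ hj)) hx

variable [DecidableEq ι] [∀ i, Fintype (W i)] {N : ι → K}

/-- Up to the factor `N i`, the functionals `q i w` are the coefficients of a projection. -/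
theorem sub_mem_levelSpan_erase (hq : ∀ i j w w', i ≠ j → q i w (g j w') = 0)
    (hN : ∀ i, N i ≠ 0) (hproj : ∀ i w', ∑ w, q i w (g i w') • g i w = N i • g i w')
    {A : Finset ι} (i : ι) {x : M} (hx : x ∈ levelSpan K g A) :
    x - (N i)⁻¹ • ∑ w, q i w x • g i w ∈ levelSpan K g (A.erase i) := by
  let f : M →ₗ[K] M := LinearMap.id - (N i)⁻¹ • ∑ w, (q i w).smulRight (g i w)
  have hf : ∀ x, f x = x - (N i)⁻¹ • ∑ w, q i w x • g i w := fun x => by simp [f]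
  rw [← hf]
  refine levelSpan_le (P := (levelSpan K g (A.erase i)).comap f) (fun j hj w' => ?_) hx
  rw [Submodule.mem_comap, hf]
  by_cases hij : i = j
  · subst hij
    rw [hproj, inv_smul_smul₀ (hN i), sub_self]
    exact zero_mem _
  · rw [Finset.sum_eq_zero fun w _ => by rw [hq i j w w' hij, zero_smul], smul_zero, sub_zero]
    exact mem_levelSpan (Finset.mem_erase.2 ⟨Ne.symm hij, hj⟩) w'

theorem eq_zero_of_forall_eq_zero (hq : ∀ i j w w', i ≠ j → q i w (g j w') = 0)
    (hN : ∀ i, N i ≠ 0) (hproj : ∀ i w', ∑ w, q i w (g i w') • g i w = N i • g i w')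
    {A : Finset ι} {x : M} (hx : x ∈ levelSpan K g A)
    (h : ∀ i w, q i w x = 0) : x = 0 := by
  induction A using Finset.induction_on with
  | empty => simpa [levelSpan] using hx
  | insert i A hi ih =>
    refine ih ?_
    have := sub_mem_levelSpan_erase hq hN hproj i hx
    rwa [Finset.sum_eq_zero fun w _ => by rw [h, zero_smul], smul_zero, sub_zero,
      Finset.erase_insert hi] at this

end Levels

section Families

instance HairyGraph.finite {V E S : Type*} [Finite V] [Finite E] [Finite S] :
    Finite (HairyGraph V E S) :=
  Finite.of_injective (fun Γ => (Γ.src, Γ.tgt)) fun _ _ h =>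
    HairyGraph.ext (congrArg Prod.fst h) (congrArg Prod.snd h)

/-- Undirected-admissible graphs with given numbers of internal vertices and edges. -/
def UndirectedGraph (S : Type w) (i : ℕ × ℕ) : Type w :=
  {Γ : HairyGraph (Fin i.1) (Fin i.2) S // Γ.IsAdmissible .undirected}

instance (S : Type w) [Finite S] (i : ℕ × ℕ) : Fintype (UndirectedGraph S i) :=
  have : Finite (UndirectedGraph S i) := by unfold UndirectedGraph; infer_instance
  Fintype.ofFinite _

variable (K : Type u) [Field K] (n : ℤ) {S : Type w}

/-- The generators of the undirected complex. -/
def undirectedFamily (k : ℤ) (i : ℕ × ℕ) (Γ : UndirectedGraph S i) :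
    GraphSpace K .undirected n S k :=
  graphClass K .undirected n k Γ.1

/-- The generators of the oriented complex. -/
def orientedFamily (k : ℤ) (i : ℕ × ℕ) (x : UndirectedGraph S i × (Fin i.2 → Option Bool)) :
    GraphSpace K .oriented (n + 1) S k :=
  zigzagClass K n k x.1.1 x.2

/-- The number of relabellings. -/
def relabelCard (i : ℕ × ℕ) : K :=
  (Fintype.card ((Fin i.1 ≃ Fin i.1) × (Fin i.2 ≃ Fin i.2) × (Fin i.2 → Bool)) : K)

theorem relabelCard_ne_zero [CharZero K] (i : ℕ × ℕ) : relabelCard K i ≠ 0 := by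
  rw [relabelCard, Nat.cast_ne_zero]
  have : Nonempty ((Fin i.1 ≃ Fin i.1) × (Fin i.2 ≃ Fin i.2) × (Fin i.2 → Bool)) :=
    ⟨Equiv.refl _, Equiv.refl _, fun _ => false⟩
  exact Fintype.card_ne_zero

variable {K n}

theorem UndirectedGraph.valency_ne_two {i : ℕ × ℕ} (Γ : UndirectedGraph S i) (v : Fin i.1) :
    Γ.1.valency (Sum.inl v) ≠ 2 := by
  have := Γ.2.2.1 v
  omega

theorem pairing_orientedFamily {k : ℤ} {i j : ℕ × ℕ}
    (x : UndirectedGraph S i × (Fin i.2 → Option Bool))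
    (y : UndirectedGraph S j × (Fin j.2 → Option Bool)) (hy : orientedFamily K n k j y ≠ 0) :
    pairing K .oriented (n + 1) k (orientedFamily K n k i x) (orientedFamily K n k j y) =
      stateSum n x.1.1 x.2 y.1.1 y.2 := by
  refine pairing_zigzagClass x.1.valency_ne_two y.1.valency_ne_two ?_ ?_
  · by_contra h
    refine hy (zigzagClass_eq_zero K n fun h' => h ?_)
    exact h'.isAdmissible_zigzagGraph y.1.2
  · by_contra h
    exact hy (zigzagClass_eq_zero_of_degree K h)

theorem pairing_orientedFamily_of_ne {k : ℤ} {i j : ℕ × ℕ} (x y) (hij : i ≠ j) :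
    pairing K .oriented (n + 1) k (orientedFamily (S := S) K n k i x)
      (orientedFamily K n k j y) = 0 := by
  by_cases hy : orientedFamily K n k j y = 0
  · rw [hy, map_zero]
  · rw [pairing_orientedFamily x y hy, stateSum, Finset.sum_eq_zero, Int.cast_zero]
    intro g _
    refine absurd (Prod.ext ?_ ?_) hij
    · simpa using Fintype.card_congr g.1
    · simpa using Fintype.card_congr g.2.1

theorem pairing_undirectedFamily {k : ℤ} {i j : ℕ × ℕ} (x : UndirectedGraph S i)
    (y : UndirectedGraph S j) (hy : undirectedFamily K n k j y ≠ 0) :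
    pairing K .undirected n k (undirectedFamily K n k i x) (undirectedFamily K n k j y) =
      isoSum .undirected n x.1 y.1 := by
  refine pairing_graphClass y.2 ?_
  by_contra h
  exact hy (graphClass_eq_zero K .undirected n (S := S) _ h)

theorem pairing_undirectedFamily_of_ne {k : ℤ} {i j : ℕ × ℕ} (x y) (hij : i ≠ j) :
    pairing K .undirected n k (undirectedFamily (S := S) K n k i x)
      (undirectedFamily K n k j y) = 0 := by
  by_cases hy : undirectedFamily K n k j y = 0
  · rw [hy, map_zero]
  · rw [pairing_undirectedFamily x y hy, isoSum, Finset.sum_eq_zero, Int.cast_zero]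
    intro g _
    refine absurd (Prod.ext ?_ ?_) hij
    · simpa using Fintype.card_congr g.1
    · simpa using Fintype.card_congr g.2.1

theorem exists_unique_isIso {i : ℕ × ℕ} (y : UndirectedGraph S i) (g) :
    ∃ x : UndirectedGraph S i, IsIso .undirected x.1 y.1 g ∧
      ∀ x' : UndirectedGraph S i, IsIso .undirected x'.1 y.1 g → x' = x := by
  have h := (isIso_relabel (c := .undirected) (Γ := y.1) (relabelSymm g) nofun).symm
  rw [show relabelSymm (relabelSymm g) = g from relabelSymm.left_inv g] at h
  refine ⟨⟨_, h.isAdmissible_iff.1 y.2⟩, h, fun x' hx' => Subtype.ext ?_⟩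
  exact hx'.symm.eq_relabel

/-- If a function on graphs transforms like the generators under isomorphisms, then its sum over
all graphs, weighted by isomorphisms to a fixed graph, is a multiple of its value there. -/
theorem sum_isoSum_smul {M : Type*} [AddCommGroup M] [Module K M] [Finite S] {i : ℕ × ℕ}
    (F : UndirectedGraph S i → M)
    (hF : ∀ x y g, IsIso .undirected x.1 y.1 g → F y = (orientSign n g.1 g.2.1 g.2.2 : K) • F x)
    (y : UndirectedGraph S i) :
    ∑ x, (isoSum .undirected n x.1 y.1 : K) • F x = relabelCard K i • F y := by
  classical
  simp only [isoSum, Int.cast_sum, Finset.sum_smul]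
  rw [Finset.sum_comm, relabelCard, Nat.cast_smul_eq_nsmul, ← Finset.card_univ, ← Finset.sum_const]
  refine Finset.sum_congr rfl fun g _ => ?_
  obtain ⟨x, hx, hu⟩ := exists_unique_isIso y g
  rw [Finset.sum_eq_single x, if_pos hx, hF x y g hx]
  · exact fun x' _ hx' => by rw [if_neg fun h => hx' (hu x' h), Int.cast_zero, zero_smul]
  · exact fun h => absurd (Finset.mem_univ _) h

theorem exists_unique_isStateIso {i : ℕ × ℕ} (y : UndirectedGraph S i × (Fin i.2 → Option Bool))
    (g : (Fin i.1 ≃ Fin i.1) × (Fin i.2 ≃ Fin i.2) × (Fin i.2 → Bool)) :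
    ∃ x : UndirectedGraph S i × (Fin i.2 → Option Bool),
      IsStateIso x.1.1 x.2 y.1.1 y.2 g.1 g.2.1 g.2.2 ∧
      ∀ x' : UndirectedGraph S i × (Fin i.2 → Option Bool),
        IsStateIso x'.1.1 x'.2 y.1.1 y.2 g.1 g.2.1 g.2.2 → x' = x := by
  obtain ⟨x, hx, hu⟩ := exists_unique_isIso y.1 g
  refine ⟨(x, fun a => (y.2 (g.2.1 a)).map (xor (g.2.2 a))), ⟨hx.endpoint, fun a => ?_⟩,
    fun x' hx' => Prod.ext (hu x'.1 ⟨nofun, hx'.endpoint⟩) (funext fun a => ?_)⟩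
  · change y.2 (g.2.1 a) = ((y.2 (g.2.1 a)).map (xor (g.2.2 a))).map (xor (g.2.2 a))
    rcases y.2 (g.2.1 a) with _ | r <;> simp
  · simp only [hx'.state]
    rcases x'.2 a with _ | r <;> simp

theorem sum_stateSum_smul {M : Type*} [AddCommGroup M] [Module K M] [Finite S] {i : ℕ × ℕ}
    (F : UndirectedGraph S i × (Fin i.2 → Option Bool) → M)
    (hF : ∀ x y g, IsStateIso x.1.1 x.2 y.1.1 y.2 g.1 g.2.1 g.2.2 →
      F y = (stateSign n x.2 y.2 g : K) • F x)
    (y : UndirectedGraph S i × (Fin i.2 → Option Bool)) :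
    ∑ x, (stateSum n x.1.1 x.2 y.1.1 y.2 : K) • F x = relabelCard K i • F y := by
  classical
  simp only [stateSum, Int.cast_sum, Finset.sum_smul]
  rw [Finset.sum_comm, relabelCard, Nat.cast_smul_eq_nsmul, ← Finset.card_univ, ← Finset.sum_const]
  refine Finset.sum_congr rfl fun g _ => ?_
  obtain ⟨x, hx, hu⟩ := exists_unique_isStateIso y g
  rw [Finset.sum_eq_single x, if_pos hx, hF x y g hx]
  · exact fun x' _ hx' => by rw [if_neg fun h => hx' (hu x' h), Int.cast_zero, zero_smul]
  · exact fun h => absurd (Finset.mem_univ _) h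

theorem sum_pairing_orientedFamily [Finite S] {k : ℤ} (i : ℕ × ℕ)
    (y : UndirectedGraph S i × (Fin i.2 → Option Bool)) :
    ∑ x, pairing K .oriented (n + 1) k (orientedFamily K n k i x) (orientedFamily K n k i y) •
      orientedFamily K n k i x = relabelCard K i • orientedFamily K n k i y := by
  by_cases hy : orientedFamily K n k i y = 0
  · simp [hy]
  · rw [← sum_stateSum_smul (n := n) (orientedFamily K n k i)
      (fun x y g h => h.zigzagClass_eq n K) y]
    exact Finset.sum_congr rfl fun x _ => by rw [pairing_orientedFamily x y hy]

theorem sum_pairing_undirectedFamily [Finite S] {k : ℤ} (i : ℕ × ℕ) (y : UndirectedGraph S i) :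
    ∑ x, pairing K .undirected n k (undirectedFamily K n k i x) (undirectedFamily K n k i y) •
      undirectedFamily K n k i x = relabelCard K i • undirectedFamily K n k i y := by
  by_cases hy : undirectedFamily K n k i y = 0
  · simp [hy]
  · rw [← sum_isoSum_smul (n := n) (undirectedFamily K n k i) (fun x y g h =>
      graphClass_eq_of_endpoint K .undirected n k _ _ _ h.direction h.endpoint) y]
    exact Finset.sum_congr rfl fun x _ => by rw [pairing_undirectedFamily x y hy]

end Families

/-! ### The differential and the decomposition -/

section Equivariance

variable {V E V' E' : Type*} [Fintype V] [LinearOrder V] [Fintype E] [LinearOrder E]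
    [Fintype V'] [LinearOrder V'] [Fintype E'] [LinearOrder E'] {S : Type w}

theorem ne_of_update_ne_none {X Y : Type*} [DecidableEq X] (s : X → Option Y) (a b : X)
    (hb : Function.update s a none b ≠ none) : b ≠ a ∧ s b ≠ none := by
  by_cases hba : b = a
  · subst hba; simp at hb
  · rw [Function.update_of_ne hba] at hb
    exact ⟨hba, hb⟩

theorem dirSgn_update {st : E → Option Bool} {st' : E' → Option Bool} {ρ : E ≃ E'}
    (h : ∀ a, st a ≠ none ↔ st' (ρ a) ≠ none) {a : E} (ha : st a ≠ none) :
    dirSgn st st' ρ = (-1) ^ dirRk st a * (-1) ^ dirRk st' (ρ a) *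
      dirSgn (Function.update st a none) (Function.update st' (ρ a) none) ρ := by
  have h0 : ∀ b, Function.update st a none b ≠ none ↔
      Function.update st' (ρ a) none (ρ b) ≠ none := fun b => by
    by_cases hb : b = a
    · subst hb; simp
    · rw [Function.update_of_ne hb, Function.update_of_ne (by simpa using hb), h]
  let ρD : {b // st b ≠ none} ≃ {b // st' b ≠ none} := ρ.subtypeEquiv h
  let ρD₀ : {b // Function.update st a none b ≠ none} ≃
    {b // Function.update st' (ρ a) none b ≠ none} := ρ.subtypeEquiv h0
  let i : {b // Function.update st a none b ≠ none} → {b // st b ≠ none} :=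
    fun b => ⟨b, (ne_of_update_ne_none st a b b.2).2⟩
  let j : {b // Function.update st' (ρ a) none b ≠ none} → {b // st' b ≠ none} :=
    fun b => ⟨b, (ne_of_update_ne_none st' (ρ a) b b.2).2⟩
  have hi : StrictMono i := fun _ _ hlt => hlt
  have hj : StrictMono j := fun _ _ hlt => hlt
  have hx : ∀ b, b ≠ ⟨a, ha⟩ ↔ ∃ b₀, i b₀ = b := by
    refine fun b => ⟨fun hb => ?_, ?_⟩
    · have hb' : (b : E) ≠ a := fun h => hb (Subtype.ext h)
      exact ⟨⟨b, by rw [Function.update_of_ne hb']; exact b.2⟩, rfl⟩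
    · rintro ⟨b, rfl⟩ hb
      exact (ne_of_update_ne_none st a b b.2).1 (congrArg Subtype.val hb)
  have h1 : dirSgn st st' ρ = sgn ρD := dirSgn_eq fun _ => rfl
  have h2 : dirSgn (Function.update st a none) (Function.update st' (ρ a) none) ρ = sgn ρD₀ :=
    dirSgn_eq fun _ => rfl
  have h3 := sgn_eq_of_delete ρD (x := ⟨a, ha⟩) (y := ⟨ρ a, (h a).1 ha⟩) rfl hi hj hx ρD₀
    fun _ => rfl
  rw [h1, h2, h3, rk_dir, rk_dir]

/-- If a function on states transforms like the classes of states, then so does its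
differential. -/
theorem HairyGraph.IsStateIso.zigzagDiff_eq {K : Type u} [CommRing K] (n : ℤ)
    {Γ : HairyGraph V E S} {Γ' : HairyGraph V' E' S} {g : (V ≃ V') × (E ≃ E') × (E → Bool)}
    {u : (E → Option Bool) → K} {u' : (E' → Option Bool) → K}
    (hu : ∀ st st', IsStateIso Γ st Γ' st' g.1 g.2.1 g.2.2 →
      u' st' = (stateSign n st st' g : K) * u st)
    {st : E → Option Bool} {st' : E' → Option Bool} (h : IsStateIso Γ st Γ' st' g.1 g.2.1 g.2.2) :
    zigzagDiff u' st' = (stateSign n st st' g : K) * zigzagDiff u st := by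
  rw [zigzagDiff, zigzagDiff, Finset.mul_sum, ← g.2.1.sum_comp]
  have hD : ∀ a, st a ≠ none ↔ st' (g.2.1 a) ≠ none := fun a => by rw [h.state]; simp
  refine Finset.sum_congr rfl fun a _ => ?_
  by_cases ha : st a = none
  · rw [if_pos ha, if_pos (by rw [h.state, ha]; rfl), mul_zero]
  · rw [if_neg ha, if_neg ((hD a).1 ha), hu (Function.update st a none) _ ⟨h.endpoint, fun b => ?_⟩]
    · rw [stateSign, stateSign, dirSgn_update hD ha]
      have h1 : ((-1 : K) ^ dirRk st a) * (-1) ^ dirRk st a = 1 := by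
        rw [← pow_add, ← two_mul, pow_mul]; simp
      push_cast
      linear_combination (-(-1) ^ dirRk st' (g.2.1 a) * (orientSign n g.1 g.2.1 g.2.2 : K) *
        (sgn g.1 : K) * (dirSgn (Function.update st a none)
          (Function.update st' (g.2.1 a) none) g.2.1 : K) * u (Function.update st a none)) * h1
    · by_cases hb : b = a
      · subst hb; simp
      · rw [Function.update_of_ne hb, Function.update_of_ne (by simpa using hb), h.state]

end Equivariance

section Span

variable {K : Type u} [Field K] {n : ℤ} {S : Type w}

theorem mk_eq_graphClass {c : Flavor} {k : ℤ} (Δ : {Γ : LabelledGraph c S // Γ.degree n = k}) :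
    (Submodule.Quotient.mk (Finsupp.single Δ 1) : GraphSpace K c n S k) =
      graphClass K c n k Δ.1.graph := by
  obtain ⟨⟨v, e, Γ, h⟩, hk⟩ := Δ
  rw [← finClass_eq_graphClass, finClass, dif_pos ⟨h, hk⟩]

variable {V E : Type*} [Fintype V] [LinearOrder V] [Fintype E] [LinearOrder E]

theorem zigzagClass_mem_levelSpan (k : ℤ) {Γ : HairyGraph V E S} (h : Γ.IsAdmissible .undirected)
    (st : E → Option Bool) {A : Finset (ℕ × ℕ)} (hA : (Fintype.card V, Fintype.card E) ∈ A) :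
    zigzagClass K n k Γ st ∈ levelSpan K (orientedFamily (S := S) K n k) A := by
  let g : (V ≃ Fin (Fintype.card V)) × (E ≃ Fin (Fintype.card E)) × (E → Bool) :=
    ((monoEquivOfFin V rfl).symm.toEquiv, (monoEquivOfFin E rfl).symm.toEquiv, fun _ => false)
  have hadm := (isIso_numbered (c := .undirected) Γ).isAdmissible_iff.2 h
  have hiso : IsStateIso Γ st Γ.numbered (fun b => st (g.2.1.symm b)) g.1 g.2.1 g.2.2 :=
    ⟨(isIso_numbered (c := .undirected) Γ).endpoint, fun a => by cases h : st a <;> simp [g, h]⟩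
  have h1 := hiso.zigzagClass_eq n K (k := k)
  have h2 : zigzagClass K n k Γ st =
      (stateSign n st (fun b => st (g.2.1.symm b)) g : K) •
        zigzagClass K n k Γ.numbered fun b => st (g.2.1.symm b) := by
    rw [h1, smul_smul, ← Int.cast_mul, hiso.stateSign_mul_self, Int.cast_one, one_smul]
  rw [h2]
  exact Submodule.smul_mem _ _ (mem_levelSpan (g := orientedFamily (S := S) K n k) hA
    (⟨Γ.numbered, hadm⟩, fun b => st (g.2.1.symm b)))

theorem exists_mem_levelSpan_of_generators {c : Flavor} {W : ℕ × ℕ → Type*} {k : ℤ}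
    (g : ∀ i, W i → GraphSpace K c n S k)
    (h : ∀ Δ : {Γ : LabelledGraph c S // Γ.degree n = k}, ∃ i,
      graphClass K c n k Δ.1.graph ∈ levelSpan K g {i})
    (x : GraphSpace K c n S k) : ∃ N, x ∈ levelSpan K g (Finset.range N ×ˢ Finset.range N) := by
  obtain ⟨x, rfl⟩ := Submodule.Quotient.mk_surjective _ x
  have hmono : ∀ {N N'}, N ≤ N' → levelSpan K g (Finset.range N ×ˢ Finset.range N) ≤
      levelSpan K g (Finset.range N' ×ˢ Finset.range N') := fun h =>
    levelSpan_mono (Finset.product_subset_product (Finset.range_mono h) (Finset.range_mono h))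
  induction x using Finsupp.induction_linear with
  | zero => exact ⟨0, zero_mem _⟩
  | add x y hx hy =>
    obtain ⟨N, hx⟩ := hx
    obtain ⟨N', hy⟩ := hy
    exact ⟨max N N', add_mem (hmono (le_max_left _ _) hx) (hmono (le_max_right _ _) hy)⟩
  | single Δ a =>
    obtain ⟨i, hi⟩ := h Δ
    refine ⟨max i.1 i.2 + 1, ?_⟩
    have h1 : Finsupp.single Δ a = a • Finsupp.single Δ (1 : K) := by simp
    rw [h1, Submodule.Quotient.mk_smul, mk_eq_graphClass]
    refine Submodule.smul_mem _ _ (levelSpan_mono ?_ hi)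
    rw [Finset.singleton_subset_iff, Finset.mem_product, Finset.mem_range, Finset.mem_range]
    omega

theorem exists_mem_levelSpan_undirected {k : ℤ} (z : GraphSpace K .undirected n S k) :
    ∃ N, z ∈ levelSpan K (undirectedFamily (S := S) K n k) (Finset.range N ×ˢ Finset.range N) :=
  exists_mem_levelSpan_of_generators _ (fun Δ => ⟨(Δ.1.v, Δ.1.e),
    mem_levelSpan (g := undirectedFamily (S := S) K n k) (i := (Δ.1.v, Δ.1.e))
      (Finset.mem_singleton_self _) ⟨Δ.1.graph, Δ.1.adm⟩⟩) z

theorem exists_mem_levelSpan_oriented {k : ℤ} (x : GraphSpace K .oriented (n + 1) S k) :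
    ∃ N, x ∈ levelSpan K (orientedFamily (S := S) K n k) (Finset.range N ×ˢ Finset.range N) := by
  refine exists_mem_levelSpan_of_generators _ (fun Δ => ?_) x
  obtain ⟨V, E, _, _, Γ, st, σ, ρ, hadm, hiso⟩ := Δ.1.adm.exists_zigzagGraph
  have := Fintype.ofFinite V
  have := Fintype.ofFinite E
  let _ : LinearOrder V := LinearOrder.lift' (Fintype.equivFin V) (Equiv.injective _)
  let _ : LinearOrder E := LinearOrder.lift' (Fintype.equivFin E) (Equiv.injective _)
  refine ⟨(Fintype.card V, Fintype.card E), ?_⟩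
  rw [graphClass_eq_of_endpoint K .oriented (n + 1) k σ ρ (fun _ => false) (fun _ _ => rfl)
    hiso.endpoint, graphClass_zigzagGraph]
  exact Submodule.smul_mem _ _ (Submodule.smul_mem _ _
    (zigzagClass_mem_levelSpan k hadm st (Finset.mem_singleton_self _)))

end Span

/-! ### The leading part of the differential -/

section LeadingPart

variable {K : Type u} [Field K] {n : ℤ} {S : Type w}

theorem card_dir_update {E : Type*} [Fintype E] [DecidableEq E] {st : E → Option Bool} {a : E}
    (ha : st a = none) (β : Bool) :
    Fintype.card {b // Function.update st a (some β) b ≠ none} =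
      Fintype.card {b // st b ≠ none} + 1 := by
  rw [Fintype.card_subtype, Fintype.card_subtype, ← Finset.card_insert_of_notMem (a := a)
    (by simp [ha])]
  congr 1
  ext b
  by_cases hb : b = a
  · subst hb; simp
  · simp [hb]

theorem HairyGraph.IsGood.card_le {V E : Type*} [Fintype V] [Fintype E] {Γ : HairyGraph V E S}
    {st : E → Option Bool} (h : Γ.IsGood st) :
    Fintype.card V ≤ Fintype.card {a // st a ≠ none} := by
  choose y a r ha h1 h2 using h.2.1
  refine Fintype.card_le_of_injective (fun v => ⟨a v, by simp [ha]⟩) fun v w hvw => ?_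
  have hvw' : a v = a w := congrArg Subtype.val hvw
  have h3 := ha w
  rw [← hvw', ha] at h3
  have h4 := h1 w
  rw [← hvw', ← Option.some.inj h3, h1] at h4
  exact Sum.inl_injective h4

theorem exists_zigzagSign_eq (n k : ℤ) (m : ℕ × ℕ) : ∃ s : ℤ, s * s = 1 ∧
    ∀ st : Fin m.2 → Option Bool,
      (n - 1) * (Fintype.card (Fin m.2) : ℤ) - n * Fintype.card (Fin m.1) +
        (Fintype.card {a // st a ≠ none} - Fintype.card (Fin m.1)) = k →
      zigzagSign n (Fin m.1) st = s := by
  by_cases h : ∃ st : Fin m.2 → Option Bool,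
      (n - 1) * (Fintype.card (Fin m.2) : ℤ) - n * Fintype.card (Fin m.1) +
        (Fintype.card {a // st a ≠ none} - Fintype.card (Fin m.1)) = k
  · obtain ⟨st, h⟩ := h
    refine ⟨zigzagSign n (Fin m.1) st, ?_, fun st' h' => ?_⟩
    · rw [zigzagSign]
      split_ifs
      · rw [← pow_add, ← two_mul, pow_mul]; simp
      · rfl
    · have : Fintype.card {a // st' a ≠ none} = Fintype.card {a // st a ≠ none} := by
        zify
        linarith
      rw [zigzagSign, zigzagSign, this]
  · exact ⟨1, rfl, fun st hst => absurd ⟨st, hst⟩ h⟩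

variable {m : ℕ × ℕ} {i j : ℤ} {s : ℤ} {B : Finset (ℕ × ℕ)}

/-- Up to graphs with fewer vertices, the differential directs the zigzags. -/
theorem dMap_zigzagClass_sub_mem [Finite S] (hij : i + 1 = j)
    (hs : ∀ st : Fin m.2 → Option Bool,
      (n - 1) * (Fintype.card (Fin m.2) : ℤ) - n * Fintype.card (Fin m.1) +
        (Fintype.card {a // st a ≠ none} - Fintype.card (Fin m.1)) = i →
      zigzagSign n (Fin m.1) st = s)
    (hB : ∀ a b, (a + 1, b + 1) = m → (a, b) ∈ B) (Γ : UndirectedGraph S m)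
    {st : Fin m.2 → Option Bool} (hst : Γ.1.IsGood st) :
    dMap K .oriented (n + 1) i j (zigzagClass K n i Γ.1 st) -
      (s : K) • (∑ a, if st a = none then ∑ β, (((-1) ^ dirRk st a : ℤ) : K) •
        zigzagClass K n j Γ.1 (Function.update st a (some β)) else 0) ∈
      levelSpan K (orientedFamily (S := S) K n j) B := by
  by_cases hi : (n - 1) * (Fintype.card (Fin m.2) : ℤ) - n * Fintype.card (Fin m.1) +
        (Fintype.card {a // st a ≠ none} - Fintype.card (Fin m.1)) = i
  · rw [dMap_zigzagClass K Γ.2 hst hi, hs st hi, add_sub_cancel_left]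
    refine sum_mem fun p _ => ?_
    split_ifs
    · exact zero_mem _
    · refine Submodule.smul_mem _ _ (zigzagClass_mem_levelSpan j (Γ.2.contract_undirected p) _ ?_)
      refine hB _ _ (Prod.ext ?_ ?_)
      · have : 0 < m.1 := p.tail.pos
        simp only [ne_eq, Fintype.card_subtype_compl, Fintype.card_subtype_eq, Fintype.card_fin]
        omega
      · have : 0 < m.2 := p.edge.pos
        simp only [ne_eq, Fintype.card_subtype_compl, Fintype.card_subtype_eq, Fintype.card_fin]
        omega
  · rw [zigzagClass_eq_zero_of_degree K hi, map_zero, Finset.sum_eq_zero, smul_zero, sub_zero]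
    · exact zero_mem _
    · intro a _
      split_ifs with ha
      · refine Finset.sum_eq_zero fun β _ => smul_eq_zero_of_right _
          (zigzagClass_eq_zero_of_degree K fun h => hi ?_)
        rw [card_dir_update ha] at h
        push_cast at h
        linarith
      · rfl

theorem dMap_sum_sub_mem [Finite S] (hij : i + 1 = j)
    (hs : ∀ st : Fin m.2 → Option Bool,
      (n - 1) * (Fintype.card (Fin m.2) : ℤ) - n * Fintype.card (Fin m.1) +
        (Fintype.card {a // st a ≠ none} - Fintype.card (Fin m.1)) = i →
      zigzagSign n (Fin m.1) st = s)
    (hB : ∀ a b, (a + 1, b + 1) = m → (a, b) ∈ B)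
    (y : UndirectedGraph S m × (Fin m.2 → Option Bool) → K)
    (hy : ∀ x, ¬ x.1.1.IsGood x.2 → y x = 0) :
    dMap K .oriented (n + 1) i j (∑ x, y x • orientedFamily K n i m x) -
      (s : K) • ∑ x : UndirectedGraph S m × (Fin m.2 → Option Bool),
        zigzagDiff (fun t => y (x.1, t)) x.2 • orientedFamily K n j m x ∈
      levelSpan K (orientedFamily (S := S) K n j) B := by
  rw [Fintype.sum_prod_type, Fintype.sum_prod_type, map_sum, Finset.smul_sum,
    ← Finset.sum_sub_distrib]
  refine sum_mem fun Γ _ => ?_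
  simp only [orientedFamily]
  rw [← sum_smul_update K (fun t => y (Γ, t)) fun t => zigzagClass K n j Γ.1 t, map_sum,
    Finset.smul_sum, ← Finset.sum_sub_distrib]
  refine sum_mem fun st _ => ?_
  by_cases hst : Γ.1.IsGood st
  · rw [map_smul, smul_comm (s : K), ← smul_sub]
    exact Submodule.smul_mem _ _ (dMap_zigzagClass_sub_mem hij hs hB Γ hst)
  · rw [hy (Γ, st) hst]
    simp

theorem dMap_mem_levelSpan [Finite S] (hij : i + 1 = j)
    (hB : ∀ a b, (a + 1, b + 1) ∈ B → (a, b) ∈ B) {x : GraphSpace K .oriented (n + 1) S i}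
    (hx : x ∈ levelSpan K (orientedFamily (S := S) K n i) B) :
    dMap K .oriented (n + 1) i j x ∈ levelSpan K (orientedFamily (S := S) K n j) B := by
  refine levelSpan_le (P := (levelSpan K (orientedFamily (S := S) K n j) B).comap
    (dMap K .oriented (n + 1) i j)) (fun m hm y => ?_) hx
  rw [Submodule.mem_comap]
  obtain ⟨s, -, hs⟩ := exists_zigzagSign_eq n i m
  by_cases hy : y.1.1.IsGood y.2
  · have h1 := dMap_zigzagClass_sub_mem (K := K) (B := B) hij hs
      (fun a b hab => hB a b (hab ▸ hm)) y.1 hy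
    have h2 : (s : K) • (∑ a, if y.2 a = none then ∑ β, (((-1) ^ dirRk y.2 a : ℤ) : K) •
        zigzagClass K n j y.1.1 (Function.update y.2 a (some β)) else 0) ∈
        levelSpan K (orientedFamily (S := S) K n j) B := by
      refine Submodule.smul_mem _ _ (sum_mem fun a _ => ?_)
      split_ifs
      · exact sum_mem fun β _ => Submodule.smul_mem _ _
          (mem_levelSpan (g := orientedFamily (S := S) K n j) hm (y.1, _))
      · exact zero_mem _
    have h3 := add_mem h1 h2
    rwa [sub_add_cancel] at h3
  · rw [orientedFamily, zigzagClass_eq_zero K n hy, map_zero]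
    exact zero_mem _

theorem phiMap_undirectedFamily [Finite S] {k : ℤ} (Γ : UndirectedGraph S m) :
    phiMap K n S k (undirectedFamily K n k m Γ) =
      ∑ st, (Γ.1.forestCoeff st : K) • orientedFamily K n k m (Γ, st) := by
  by_cases hk : (n - 1) * (Fintype.card (Fin m.2) : ℤ) - n * (Fintype.card (Fin m.1) : ℤ) = k
  · exact phiMap_graphClass Γ.2 hk
  · rw [undirectedFamily, graphClass_eq_zero K .undirected n (S := S) _ hk, map_zero,
      Finset.sum_eq_zero]
    intro st _
    by_cases h0 : Γ.1.forestCoeff st = 0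
    · rw [h0, Int.cast_zero, zero_smul]
    · refine smul_eq_zero_of_right _ (zigzagClass_eq_zero_of_degree K ?_)
      rwa [card_dir_of_forestCoeff_ne_zero h0, sub_self, add_zero]

/-- The coefficients of an element in the image of `Φ`. -/
theorem pairing_phiMap [Finite S] {k : ℤ} (x : UndirectedGraph S m × (Fin m.2 → Option Bool))
    (z : GraphSpace K .undirected n S k) :
    pairing K .oriented (n + 1) k (orientedFamily K n k m x) (phiMap K n S k z) =
      x.1.1.forestCoeff x.2 * pairing K .undirected n k (undirectedFamily K n k m x.1) z := by
  classical
  obtain ⟨N, hz⟩ := exists_mem_levelSpan_undirected z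
  refine levelSpan_le (P := LinearMap.ker
    ((pairing K .oriented (n + 1) k (orientedFamily K n k m x)) ∘ₗ phiMap K n S k -
      (x.1.1.forestCoeff x.2 : K) • pairing K .undirected n k (undirectedFamily K n k m x.1)))
    (fun m' _ Γ => ?_) hz |> fun h => sub_eq_zero.1 h
  rw [LinearMap.mem_ker, LinearMap.sub_apply, sub_eq_zero, LinearMap.comp_apply,
    LinearMap.smul_apply, smul_eq_mul]
  by_cases hΓ : undirectedFamily K n k m' Γ = 0
  · rw [hΓ, map_zero, map_zero, map_zero, mul_zero]
  have hk : (n - 1) * (Fintype.card (Fin m'.2) : ℤ) - n * (Fintype.card (Fin m'.1) : ℤ) = k := by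
    by_contra h
    exact hΓ (graphClass_eq_zero K .undirected n (S := S) _ h)
  rw [pairing_undirectedFamily _ _ hΓ, phiMap_undirectedFamily, map_sum]
  have h1 : ∀ st, pairing K .oriented (n + 1) k (orientedFamily K n k m x)
      ((Γ.1.forestCoeff st : K) • orientedFamily K n k m' (Γ, st)) =
      ((Γ.1.forestCoeff st * stateSum n x.1.1 x.2 Γ.1 st : ℤ) : K) := by
    intro st
    rw [map_smul, smul_eq_mul, Int.cast_mul]
    by_cases h0 : Γ.1.forestCoeff st = 0
    · rw [h0, Int.cast_zero, zero_mul, zero_mul]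
    · congr 1
      refine pairing_zigzagClass x.1.valency_ne_two Γ.valency_ne_two
        ((exists_isOut_of_forestCoeff_ne_zero h0).1.isAdmissible_zigzagGraph Γ.2) ?_
      rw [card_dir_of_forestCoeff_ne_zero h0, sub_self, add_zero, hk]
  rw [Finset.sum_congr rfl fun st _ => h1 st, ← Int.cast_sum, ← Int.cast_mul]
  congr 1
  simp only [stateSum, isoSum, Finset.mul_sum]
  rw [Finset.sum_comm]
  refine Finset.sum_congr rfl fun g _ => ?_
  by_cases hg : IsIso .undirected x.1.1 Γ.1 g
  · rw [if_pos hg, Finset.sum_eq_single fun b =>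
      (x.2 (g.2.1.symm b)).map (xor (g.2.2 (g.2.1.symm b)))]
    · have hiso : IsStateIso x.1.1 x.2 Γ.1
          (fun b => (x.2 (g.2.1.symm b)).map (xor (g.2.2 (g.2.1.symm b)))) g.1 g.2.1 g.2.2 :=
        ⟨hg.endpoint, fun a => by simp⟩
      obtain ⟨ρD, hρD⟩ := hiso.exists_dirEquiv
      rw [if_pos hiso, hiso.forestCoeff hρD, stateSign, dirSgn_eq hρD]
      linear_combination (sgn ρD * sgn ρD * x.1.1.forestCoeff x.2 *
        orientSign n g.1 g.2.1 g.2.2) * sgn_mul_self g.1 + (x.1.1.forestCoeff x.2 *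
        orientSign n g.1 g.2.1 g.2.2) * sgn_mul_self ρD
    · intro st _ hne
      rw [if_neg, mul_zero]
      intro hiso
      refine hne (funext fun b => ?_)
      obtain ⟨a, rfl⟩ := g.2.1.surjective b
      rw [hiso.state, Equiv.symm_apply_apply]
    · exact fun h => absurd (Finset.mem_univ _) h
  · rw [if_neg hg, mul_zero]
    refine Finset.sum_eq_zero fun st _ => ?_
    rw [if_neg fun hiso => hg ⟨nofun, hiso.endpoint⟩, mul_zero]

end LeadingPart

/-! ### The mapping cone of `Φ` is acyclic -/

section Cone

variable {K : Type u} [Field K] [CharZero K] {n : ℤ} {S : Type w} [Finite S]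

theorem phiMap_injective [Nonempty S] {k : ℤ} {z : GraphSpace K .undirected n S k}
    (hz : phiMap K n S k z = 0) : z = 0 := by
  obtain ⟨N, hN⟩ := exists_mem_levelSpan_undirected z
  refine eq_zero_of_forall_eq_zero
    (q := fun m Γ => pairing K .undirected n k (undirectedFamily K n k m Γ))
    (fun _ _ x y hij => pairing_undirectedFamily_of_ne x y hij) (relabelCard_ne_zero K)
    (fun m y => sum_pairing_undirectedFamily m y) hN fun m Γ => ?_
  obtain ⟨τ, hτ, -⟩ := exists_zigzagDiff_eq (K := K) Γ.2.1
  -- the coefficient of a forest state of `Γ` in `Φ z` is, up to sign, that of `Γ` in `z`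
  have h1 := pairing_phiMap (K := K) (n := n) (k := k) (Γ, τ) z
  rw [hz, map_zero] at h1
  have h2 : (Γ.1.forestCoeff τ : K) ≠ 0 := fun h => by
    have := congrArg (Int.cast : ℤ → K) hτ.forestCoeff_mul_self
    rw [Int.cast_mul, h] at this
    simp at this
  exact (mul_eq_zero.1 h1.symm).resolve_left h2

variable {k l : ℤ} {m : ℕ × ℕ} {A : Finset (ℕ × ℕ)}

/-- If the boundary of `x` lies in the image of `Φ`, then the coefficients of the leading part of
`x` form a cocycle. -/
theorem zigzagDiff_pairing_eq_zero (hkl : k + 1 = l)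
    (hA : ∀ a b, (a + 1, b + 1) ∈ A → (a, b) ∈ A) (hm : m ∈ A) (hmax : ∀ m' ∈ A, m'.1 ≤ m.1)
    {x : GraphSpace K .oriented (n + 1) S k}
    (hx : x ∈ levelSpan K (orientedFamily (S := S) K n k) A)
    {z : GraphSpace K .undirected n S l} (hz : dMap K .oriented (n + 1) k l x = phiMap K n S l z)
    (Γ : UndirectedGraph S m) {t : Fin m.2 → Option Bool} (ht : Γ.1.IsGood t) :
    zigzagDiff (fun st => pairing K .oriented (n + 1) k (orientedFamily K n k m (Γ, st)) x) t =
      0 := by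
  set u : UndirectedGraph S m × (Fin m.2 → Option Bool) → K :=
    fun y => pairing K .oriented (n + 1) k (orientedFamily K n k m y) x with hu
  have hgood : ∀ y, ¬ y.1.1.IsGood y.2 → u y = 0 := fun y hy => by
    simp only [hu, orientedFamily]
    rw [zigzagClass_eq_zero K n hy, map_zero, LinearMap.zero_apply]
  have hdeg : ∀ y : UndirectedGraph S m × (Fin m.2 → Option Bool),
      (n - 1) * (Fintype.card (Fin m.2) : ℤ) - n * Fintype.card (Fin m.1) +
        (Fintype.card {a // y.2 a ≠ none} - Fintype.card (Fin m.1)) ≠ k → u y = 0 := fun y hy => by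
    simp only [hu, orientedFamily]
    rw [zigzagClass_eq_zero_of_degree K hy, map_zero, LinearMap.zero_apply]
  have hcard : ∀ a, t a ≠ none → Fintype.card {a // t a ≠ none} =
      Fintype.card {b // Function.update t a none b ≠ none} + 1 := by
    intro a ha
    obtain ⟨r, hr⟩ := Option.ne_none_iff_exists'.1 ha
    rw [← card_dir_update (st := Function.update t a none) (Function.update_self ..) r]
    congr! 3 with b
    by_cases hb : b = a
    · subst hb; simp [hr]
    · simp [hb]
  by_cases hforest : Fintype.card {a // t a ≠ none} = Fintype.card (Fin m.1)
  · -- a state with fewer directed edges than vertices is not good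
    refine Finset.sum_eq_zero fun a _ => ?_
    split_ifs with ha
    · rfl
    · refine mul_eq_zero_of_right _ (hgood (Γ, _) fun h => ?_)
      have h1 := h.card_le
      have h2 := hcard a ha
      simp only at h1
      omega
  by_cases hl : (n - 1) * (Fintype.card (Fin m.2) : ℤ) - n * Fintype.card (Fin m.1) +
        (Fintype.card {a // t a ≠ none} - Fintype.card (Fin m.1)) ≠ l
  · refine Finset.sum_eq_zero fun a _ => ?_
    split_ifs with ha
    · rfl
    · refine mul_eq_zero_of_right _ (hdeg (Γ, _) fun h => hl ?_)
      rw [hcard a ha, ← hkl, ← h]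
      push_cast
      ring
  rw [not_not] at hl
  -- compare the coefficients of `t` in `d x` and in `Φ z`
  have hphi := pairing_phiMap (K := K) (n := n) (k := l) (Γ, t) z
  rw [show Γ.1.forestCoeff t = 0 from by
    by_contra h
    exact hforest (card_dir_of_forestCoeff_ne_zero h), Int.cast_zero, zero_mul, ← hz] at hphi
  obtain ⟨s, hss, hs⟩ := exists_zigzagSign_eq n k m
  have hq : ∀ (i j : ℕ × ℕ) (y y'), i ≠ j → pairing K .oriented (n + 1) l
      (orientedFamily (S := S) K n l i y) (orientedFamily K n l j y') = 0 :=
    fun _ _ y y' => pairing_orientedFamily_of_ne y y'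
  have hlower : ∀ a b, (a + 1, b + 1) ∈ A.erase m → (a, b) ∈ A.erase m := by
    intro a b hab
    refine Finset.mem_erase.2 ⟨fun h => ?_, hA a b (Finset.mem_of_mem_erase hab)⟩
    have := hmax _ (Finset.mem_of_mem_erase hab)
    rw [← h] at this
    simp only at this
    omega
  have h1 := sub_mem_levelSpan_erase
    (q := fun m y => pairing K .oriented (n + 1) k (orientedFamily K n k m y))
    (fun _ _ x y hij => pairing_orientedFamily_of_ne x y hij) (relabelCard_ne_zero K)
    (fun m y => sum_pairing_orientedFamily m y) m hx
  have h2 := eq_zero_of_mem_levelSpan hq (Finset.notMem_erase m A) (Γ, t)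
    (dMap_mem_levelSpan hkl hlower h1)
  have h3 := eq_zero_of_mem_levelSpan hq (Finset.notMem_erase m A) (Γ, t)
    (dMap_sum_sub_mem (K := K) (B := A.erase m) hkl hs (fun a b hab =>
      Finset.mem_erase.2 ⟨fun h => by rw [← h] at hab; simp at hab, hA a b (hab ▸ hm)⟩) u hgood)
  have hequi : ∀ y y' g, IsStateIso y.1.1 y.2 y'.1.1 y'.2 g.1 g.2.1 g.2.2 →
      (fun y : UndirectedGraph S m × (Fin m.2 → Option Bool) =>
        zigzagDiff (fun t => u (y.1, t)) y.2) y' = (stateSign n y.2 y'.2 g : K) •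
      (fun y : UndirectedGraph S m × (Fin m.2 → Option Bool) =>
        zigzagDiff (fun t => u (y.1, t)) y.2) y := by
    intro y y' g h
    refine h.zigzagDiff_eq n fun st st' hst => ?_
    simp only [hu, orientedFamily]
    rw [hst.zigzagClass_eq n K, map_smul, LinearMap.smul_apply, smul_eq_mul]
  have h4 : ∑ y, zigzagDiff (fun t => u (y.1, t)) y.2 * pairing K .oriented (n + 1) l
      (orientedFamily K n l m (Γ, t)) (orientedFamily K n l m y) =
      relabelCard K m * zigzagDiff (fun st => u (Γ, st)) t := by
    rw [← smul_eq_mul (relabelCard K m)]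
    refine Eq.trans (Finset.sum_congr rfl fun y _ => ?_)
      (sum_stateSum_smul (K := K) (n := n) _ hequi (Γ, t))
    rw [pairing_comm, mul_comm, smul_eq_mul]
    congr 1
    exact pairing_zigzagClass y.1.valency_ne_two Γ.valency_ne_two
      (ht.isAdmissible_zigzagGraph Γ.2) hl
  rw [map_sub, map_smul, map_sub, hphi, zero_sub, neg_eq_zero, map_smul, smul_eq_mul] at h2
  have h5 := (mul_eq_zero.1 h2).resolve_left (inv_ne_zero (relabelCard_ne_zero K m))
  rw [map_sub, h5, zero_sub, neg_eq_zero, map_smul, map_sum, smul_eq_mul] at h3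
  simp only [map_smul, smul_eq_mul] at h3
  rw [h4] at h3
  have hs0 : (s : K) ≠ 0 := fun h => by
    have := congrArg (Int.cast : ℤ → K) hss
    rw [Int.cast_mul, h] at this
    simp at this
  exact (mul_eq_zero.1 ((mul_eq_zero.1 h3).resolve_left hs0)).resolve_left (relabelCard_ne_zero K m)

/-- The leading part of `x` is removed by an element in the image of `Φ` and a boundary. -/
theorem exists_sub_mem_levelSpan_erase [Nonempty S] {j : ℤ} (hjk : j + 1 = k) (hkl : k + 1 = l)
    (hA : ∀ a b, (a + 1, b + 1) ∈ A → (a, b) ∈ A) (hm : m ∈ A) (hmax : ∀ m' ∈ A, m'.1 ≤ m.1)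
    {x : GraphSpace K .oriented (n + 1) S k}
    (hx : x ∈ levelSpan K (orientedFamily (S := S) K n k) A)
    {z : GraphSpace K .undirected n S l} (hz : dMap K .oriented (n + 1) k l x = phiMap K n S l z) :
    ∃ (z' : GraphSpace K .undirected n S k) (y : GraphSpace K .oriented (n + 1) S j),
      x - phiMap K n S k z' - dMap K .oriented (n + 1) j k y ∈
        levelSpan K (orientedFamily (S := S) K n k) (A.erase m) := by
  have h1 := sub_mem_levelSpan_erase
    (q := fun m y => pairing K .oriented (n + 1) k (orientedFamily K n k m y))
    (fun _ _ x y hij => pairing_orientedFamily_of_ne x y hij) (relabelCard_ne_zero K)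
    (fun m y => sum_pairing_orientedFamily m y) m hx
  have hcocycle := fun Γ t => zigzagDiff_pairing_eq_zero hkl hA hm hmax hx hz Γ (t := t)
  set u : UndirectedGraph S m × (Fin m.2 → Option Bool) → K :=
    fun y => pairing K .oriented (n + 1) k (orientedFamily K n k m y) x with hu
  have hgood : ∀ y, ¬ y.1.1.IsGood y.2 → u y = 0 := fun y hy => by
    simp only [hu, orientedFamily]
    rw [zigzagClass_eq_zero K n hy, map_zero, LinearMap.zero_apply]
  -- on the states of each graph, a cocycle is a multiple of the forest cocycle plus a coboundary
  have hex : ∀ Γ : UndirectedGraph S m, ∃ (c : K) (y : (Fin m.2 → Option Bool) → K),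
      (∀ t, ¬ Γ.1.IsGood t → y t = 0) ∧
        ∀ t, Γ.1.IsGood t → u (Γ, t) = c * Γ.1.forestCoeff t + zigzagDiff y t := by
    intro Γ
    obtain ⟨τ, hτ, h⟩ := exists_zigzagDiff_eq (K := K) Γ.2.1
    have hτ' := congrArg (Int.cast : ℤ → K) hτ.forestCoeff_mul_self
    rw [Int.cast_mul, Int.cast_one] at hτ'
    obtain ⟨y, hy, hy'⟩ := h (fun t => u (Γ, t) - u (Γ, τ) * Γ.1.forestCoeff τ * Γ.1.forestCoeff t)
      (fun t ht => by
        rw [zigzagDiff_sub, zigzagDiff_mul, zigzagDiff_forestCoeff ht, mul_zero, sub_zero]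
        exact hcocycle Γ t ht)
      (fun t ht => by
        rw [hgood (Γ, t) ht, forestCoeff_eq_zero_of_not_isGood ht, Int.cast_zero, mul_zero,
          sub_zero])
      (by linear_combination (-u (Γ, τ)) * hτ')
    exact ⟨u (Γ, τ) * Γ.1.forestCoeff τ, y, hy, fun t ht => by rw [← hy' t ht]; ring⟩
  choose c y hy huy using hex
  obtain ⟨s, hss, hs⟩ := exists_zigzagSign_eq n j m
  have hss' : (s : K) * s = 1 := by rw [← Int.cast_mul, hss, Int.cast_one]
  have h3 := dMap_sum_sub_mem (K := K) (B := A.erase m) hjk hs (fun a b hab =>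
      Finset.mem_erase.2 ⟨fun h => by rw [← h] at hab; simp at hab, hA a b (hab ▸ hm)⟩)
      (fun p => y p.1 p.2) fun p => hy p.1 p.2
  refine ⟨(relabelCard K m)⁻¹ • ∑ Γ, c Γ • undirectedFamily K n k m Γ,
    ((relabelCard K m)⁻¹ * s) • ∑ p, y p.1 p.2 • orientedFamily K n j m p, ?_⟩
  have h4 : ∑ p, u p • orientedFamily K n k m p =
      phiMap K n S k (∑ Γ, c Γ • undirectedFamily K n k m Γ) +
        ∑ p : UndirectedGraph S m × (Fin m.2 → Option Bool),
          zigzagDiff (fun t => y p.1 t) p.2 • orientedFamily K n k m p := by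
    simp only [map_sum, map_smul, phiMap_undirectedFamily, Finset.smul_sum]
    rw [Fintype.sum_prod_type, Fintype.sum_prod_type, ← Finset.sum_add_distrib]
    refine Finset.sum_congr rfl fun Γ _ => ?_
    rw [← Finset.sum_add_distrib]
    refine Finset.sum_congr rfl fun t _ => ?_
    by_cases ht : Γ.1.IsGood t
    · rw [huy Γ t ht, add_smul, mul_smul]
    · simp only [orientedFamily]
      rw [zigzagClass_eq_zero K n ht]
      simp
  have h5 := Submodule.sub_mem _ h1 (Submodule.smul_mem _ ((relabelCard K m)⁻¹ * s) h3)
  rw [h4] at h5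
  convert h5 using 1
  rw [map_smul, map_smul, smul_sub, smul_smul, mul_assoc, hss', mul_one, smul_add]
  abel

/-- The mapping cone of `Φ` is acyclic. The condition that `z` is a cocycle is not needed, since it
follows from the injectivity of `Φ`. -/
theorem exists_eq_phiMap_add_dMap [Nonempty S] {j : ℤ} (hjk : j + 1 = k) (hkl : k + 1 = l)
    {x : GraphSpace K .oriented (n + 1) S k} {z : GraphSpace K .undirected n S l}
    (hz : dMap K .oriented (n + 1) k l x = phiMap K n S l z) :
    ∃ (z' : GraphSpace K .undirected n S k) (y : GraphSpace K .oriented (n + 1) S j),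
      dMap K .undirected n k l z' = z ∧
        x = phiMap K n S k z' + dMap K .oriented (n + 1) j k y := by
  obtain ⟨N, hN⟩ := exists_mem_levelSpan_oriented x
  have hlow : ∀ a b, (a + 1, b + 1) ∈ Finset.range N ×ˢ Finset.range N →
      (a, b) ∈ Finset.range N ×ˢ Finset.range N := by
    intro a b h
    simp only [Finset.mem_product, Finset.mem_range] at h ⊢
    omega
  have hdd : ∀ y : GraphSpace K .oriented (n + 1) S j,
      dMap K .oriented (n + 1) k l (dMap K .oriented (n + 1) j k y) = 0 := fun y =>
    LinearMap.congr_fun ((isGraphComplex K .oriented (n + 1) S).sq_zero j k l) y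
  generalize Finset.range N ×ˢ Finset.range N = A at hN hlow
  induction hA : A.card generalizing A x z with
  | zero =>
    rw [Finset.card_eq_zero] at hA
    have hx : x = 0 := by simpa [hA, levelSpan] using hN
    refine ⟨0, 0, ?_, by simp [hx]⟩
    rw [hx, map_zero] at hz
    rw [map_zero, phiMap_injective hz.symm]
  | succ p ih =>
    obtain ⟨m, hm, hmax⟩ := Finset.exists_max_image A Prod.fst (Finset.card_pos.1 (by omega))
    obtain ⟨z₁, y₁, h1⟩ := exists_sub_mem_levelSpan_erase hjk hkl hlow hm hmax hN hz
    obtain ⟨z₂, y₂, h2, h3⟩ := ih (z := z - dMap K .undirected n k l z₁) (by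
      rw [map_sub, map_sub, map_sub, hdd, sub_zero, hz, dMap_phiMap]) _ h1 (fun a b hab => by
        refine Finset.mem_erase.2 ⟨fun h => ?_, hlow a b (Finset.mem_of_mem_erase hab)⟩
        have := hmax _ (Finset.mem_of_mem_erase hab)
        rw [← h] at this
        simp only at this
        omega) (by rw [Finset.card_erase_of_mem hm, hA]; rfl)
    refine ⟨z₁ + z₂, y₁ + y₂, by rw [map_add, h2]; abel, ?_⟩
    rw [map_add, map_add, ← sub_eq_iff_eq_add.2 (h3.trans (add_comm _ _))]
    abel

end Cone

/-! ### Quasi-isomorphisms of complexes of vector spaces -/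

section QuasiIso

variable {K : Type u} [Field K]

theorem exists_comp_eq_of_forall_mem_range {A B C : Type*} [AddCommGroup A] [Module K A]
    [AddCommGroup B] [Module K B] [AddCommGroup C] [Module K C] (f : A →ₗ[K] C) (g : B →ₗ[K] C)
    (h : ∀ a, f a ∈ LinearMap.range g) : ∃ s : A →ₗ[K] B, g ∘ₗ s = f := by
  obtain ⟨s, hs⟩ := Module.projective_lifting_property g.rangeRestrict
    (f.codRestrict (LinearMap.range g) h) g.surjective_rangeRestrict
  refine ⟨s, LinearMap.ext fun a => ?_⟩
  exact congrArg Subtype.val (LinearMap.congr_fun hs a)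

/-- A map of complexes of vector spaces is a quasi-isomorphism if its mapping cone is acyclic: the
case `z = 0` gives surjectivity on cohomology, and injectivity is the assertion about `z'`. -/
theorem quasiIso_of_cone {X Y : CochainComplex (ModuleCat.{max u w} K) ℤ} (f : X ⟶ Y)
    (h : ∀ i j k l : ℤ, i + 1 = j → j + 1 = k → k + 1 = l → ∀ (x : Y.X j) (z : X.X k),
      (X.d k l).hom z = 0 → (Y.d j k).hom x = (f.f k).hom z →
      ∃ (z' : X.X j) (y : Y.X i), (X.d j k).hom z' = z ∧
        x = (f.f j).hom z' + (Y.d i j).hom y) : QuasiIso f := by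
  rw [quasiIso_iff]
  intro k
  rw [quasiIsoAt_iff_isIso_homologyMap]
  have hprev : (ComplexShape.up ℤ).prev k = k - 1 := by simp
  have hnext : (ComplexShape.up ℤ).next k = k + 1 := by simp
  have hmono : Mono (HomologicalComplex.homologyMap f k) := by
    rw [HomologicalComplex.mono_homologyMap_iff_up_to_refinements f (k - 1) k (k + 1) hprev hnext]
    intro A x hx y hxy
    obtain ⟨s, hs⟩ := exists_comp_eq_of_forall_mem_range x.hom (X.d (k - 1) k).hom fun a => by
      obtain ⟨z', -, hz', -⟩ := h (k - 2) (k - 1) k (k + 1) (by ring) (by ring) rfl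
        (y.hom a) (x.hom a) (LinearMap.congr_fun (congrArg ModuleCat.Hom.hom hx) a)
        (LinearMap.congr_fun (congrArg ModuleCat.Hom.hom hxy) a).symm
      exact ⟨z', hz'⟩
    refine ⟨A, 𝟙 A, inferInstance, ModuleCat.ofHom s, ?_⟩
    rw [Category.id_comp]
    exact ModuleCat.hom_ext hs.symm
  have hepi : Epi (HomologicalComplex.homologyMap f k) := by
    rw [HomologicalComplex.epi_homologyMap_iff_up_to_refinements f (k - 1) k (k + 1) hprev hnext]
    intro A y hy
    obtain ⟨s, hs⟩ := exists_comp_eq_of_forall_mem_range y.hom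
      (((f.f k).hom ∘ₗ (LinearMap.ker (X.d k (k + 1)).hom).subtype).coprod
        (Y.d (k - 1) k).hom) fun a => by
      obtain ⟨z', y', hz', hy'⟩ := h (k - 1) k (k + 1) (k + 2) (by ring) rfl (by ring)
        (y.hom a) 0 (map_zero _)
        ((LinearMap.congr_fun (congrArg ModuleCat.Hom.hom hy) a).trans (map_zero _).symm)
      exact ⟨(⟨z', hz'⟩, y'), by simpa using hy'.symm⟩
    refine ⟨A, 𝟙 A, inferInstance,
      ModuleCat.ofHom (Submodule.subtype _ ∘ₗ LinearMap.fst K _ _ ∘ₗ s), ?_,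
      ModuleCat.ofHom (LinearMap.snd K _ _ ∘ₗ s), ?_⟩
    · ext a
      exact (s a).1.2
    · rw [Category.id_comp]
      exact ModuleCat.hom_ext hs.symm
  exact isIso_of_mono_of_epi _

end QuasiIso

section ForestMap

variable {K : Type u} [Field K] [CharZero K] {n : ℤ} {S : Type w} [Finite S]
  {hG : IsGraphComplex K .undirected n S} {hO : IsGraphComplex K .oriented (n + 1) S}

theorem IsForestMap.quasiIso_ΦHom [Nonempty S] (h : IsForestMap hG hO) : QuasiIso h.ΦHom := by
  refine quasiIso_of_cone _ fun i j k l hij hjk _ x z _ hxz => ?_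
  exact exists_eq_phiMap_add_dMap hij hjk hxz

/-- The mapping cone of `F` is the dual of the mapping cone of `Φ`, so it is acyclic, too. -/
theorem IsForestMap.quasiIso_FHom [Nonempty S] (h : IsForestMap hG hO) : QuasiIso h.FHom := by
  refine quasiIso_of_cone _ fun i j k l hij hjk hkl x z hz hxz => ?_
  change Module.Dual K (GraphSpace K .undirected n S (-j)) at x
  change Module.Dual K (GraphSpace K .oriented (n + 1) S (-k)) at z
  change z ∘ₗ hO.d (-l) (-k) = 0 at hz
  change x ∘ₗ hG.d (-k) (-j) = z ∘ₗ h.Φ (-k) at hxz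
  -- `(z, x)` is a cocycle of the dual of the mapping cone, and `D` is the differential of the cone
  let D := ((hO.d (-k) (-j)).prod 0).coprod ((h.Φ (-j)).prod (hG.d (-j) (-i)))
  have hw : z.coprod x ∈ LinearMap.range D.dualMap := by
    rw [LinearMap.range_dualMap_eq_dualAnnihilator_ker, Submodule.mem_dualAnnihilator]
    rintro ⟨p, q⟩ hpq
    have hD : (hO.d (-k) (-j) p + h.Φ (-j) q, (0 : GraphSpace K .undirected n S (-i)) +
      hG.d (-j) (-i) q) = 0 := hpq
    rw [zero_add, Prod.mk_eq_zero] at hD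
    obtain ⟨q', p', hq, hp⟩ := exists_eq_phiMap_add_dMap (K := K) (n := n) (S := S)
      (j := -l) (k := -k) (l := -j) (by omega) (by omega) (x := -p) (z := q)
      ((map_neg _ p).trans (neg_eq_of_add_eq_zero_right hD.1))
    have h1 : x q = z (phiMap K n S (-k) q') := by
      rw [← hq]
      exact LinearMap.congr_fun hxz q'
    have h2 : z (dMap K .oriented (n + 1) (-l) (-k) p') = 0 := LinearMap.congr_fun hz p'
    have h3 : -z p = x q := by
      rw [← map_neg, hp, map_add, h2, add_zero, h1]
    rw [LinearMap.coprod_apply, ← h3, add_neg_cancel]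
  obtain ⟨w, hw⟩ := hw
  refine ⟨w ∘ₗ LinearMap.inl K _ _, w ∘ₗ LinearMap.inr K _ _, ?_, ?_⟩
  · refine LinearMap.ext fun p => ?_
    have hp : w (hO.d (-k) (-j) p + h.Φ (-j) 0, 0 + hG.d (-j) (-i) 0) = z p + x 0 :=
      LinearMap.congr_fun hw (p, 0)
    rw [map_zero, map_zero, map_zero, add_zero, add_zero, add_zero] at hp
    exact hp
  · refine LinearMap.ext fun q => ?_
    have hq : w (hO.d (-k) (-j) 0 + h.Φ (-j) q, 0 + hG.d (-j) (-i) q) = z 0 + x q :=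
      LinearMap.congr_fun hw (0, q)
    rw [map_zero, map_zero, zero_add, zero_add, zero_add] at hq
    have hadd : w (h.Φ (-j) q, hG.d (-j) (-i) q) =
        w (h.Φ (-j) q, 0) + w (0, hG.d (-j) (-i) q) := by
      rw [← map_add, Prod.mk_add_mk, add_zero, zero_add]
    exact hq.symm.trans hadd

end ForestMap

/-! ### Loop order -/

section LoopOrder

variable {K : Type u} [Field K] {n : ℤ} {S : Type w}

/-- No admissibility or degree is assumed, because the class is zero otherwise. -/
theorem graphClass_mem_loopPart {c : Flavor} {g k : ℤ} {V E : Type*} [Fintype V] [LinearOrder V]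
    [Fintype E] [LinearOrder E] {Γ : HairyGraph V E S}
    (hg : (Fintype.card E : ℤ) - (Fintype.card V + Nat.card S) + 1 = g) :
    graphClass K c n k Γ ∈ loopPart K c n S g k := by
  rw [graphClass]
  split_ifs with h
  · exact Submodule.subset_span ⟨⟨⟨_, _, Γ.numbered, h.1⟩, h.2⟩, hg, rfl⟩
  · exact zero_mem _

theorem loopPart_le_comap {c : Flavor} {g k : ℤ} {M : Type*} [AddCommGroup M] [Module K M]
    {f : GraphSpace K c n S k →ₗ[K] M} {P : Submodule K M}
    (h : ∀ Γ : {Γ : LabelledGraph c S // Γ.degree n = k}, Γ.1.loopOrder = g →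
      f (Submodule.Quotient.mk (Finsupp.single Γ 1)) ∈ P) :
    loopPart K c n S g k ≤ P.comap f := by
  refine Submodule.span_le.2 ?_
  rintro _ ⟨Γ, hΓ, rfl⟩
  exact h Γ hΓ

theorem loopPart_le_comap_dMap {c : Flavor} (g i j : ℤ) :
    loopPart K c n S g i ≤ (loopPart K c n S g j).comap (dMap K c n i j) := by
  refine loopPart_le_comap fun ⟨⟨v, e, Γ, h⟩, hi⟩ hg => ?_
  have h1 : dMap K c n i j (Submodule.Quotient.mk (Finsupp.single ⟨⟨v, e, Γ, h⟩, hi⟩ 1))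
      = boundary K c n j Γ := contractFree_single ..
  rw [h1, boundary]
  refine Submodule.sum_mem _ fun p _ => Submodule.smul_mem _ _ (graphClass_mem_loopPart ?_)
  have hv : 0 < v := p.tail.pos
  have he : 0 < e := p.edge.pos
  simp only [LabelledGraph.loopOrder] at hg
  simp only [ne_eq, Fintype.card_subtype_compl, Fintype.card_fin, Fintype.card_subtype_eq,
    Nat.cast_sub hv, Nat.cast_sub he]
  push_cast
  linarith

theorem loopPart_le_comap_phiMap [Finite S] (g k : ℤ) :
    loopPart K .undirected n S g k ≤
      (loopPart K .oriented (n + 1) S g k).comap (phiMap K n S k) := by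
  refine loopPart_le_comap fun Γ hg => ?_
  rw [phiMap_mk, phiClass]
  refine Submodule.sum_mem _ fun st _ => Submodule.smul_mem _ _ <|
    Submodule.smul_mem _ _ (graphClass_mem_loopPart ?_)
  -- each zigzag adds one vertex and one edge
  have h : Fintype.card {a // st a ≠ none} + Fintype.card {a // st a = none} = Γ.1.e := by
    rw [← Fintype.card_sum,
      Fintype.card_congr ((Equiv.sumComm _ _).trans (Equiv.sumCompl fun a => st a = none)),
      Fintype.card_fin]
  have hV : Fintype.card (Fin Γ.1.v ⊕ₗ {a // st a = none}) =
      Γ.1.v + Fintype.card {a // st a = none} :=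
    (Fintype.card_congr ofLex).trans (by rw [Fintype.card_sum, Fintype.card_fin])
  have hE : Fintype.card ({a // st a ≠ none} ⊕ₗ ({a // st a = none} ×ₗ Bool)) =
      Fintype.card {a // st a ≠ none} + Fintype.card {a // st a = none} * 2 :=
    (Fintype.card_congr (ofLex.trans (Equiv.sumCongr (Equiv.refl _) ofLex))).trans
      (by rw [Fintype.card_sum, Fintype.card_prod, Fintype.card_bool])
  rw [LabelledGraph.loopOrder] at hg
  rw [hV, hE]
  omega

theorem dualLoopPart_le_comap_dualMap {c c' : Flavor} {n' : ℤ} {g i j : ℤ}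
    {f : GraphSpace K c n S (-j) →ₗ[K] GraphSpace K c' n' S (-i)}
    (h : ∀ g', loopPart K c n S g' (-j) ≤ (loopPart K c' n' S g' (-i)).comap f) :
    dualLoopPart K c' n' S g i ≤
      (dualLoopPart K c n S g j).comap (f.dualMap : DualGraphSpace K c' n' S i →ₗ[K] _) := by
  intro x hx
  rw [dualLoopPart, Submodule.mem_dualAnnihilator] at hx
  rw [Submodule.mem_comap, dualLoopPart, Submodule.mem_dualAnnihilator]
  intro y hy
  refine hx (f y) ?_
  have hle : (⨆ g' : {g' : ℤ // g' ≠ g}, loopPart K c n S g' (-j)) ≤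
      (⨆ g' : {g' : ℤ // g' ≠ g}, loopPart K c' n' S g' (-i)).comap f :=
    iSup_le fun g' => (h g').trans (Submodule.comap_mono (le_iSup (fun g' : {g' : ℤ // g' ≠ g} =>
      loopPart K c' n' S g' (-i)) g'))
  exact hle hy

end LoopOrder

/-! ### Naturality in the label set -/

namespace HairyGraph

variable {V E : Type*} {S T : Type w} (Γ : HairyGraph V E S) (θ : S ≃ T)

theorem mapHairs_symm_mapHairs : (Γ.mapHairs θ).mapHairs θ.symm = Γ := by
  ext a
  · exact (Equiv.sumCongr (Equiv.refl V) θ).symm_apply_apply _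
  · exact (Equiv.sumCongr (Equiv.refl V) θ).symm_apply_apply _

theorem isAdmissible_mapHairs_iff {c : Flavor} :
    (Γ.mapHairs θ).IsAdmissible c ↔ Γ.IsAdmissible c :=
  ⟨fun h => Γ.mapHairs_symm_mapHairs θ ▸ h.mapHairs θ.symm, fun h => h.mapHairs θ⟩

/-- The edges that can be contracted do not depend on the names of the hairs. -/
def contractibleMapHairs : Γ.Contractible ≃ (Γ.mapHairs θ).Contractible :=
  Equiv.subtypeEquivRight fun p => by
    have h (x : V ⊕ S) (v : V) : Equiv.sumCongr (Equiv.refl V) θ x = Sum.inl v ↔ x = Sum.inl v := by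
      cases x <;> simp
    rw [← h, ← h (Γ.tgt p.1)]
    rfl

theorem contract_mapHairs (p : Γ.Contractible) :
    (Γ.mapHairs θ).contract (Γ.contractibleMapHairs θ p) = (Γ.contract p).mapHairs θ := by
  have h (x : V ⊕ S) : (Γ.contractibleMapHairs θ p).merge (Equiv.sumCongr (Equiv.refl V) θ x) =
      Equiv.sumCongr (Equiv.refl _) θ (p.merge x) := by
    cases x <;> rfl
  ext b
  · exact h (Γ.src b)
  · exact h (Γ.tgt b)

/-- Renaming of the hairs as an isomorphism of subgraphs. -/
def subgraphMapHairs (τ : Set E) : Γ.subgraph τ ≃g (Γ.mapHairs θ).subgraph τ where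
  toEquiv := Equiv.sumCongr (Equiv.refl V) θ
  map_rel_iff' := by
    intro x y
    simp only [subgraph, SimpleGraph.fromRel_adj, HairyGraph.mapHairs,
      EmbeddingLike.apply_eq_iff_eq, ne_eq]

theorem reachable_mapHairs_iff (τ : Set E) (x : V ⊕ S) (s : S) :
    (Γ.subgraph τ).Reachable x (Sum.inr s) ↔
      ((Γ.mapHairs θ).subgraph τ).Reachable (Equiv.sumCongr (Equiv.refl V) θ x) (Sum.inr (θ s)) :=
  (SimpleGraph.Iso.reachable_iff (φ := Γ.subgraphMapHairs θ τ)).symm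

theorem isSpanningForest_mapHairs_iff (τ : Finset E) :
    Γ.IsSpanningForest τ ↔ (Γ.mapHairs θ).IsSpanningForest τ := by
  refine and_congr ?_ (and_congr ?_ (and_congr (Γ.subgraphMapHairs θ τ).isAcyclic_iff ?_))
  · simp only [mapHairs, EmbeddingLike.apply_eq_iff_eq, ne_eq]
  · refine forall₄_congr fun a _ b _ => imp_congr ?_ Iff.rfl
    exact (Sym2.map.injective (Equiv.sumCongr (Equiv.refl V) θ).injective).eq_iff.symm
  · refine (Equiv.sumCongr (Equiv.refl V) θ).forall_congr fun x => ?_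
    exact Equiv.existsUnique_congr θ fun s => Γ.reachable_mapHairs_iff θ τ x s

theorem leavesThrough_mapHairs_iff (τ : Finset E) (x : V) (a : E) :
    Γ.LeavesThrough τ x a ↔ (Γ.mapHairs θ).LeavesThrough τ x a := by
  have h (y : V ⊕ S) : y = Sum.inl x ↔ Equiv.sumCongr (Equiv.refl V) θ y = Sum.inl x := by
    cases y <;> simp
  refine and_congr Iff.rfl (and_congr (or_congr (h _) (h _)) ?_)
  exact θ.forall_congr fun s => not_congr (Γ.reachable_mapHairs_iff θ _ (Sum.inl x) s)

/-- The spanning forests do not depend on the names of the hairs. -/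
def spanningForestMapHairs : Γ.SpanningForest ≃ (Γ.mapHairs θ).SpanningForest :=
  Equiv.subtypeEquivRight fun p => and_congr (Γ.isSpanningForest_mapHairs_iff θ p.1)
    (forall_congr' fun x => Γ.leavesThrough_mapHairs_iff θ p.1 x (p.2 x))

theorem src_mapHairs_eq_inl_iff (a : E) (x : V) :
    (Γ.mapHairs θ).src a = Sum.inl x ↔ Γ.src a = Sum.inl x := by
  change Equiv.sumCongr (Equiv.refl V) θ (Γ.src a) = Sum.inl x ↔ _
  cases Γ.src a <;> simp

open Classical in
theorem forestGraph_mapHairs (τ : Γ.SpanningForest) :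
    (Γ.mapHairs θ).forestGraph (Γ.spanningForestMapHairs θ τ) = (Γ.forestGraph τ).mapHairs θ := by
  have h (x : V ⊕ S) : Sum.map τ.out id (Equiv.sumCongr (Equiv.refl V) θ x) =
      Equiv.sumCongr (Equiv.refl E) θ (Sum.map τ.out id x) := by
    cases x <;> rfl
  ext b
  · rcases b with x | q <;> rfl
  · refine Eq.trans ?_ (h _)
    refine congrArg (Sum.map τ.out id) ?_
    rcases b with x | ⟨q, r⟩
    · change (if (Γ.mapHairs θ).src (τ.out x) = Sum.inl x then _ else _) =
        Equiv.sumCongr (Equiv.refl V) θ (if Γ.src (τ.out x) = Sum.inl x then _ else _)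
      by_cases hx : Γ.src (τ.out x) = Sum.inl x
      · rw [if_pos hx, if_pos ((Γ.src_mapHairs_eq_inl_iff θ _ _).2 hx)]
        rfl
      · rw [if_neg hx, if_neg fun h => hx ((Γ.src_mapHairs_eq_inl_iff θ _ _).1 h)]
        rfl
    · cases r <;> rfl

open Classical in
theorem forestSign_mapHairs (n : ℤ) [Fintype V] (τ : Γ.SpanningForest) :
    (Γ.mapHairs θ).forestSign n (Γ.spanningForestMapHairs θ τ) = Γ.forestSign n τ := by
  rw [forestSign, forestSign]
  exact if_congr Iff.rfl rfl (Finset.prod_congr rfl fun x _ =>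
    if_congr (Γ.src_mapHairs_eq_inl_iff θ _ x) rfl rfl)

end HairyGraph

section Naturality

variable (K : Type u) [Field K] (c : Flavor) (n : ℤ) {S T : Type w} (θ : S ≃ T)

theorem graphMap_mk {k : ℤ} (Γ : {Γ : LabelledGraph c S // Γ.degree n = k}) :
    graphMap K c n θ k (Submodule.Quotient.mk (Finsupp.single Γ 1)) =
      Submodule.Quotient.mk (Finsupp.single ⟨Γ.1.mapHairs θ, Γ.2⟩ 1) := by
  refine congrArg Submodule.Quotient.mk ?_
  rw [mapFree, Finsupp.lmapDomain_apply, Finsupp.mapDomain_single]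

theorem graphMap_graphClass {V E : Type*} [Fintype V] [LinearOrder V] [Fintype E] [LinearOrder E]
    (k : ℤ) (Γ : HairyGraph V E S) :
    graphMap K c n θ k (graphClass K c n k Γ) = graphClass K c n k (Γ.mapHairs θ) := by
  have hnum : (Γ.mapHairs θ).numbered = Γ.numbered.mapHairs θ := (mapHairs_relabel _ _ _ _ _).symm
  by_cases h : ∃ h : Γ.numbered.IsAdmissible c, LabelledGraph.degree n ⟨_, _, Γ.numbered, h⟩ = k
  · have h' : ∃ h : (Γ.mapHairs θ).numbered.IsAdmissible c,
        LabelledGraph.degree n ⟨_, _, (Γ.mapHairs θ).numbered, h⟩ = k :=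
      ⟨hnum ▸ h.1.mapHairs θ, h.2⟩
    rw [graphClass, graphClass, dif_pos h, dif_pos h', graphMap_mk]
    congr 3
    simp only [LabelledGraph.mapHairs, hnum]
  · have h' : ¬ ∃ h : (Γ.mapHairs θ).numbered.IsAdmissible c,
        LabelledGraph.degree n ⟨_, _, (Γ.mapHairs θ).numbered, h⟩ = k := fun h' =>
      h ⟨(isAdmissible_mapHairs_iff _ θ).1 (hnum ▸ h'.1), h'.2⟩
    rw [graphClass, graphClass, dif_neg h, dif_neg h', map_zero]

theorem dMap_comp_graphMap (i j : ℤ) :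
    dMap K c n i j ∘ₗ graphMap K c n θ i = graphMap K c n θ j ∘ₗ dMap K c n i j := by
  refine Submodule.linearMap_qext _ (Finsupp.lhom_ext' fun ⟨⟨v, e, Γ, h⟩, hi⟩ =>
    LinearMap.ext_ring ?_)
  simp only [LinearMap.comp_apply, Finsupp.lsingle_apply, Submodule.mkQ_apply]
  rw [graphMap_mk]
  have h1 : dMap K c n i j (Submodule.Quotient.mk (Finsupp.single ⟨⟨v, e, Γ, h⟩, hi⟩ 1))
      = boundary K c n j Γ := contractFree_single ..
  have h2 : dMap K c n i j (Submodule.Quotient.mk (Finsupp.single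
      ⟨LabelledGraph.mapHairs θ ⟨v, e, Γ, h⟩, hi⟩ 1)) = boundary K c n j (Γ.mapHairs θ) :=
    contractFree_single _ _ _ (h.mapHairs θ) _
  rw [h1, h2, boundary, boundary, map_sum]
  refine (Fintype.sum_equiv (Γ.contractibleMapHairs θ) _ _ fun p => ?_).symm
  rw [map_smul, contract_mapHairs, graphMap_graphClass]
  rfl

theorem phiMap_comp_graphMap [Finite S] [Finite T] (k : ℤ) :
    phiMap K n T k ∘ₗ graphMap K .undirected n θ k =
      graphMap K .oriented (n + 1) θ k ∘ₗ phiMap K n S k := by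
  refine Submodule.linearMap_qext _ (Finsupp.lhom_ext' fun Γ => LinearMap.ext_ring ?_)
  simp only [LinearMap.comp_apply, Finsupp.lsingle_apply, Submodule.mkQ_apply]
  rw [graphMap_mk, phiMap_mk, phiMap_mk, ← sum_forestGraph, ← sum_forestGraph, map_sum]
  refine (Fintype.sum_equiv (Γ.1.graph.spanningForestMapHairs θ) _ _ fun τ => ?_).symm
  rw [map_smul, graphMap_graphClass, ← forestGraph_mapHairs, ← forestSign_mapHairs]
  rfl

/-- Naturality of the transpose. The inverse of `θ` appears, as dual spaces are contravariant. -/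
theorem dualGraphMap_comm {c c' : Flavor} {n n' i j : ℤ}
    {f : GraphSpace K c n S (-j) →ₗ[K] GraphSpace K c' n' S (-i)}
    {f' : GraphSpace K c n T (-j) →ₗ[K] GraphSpace K c' n' T (-i)}
    (h : f ∘ₗ graphMap K c n θ.symm (-j) = graphMap K c' n' θ.symm (-i) ∘ₗ f') :
    f'.dualMap ∘ₗ dualGraphMap K c' n' θ i = dualGraphMap K c n θ j ∘ₗ f.dualMap := by
  rw [dualGraphMap, dualGraphMap, LinearMap.dualMap_comp_dualMap, LinearMap.dualMap_comp_dualMap,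
    h]

end Naturality

end

theorem theorem1p2 {K : Type u} [Field K] [CharZero K] (n : ℤ) :
    ∃ (hG : ∀ (S : Type w) [Finite S], IsGraphComplex K .undirected n S)
      (hO : ∀ (S : Type w) [Finite S], IsGraphComplex K .oriented (n + 1) S)
      (hΦ : ∀ (S : Type w) [Finite S], IsForestMap (hG S) (hO S)),
      -- `F`, and its predual `Φ`, are quasi-isomorphisms
      (∀ (S : Type w) [Finite S] [Nonempty S],
        QuasiIso (hΦ S).FHom ∧ QuasiIso (hΦ S).ΦHom) ∧
      -- naturality: the complexes are functors of `S`, and `F`, `Φ` are natural transformations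
      (∀ (S T : Type w) [Finite S] [Finite T] (θ : S ≃ T),
        (∀ i j : ℤ,
          (hG T).δ i j ∘ₗ dualGraphMap K .undirected n θ i =
            dualGraphMap K .undirected n θ j ∘ₗ (hG S).δ i j ∧
          (hO T).δ i j ∘ₗ dualGraphMap K .oriented (n + 1) θ i =
            dualGraphMap K .oriented (n + 1) θ j ∘ₗ (hO S).δ i j) ∧
        ∀ k : ℤ,
          (hΦ T).F k ∘ₗ dualGraphMap K .oriented (n + 1) θ k =
            dualGraphMap K .undirected n θ k ∘ₗ (hΦ S).F k ∧
          (hΦ T).Φ k ∘ₗ graphMap K .undirected n θ k =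
            graphMap K .oriented (n + 1) θ k ∘ₗ (hΦ S).Φ k) ∧
      -- the differentials, `F` and `Φ` respect the loop order
      (∀ (S : Type w) [Finite S] (g : ℤ),
        (∀ i j : ℤ,
          dualLoopPart K .undirected n S g i ≤
            (dualLoopPart K .undirected n S g j).comap ((hG S).δ i j) ∧
          dualLoopPart K .oriented (n + 1) S g i ≤
            (dualLoopPart K .oriented (n + 1) S g j).comap ((hO S).δ i j)) ∧
        ∀ k : ℤ,
          dualLoopPart K .oriented (n + 1) S g k ≤
            (dualLoopPart K .undirected n S g k).comap ((hΦ S).F k) ∧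
          loopPart K .undirected n S g k ≤
            (loopPart K .oriented (n + 1) S g k).comap ((hΦ S).Φ k)) := by
  refine ⟨fun S _ => isGraphComplex K _ n S, fun S _ => isGraphComplex K _ (n + 1) S,
    fun S _ => isForestMap _ _, fun S _ _ => ⟨IsForestMap.quasiIso_FHom _,
      IsForestMap.quasiIso_ΦHom _⟩, fun S T _ _ θ => ⟨fun i j => ⟨?_, ?_⟩, fun k => ⟨?_, ?_⟩⟩,
    fun S _ g => ⟨fun i j => ⟨?_, ?_⟩, fun k => ⟨?_, ?_⟩⟩⟩
  · exact dualGraphMap_comm K θ (dMap_comp_graphMap K _ n θ.symm (-j) (-i))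
  · exact dualGraphMap_comm K θ (dMap_comp_graphMap K _ (n + 1) θ.symm (-j) (-i))
  · exact dualGraphMap_comm K θ (phiMap_comp_graphMap K n θ.symm (-k))
  · exact phiMap_comp_graphMap K n θ k
  · exact dualLoopPart_le_comap_dualMap fun g' => loopPart_le_comap_dMap g' (-j) (-i)
  · exact dualLoopPart_le_comap_dualMap fun g' => loopPart_le_comap_dMap g' (-j) (-i)
  · exact dualLoopPart_le_comap_dualMap fun g' => loopPart_le_comap_phiMap g' (-k)
  · exact loopPart_le_comap_phiMap g k
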